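/- **Setting.** Let $\mathbb T^2=\mathbb R^2/\mathbb Z^2$, let $s\ge 3$ be an integer, and let $c_0,L_0,L_1,L_2,T>0$. Let $f:[0,T]\times\mathbb T^2\to\mathbb R$ and put $$\Omega_f^{+}=\{f(t,x')<x_3<1\},\qquad \Omega_f^-=\{-1<x_3<f(t,x')\},\qquad \Gamma_f=\{x_3=f(t,x')\},$$ $\Gamma^\pm=\mathbb T^2\times\{\pm1\}$ and $N_f=(-\partial_1f,-\partial_2f,1)$. Let $u^\pm(t),h^\pm(t)\in H^s(\Omega_f^\pm;\mathbb R^3)$ (identified with their representatives continuous up to the boundary) have traces $\underline u^\pm,\underline h^\pm$ on $\Gamma_f$, regarded as functions of $x'\in\mathbb T^2$. Write $w_i=\frac12(\underline u_i^++\underline u_i^-)$ and $v_i=\frac12(\underline u^+_i-\underline u^-_i)$ for $i=1,2$. Assume that for every $t\in[0,T]$: 1. $|\underline u^\pm|\le L_0$ and $|\underline h^\pm|\le L_0$ on $\mathbb T^2$; 2. $\|f\|_{H^{s+1/2}}+\|\partial_tf\|_{H^{s-1/2}}+\sum_\pm\|u^\pm\|_{H^s(\Omega^\pm_f)}+\sum_\pm\|h^\pm\|_{H^s(\Omega^\pm_f)}\le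 L_1$; 3. $u^\pm,h^\pm$ are differentiable in $(t,x)$ at every point of $\Gamma_f$ within the closed space-time region on their side, with $|\partial_tu^\pm|\le L_2$ and $|\partial_th^\pm|\le L_2$ on $\Gamma_f$; 4. $-(1-c_0)\le f\le 1-c_0$; 5. (stability) $\displaystyle\Lambda:=\inf_{x'\in\mathbb T^2}\ \inf_{\varphi_1^2+\varphi_2^2=1}\Big[(\underline h^+_1\varphi_1+\underline h^+_2\varphi_2)^2+(\underline h^-_1\varphi_1+\underline h^-_2\varphi_2)^2-2(v_1\varphi_1+v_2\varphi_2)^2\Big]\ge c_0$; 6. $\operatorname{div}u^\pm=\operatorname{div}h^\pm=0$ in $\Omega_f^\pm$, $\ \underline h^\pm\cdot N_f=0$, $\ \partial_tf=\underline u^\pm\cdot N_f$, and $u_3^\pm=h_3^\pm=0$ on $\Gamma^\pm$. For functions $\bar f,\bar\theta$ on $\mathbb T^2$ define, with $\langle\nabla\rangle^\sigma$ the Fourier multiplier $(1+|\xi|^2)^{\sigma/2}$ and summation over $i=1,2$, $$E_s(\bar\theta,\bar f)=\big\|\langle\nabla\rangle^{s-\frac12}\bar\theta+w_i\partial_i\langle\nabla\rangle^{s-\frac12}\bar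 f\big\|_{L^2}^2-\big\|v_i\partial_i\langle\nabla\rangle^{s-\frac12}\bar f\big\|_{L^2}^2+\tfrac12\sum_\pm\big\|\underline h^\pm_i\partial_i\langle\nabla\rangle^{s-\frac12}\bar f\big\|_{L^2}^2 .$$ **Proposition.** There are constants $C=C(c_0,L_0)$ and $K=K(c_0,L_1,L_2)$, depending otherwise only on $s$, such that in this setting the following holds. (a) For every $t\in[0,T]$, $\bar f\in H^{s+1/2}(\mathbb T^2)$ and $\bar\theta\in H^{s-1/2}(\mathbb T^2)$, $$\|\bar\theta\|_{H^{s-1/2}}^2+\|\bar f\|_{H^{s+1/2}}^2\le C\big(E_s(\bar\theta,\bar f)+\|\bar\theta\|_{L^2}^2+\|\bar f\|_{L^2}^2\big).$$ (b) For every $\mathfrak g\in L^\infty(0,T;H^{s-1/2}(\mathbb T^2))$ and $(\bar f_0,\bar\theta_0)\in H^{s+1/2}\times H^{s-1/2}(\mathbb T^2)$ the system $$\partial_t\bar f=\bar\theta,\qquad \partial_t\bar\theta=-\sum_{i=1,2}(\underline u_i^++\underline u_i^-)\partial_i\bar\theta-\frac12\sum_{i,j=1,2}\big(\underline u^+_i\underline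 u^+_j-\underline h^+_i\underline h^+_j+\underline u^-_i\underline u^-_j-\underline h^-_i\underline h^-_j\big)\partial_i\partial_j\bar f+\mathfrak g$$ with $(\bar f,\bar\theta)|_{t=0}=(\bar f_0,\bar\theta_0)$ (the second equation being understood in integrated form in $t$) has exactly one solution $(\bar f,\bar\theta)\in C([0,T];H^{s+1/2}\times H^{s-1/2}(\mathbb T^2))$, and $$\sup_{t\in[0,T]}\Big(\|\partial_t\bar f(t)\|_{H^{s-1/2}}^2+\|\bar f(t)\|_{H^{s+1/2}}^2\Big)\le C\Big(\|\bar\theta_0\|_{H^{s-1/2}}^2+\|\bar f_0\|_{H^{s+1/2}}^2+\int_0^T\|\mathfrak g(\tau)\|_{H^{s-1/2}}^2\,d\tau\Big)e^{KT}.$$ -/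

import Mathlib

open MeasureTheory Set
open scoped ENNReal ContDiff

noncomputable section

namespace CurrentVortex

/-! ### The torus and its Sobolev spaces -/

/-- The flat two-dimensional torus `ℝ² / ℤ²`. -/
abbrev Torus2 : Type := UnitAddTorus (Fin 2)

/-- Lebesgue (Haar) measure on the torus, of total mass one. -/
abbrev torusMeasure : Measure Torus2 :=
  Measure.pi fun _ : Fin 2 => (AddCircle.haarAddCircle : Measure UnitAddCircle)

/-- The partial derivative `∂ᵢ φ` on the torus (the coordinates have period one). -/
def surfPartial (i : Fin 2) (φ : Torus2 → ℝ) (x : Torus2) : ℝ :=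
  deriv (fun r : ℝ => φ (x + Pi.single i (r : UnitAddCircle))) 0

/-- Fourier coefficients of a real function on the torus. -/
def coeff (φ : Torus2 → ℝ) (k : Fin 2 → ℤ) : ℂ :=
  UnitAddTorus.mFourierCoeff (fun x => (φ x : ℂ)) k

/-- The symbol `⟨ξ⟩^σ = (1 + |ξ|²)^(σ/2)` at the frequency `ξ = 2πk` of `x ↦ exp (2πi k·x)`. -/
def japanese (σ : ℝ) (k : Fin 2 → ℤ) : ℝ :=
  (1 + ∑ i, (2 * Real.pi * (k i : ℝ)) ^ 2) ^ (σ / 2)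

/-- The weighted Fourier coefficients `⟨ξ⟩^σ φ^(ξ)`. -/
def sobCoeff (σ : ℝ) (φ : Torus2 → ℝ) (k : Fin 2 → ℤ) : ℂ :=
  (japanese σ k : ℂ) * coeff φ k

/-- `φ ∈ H^σ(𝕋²)`. Used only for `σ > 1`, where every element of `H^σ` has exactly one continuous
representative; `φ` is that representative. -/
def MemH (σ : ℝ) (φ : Torus2 → ℝ) : Prop :=
  Continuous φ ∧ Memℓp (sobCoeff σ φ) 2

open Classical in
/-- A function of `H^σ(𝕋²)` as a point of the Hilbert space `ℓ²`, through its weighted Fourier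
coefficients. On `H^σ` this is injective, linear, and `‖toSob σ φ‖` is the `H^σ` norm of `φ`;
hence continuity and strong measurability of `t ↦ φ(t) ∈ H^σ` are those of
`t ↦ toSob σ (φ t)`. -/
def toSob (σ : ℝ) (φ : Torus2 → ℝ) : lp (fun _ : Fin 2 → ℤ => ℂ) 2 :=
  if hφ : Memℓp (sobCoeff σ φ) 2 then ⟨sobCoeff σ φ, hφ⟩ else 0

/-- `φ ∈ C([0,T]; H^σ(𝕋²))`. -/
def MemCH (T σ : ℝ) (φ : ℝ → Torus2 → ℝ) : Prop :=
  (∀ t ∈ Icc 0 T, MemH σ (φ t)) ∧ ContinuousOn (fun t => toSob σ (φ t)) (Icc 0 T)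

/-- `φ ∈ L^∞(0,T; H^σ(𝕋²))`. -/
def MemLinftyH (T σ : ℝ) (φ : ℝ → Torus2 → ℝ) : Prop :=
  (∀ᵐ t ∂(volume.restrict (Ioo 0 T)), MemH σ (φ t)) ∧
    MemLp (fun t => toSob σ (φ t)) ⊤ (volume.restrict (Ioo 0 T))

/-- The Fourier multiplier `φ ↦ ∑ₖ m(k) φ^(k) exp (2πi k·x)`, as an element of `L²(𝕋²)`. -/
def multiplier (m : (Fin 2 → ℤ) → ℂ) (φ : Torus2 → ℝ) : Lp ℂ 2 torusMeasure :=
  ∑' k : Fin 2 → ℤ,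
    (m k * coeff φ k) • ContinuousMap.toLp 2 torusMeasure ℂ (UnitAddTorus.mFourier k)

/-- `⟨∇⟩^σ φ`. -/
def bessel (σ : ℝ) (φ : Torus2 → ℝ) : Lp ℂ 2 torusMeasure :=
  multiplier (fun k => (japanese σ k : ℂ)) φ

/-- `∂ᵢ ⟨∇⟩^σ φ`. -/
def besselPartial (σ : ℝ) (i : Fin 2) (φ : Torus2 → ℝ) : Lp ℂ 2 torusMeasure :=
  multiplier (fun k => (2 * Real.pi * (k i : ℝ) : ℝ) * Complex.I * (japanese σ k : ℂ)) φ

/-! ### The two fluid regions and their Sobolev spaces -/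

/-- `𝕋² × ℝ`, which contains the slab `𝕋² × (-1,1)`. -/
abbrev Bulk : Type := Torus2 × ℝ

abbrev bulkMeasure : Measure Bulk := torusMeasure.prod volume

/-- Three-dimensional vectors. -/
abbrev Vec3 : Type := EuclideanSpace ℝ (Fin 3)

/-- The covering map `ℝ³ → 𝕋² × ℝ`. -/
def bulkProj (y : Fin 3 → ℝ) : Bulk := (fun i => (y i.castSucc : UnitAddCircle), y 2)

/-- The partial derivative `∂ᵢ φ` on `𝕋² × ℝ`. -/
def bulkPartial (i : Fin 3) (φ : Bulk → ℝ) (p : Bulk) : ℝ :=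
  deriv (fun r : ℝ => φ (p + bulkProj (Pi.single i r))) 0

/-- `∂^α φ` for a multi-index `α`. -/
def multiPartial (α : Fin 3 → ℕ) (φ : Bulk → ℝ) : Bulk → ℝ :=
  (bulkPartial 0)^[α 0] ((bulkPartial 1)^[α 1] ((bulkPartial 2)^[α 2] φ))

/-- `φ ∈ C_c^∞(Ω)` for an open set `Ω ⊆ 𝕋² × ℝ`. -/
def IsTest (Ω : Set Bulk) (φ : Bulk → ℝ) : Prop :=
  ContDiff ℝ ∞ (fun y : Fin 3 → ℝ => φ (bulkProj y)) ∧ HasCompactSupport φ ∧ tsupport φ ⊆ Ω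

/-- `v ∈ L²(Ω)` is the weak derivative `∂^α u` of `u ∈ L²(Ω)`. -/
def IsWeakDeriv (Ω : Set Bulk) (α : Fin 3 → ℕ) (u v : Bulk → ℝ) : Prop :=
  MemLp u 2 (bulkMeasure.restrict Ω) ∧ MemLp v 2 (bulkMeasure.restrict Ω) ∧
    ∀ φ, IsTest Ω φ →
      ∫ p in Ω, u p * multiPartial α φ p ∂bulkMeasure =
        (-1) ^ (∑ i, α i) * ∫ p in Ω, v p * φ p ∂bulkMeasure

/-- The multi-indices of order at most `s`. -/
def multiIndices (s : ℕ) : Finset (Fin 3 → ℕ) :=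
  (Fintype.piFinset fun _ : Fin 3 => Finset.range (s + 1)).filter fun α => ∑ i, α i ≤ s

/-- The norm `(∑_{|α| ≤ s} ‖∂^α u‖²_{L²(Ω)})^{1/2}` of `H^s(Ω)`. Weak derivatives are unique almost
everywhere, so the infimum is over equal values; it is `∞` when `u ∉ H^s(Ω)`. -/
def bulkNorm (Ω : Set Bulk) (s : ℕ) (u : Bulk → ℝ) : ℝ≥0∞ :=
  ⨅ (v : (Fin 3 → ℕ) → Bulk → ℝ) (_ : ∀ α ∈ multiIndices s, IsWeakDeriv Ω α u (v α)),
    (∑ α ∈ multiIndices s, eLpNorm (v α) 2 (bulkMeasure.restrict Ω) ^ 2) ^ (1 / 2 : ℝ)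

/-- The `H^s(Ω)` norm of a vector field. -/
def bulkNormVec (Ω : Set Bulk) (s : ℕ) (u : Bulk → Vec3) : ℝ≥0∞ :=
  (∑ i, bulkNorm Ω s (fun p => u p i) ^ 2) ^ (1 / 2 : ℝ)

/-- `div u = 0` in `Ω`, in the sense of distributions. -/
def DivFree (Ω : Set Bulk) (u : Bulk → Vec3) : Prop :=
  ∀ φ, IsTest Ω φ → ∫ p in Ω, ∑ i, u p i * bulkPartial i φ p ∂bulkMeasure = 0

/-- The two sides of the interface. -/
inductive Side : Type
  | plus : Side
  | minus : Side

/-- The region `Ω_f^±`. -/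
def region (f : Torus2 → ℝ) : Side → Set Bulk
  | Side.plus => {p | f p.1 < p.2 ∧ p.2 < 1}
  | Side.minus => {p | -1 < p.2 ∧ p.2 < f p.1}

/-- `Ω_f^±` together with the interface `Γ_f` and the wall `Γ^±`. -/
def closedRegion (f : Torus2 → ℝ) : Side → Set Bulk
  | Side.plus => {p | f p.1 ≤ p.2 ∧ p.2 ≤ 1}
  | Side.minus => {p | -1 ≤ p.2 ∧ p.2 ≤ f p.1}

/-- The height of the wall `Γ^±`. -/
def wall : Side → ℝ
  | Side.plus => 1
  | Side.minus => -1

/-- The trace of a vector field on `Γ_f`, as a function on the torus. -/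
def trace (f : Torus2 → ℝ) (u : Bulk → Vec3) (x : Torus2) : Vec3 := u (x, f x)

/-- `N_f · a` at `x`, where `N_f = (-∂₁f, -∂₂f, 1)`. -/
def normalComp (f : Torus2 → ℝ) (x : Torus2) (a : Vec3) : ℝ :=
  -surfPartial 0 f x * a 0 - surfPartial 1 f x * a 1 + a 2

/-- `‖∂ₜ u‖_{L^∞(Γ_f)} ≤ L` at the time `t`: at every point of the interface `u` is differentiable
as a function of `(t, x)` in the closed space-time region on its side (one-sidedly at the interface
and at `t = 0, T`), and its time derivative there has length at most `L`. -/
def TimeDerivBound (T L : ℝ) (f : ℝ → Torus2 → ℝ) (σ : Side) (u : ℝ → Bulk → Vec3) (t : ℝ) :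
    Prop :=
  ∀ y : Fin 3 → ℝ, (bulkProj y).2 = f t (bulkProj y).1 →
    ∃ A : ℝ × (Fin 3 → ℝ) →L[ℝ] Vec3,
      HasFDerivWithinAt (fun q : ℝ × (Fin 3 → ℝ) => u q.1 (bulkProj q.2)) A
        {q | q.1 ∈ Icc 0 T ∧ bulkProj q.2 ∈ closedRegion (f q.1) σ} (t, y) ∧
      ‖A (1, 0)‖ ≤ L

/-- `wᵢ = ½ (u⁺ᵢ + u⁻ᵢ)` on the interface. -/
def meanVel (f : Torus2 → ℝ) (u : Side → Bulk → Vec3) (i : Fin 2) (x : Torus2) : ℝ :=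
  (trace f (u Side.plus) x i.castSucc + trace f (u Side.minus) x i.castSucc) / 2

/-- `vᵢ = ½ (u⁺ᵢ - u⁻ᵢ)` on the interface. -/
def jumpVel (f : Torus2 → ℝ) (u : Side → Bulk → Vec3) (i : Fin 2) (x : Torus2) : ℝ :=
  (trace f (u Side.plus) x i.castSucc - trace f (u Side.minus) x i.castSucc) / 2

/-- The stability functional
`Λ = inf_x inf_{|φ|=1} (h⁺₁φ₁ + h⁺₂φ₂)² + (h⁻₁φ₁ + h⁻₂φ₂)² - 2 (v₁φ₁ + v₂φ₂)²`. -/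
def stability (f : Torus2 → ℝ) (u h : Side → Bulk → Vec3) : ℝ :=
  ⨅ z : Torus2 × {φ : Fin 2 → ℝ // φ 0 ^ 2 + φ 1 ^ 2 = 1},
    (∑ i, trace f (h Side.plus) z.1 i.castSucc * z.2.1 i) ^ 2
      + (∑ i, trace f (h Side.minus) z.1 i.castSucc * z.2.1 i) ^ 2
      - 2 * (∑ i, jumpVel f u i z.1 * z.2.1 i) ^ 2

/-- The standing assumptions on the background state `(f, u^±, h^±)` at the time `t ∈ [0,T]`; `ft`
is `∂ₜ f`. A field of `H^s(Ω_f^±)`, `s ≥ 3`, is represented by its unique representative that is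
continuous up to the boundary. -/
structure BackgroundAt (s : ℕ) (c₀ L₀ L₁ L₂ T : ℝ) (f ft : ℝ → Torus2 → ℝ)
    (u h : Side → ℝ → Bulk → Vec3) (t : ℝ) : Prop where
  mem_f : MemH (s + 1 / 2) (f t)
  mem_ft : MemH (s - 1 / 2) (ft t)
  deriv_f : ∀ x, HasDerivWithinAt (fun τ => f τ x) (ft t x) (Icc 0 T) t
  cont_u : ∀ σ, ContinuousOn (u σ t) (closedRegion (f t) σ)
  cont_h : ∀ σ, ContinuousOn (h σ t) (closedRegion (f t) σ)
  bound_trace : ∀ σ x, ‖trace (f t) (u σ t) x‖ ≤ L₀ ∧ ‖trace (f t) (h σ t) x‖ ≤ L₀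
  bound_norm :
    ENNReal.ofReal ‖toSob (s + 1 / 2) (f t)‖ + ENNReal.ofReal ‖toSob (s - 1 / 2) (ft t)‖
      + (bulkNormVec (region (f t) Side.plus) s (u Side.plus t)
        + bulkNormVec (region (f t) Side.minus) s (u Side.minus t))
      + (bulkNormVec (region (f t) Side.plus) s (h Side.plus t)
        + bulkNormVec (region (f t) Side.minus) s (h Side.minus t)) ≤ ENNReal.ofReal L₁
  bound_time_u : ∀ σ, TimeDerivBound T L₂ f σ (u σ) t
  bound_time_h : ∀ σ, TimeDerivBound T L₂ f σ (h σ) t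
  height : ∀ x, -(1 - c₀) ≤ f t x ∧ f t x ≤ 1 - c₀
  stable : c₀ ≤ stability (f t) (fun σ => u σ t) (fun σ => h σ t)
  div_u : ∀ σ, DivFree (region (f t) σ) (u σ t)
  div_h : ∀ σ, DivFree (region (f t) σ) (h σ t)
  interface_h : ∀ σ x, normalComp (f t) x (trace (f t) (h σ t) x) = 0
  interface_u : ∀ σ x, ft t x = normalComp (f t) x (trace (f t) (u σ t) x)
  wall_u : ∀ σ x, u σ t (x, wall σ) 2 = 0
  wall_h : ∀ σ x, h σ t (x, wall σ) 2 = 0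

/-! ### The linearized system -/

/-- The right-hand side of the equation for `∂ₜ θ` at a fixed time, at the unknowns `(φ, θ)`:
`-(u⁺ᵢ + u⁻ᵢ) ∂ᵢθ - ½ (u⁺ᵢu⁺ⱼ - h⁺ᵢh⁺ⱼ + u⁻ᵢu⁻ⱼ - h⁻ᵢh⁻ⱼ) ∂ᵢ∂ⱼφ + g`. -/
def linRHS (f : Torus2 → ℝ) (u h : Side → Bulk → Vec3) (g φ θ : Torus2 → ℝ) (x : Torus2) : ℝ :=
  -(∑ i : Fin 2, (trace f (u Side.plus) x i.castSucc + trace f (u Side.minus) x i.castSucc)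
      * surfPartial i θ x)
    - 1 / 2 * (∑ i : Fin 2, ∑ j : Fin 2,
      (trace f (u Side.plus) x i.castSucc * trace f (u Side.plus) x j.castSucc
        - trace f (h Side.plus) x i.castSucc * trace f (h Side.plus) x j.castSucc
        + trace f (u Side.minus) x i.castSucc * trace f (u Side.minus) x j.castSucc
        - trace f (h Side.minus) x i.castSucc * trace f (h Side.minus) x j.castSucc)
        * surfPartial i (surfPartial j φ) x)
    + g x

/-- `(φ, θ) ∈ C([0,T]; H^{s+1/2} × H^{s-1/2})` solves `∂ₜφ = θ`, `∂ₜθ = linRHS`, with initial data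
`(φ₀, θ₀)`. As `s ≥ 3`, all terms are continuous in `x`; the second equation holds for almost every
time, which is expressed by its integrated form. -/
structure IsLinSolution (s : ℕ) (T : ℝ) (f : ℝ → Torus2 → ℝ) (u h : Side → ℝ → Bulk → Vec3)
    (g : ℝ → Torus2 → ℝ) (φ₀ θ₀ : Torus2 → ℝ) (φ θ : ℝ → Torus2 → ℝ) : Prop where
  mem_φ : MemCH T (s + 1 / 2) φ
  mem_θ : MemCH T (s - 1 / 2) θ
  init_φ : φ 0 = φ₀
  init_θ : θ 0 = θ₀
  eq_φ : ∀ t ∈ Icc 0 T, ∀ x, HasDerivWithinAt (fun τ => φ τ x) (θ t x) (Icc 0 T) t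
  integrable_rhs : ∀ x, IntervalIntegrable
    (fun τ => linRHS (f τ) (fun σ => u σ τ) (fun σ => h σ τ) (g τ) (φ τ) (θ τ) x) volume 0 T
  eq_θ : ∀ t ∈ Icc 0 T, ∀ x, θ t x = θ₀ x +
    ∫ τ in (0 : ℝ)..t, linRHS (f τ) (fun σ => u σ τ) (fun σ => h σ τ) (g τ) (φ τ) (θ τ) x

/-- The energy functional
`E_s(θ, φ) = ‖⟨∇⟩^{s-1/2}θ + wᵢ∂ᵢ⟨∇⟩^{s-1/2}φ‖² - ‖vᵢ∂ᵢ⟨∇⟩^{s-1/2}φ‖²`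
`+ ½ ‖h⁺ᵢ∂ᵢ⟨∇⟩^{s-1/2}φ‖² + ½ ‖h⁻ᵢ∂ᵢ⟨∇⟩^{s-1/2}φ‖²` (norms of `L²(𝕋²)`). -/
def energy (s : ℕ) (f : Torus2 → ℝ) (u h : Side → Bulk → Vec3) (θ φ : Torus2 → ℝ) : ℝ :=
  (∫ x, ‖bessel (s - 1 / 2) θ x
      + ∑ i, (meanVel f u i x : ℂ) * besselPartial (s - 1 / 2) i φ x‖ ^ 2 ∂torusMeasure)
    - (∫ x, ‖∑ i, (jumpVel f u i x : ℂ) * besselPartial (s - 1 / 2) i φ x‖ ^ 2 ∂torusMeasure)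
    + 1 / 2 * (∫ x, ‖∑ i : Fin 2, (trace f (h Side.plus) x i.castSucc : ℂ)
        * besselPartial (s - 1 / 2) i φ x‖ ^ 2 ∂torusMeasure)
    + 1 / 2 * (∫ x, ‖∑ i : Fin 2, (trace f (h Side.minus) x i.castSucc : ℂ)
        * besselPartial (s - 1 / 2) i φ x‖ ^ 2 ∂torusMeasure)

end CurrentVortex

end

noncomputable section

namespace CurrentVortex

open Filter Topology
open ENNReal (ofReal ofReal_add ofReal_mul ofReal_ofNat ofReal_one ofReal_pow tsum_add tsum_le_tsum)
open UnitAddTorus (mFourier mFourierCoeff mFourier_neg)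
open Complex (I I_sq add_re continuous_re norm_I norm_real ofReal_re reCLM real_smul)
open Real (exp norm_eq_abs norm_of_nonneg rpow_add rpow_add_one rpow_mul rpow_zero sq_sqrt sqrt
  sqrt_nonneg)
open ContinuousMap (coeFn_toLp coe_mk dist_le evalCLM norm_le toLp)
open intervalIntegral (integral_congr integral_of_le integral_same)
open ContinuousLinearMap (fst intervalIntegral_comp_comm prodₗᵢ single snd)
open Metric (tendstoUniformly_iff)
open Finset (sum_add_distrib sum_congr sum_le_sum sum_sub_distrib)
open Fin (sum_univ_three sum_univ_two)
open HasCompactSupport (of_compactSpace)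
open Function (comp_def)

section

/-- Frequencies on the torus. -/
abbrev Freq : Type := Fin 2 → ℤ

/-- Square summable sequences of Fourier coefficients. -/
abbrev Seq : Type := lp (fun _ : Freq => ℂ) 2

/-! ### Weights -/

/-- The component `2π kᵢ` of the frequency. -/
def xi (i : Fin 2) (k : Freq) : ℝ := 2 * Real.pi * (k i : ℝ)

/-- The bracket `⟨ξ⟩`. -/
def jap (k : Freq) : ℝ := sqrt (1 + ∑ i, xi i k ^ 2)

lemma jap_sq (k : Freq) : jap k ^ 2 = 1 + ∑ i, xi i k ^ 2 :=
  sq_sqrt (by positivity)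

lemma one_le_jap (k : Freq) : 1 ≤ jap k := by
  rw [jap, Real.one_le_sqrt]
  have : 0 ≤ ∑ i, xi i k ^ 2 := by positivity
  linarith

lemma jap_pos (k : Freq) : 0 < jap k := lt_of_lt_of_le one_pos (one_le_jap k)

lemma japanese_eq (σ : ℝ) (k : Freq) : japanese σ k = jap k ^ σ := by
  have h : (0 : ℝ) ≤ 1 + ∑ i, xi i k ^ 2 := by positivity
  rw [jap, Real.sqrt_eq_rpow, ← rpow_mul h, japanese, div_eq_inv_mul σ 2, one_div]
  rfl

lemma abs_xi_le (i : Fin 2) (k : Freq) : |xi i k| ≤ jap k := by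
  apply Real.abs_le_sqrt
  have := Finset.single_le_sum (f := fun i => xi i k ^ 2) (fun i _ => sq_nonneg _)
    (Finset.mem_univ i)
  linarith

lemma xi_sub (i : Fin 2) (k l : Freq) : xi i (k - l) = xi i k - xi i l := by
  simp [xi]; ring

lemma xi_neg (i : Fin 2) (k : Freq) : xi i (-k) = -xi i k := by
  simp [xi]

lemma jap_neg (k : Freq) : jap (-k) = jap k := by
  simp [jap, xi_neg]

lemma jap_eq_norm (k : Freq) : jap k = ‖(!₂[1, xi 0 k, xi 1 k] : EuclideanSpace ℝ (Fin 3))‖ := by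
  rw [EuclideanSpace.norm_eq, jap]
  simp [sum_univ_three, sum_univ_two, add_assoc]

lemma abs_jap_sub_le (k l : Freq) : |jap k - jap l| ≤ jap (k - l) := by
  rw [jap_eq_norm k, jap_eq_norm l]
  refine (abs_norm_sub_norm_le _ _).trans ?_
  rw [EuclideanSpace.norm_eq, jap]
  apply Real.sqrt_le_sqrt
  simp [sum_univ_three, sum_univ_two, xi_sub]

lemma jap_le_add (k l : Freq) : jap k ≤ jap (k - l) + jap l := by
  have := (abs_le.1 (abs_jap_sub_le k l)).2
  linarith

lemma norm_le_jap (k : Freq) : ‖k‖ ≤ jap k := by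
  rw [pi_norm_le_iff_of_nonneg (jap_pos k).le]
  intro i
  refine le_trans ?_ (abs_xi_le i k)
  rw [xi, abs_mul, abs_of_pos Real.two_pi_pos, Int.norm_eq_abs]
  have h := abs_nonneg (k i : ℝ)
  nlinarith [Real.pi_gt_three]

lemma summable_jap_rpow {p : ℝ} (hp : 2 < p) : Summable fun k : Freq => jap k ^ (-p) := by
  have h := (EisensteinSeries.summable_one_div_norm_rpow hp).add
    (summable_of_hasFiniteSupport (f := fun k : Freq => if k = 0 then (1 : ℝ) else 0) (by
      apply (Set.finite_singleton (0 : Freq)).subset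
      intro k hk; simpa using hk))
  refine Summable.of_nonneg_of_le (fun k => by have := jap_pos k; positivity) (fun k => ?_) h
  by_cases hk : k = 0
  · subst hk
    have : jap 0 ^ (-p) ≤ 1 :=
      Real.rpow_le_one_of_one_le_of_nonpos (one_le_jap 0) (by linarith)
    have h0 : 0 ≤ ‖(0 : Freq)‖ ^ (-p) := by positivity
    simp only [if_true]
    linarith
  · simp only [hk, if_false, add_zero]
    exact Real.rpow_le_rpow_of_nonpos (norm_pos_iff.2 hk) (norm_le_jap k) (by linarith)

lemma rpow_add_le {σ x y : ℝ} (hσ : 0 ≤ σ) (hx : 0 ≤ x) (hy : 0 ≤ y) :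
    (x + y) ^ σ ≤ 2 ^ σ * (x ^ σ + y ^ σ) := by
  have h1 : x + y ≤ 2 * max x y := by
    have := le_max_left x y
    have := le_max_right x y
    linarith
  calc (x + y) ^ σ ≤ (2 * max x y) ^ σ := Real.rpow_le_rpow (by positivity) h1 hσ
    _ = 2 ^ σ * (max x y) ^ σ := Real.mul_rpow (by norm_num) (by positivity)
    _ ≤ 2 ^ σ * (x ^ σ + y ^ σ) := by
        gcongr
        rcases max_cases x y with h | h <;> rw [h.1]
        · have : 0 ≤ y ^ σ := by positivity
          linarith
        · have : 0 ≤ x ^ σ := by positivity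
          linarith

lemma jap_rpow_le {σ : ℝ} (hσ : 0 ≤ σ) (k l : Freq) :
    jap k ^ σ ≤ 2 ^ σ * (jap (k - l) ^ σ + jap l ^ σ) :=
  (Real.rpow_le_rpow (jap_pos k).le (jap_le_add k l) hσ).trans
    (rpow_add_le hσ (jap_pos _).le (jap_pos _).le)

lemma abs_rpow_sub_le {r x y : ℝ} (hr : 1 ≤ r) (hx : 0 ≤ x) (hy : 0 ≤ y) :
    |x ^ r - y ^ r| ≤ r * 2 ^ (r - 1) * |x - y| * (|x - y| ^ (r - 1) + y ^ (r - 1)) := by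
  have hmax : |x ^ r - y ^ r| ≤ r * (max x y) ^ (r - 1) * |x - y| := by
    have key := Convex.norm_image_sub_le_of_norm_hasDerivWithin_le (𝕜 := ℝ)
      (f := fun t : ℝ => t ^ r) (f' := fun t => r * t ^ (r - 1)) (s := Icc 0 (max x y))
      (x := y) (y := x) (C := r * (max x y) ^ (r - 1))
      (fun t ht => (Real.hasDerivAt_rpow_const (Or.inr hr)).hasDerivWithinAt)
      (fun t ht => by
        rw [norm_eq_abs, abs_of_nonneg (by have := ht.1; positivity)]
        have := Real.rpow_le_rpow ht.1 ht.2 (by linarith : 0 ≤ r - 1)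
        gcongr) (convex_Icc _ _) ⟨hy, le_max_right _ _⟩ ⟨hx, le_max_left _ _⟩
    simpa [norm_eq_abs] using key
  have h2 : max x y ≤ |x - y| + y := by
    rcases max_cases x y with h | h <;> rw [h.1]
    · have := le_abs_self (x - y); linarith
    · have := abs_nonneg (x - y); linarith
  have h3 : (max x y) ^ (r - 1) ≤ 2 ^ (r - 1) * (|x - y| ^ (r - 1) + y ^ (r - 1)) :=
    (Real.rpow_le_rpow (by positivity) h2 (by linarith)).trans
      (rpow_add_le (by linarith) (abs_nonneg _) hy)
  calc _ ≤ r * (max x y) ^ (r - 1) * |x - y| := hmax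
    _ ≤ r * (2 ^ (r - 1) * (|x - y| ^ (r - 1) + y ^ (r - 1))) * |x - y| := by gcongr
    _ = _ := by ring

/-! ### Convolution estimates in `ℝ≥0∞` -/

lemma ENNReal_tsum_mul_sq_le {ι : Type*} (f g : ι → ℝ≥0∞) :
    (∑' k, f k * g k) ^ 2 ≤ (∑' k, f k ^ 2) * ∑' k, g k ^ 2 := by
  let _ : MeasurableSpace ι := ⊤
  have h := ENNReal.lintegral_mul_le_Lp_mul_Lq (Measure.count : Measure ι)
    Real.HolderConjugate.two_two (f := f) (g := g)
    (measurable_from_top.aemeasurable) (measurable_from_top.aemeasurable)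
  simp only [Pi.mul_apply, lintegral_count] at h
  have h2 := ENNReal.rpow_le_rpow h (z := 2) (by norm_num)
  rw [ENNReal.mul_rpow_of_nonneg _ _ (by norm_num), ← ENNReal.rpow_mul, ← ENNReal.rpow_mul] at h2
  norm_num at h2
  exact h2

lemma ENNReal_tsum_add_sq_le {ι : Type*} (f g : ι → ℝ≥0∞) :
    ∑' k, (f k + g k) ^ 2 ≤ 2 * ∑' k, f k ^ 2 + 2 * ∑' k, g k ^ 2 := by
  rw [← ENNReal.tsum_mul_left, ← ENNReal.tsum_mul_left, ← tsum_add]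
  refine tsum_le_tsum fun k => ?_
  have h := ENNReal.rpow_add_le_mul_rpow_add_rpow (f k) (g k) (p := 2) (by norm_num)
  norm_num at h
  rwa [mul_add] at h

/-- Discrete convolution. -/
def conv (f g : Freq → ℝ≥0∞) (k : Freq) : ℝ≥0∞ := ∑' l, f (k - l) * g l

lemma conv_comm (f g : Freq → ℝ≥0∞) : conv f g = conv g f := by
  funext k
  rw [conv, conv, ← (Equiv.subLeft k).tsum_eq]
  simp [mul_comm]

/-- Young's inequality `ℓ¹ * ℓ² ⊆ ℓ²`. -/
lemma young (f g : Freq → ℝ≥0∞) :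
    ∑' k, conv f g k ^ 2 ≤ (∑' k, f k) ^ 2 * ∑' k, g k ^ 2 := by
  have hs : ∀ k : Freq, ∑' l, f (k - l) = ∑' l, f l := fun k => (Equiv.subLeft k).tsum_eq f
  have h1 : ∀ k, conv f g k ^ 2 ≤ (∑' l, f l) * ∑' l, f (k - l) * g l ^ 2 := by
    intro k
    have h := ENNReal_tsum_mul_sq_le (fun l => f (k - l) ^ (1 / 2 : ℝ))
      (fun l => f (k - l) ^ (1 / 2 : ℝ) * g l)
    have e1 : ∀ x : ℝ≥0∞, x ^ (1 / 2 : ℝ) * x ^ (1 / 2 : ℝ) = x := fun x => by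
      rw [← ENNReal.rpow_add_of_nonneg _ _ (by norm_num) (by norm_num)]; norm_num
    have e2 : ∀ x : ℝ≥0∞, (x ^ (1 / 2 : ℝ)) ^ 2 = x := fun x => by rw [sq, e1]
    simp only [mul_pow, e2, ← mul_assoc, e1, hs] at h
    exact h
  calc ∑' k, conv f g k ^ 2 ≤ ∑' k, (∑' l, f l) * ∑' l, f (k - l) * g l ^ 2 :=
        tsum_le_tsum h1
    _ = (∑' l, f l) * ∑' l, ∑' k, f (k - l) * g l ^ 2 := by
        rw [ENNReal.tsum_mul_left, ENNReal.tsum_comm]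
    _ = (∑' l, f l) * ∑' l, (∑' k, f k) * g l ^ 2 := by
        congr 1
        refine tsum_congr fun l => ?_
        rw [ENNReal.tsum_mul_right, ← (Equiv.subRight l).tsum_eq f]
        rfl
    _ = _ := by rw [ENNReal.tsum_mul_left, sq, mul_assoc]

/-- The squared weighted norm `∑ ⟨k⟩^{2σ} |c k|²`. -/
def wsq (σ : ℝ) (c : Freq → ℝ≥0∞) : ℝ≥0∞ := ∑' k, (ofReal (jap k ^ σ) * c k) ^ 2

/-- The sum `∑ ⟨k⟩^{-2p}`. -/
def wconst (p : ℝ) : ℝ≥0∞ := ∑' k : Freq, ofReal (jap k ^ (-p)) ^ 2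

lemma wconst_lt_top {p : ℝ} (hp : 1 < p) : wconst p < ⊤ := by
  have h : ∀ k : Freq, ofReal (jap k ^ (-p)) ^ 2 = ofReal (jap k ^ (-(2 * p))) := by
    intro k
    have := jap_pos k
    rw [← ofReal_pow (by positivity), ← Real.rpow_natCast, ← rpow_mul this.le]
    congr 2; push_cast; ring
  rw [wconst]
  simp only [h]
  exact (summable_jap_rpow (by linarith : 2 < 2 * p)).tsum_ofReal_lt_top

lemma ofReal_jap_mul (k : Freq) (a b : ℝ) :
    ofReal (jap k ^ a) * ofReal (jap k ^ b) = ofReal (jap k ^ (a + b)) := by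
  have := jap_pos k
  rw [← ofReal_mul (by positivity), rpow_add this]

/-- A weighted `ℓ²` bound gives a weighted `ℓ¹` bound. -/
lemma tsum_weight_sq_le (σ τ : ℝ) (c : Freq → ℝ≥0∞) :
    (∑' k, ofReal (jap k ^ σ) * c k) ^ 2 ≤ wconst (τ - σ) * wsq τ c := by
  have h := ENNReal_tsum_mul_sq_le (fun k => ofReal (jap k ^ (-(τ - σ))))
    (fun k => ofReal (jap k ^ τ) * c k)
  refine le_trans (le_of_eq ?_) h
  congr 1
  refine tsum_congr fun k => ?_
  rw [← mul_assoc, ofReal_jap_mul]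
  congr 3; ring

lemma wsq_mono {σ τ : ℝ} (h : σ ≤ τ) (c : Freq → ℝ≥0∞) : wsq σ c ≤ wsq τ c := by
  refine tsum_le_tsum fun k => ?_
  gcongr
  exact one_le_jap k

/-- Multiplication by an element of `H^r` is bounded on `H^σ` for `0 ≤ σ ≤ r`. -/
lemma wsq_conv_le {r σ : ℝ} (hr : 5 / 2 ≤ r) (h0 : 0 ≤ σ) (hσ : σ ≤ r) (a g : Freq → ℝ≥0∞) :
    wsq σ (conv a g) ≤ 4 * ofReal (2 ^ σ) ^ 2 * wconst (5 / 4) * wsq r a * wsq σ g := by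
  set A : Freq → ℝ≥0∞ := fun k => ofReal (jap k ^ σ) * a k with hA
  set G : Freq → ℝ≥0∞ := fun k => ofReal (jap k ^ σ) * g k with hG
  have h1 : ∀ k, ofReal (jap k ^ σ) * conv a g k ≤
      ofReal (2 ^ σ) * (conv A g k + conv a G k) := by
    intro k
    simp only [conv]
    rw [← ENNReal.tsum_mul_left, ← tsum_add, ← ENNReal.tsum_mul_left]
    refine tsum_le_tsum fun l => ?_
    have e : ofReal (2 ^ σ) * (A (k - l) * g l + a (k - l) * G l) =
      (ofReal (2 ^ σ) * (ofReal (jap (k - l) ^ σ) + ofReal (jap l ^ σ)))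
        * (a (k - l) * g l) := by
      simp only [hA, hG]; ring
    rw [e]
    gcongr
    have := jap_pos (k - l)
    have := jap_pos l
    rw [← ofReal_add (by positivity) (by positivity), ← ofReal_mul (by positivity)]
    exact ENNReal.ofReal_le_ofReal (jap_rpow_le h0 k l)
  have h2 : wsq σ (conv a g) ≤ ofReal (2 ^ σ) ^ 2 *
      (2 * ∑' k, conv A g k ^ 2 + 2 * ∑' k, conv a G k ^ 2) := by
    calc wsq σ (conv a g) ≤ ∑' k, (ofReal (2 ^ σ) * (conv A g k + conv a G k)) ^ 2 :=
          tsum_le_tsum fun k => pow_le_pow_left' (h1 k) 2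
      _ = ofReal (2 ^ σ) ^ 2 * ∑' k, (conv A g k + conv a G k) ^ 2 := by
          simp only [mul_pow, ENNReal.tsum_mul_left]
      _ ≤ _ := by gcongr; exact ENNReal_tsum_add_sq_le _ _
  have hGsq : ∑' k, G k ^ 2 = wsq σ g := rfl
  have hAsq : ∑' k, A k ^ 2 = wsq σ a := rfl
  have hw : ∀ p, 5 / 4 ≤ p → wconst p ≤ wconst (5 / 4) := by
    intro p hp
    refine tsum_le_tsum fun k => ?_
    gcongr
    exact one_le_jap k
  have h4 : ∑' k, conv a G k ^ 2 ≤ wconst (5 / 4) * wsq r a * wsq σ g := by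
    refine (young a G).trans ?_
    rw [hGsq]
    gcongr
    have := tsum_weight_sq_le 0 r a
    simp only [rpow_zero, ofReal_one, one_mul] at this
    refine this.trans ?_
    gcongr
    exact hw _ (by linarith)
  have h3 : ∑' k, conv A g k ^ 2 ≤ wconst (5 / 4) * wsq r a * wsq σ g := by
    by_cases hc : σ ≤ 5 / 4
    · refine (young A g).trans ?_
      gcongr
      · refine (tsum_weight_sq_le σ r a).trans ?_
        gcongr
        exact hw _ (by linarith)
      · have := wsq_mono h0 g
        simpa [wsq] using this
    · rw [conv_comm]
      refine (young g A).trans ?_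
      rw [hAsq]
      have := tsum_weight_sq_le 0 σ g
      simp only [rpow_zero, ofReal_one, one_mul] at this
      calc _ ≤ (wconst (σ - 0) * wsq σ g) * wsq σ a := by gcongr
        _ ≤ (wconst (5 / 4) * wsq σ g) * wsq r a := by
            gcongr
            · exact hw _ (by linarith)
            · exact wsq_mono hσ a
        _ = _ := by ring
  calc _ ≤ ofReal (2 ^ σ) ^ 2 *
      (2 * (wconst (5 / 4) * wsq r a * wsq σ g) + 2 * (wconst (5 / 4) * wsq r a * wsq σ g)) := by
        refine h2.trans ?_
        gcongr
    _ = _ := by ring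

end

section

/-! ### Norms of square summable sequences -/

lemma Seq.summable_sq (x : Seq) : Summable fun k => ‖x k‖ ^ 2 := by
  simpa using (lp.memℓp x).summable (by norm_num)

lemma Seq.norm_sq (x : Seq) : ‖x‖ ^ 2 = ∑' k, ‖x k‖ ^ 2 := by
  simpa using lp.norm_rpow_eq_tsum (p := 2) (by norm_num) x

lemma Seq.enorm_sq (x : Seq) : ‖x‖ₑ ^ 2 = ∑' k, ‖x k‖ₑ ^ 2 := by
  rw [← ofReal_norm, ← ofReal_pow (norm_nonneg _), Seq.norm_sq,
    ENNReal.ofReal_tsum_of_nonneg (fun _ => by positivity) x.summable_sq]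
  simp only [ofReal_pow (norm_nonneg _), ofReal_norm]

lemma Seq.norm_apply_le (x : Seq) (k : Freq) : ‖x k‖ ≤ ‖x‖ :=
  lp.norm_apply_le_norm (by norm_num) x k

lemma Seq.norm_le_of_sum {x : Seq} {C : ℝ} (hC : 0 ≤ C)
    (h : ∀ s : Finset Freq, ∑ k ∈ s, ‖x k‖ ^ 2 ≤ C ^ 2) : ‖x‖ ≤ C := by
  refine lp.norm_le_of_forall_sum_le (by norm_num) hC fun s => ?_
  simpa using h s

lemma Seq.sum_le_norm_sq (x : Seq) (s : Finset Freq) : ∑ k ∈ s, ‖x k‖ ^ 2 ≤ ‖x‖ ^ 2 := by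
  simpa using lp.sum_rpow_le_norm_rpow (p := 2) (by norm_num) x s

lemma Seq.norm_le_mul {x y : Seq} {C : ℝ} (hC : 0 ≤ C) (h : ∀ k, ‖x k‖ ≤ C * ‖y k‖) :
    ‖x‖ ≤ C * ‖y‖ := by
  refine Seq.norm_le_of_sum (by positivity) fun s => ?_
  calc ∑ k ∈ s, ‖x k‖ ^ 2 ≤ ∑ k ∈ s, C ^ 2 * ‖y k‖ ^ 2 := by
        refine sum_le_sum fun k _ => ?_
        rw [← mul_pow]
        exact pow_le_pow_left₀ (norm_nonneg _) (h k) 2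
    _ ≤ (C * ‖y‖) ^ 2 := by
        rw [← Finset.mul_sum, mul_pow]
        have := y.sum_le_norm_sq s
        gcongr

/-- A sequence as an element of `ℓ²`; zero when it is not square summable. -/
def mkSeq (c : Freq → ℂ) : Seq := by
  classical exact if h : Memℓp c 2 then ⟨c, h⟩ else 0

lemma mkSeq_apply {c : Freq → ℂ} (h : Memℓp c 2) (k : Freq) : mkSeq c k = c k := by
  rw [mkSeq, dif_pos h]

lemma memℓp_of_bound {c : Freq → ℂ} {C : ℝ} (h : ∀ s : Finset Freq, ∑ k ∈ s, ‖c k‖ ^ 2 ≤ C) :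
    Memℓp c 2 := by
  refine memℓp_gen' (C := C) fun s => ?_
  simpa using h s

lemma memℓp_of_le {c : Freq → ℂ} {y : Seq} {C : ℝ} (h : ∀ k, ‖c k‖ ≤ C * ‖y k‖) :
    Memℓp c 2 := by
  refine memℓp_of_bound (C := C ^ 2 * ‖y‖ ^ 2) fun s => ?_
  calc ∑ k ∈ s, ‖c k‖ ^ 2 ≤ ∑ k ∈ s, C ^ 2 * ‖y k‖ ^ 2 := by
        refine sum_le_sum fun k _ => ?_
        rw [← mul_pow]
        exact pow_le_pow_left₀ (norm_nonneg _) (h k) 2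
    _ ≤ _ := by
        rw [← Finset.mul_sum]
        have := y.sum_le_norm_sq s
        gcongr

lemma Seq.real_inner_eq (x y : Seq) : inner ℝ x y = ∑' k, (x k * star (y k)).re := by
  rw [lp.inner_eq_tsum]
  refine tsum_congr fun k => ?_
  rw [Complex.inner]
  simp [mul_comm]

/-! ### Fourier multipliers -/

/-- Being a bounded symbol. -/
def IsBdd (m : Freq → ℂ) : Prop := ∃ C, ∀ k, ‖m k‖ ≤ C

lemma IsBdd.memℓp {m : Freq → ℂ} (hm : IsBdd m) (x : Seq) : Memℓp (fun k => m k * x k) 2 := by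
  obtain ⟨C, hC⟩ := hm
  refine memℓp_of_le (y := x) (C := C) fun k => ?_
  rw [norm_mul]
  gcongr
  exact hC k

/-- The diagonal operator with a bounded symbol. -/
def diagOfBdd {m : Freq → ℂ} (hm : IsBdd m) : Seq →L[ℝ] Seq :=
  LinearMap.mkContinuous
    { toFun := fun x => ⟨fun k => m k * x k, hm.memℓp x⟩
      map_add' := fun x y => by ext k; exact mul_add _ _ _
      map_smul' := fun c x => by ext k; simp [mul_left_comm] }
    (max hm.choose 0) (fun x => Seq.norm_le_mul (le_max_right _ _) fun k => by
      simp only [LinearMap.coe_mk, AddHom.coe_mk, norm_mul]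
      gcongr
      exact (hm.choose_spec k).trans (le_max_left _ _))

open Classical in
/-- The diagonal operator with symbol `m`; zero when `m` is unbounded. -/
def diag (m : Freq → ℂ) : Seq →L[ℝ] Seq :=
  if hm : IsBdd m then diagOfBdd hm else 0

lemma diag_apply {m : Freq → ℂ} (hm : IsBdd m) (x : Seq) (k : Freq) :
    diag m x k = m k * x k := by
  rw [diag, dif_pos hm]; rfl

lemma norm_diag_apply_le {m : Freq → ℂ} {C : ℝ} (hC : ∀ k, ‖m k‖ ≤ C) (x : Seq) :
    ‖diag m x‖ ≤ C * ‖x‖ := by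
  have h0 : 0 ≤ C := (norm_nonneg _).trans (hC 0)
  refine Seq.norm_le_mul h0 fun k => ?_
  rw [diag_apply ⟨C, hC⟩, norm_mul]
  gcongr
  exact hC k

lemma diag_comm {m n : Freq → ℂ} (hm : IsBdd m) (hn : IsBdd n) (x : Seq) :
    diag m (diag n x) = diag n (diag m x) := by
  ext k
  rw [diag_apply hm, diag_apply hn, diag_apply hn, diag_apply hm]
  ring

lemma diag_one (x : Seq) : diag (fun _ => 1) x = x := by
  ext k
  rw [diag_apply ⟨1, by simp⟩, one_mul]

lemma inner_diag_real {m : Freq → ℝ} (hm : IsBdd fun k => (m k : ℂ)) (x y : Seq) :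
    inner ℝ (diag (fun k => (m k : ℂ)) x) y = inner ℝ x (diag (fun k => (m k : ℂ)) y) := by
  rw [Seq.real_inner_eq, Seq.real_inner_eq]
  refine tsum_congr fun k => ?_
  rw [diag_apply hm, diag_apply hm]
  simp
  ring

lemma inner_diag_imag {m : Freq → ℝ} (hm : IsBdd fun k => (m k : ℂ) * I) (x y : Seq) :
    inner ℝ (diag (fun k => (m k : ℂ) * I) x) y =
      -inner ℝ x (diag (fun k => (m k : ℂ) * I) y) := by
  rw [Seq.real_inner_eq, Seq.real_inner_eq, ← tsum_neg]
  refine tsum_congr fun k => ?_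
  rw [diag_apply hm, diag_apply hm]
  simp
  ring

/-! ### Multiplication operators -/

/-- The trigonometric basis of `L²(𝕋²)`. -/
def torusBasis : HilbertBasis Freq ℂ (Lp ℂ 2 torusMeasure) := UnitAddTorus.mFourierBasis

lemma torusBasis_repr (f : Lp ℂ 2 torusMeasure) (k : Freq) :
    torusBasis.repr f k = mFourierCoeff (f : Torus2 → ℂ) k :=
  UnitAddTorus.mFourierBasis_repr f k

lemma mFourierCoeff_eq (f : Torus2 → ℂ) (k : Freq) :
    mFourierCoeff f k = ∫ x, mFourier (-k) x * f x ∂torusMeasure := rfl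

lemma coeff_eq (φ : Torus2 → ℝ) (k : Freq) :
    coeff φ k = ∫ x, mFourier (-k) x * (φ x : ℂ) ∂torusMeasure := rfl

lemma norm_mFourier_apply (k : Freq) (x : Torus2) : ‖mFourier k x‖ = 1 := by
  simp [mFourier, fourier_apply, Circle.norm_coe]

/-- A real continuous function as a complex one. -/
def toC (a : C(Torus2, ℝ)) : C(Torus2, ℂ) := ⟨fun x => (a x : ℂ), by fun_prop⟩

lemma memLp_mul (a : C(Torus2, ℝ)) (f : Lp ℂ 2 torusMeasure) :
    MemLp (fun x => (a x : ℂ) * f x) 2 torusMeasure :=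
  (Lp.memLp f).of_le_mul (c := ‖a‖)
    (((toC a).continuous.aestronglyMeasurable).mul (Lp.memLp f).1)
    (Filter.Eventually.of_forall fun x => by
      rw [norm_mul, norm_real]
      gcongr
      exact a.norm_coe_le_norm x)

/-- Multiplication by `a` on `L²(𝕋²)`. -/
def mulLp (a : C(Torus2, ℝ)) : Lp ℂ 2 torusMeasure →L[ℝ] Lp ℂ 2 torusMeasure :=
  LinearMap.mkContinuous
    { toFun := fun f => (memLp_mul a f).toLp
      map_add' := fun f g => by
        rw [← MemLp.toLp_add]
        apply MemLp.toLp_congr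
        filter_upwards [Lp.coeFn_add f g] with x hx
        simp only [hx, Pi.add_apply, mul_add]
      map_smul' := fun c f => by
        simp only [RingHom.id_apply]
        rw [← MemLp.toLp_const_smul]
        apply MemLp.toLp_congr
        filter_upwards [Lp.coeFn_smul c f] with x hx
        simp [hx, mul_left_comm] }
    ‖a‖ (fun f => by
      refine Lp.norm_le_mul_norm_of_ae_le_mul ?_
      simp only [LinearMap.coe_mk, AddHom.coe_mk]
      filter_upwards [(memLp_mul a f).coeFn_toLp] with x hx
      rw [hx, norm_mul, norm_real]
      gcongr
      exact a.norm_coe_le_norm x)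

lemma coeFn_mulLp (a : C(Torus2, ℝ)) (f : Lp ℂ 2 torusMeasure) :
    mulLp a f =ᵐ[torusMeasure] fun x => (a x : ℂ) * f x := (memLp_mul a f).coeFn_toLp

lemma norm_mulLp_le (a : C(Torus2, ℝ)) : ‖mulLp a‖ ≤ ‖a‖ :=
  LinearMap.mkContinuous_norm_le _ (norm_nonneg _) _

lemma inner_mulLp (a : C(Torus2, ℝ)) (f g : Lp ℂ 2 torusMeasure) :
    inner ℝ (mulLp a f) g = inner ℝ f (mulLp a g) := by
  rw [L2.inner_def, L2.inner_def]
  refine integral_congr_ae ?_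
  filter_upwards [coeFn_mulLp a f, coeFn_mulLp a g] with x h1 h2
  rw [h1, h2, Complex.inner, Complex.inner]
  simp
  ring

/-- The isometry between `L²(𝕋²)` and `ℓ²`, as a real linear map. -/
def fourierL : Lp ℂ 2 torusMeasure ≃L[ℝ] Seq :=
  { torusBasis.repr.toLinearEquiv.restrictScalars ℝ with
    continuous_toFun := torusBasis.repr.continuous
    continuous_invFun := torusBasis.repr.symm.continuous }

lemma norm_fourierL (f : Lp ℂ 2 torusMeasure) : ‖fourierL f‖ = ‖f‖ :=
  torusBasis.repr.norm_map f

lemma norm_fourierL_symm (x : Seq) : ‖fourierL.symm x‖ = ‖x‖ :=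
  torusBasis.repr.symm.norm_map x

lemma fourierL_apply (f : Lp ℂ 2 torusMeasure) (k : Freq) :
    fourierL f k = mFourierCoeff (f : Torus2 → ℂ) k := torusBasis_repr f k

lemma inner_fourierL (f g : Lp ℂ 2 torusMeasure) :
    inner ℝ (fourierL f) (fourierL g) = inner ℝ f g := by
  rw [real_inner_eq_norm_add_mul_self_sub_norm_mul_self_sub_norm_mul_self_div_two,
    real_inner_eq_norm_add_mul_self_sub_norm_mul_self_sub_norm_mul_self_div_two, ← map_add,
    norm_fourierL, norm_fourierL, norm_fourierL]

/-- Multiplication by `a` on the Fourier side. -/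
def mulSeq (a : C(Torus2, ℝ)) : Seq →L[ℝ] Seq :=
  (fourierL : Lp ℂ 2 torusMeasure →L[ℝ] Seq) ∘L mulLp a ∘L (fourierL.symm : Seq →L[ℝ] _)

lemma mulSeq_apply (a : C(Torus2, ℝ)) (x : Seq) :
    mulSeq a x = fourierL (mulLp a (fourierL.symm x)) := rfl

lemma mulSeq_fourierL (a : C(Torus2, ℝ)) (f : Lp ℂ 2 torusMeasure) :
    mulSeq a (fourierL f) = fourierL (mulLp a f) := by
  rw [mulSeq_apply, ContinuousLinearEquiv.symm_apply_apply]

lemma norm_mulSeq_apply_le (a : C(Torus2, ℝ)) (x : Seq) : ‖mulSeq a x‖ ≤ ‖a‖ * ‖x‖ := by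
  rw [mulSeq_apply, norm_fourierL, ← norm_fourierL_symm x]
  exact (mulLp a).le_of_opNorm_le (norm_mulLp_le a) _

lemma norm_mulSeq_le (a : C(Torus2, ℝ)) : ‖mulSeq a‖ ≤ ‖a‖ :=
  ContinuousLinearMap.opNorm_le_bound _ (norm_nonneg _) (norm_mulSeq_apply_le a)

lemma inner_mulSeq (a : C(Torus2, ℝ)) (x y : Seq) :
    inner ℝ (mulSeq a x) y = inner ℝ x (mulSeq a y) := by
  obtain ⟨f, rfl⟩ := fourierL.surjective x
  obtain ⟨g, rfl⟩ := fourierL.surjective y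
  rw [mulSeq_fourierL, mulSeq_fourierL, inner_fourierL, inner_fourierL, inner_mulLp]

lemma mulLp_add (a b : C(Torus2, ℝ)) (f : Lp ℂ 2 torusMeasure) :
    mulLp (a + b) f = mulLp a f + mulLp b f := by
  refine Lp.ext ?_
  filter_upwards [coeFn_mulLp (a + b) f, coeFn_mulLp a f, coeFn_mulLp b f,
    Lp.coeFn_add (mulLp a f) (mulLp b f)] with x h1 h2 h3 h4
  rw [h1, h4, Pi.add_apply, h2, h3]
  simp [add_mul]

lemma mulLp_smul (c : ℝ) (a : C(Torus2, ℝ)) (f : Lp ℂ 2 torusMeasure) :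
    mulLp (c • a) f = c • mulLp a f := by
  refine Lp.ext ?_
  filter_upwards [coeFn_mulLp (c • a) f, coeFn_mulLp a f, Lp.coeFn_smul c (mulLp a f)]
    with x h1 h2 h4
  rw [h1, h4, Pi.smul_apply, h2]
  simp [mul_assoc]

lemma mulLp_mul (a b : C(Torus2, ℝ)) (f : Lp ℂ 2 torusMeasure) :
    mulLp (a * b) f = mulLp a (mulLp b f) := by
  refine Lp.ext ?_
  filter_upwards [coeFn_mulLp (a * b) f, coeFn_mulLp a (mulLp b f), coeFn_mulLp b f]
    with x h1 h2 h3
  rw [h1, h2, h3]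
  simp [mul_assoc]

lemma mulSeq_add (a b : C(Torus2, ℝ)) : mulSeq (a + b) = mulSeq a + mulSeq b := by
  ext1 x
  simp [mulSeq_apply, mulLp_add]

lemma mulSeq_smul (c : ℝ) (a : C(Torus2, ℝ)) : mulSeq (c • a) = c • mulSeq a := by
  ext1 x
  simp [mulSeq_apply, mulLp_smul]

lemma mulSeq_mul (a b : C(Torus2, ℝ)) (x : Seq) : mulSeq (a * b) x = mulSeq a (mulSeq b x) := by
  simp [mulSeq_apply, mulLp_mul]

lemma mulSeq_comm (a b : C(Torus2, ℝ)) (x : Seq) :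
    mulSeq a (mulSeq b x) = mulSeq b (mulSeq a x) := by
  rw [← mulSeq_mul, mul_comm, mulSeq_mul]

/-- Multiplication as a linear map in the coefficient. -/
def mulSeqL : C(Torus2, ℝ) →ₗ[ℝ] (Seq →L[ℝ] Seq) where
  toFun := mulSeq
  map_add' := mulSeq_add
  map_smul' := mulSeq_smul

lemma mulSeq_sub (a b : C(Torus2, ℝ)) : mulSeq (a - b) = mulSeq a - mulSeq b :=
  map_sub mulSeqL a b

lemma mulSeq_sum {ι : Type*} (s : Finset ι) (a : ι → C(Torus2, ℝ)) :
    mulSeq (∑ i ∈ s, a i) = ∑ i ∈ s, mulSeq (a i) := map_sum mulSeqL a s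

/-- Multiplication acts on Fourier coefficients by convolution. -/
lemma hasSum_coeff_mul (a : C(Torus2, ℝ)) {f : Torus2 → ℂ} (hf : MemLp f 2 torusMeasure)
    (k : Freq) :
    HasSum (fun l => coeff a (k - l) * mFourierCoeff f l)
      (mFourierCoeff (fun x => (a x : ℂ) * f x) k) := by
  have h := UnitAddTorus.hasSum_prod_mFourierCoeff
    (toLp 2 torusMeasure ℂ (mFourier k * toC a)) (hf.toLp f)
  have e1 : ∀ l, mFourierCoeff (hf.toLp f : Torus2 → ℂ) l =
      mFourierCoeff f l := fun l => by
    rw [mFourierCoeff_eq, mFourierCoeff_eq]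
    refine integral_congr_ae ?_
    filter_upwards [hf.coeFn_toLp] with x hx
    rw [hx]
  have e2 : ∀ l, (starRingEnd ℂ) (mFourierCoeff
      (toLp 2 torusMeasure ℂ (mFourier k * toC a) : Torus2 → ℂ) l) =
        coeff a (k - l) := fun l => by
    rw [mFourierCoeff_eq, coeff_eq, ← integral_conj]
    refine integral_congr_ae ?_
    filter_upwards [coeFn_toLp (𝕜 := ℂ) (p := 2) torusMeasure (mFourier k * toC a)]
      with x hx
    rw [hx]
    simp only [toC, ContinuousMap.mul_apply, coe_mk, map_mul, Complex.conj_ofReal,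
      ← mFourier_neg, ← mul_assoc, ← UnitAddTorus.mFourier_add]
    congr 3
    abel
  simp only [e1, e2] at h
  convert! h using 1
  rw [mFourierCoeff_eq]
  refine integral_congr_ae ?_
  filter_upwards [coeFn_toLp (𝕜 := ℂ) (p := 2) torusMeasure (mFourier k * toC a),
    hf.coeFn_toLp] with x h1 h2
  rw [h1, h2]
  simp [toC, mFourier_neg, mul_assoc]

lemma hasSum_mulSeq (a : C(Torus2, ℝ)) (x : Seq) (k : Freq) :
    HasSum (fun l => coeff a (k - l) * x l) (mulSeq a x k) := by
  obtain ⟨f, rfl⟩ := fourierL.surjective x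
  rw [mulSeq_fourierL, fourierL_apply]
  simp only [fourierL_apply]
  have h := hasSum_coeff_mul a (Lp.memLp f) k
  convert! h using 1
  rw [mFourierCoeff_eq, mFourierCoeff_eq]
  refine integral_congr_ae ?_
  filter_upwards [coeFn_mulLp a f] with x hx
  rw [hx]

end

section

/-! ### Regularised symbols -/

/-- The truncated bracket `min(⟨ξ⟩, N)`. -/
def trunc (N : ℝ) (k : Freq) : ℝ := min (jap k) N

lemma trunc_pos {N : ℝ} (hN : 1 ≤ N) (k : Freq) : 0 < trunc N k :=
  lt_min (jap_pos k) (by linarith)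

lemma trunc_le_jap (N : ℝ) (k : Freq) : trunc N k ≤ jap k := min_le_left _ _

lemma trunc_le (N : ℝ) (k : Freq) : trunc N k ≤ N := min_le_right _ _

lemma abs_trunc_sub_le (N : ℝ) (k l : Freq) : |trunc N k - trunc N l| ≤ jap (k - l) := by
  refine (abs_min_sub_min_le_max _ _ _ _).trans ?_
  simp [abs_jap_sub_le]

/-- A Lipschitz cutoff, `1` for `⟨ξ⟩ ≤ N / 2` and `0` for `⟨ξ⟩ ≥ N`. -/
def cutoff (N : ℝ) (k : Freq) : ℝ := max 0 (min 1 (2 - 2 * jap k / N))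

lemma cutoff_nonneg (N : ℝ) (k : Freq) : 0 ≤ cutoff N k := le_max_left _ _

lemma cutoff_le_one (N : ℝ) (k : Freq) : cutoff N k ≤ 1 := max_le zero_le_one (min_le_left _ _)

lemma cutoff_eq_one {N : ℝ} (hN : 1 ≤ N) {k : Freq} (hk : jap k ≤ N / 2) : cutoff N k = 1 := by
  have : 2 * jap k / N ≤ 1 := by rw [div_le_one (by linarith)]; linarith
  rw [cutoff, min_eq_left (by linarith), max_eq_right zero_le_one]

lemma cutoff_eq_zero {N : ℝ} (hN : 1 ≤ N) {k : Freq} (hk : N ≤ jap k) : cutoff N k = 0 := by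
  have : 2 ≤ 2 * jap k / N := by rw [le_div_iff₀ (by linarith)]; linarith
  rw [cutoff, max_eq_left]
  exact (min_le_right _ _).trans (by linarith)

lemma abs_cutoff_sub_le {N : ℝ} (hN : 1 ≤ N) (k l : Freq) :
    |cutoff N k - cutoff N l| ≤ 2 / N * jap (k - l) := by
  have h0 : 0 ≤ 2 / N * jap (k - l) := by have := jap_pos (k - l); positivity
  refine (abs_max_sub_max_le_max _ _ _ _).trans (max_le (by simpa using h0) ?_)
  refine (abs_min_sub_min_le_max _ _ _ _).trans (max_le (by simpa using h0) ?_)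
  have : 2 - 2 * jap k / N - (2 - 2 * jap l / N) = 2 / N * (jap l - jap k) := by ring
  rw [this, abs_mul, abs_of_pos (by positivity), abs_sub_comm]
  gcongr
  exact abs_jap_sub_le k l

/-- The truncated symbol of `-i ∂ᵢ`. -/
def dsym (N : ℝ) (i : Fin 2) (k : Freq) : ℝ := xi i k * cutoff N k

lemma abs_dsym_le_jap (N : ℝ) (i : Fin 2) (k : Freq) : |dsym N i k| ≤ jap k := by
  rw [dsym, abs_mul, abs_of_nonneg (cutoff_nonneg N k)]
  calc _ ≤ jap k * 1 := by
        gcongr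
        exacts [cutoff_nonneg N k, (jap_pos k).le, abs_xi_le i k, cutoff_le_one N k]
    _ = _ := mul_one _

lemma abs_dsym_le {N : ℝ} (hN : 1 ≤ N) (i : Fin 2) (k : Freq) : |dsym N i k| ≤ trunc N k := by
  by_cases hk : N ≤ jap k
  · rw [dsym, cutoff_eq_zero hN hk, mul_zero, abs_zero]
    exact (trunc_pos hN k).le
  · rw [trunc, min_eq_left (by linarith)]
    exact abs_dsym_le_jap N i k

lemma abs_dsym_le_N {N : ℝ} (hN : 1 ≤ N) (i : Fin 2) (k : Freq) : |dsym N i k| ≤ N :=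
  (abs_dsym_le hN i k).trans (trunc_le N k)

lemma dsym_eq_zero {N : ℝ} (hN : 1 ≤ N) (i : Fin 2) {k : Freq} (hk : N ≤ jap k) :
    dsym N i k = 0 := by rw [dsym, cutoff_eq_zero hN hk, mul_zero]

lemma dsym_eq {N : ℝ} (hN : 1 ≤ N) (i : Fin 2) {k : Freq} (hk : jap k ≤ N / 2) :
    dsym N i k = xi i k := by rw [dsym, cutoff_eq_one hN hk, mul_one]

lemma abs_dsym_sub_le {N : ℝ} (hN : 1 ≤ N) (i : Fin 2) (k l : Freq) :
    |dsym N i k - dsym N i l| ≤ 3 * jap (k - l) := by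
  have key : ∀ k l : Freq, jap l ≤ N → |dsym N i k - dsym N i l| ≤ 3 * jap (k - l) := by
    intro k l hl
    have e : dsym N i k - dsym N i l =
        xi i (k - l) * cutoff N k + xi i l * (cutoff N k - cutoff N l) := by
      rw [dsym, dsym, xi_sub]; ring
    have h1 : |xi i (k - l) * cutoff N k| ≤ jap (k - l) * 1 := by
      rw [abs_mul, abs_of_nonneg (cutoff_nonneg N k)]
      gcongr
      exacts [cutoff_nonneg N k, (jap_pos _).le, abs_xi_le i _, cutoff_le_one N k]
    have h2 : |xi i l * (cutoff N k - cutoff N l)| ≤ N * (2 / N * jap (k - l)) := by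
      rw [abs_mul]
      gcongr
      exacts [(abs_xi_le i l).trans hl, abs_cutoff_sub_le hN k l]
    have h3 : N * (2 / N * jap (k - l)) = 2 * jap (k - l) := by field_simp
    rw [e]
    refine (abs_add_le _ _).trans ?_
    linarith
  by_cases hl : jap l ≤ N
  · exact key k l hl
  · by_cases hk : jap k ≤ N
    · rw [abs_sub_comm, ← jap_neg, neg_sub]
      exact key l k hk
    · rw [dsym_eq_zero hN i (by linarith), dsym_eq_zero hN i (by linarith), sub_self, abs_zero]
      have := jap_pos (k - l)
      positivity

/-- The regularised derivative. -/
def dOp (N : ℝ) (i : Fin 2) : Seq →L[ℝ] Seq := diag fun k => (dsym N i k : ℂ) * I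

lemma isBdd_dsym {N : ℝ} (hN : 1 ≤ N) (i : Fin 2) :
    IsBdd fun k => (dsym N i k : ℂ) * I :=
  ⟨N, fun k => by simpa using abs_dsym_le_N hN i k⟩

lemma dOp_apply {N : ℝ} (hN : 1 ≤ N) (i : Fin 2) (x : Seq) (k : Freq) :
    dOp N i x k = (dsym N i k : ℂ) * I * x k := diag_apply (isBdd_dsym hN i) x k

lemma norm_dOp_apply {N : ℝ} (hN : 1 ≤ N) (i : Fin 2) (x : Seq) (k : Freq) :
    ‖dOp N i x k‖ = |dsym N i k| * ‖x k‖ := by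
  rw [dOp_apply hN]; simp

lemma inner_dOp {N : ℝ} (hN : 1 ≤ N) (i : Fin 2) (x y : Seq) :
    inner ℝ (dOp N i x) y = -inner ℝ x (dOp N i y) := inner_diag_imag (isBdd_dsym hN i) x y

/-- The regularised weight. -/
def lamOp (r N : ℝ) : Seq →L[ℝ] Seq := diag fun k => ((trunc N k ^ r : ℝ) : ℂ)

lemma isBdd_lam {r N : ℝ} (hr : 0 ≤ r) (hN : 1 ≤ N) :
    IsBdd fun k => ((trunc N k ^ r : ℝ) : ℂ) :=
  ⟨N ^ r, fun k => by
    have h := trunc_pos hN k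
    rw [norm_real, norm_of_nonneg (by positivity)]
    gcongr
    exact trunc_le N k⟩

lemma lamOp_apply {r N : ℝ} (hr : 0 ≤ r) (hN : 1 ≤ N) (x : Seq) (k : Freq) :
    lamOp r N x k = ((trunc N k ^ r : ℝ) : ℂ) * x k := diag_apply (isBdd_lam hr hN) x k

lemma norm_lamOp_apply {r N : ℝ} (hr : 0 ≤ r) (hN : 1 ≤ N) (x : Seq) (k : Freq) :
    ‖lamOp r N x k‖ = trunc N k ^ r * ‖x k‖ := by
  have h := trunc_pos hN k
  rw [lamOp_apply hr hN, norm_mul, norm_real, norm_of_nonneg (by positivity)]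

/-- The operator `⟨∇⟩^{-σ}`. -/
def vOp (σ : ℝ) : Seq →L[ℝ] Seq := diag fun k => ((jap k ^ (-σ) : ℝ) : ℂ)

lemma jap_rpow_le_one {σ : ℝ} (hσ : 0 ≤ σ) (k : Freq) : jap k ^ (-σ) ≤ 1 :=
  Real.rpow_le_one_of_one_le_of_nonpos (one_le_jap k) (by linarith)

lemma norm_vsym_le {σ : ℝ} (hσ : 0 ≤ σ) (k : Freq) : ‖((jap k ^ (-σ) : ℝ) : ℂ)‖ ≤ 1 := by
  have h := jap_pos k
  rw [norm_real, norm_of_nonneg (by positivity)]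
  exact jap_rpow_le_one hσ k

lemma vOp_apply {σ : ℝ} (hσ : 0 ≤ σ) (x : Seq) (k : Freq) :
    vOp σ x k = ((jap k ^ (-σ) : ℝ) : ℂ) * x k := diag_apply ⟨1, norm_vsym_le hσ⟩ x k

lemma norm_vOp_apply {σ : ℝ} (hσ : 0 ≤ σ) (x : Seq) (k : Freq) :
    ‖vOp σ x k‖ = jap k ^ (-σ) * ‖x k‖ := by
  have h := jap_pos k
  rw [vOp_apply hσ, norm_mul, norm_real, norm_of_nonneg (by positivity)]

lemma norm_vOp_le {σ : ℝ} (hσ : 0 ≤ σ) (x : Seq) : ‖vOp σ x‖ ≤ ‖x‖ := by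
  unfold vOp
  simpa using norm_diag_apply_le (norm_vsym_le hσ) x

/-! ### Commutators -/

/-- The squared `H^r` norm. -/
def hsq (r : ℝ) (φ : Torus2 → ℝ) : ℝ≥0∞ := wsq r fun k => ‖coeff φ k‖ₑ

lemma enorm_le_of_hasSum {f : Freq → ℂ} {z : ℂ} (h : HasSum f z) : ‖z‖ₑ ≤ ∑' l, ‖f l‖ₑ := by
  rw [← h.tsum_eq]
  exact enorm_tsum_le_tsum_enorm

/-- The constant `∑ ⟨k⟩^{-5/2}`, square rooted. -/
def wroot : ℝ := sqrt (wconst (5 / 4)).toReal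

lemma wroot_nonneg : 0 ≤ wroot := sqrt_nonneg _

lemma ofReal_wroot_sq : ofReal wroot ^ 2 = wconst (5 / 4) := by
  rw [← ofReal_pow wroot_nonneg, wroot, sq_sqrt ENNReal.toReal_nonneg,
    ENNReal.ofReal_toReal (wconst_lt_top (by norm_num)).ne]

lemma wconst_le {p : ℝ} (hp : 5 / 4 ≤ p) : wconst p ≤ wconst (5 / 4) := by
  refine tsum_le_tsum fun k => ?_
  gcongr
  exact one_le_jap k

lemma norm_le_of_enorm_sq_le {x : Seq} {c : ℝ} (hc : 0 ≤ c) (h : ‖x‖ₑ ^ 2 ≤ ofReal c ^ 2) :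
    ‖x‖ ≤ c := by
  have h2 : ‖x‖ₑ ≤ ofReal c := (ENNReal.pow_right_strictMono two_ne_zero).le_iff_le.1 h
  rw [← ofReal_norm] at h2
  exact (ENNReal.ofReal_le_ofReal_iff hc).1 h2

variable {r M : ℝ} {a : C(Torus2, ℝ)}

lemma tsum_jap_coeff_le (hr : 5 / 2 ≤ r) (ha : hsq r a ≤ ofReal M ^ 2) :
    (∑' k, ofReal (jap k) * ‖coeff a k‖ₑ) ^ 2 ≤
      (ofReal wroot * ofReal M) ^ 2 := by
  have h := tsum_weight_sq_le 1 r (fun k => ‖coeff a k‖ₑ)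
  simp only [Real.rpow_one] at h
  refine h.trans ?_
  rw [mul_pow, ofReal_wroot_sq]
  gcongr
  · exact wconst_le (by linarith)
  · exact ha

/-- Commutator of a multiplication operator with a multiplier with Lipschitz symbol. -/
lemma norm_comm_diag_le (hr : 5 / 2 ≤ r) (hM : 0 ≤ M) (ha : hsq r a ≤ ofReal M ^ 2)
    {m : Freq → ℂ} (hm : IsBdd m) (hlip : ∀ k l, ‖m k - m l‖ ≤ 3 * jap (k - l)) (x : Seq) :
    ‖diag m (mulSeq a x) - mulSeq a (diag m x)‖ ≤ 3 * wroot * M * ‖x‖ := by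
  have hw := wroot_nonneg
  refine norm_le_of_enorm_sq_le (by positivity) ?_
  have h1 : ∀ k, ‖(diag m (mulSeq a x) - mulSeq a (diag m x)) k‖ₑ ≤
      3 * conv (fun l => ofReal (jap l) * ‖coeff a l‖ₑ) (fun l => ‖x l‖ₑ) k := by
    intro k
    have h := ((hasSum_mulSeq a x k).mul_left (m k)).sub (hasSum_mulSeq a (diag m x) k)
    rw [lp.coeFn_sub, Pi.sub_apply, diag_apply hm]
    refine (enorm_le_of_hasSum h).trans ?_
    rw [conv, ← ENNReal.tsum_mul_left]
    refine tsum_le_tsum fun l => ?_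
    have e : m k * (coeff a (k - l) * x l) - coeff a (k - l) * diag m x l =
        (m k - m l) * (coeff a (k - l) * x l) := by rw [diag_apply hm]; ring
    rw [e, enorm_mul, enorm_mul, ← mul_assoc, ← mul_assoc, ← mul_assoc]
    gcongr
    have := hlip k l
    rw [← ofReal_norm, ← ofReal_ofNat, ← ofReal_mul (by norm_num)]
    exact ENNReal.ofReal_le_ofReal this
  rw [Seq.enorm_sq]
  calc _ ≤ ∑' k, (3 * conv (fun l => ofReal (jap l) * ‖coeff a l‖ₑ)
        (fun l => ‖x l‖ₑ) k) ^ 2 := tsum_le_tsum fun k => pow_le_pow_left' (h1 k) 2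
    _ = 3 ^ 2 * ∑' k, (conv (fun l => ofReal (jap l) * ‖coeff a l‖ₑ)
        (fun l => ‖x l‖ₑ) k) ^ 2 := by simp only [mul_pow, ENNReal.tsum_mul_left]
    _ ≤ 3 ^ 2 * ((ofReal wroot * ofReal M) ^ 2 * ‖x‖ₑ ^ 2) := by
        gcongr
        refine (young _ _).trans ?_
        rw [Seq.enorm_sq]
        gcongr ?_ * _
        exact tsum_jap_coeff_le hr ha
    _ = _ := by
        rw [ofReal_mul (by positivity), ofReal_mul (by positivity),
          ofReal_mul (by norm_num), ofReal_norm, ofReal_ofNat]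
        ring

lemma norm_comm_dOp_le (hr : 5 / 2 ≤ r) (hM : 0 ≤ M) (ha : hsq r a ≤ ofReal M ^ 2)
    {N : ℝ} (hN : 1 ≤ N) (i : Fin 2) (x : Seq) :
    ‖dOp N i (mulSeq a x) - mulSeq a (dOp N i x)‖ ≤ 3 * wroot * M * ‖x‖ := by
  refine norm_comm_diag_le hr hM ha (isBdd_dsym hN i) (fun k l => ?_) x
  rw [← sub_mul, ← Complex.ofReal_sub, norm_mul, norm_I, mul_one, norm_real]
  exact abs_dsym_sub_le hN i k l

/-- The constant of the commutator estimate for the weights. -/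
def commConst (r : ℝ) : ℝ := 2 * (r * 2 ^ (r - 1)) * wroot

lemma commConst_nonneg (hr : 5 / 2 ≤ r) : 0 ≤ commConst r := by
  have := wroot_nonneg
  unfold commConst
  have : 0 ≤ r := by linarith
  positivity

/-- `[⟨∇⟩^r, a]` is bounded from `H^{r-1}` to `L²`, uniformly in the truncation of the weight. -/
lemma norm_comm_lamOp_le (hr : 5 / 2 ≤ r) (hM : 0 ≤ M) (ha : hsq r a ≤ ofReal M ^ 2)
    {N : ℝ} (hN : 1 ≤ N) (u : Seq) :
    ‖lamOp r N (mulSeq a (vOp (r - 1) u)) - mulSeq a (lamOp r N (vOp (r - 1) u))‖ ≤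
      commConst r * M * ‖u‖ := by
  have hw := wroot_nonneg
  have hr0 : 0 ≤ r := by linarith
  have hr1 : 0 ≤ r - 1 := by linarith
  set c : ℝ := r * 2 ^ (r - 1) with hc
  have hc0 : 0 ≤ c := by positivity
  have hcc : commConst r = 2 * c * wroot := rfl
  rw [hcc]
  refine norm_le_of_enorm_sq_le (by positivity) ?_
  set x := vOp (r - 1) u
  clear_value c
  set A : Freq → ℝ≥0∞ := fun l => ofReal (jap l ^ r) * ‖coeff a l‖ₑ with hA
  set A1 : Freq → ℝ≥0∞ := fun l => ofReal (jap l) * ‖coeff a l‖ₑ with hA1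
  have hxe : ∀ l, ‖x l‖ₑ = ofReal (jap l ^ (-(r - 1))) * ‖u l‖ₑ := fun l => by
    have := jap_pos l
    rw [← ofReal_norm, norm_vOp_apply hr1, ofReal_mul (by positivity), ofReal_norm]
  have hlam : ∀ k l, ofReal |trunc N k ^ r - trunc N l ^ r| * ‖x l‖ₑ ≤
      ofReal c * (ofReal (jap (k - l) ^ r) * ‖x l‖ₑ
        + ofReal (jap (k - l)) * ‖u l‖ₑ) := by
    intro k l
    have hk := trunc_pos hN k
    have hl := trunc_pos hN l
    have hj := jap_pos l
    have hjk := jap_pos (k - l)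
    have h := abs_rpow_sub_le (r := r) (by linarith) hk.le hl.le
    have h2 : |trunc N k ^ r - trunc N l ^ r| ≤
        c * (jap (k - l) ^ r + jap (k - l) * jap l ^ (r - 1)) := by
      refine h.trans ?_
      rw [← hc]
      have e : c * (jap (k - l) ^ r + jap (k - l) * jap l ^ (r - 1)) =
          c * jap (k - l) * (jap (k - l) ^ (r - 1) + jap l ^ (r - 1)) := by
        rw [show r = 1 + (r - 1) by ring, rpow_add hjk, Real.rpow_one]; ring_nf
      rw [e]
      have := abs_trunc_sub_le N k l
      have := trunc_le_jap N l
      gcongr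
    have e3 : ofReal c * (ofReal (jap (k - l) ^ r) * ‖x l‖ₑ
        + ofReal (jap (k - l)) * ‖u l‖ₑ) =
        ofReal (c * (jap (k - l) ^ r + jap (k - l) * jap l ^ (r - 1))) * ‖x l‖ₑ := by
      rw [ofReal_mul hc0, ofReal_add (by positivity) (by positivity),
        ofReal_mul hjk.le, hxe, mul_assoc, add_mul, mul_assoc (ofReal (jap (k - l))),
        ← mul_assoc (ofReal (jap l ^ (r - 1))), ofReal_jap_mul]
      simp
    rw [e3]
    gcongr
  have h1 : ∀ k, ‖(lamOp r N (mulSeq a x) - mulSeq a (lamOp r N x)) k‖ₑ ≤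
      ofReal c * (conv A (fun l => ‖x l‖ₑ) k + conv A1 (fun l => ‖u l‖ₑ) k) := by
    intro k
    have h := ((hasSum_mulSeq a x k).mul_left ((trunc N k ^ r : ℝ) : ℂ)).sub
      (hasSum_mulSeq a (lamOp r N x) k)
    rw [lp.coeFn_sub, Pi.sub_apply, lamOp_apply hr0 hN]
    refine (enorm_le_of_hasSum h).trans ?_
    rw [conv, conv, ← tsum_add, ← ENNReal.tsum_mul_left]
    refine tsum_le_tsum fun l => ?_
    have e : ((trunc N k ^ r : ℝ) : ℂ) * (coeff a (k - l) * x l) -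
        coeff a (k - l) * lamOp r N x l =
        coeff a (k - l) * (((trunc N k ^ r - trunc N l ^ r : ℝ) : ℂ) * x l) := by
      rw [lamOp_apply hr0 hN]; push_cast; ring
    rw [e, enorm_mul, enorm_mul]
    have e2 : ‖((trunc N k ^ r - trunc N l ^ r : ℝ) : ℂ)‖ₑ =
        ofReal |trunc N k ^ r - trunc N l ^ r| := by
      rw [← ofReal_norm, norm_real, norm_eq_abs]
    rw [e2]
    calc _ ≤ ‖coeff a (k - l)‖ₑ * (ofReal c * (ofReal (jap (k - l) ^ r) * ‖x l‖ₑ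
          + ofReal (jap (k - l)) * ‖u l‖ₑ)) := mul_le_mul' le_rfl (hlam k l)
      _ = _ := by simp only [hA, hA1]; ring
  have hxsum : (∑' l, ‖x l‖ₑ) ^ 2 ≤ ofReal wroot ^ 2 * ‖u‖ₑ ^ 2 := by
    have h := tsum_weight_sq_le (-(r - 1)) 0 (fun l => ‖u l‖ₑ)
    simp only [hxe]
    refine h.trans ?_
    rw [ofReal_wroot_sq, Seq.enorm_sq]
    simp only [wsq, rpow_zero, ofReal_one, one_mul]
    gcongr
    exact wconst_le (by linarith)
  rw [Seq.enorm_sq]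
  calc _ ≤ ∑' k, (ofReal c * (conv A (fun l => ‖x l‖ₑ) k + conv A1 (fun l => ‖u l‖ₑ) k)) ^ 2
        := tsum_le_tsum fun k => pow_le_pow_left' (h1 k) 2
    _ = ofReal c ^ 2 *
        ∑' k, (conv A (fun l => ‖x l‖ₑ) k + conv A1 (fun l => ‖u l‖ₑ) k) ^ 2 := by
        simp only [mul_pow, ENNReal.tsum_mul_left]
    _ ≤ ofReal c ^ 2 * (2 * ∑' k, (conv A (fun l => ‖x l‖ₑ) k) ^ 2
        + 2 * ∑' k, (conv A1 (fun l => ‖u l‖ₑ) k) ^ 2) := by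
        gcongr
        exact ENNReal_tsum_add_sq_le _ _
    _ ≤ ofReal c ^ 2 *
        (2 * ((ofReal wroot ^ 2 * ‖u‖ₑ ^ 2) * ofReal M ^ 2)
        + 2 * ((ofReal wroot * ofReal M) ^ 2 * ‖u‖ₑ ^ 2)) := by
        gcongr
        · rw [conv_comm]
          refine (young _ _).trans ?_
          gcongr
          exact ha
        · refine (young _ _).trans ?_
          rw [Seq.enorm_sq]
          gcongr ?_ * _
          exact tsum_jap_coeff_le hr ha
    _ = _ := by
        rw [ofReal_mul (by positivity), ofReal_mul (by positivity),
          ofReal_mul (by positivity), ofReal_mul (by norm_num), ofReal_norm,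
          ofReal_ofNat]
        ring

/-- Products of coefficients stay in `H^r`. -/
lemma hsq_mul_le (hr : 5 / 2 ≤ r) {b : C(Torus2, ℝ)} (hM : 0 ≤ M)
    (ha : hsq r a ≤ ofReal M ^ 2) (hb : hsq r b ≤ ofReal M ^ 2) :
    hsq r (a * b : C(Torus2, ℝ)) ≤ ofReal (2 * 2 ^ r * wroot * M * M) ^ 2 := by
  have hw := wroot_nonneg
  have hbL : MemLp (fun x => (b x : ℂ)) 2 torusMeasure :=
    (toC b).continuous.memLp_of_hasCompactSupport (of_compactSpace _)
  have h1 : hsq r (a * b : C(Torus2, ℝ)) ≤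
      wsq r (conv (fun k => ‖coeff a k‖ₑ) (fun k => ‖coeff b k‖ₑ)) := by
    refine tsum_le_tsum fun k => ?_
    gcongr
    have h := hasSum_coeff_mul a hbL k
    have e : coeff (a * b : C(Torus2, ℝ)) k =
        mFourierCoeff (fun x => (a x : ℂ) * (b x : ℂ)) k := by
      rw [coeff_eq, mFourierCoeff_eq]
      simp
    change ‖coeff (a * b : C(Torus2, ℝ)) k‖ₑ ≤ _
    rw [e]
    refine (enorm_le_of_hasSum h).trans (le_of_eq ?_)
    simp only [conv, enorm_mul]
    rfl
  refine h1.trans ((wsq_conv_le hr (by linarith) le_rfl _ _).trans ?_)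
  calc _ ≤ 4 * ofReal (2 ^ r) ^ 2 * ofReal wroot ^ 2 * ofReal M ^ 2
        * ofReal M ^ 2 := by
        rw [ofReal_wroot_sq]
        gcongr
        exacts [ha, hb]
    _ = _ := by
        rw [ofReal_mul (by positivity), ofReal_mul (by positivity),
          ofReal_mul (by positivity), ofReal_mul (by norm_num),
          ofReal_ofNat]
        ring

end

section

/-! ### The energy of a second order system with skew-adjoint derivations -/

/-- The signs of the quadratic terms in the energy. -/
def eps : Fin 3 → ℝ := ![-1, 1 / 2, 1 / 2]

/-- Coefficient operators of the linearised system. -/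
structure Coef (H : Type*) [NormedAddCommGroup H] [InnerProductSpace ℝ H] where
  /-- the transport field -/
  W : Fin 2 → H →L[ℝ] H
  /-- the fields of the quadratic terms -/
  B : Fin 3 → Fin 2 → H →L[ℝ] H

variable {H : Type*} [NormedAddCommGroup H] [InnerProductSpace ℝ H]


/-- The operator `∑ Aᵢ pᵢ`. -/
def contract (A : Fin 2 → H →L[ℝ] H) (p : Fin 2 → H) : H := ∑ i, A i (p i)

lemma contract_add (A : Fin 2 → H →L[ℝ] H) (p q : Fin 2 → H) :
    contract A (p + q) = contract A p + contract A q := by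
  simp [contract, sum_add_distrib]

lemma contract_sub (A : Fin 2 → H →L[ℝ] H) (p q : Fin 2 → H) :
    contract A (p - q) = contract A p - contract A q := by
  simp [contract, sum_sub_distrib]

lemma norm_contract_le {A : Fin 2 → H →L[ℝ] H} {M : ℝ} (hA : ∀ i x, ‖A i x‖ ≤ M * ‖x‖)
    (p : Fin 2 → H) : ‖contract A p‖ ≤ M * (‖p 0‖ + ‖p 1‖) := by
  rw [contract, sum_univ_two]
  refine (norm_add_le _ _).trans ?_
  have := hA 0 (p 0)
  have := hA 1 (p 1)
  linarith

/-- The energy of a state, `p` standing for the gradient of `x`. -/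
def Coef.energy (c : Coef H) (p : Fin 2 → H) (x y : H) : ℝ :=
  ‖y + contract c.W p‖ ^ 2 + ∑ m, eps m * ‖contract (c.B m) p‖ ^ 2 + ‖x‖ ^ 2

/-- The operator on the right-hand side of the second equation. -/
def Coef.rhs (c : Coef H) (q : Fin 2 → H) (pp : Fin 2 → Fin 2 → H) : H :=
  (-2 : ℝ) • contract c.W q - ∑ i, ∑ j, c.W i (c.W j (pp i j))
    + ∑ m, eps m • ∑ i, ∑ j, c.B m i (c.B m j (pp i j))

/-- The squared size of a state. -/
def sizeSq (p : Fin 2 → H) (x y : H) : ℝ := ‖x‖ ^ 2 + ‖y‖ ^ 2 + (‖p 0‖ ^ 2 + ‖p 1‖ ^ 2)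

lemma sizeSq_nonneg (p : Fin 2 → H) (x y : H) : 0 ≤ sizeSq p x y := by
  unfold sizeSq; positivity

/-- The gradient of a vector. -/
def grad (D : Fin 2 → H →L[ℝ] H) (x : H) : Fin 2 → H := fun i => D i x

/-- The Hessian of a vector. -/
def hess (D : Fin 2 → H →L[ℝ] H) (x : H) : Fin 2 → Fin 2 → H := fun i j => D i (D j x)

/-- A field of bounded self-adjoint operators with bounded commutators with the derivations. -/
structure FieldBound (D : Fin 2 → H →L[ℝ] H) (M : ℝ) (A : Fin 2 → H →L[ℝ] H) : Prop where
  symm : ∀ i x y, inner ℝ (A i x) y = inner ℝ x (A i y)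
  bound : ∀ i x, ‖A i x‖ ≤ M * ‖x‖
  comm : ∀ i j x, ‖D i (A j x) - A j (D i x)‖ ≤ M * ‖x‖

/-- Bounds for all coefficient operators. -/
structure Coef.Bound (D : Fin 2 → H →L[ℝ] H) (M : ℝ) (c : Coef H) : Prop where
  skew : ∀ i x y, inner ℝ (D i x) y = -inner ℝ x (D i y)
  commD : ∀ i j x, D i (D j x) = D j (D i x)
  W : FieldBound D M c.W
  B : ∀ m, FieldBound D M (c.B m)
  commBW : ∀ m i j x, c.B m i (c.W j x) = c.W j (c.B m i x)

variable {D : Fin 2 → H →L[ℝ] H} {M : ℝ} {A A' : Fin 2 → H →L[ℝ] H} {c : Coef H}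

lemma abs_inner_field_le (hskew : ∀ i x y, inner ℝ (D i x) y = -inner ℝ x (D i y))
    (hA : FieldBound D M A) (x y : H) :
    |inner ℝ x (contract A (grad D y)) + inner ℝ (contract A (grad D x)) y| ≤
      2 * M * (‖x‖ * ‖y‖) := by
  have h : ∀ i, |inner ℝ x (A i (D i y)) + inner ℝ (A i (D i x)) y| ≤ M * (‖x‖ * ‖y‖) := by
    intro i
    have e : inner ℝ x (A i (D i y)) + inner ℝ (A i (D i x)) y =
        -inner ℝ (D i (A i x) - A i (D i x)) y := by
      rw [← hA.symm, inner_sub_left, hskew]; ring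
    rw [e, abs_neg]
    refine (abs_real_inner_le_norm _ _).trans ?_
    have := hA.comm i i x
    calc _ ≤ (M * ‖x‖) * ‖y‖ := by gcongr
      _ = _ := by ring
  have e : inner ℝ x (contract A (grad D y)) + inner ℝ (contract A (grad D x)) y =
      (inner ℝ x (A 0 (D 0 y)) + inner ℝ (A 0 (D 0 x)) y) +
      (inner ℝ x (A 1 (D 1 y)) + inner ℝ (A 1 (D 1 x)) y) := by
    simp only [contract, grad, sum_univ_two, inner_add_left, inner_add_right]; ring
  rw [e]
  refine (abs_add_le _ _).trans ?_
  have := h 0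
  have := h 1
  linarith

/-- The second order part of the square of a field. -/
lemma norm_field_field_sub_le (hM : 0 ≤ M) (hA : FieldBound D M A) (hA' : FieldBound D M A')
    (x : H) : ‖contract A (grad D (contract A' (grad D x)))
      - ∑ i, ∑ j, A i (A' j (D i (D j x)))‖ ≤ 2 * M ^ 2 * (‖D 0 x‖ + ‖D 1 x‖) := by
  have h : ∀ i j, ‖A i (D i (A' j (D j x))) - A i (A' j (D i (D j x)))‖ ≤ M ^ 2 * ‖D j x‖ := by
    intro i j
    rw [← map_sub]
    refine (hA.bound i _).trans ?_
    have := hA'.comm i j (D j x)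
    calc _ ≤ M * (M * ‖D j x‖) := by gcongr
      _ = _ := by ring
  have e : contract A (grad D (contract A' (grad D x))) - ∑ i, ∑ j, A i (A' j (D i (D j x))) =
      ∑ i, ∑ j, (A i (D i (A' j (D j x))) - A i (A' j (D i (D j x)))) := by
    simp only [contract, grad, map_sum, sum_sub_distrib]
  rw [e]
  simp only [sum_univ_two]
  refine (norm_add_le _ _).trans ?_
  have h1 := norm_add_le (A 0 (D 0 (A' 0 (D 0 x))) - A 0 (A' 0 (D 0 (D 0 x))))
    (A 0 (D 0 (A' 1 (D 1 x))) - A 0 (A' 1 (D 0 (D 1 x))))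
  have h2 := norm_add_le (A 1 (D 1 (A' 0 (D 0 x))) - A 1 (A' 0 (D 1 (D 0 x))))
    (A 1 (D 1 (A' 1 (D 1 x))) - A 1 (A' 1 (D 1 (D 1 x))))
  have := h 0 0
  have := h 0 1
  have := h 1 0
  have := h 1 1
  linarith

lemma norm_field_comm_le (hM : 0 ≤ M) (hD : ∀ i j x, D i (D j x) = D j (D i x))
    (hA : FieldBound D M A) (hA' : FieldBound D M A')
    (hcomm : ∀ i j x, A i (A' j x) = A' j (A i x)) (x : H) :
    ‖contract A (grad D (contract A' (grad D x))) - contract A' (grad D (contract A (grad D x)))‖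
      ≤ 4 * M ^ 2 * (‖D 0 x‖ + ‖D 1 x‖) := by
  have h1 := norm_field_field_sub_le hM hA hA' x
  have h2 := norm_field_field_sub_le hM hA' hA x
  have e : ∑ i, ∑ j, A i (A' j (D i (D j x))) = ∑ i, ∑ j, A' i (A j (D i (D j x))) := by
    rw [Finset.sum_comm]
    refine sum_congr rfl fun i _ => sum_congr rfl fun j _ => ?_
    rw [hcomm, hD]
  rw [e] at h1
  have h3 := norm_sub_le
    (contract A (grad D (contract A' (grad D x))) - ∑ i, ∑ j, A' i (A j (D i (D j x))))
    (contract A' (grad D (contract A (grad D x))) - ∑ i, ∑ j, A' i (A j (D i (D j x))))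
  rw [sub_sub_sub_cancel_right] at h3
  linarith

/-- The constant of the basic energy estimate. -/
def enConst (M : ℝ) : ℝ := 200 * (1 + M) ^ 4

lemma quad_bound {M : ℝ} (hM : 0 ≤ M) {x y n z : ℝ} (hx : 0 ≤ x) (hy : 0 ≤ y) (hn : 0 ≤ n)
    (hz0 : 0 ≤ z) (hz : z ≤ y + M * n) {S : ℝ} (hS : x ^ 2 + y ^ 2 + n ^ 2 / 2 ≤ S) :
    M * z ^ 2 + z * (6 * M ^ 2 * n) + x * y
      + 2 * (2 * M * (z * (M * n)) + M * (M * n) ^ 2 + (M * n) * (4 * M ^ 2 * n)) ≤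
        enConst M * S := by
  set m := 1 + M with hm
  have hm1 : 1 ≤ m := by linarith
  have hMm : M ≤ m := by linarith
  set q := x + y + n
  have hq0 : 0 ≤ q := by positivity
  have hzq : z ≤ m * q := by
    refine hz.trans ?_
    nlinarith [mul_nonneg hM hn, mul_nonneg hM hx, mul_nonneg hM hy]
  have hnq : n ≤ q := by linarith
  have hxq : x ≤ q := by linarith
  have hyq : y ≤ q := by linarith
  have b1 : M * z ^ 2 ≤ m * (m * q) ^ 2 := by gcongr
  have b2 : z * (6 * M ^ 2 * n) ≤ (m * q) * (6 * m ^ 2 * q) := by gcongr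
  have b3 : x * y ≤ q * q := by gcongr
  have b4 : 2 * M * (z * (M * n)) ≤ 2 * m * ((m * q) * (m * q)) := by gcongr
  have b5 : M * (M * n) ^ 2 ≤ m * (m * q) ^ 2 := by gcongr
  have b6 : (M * n) * (4 * M ^ 2 * n) ≤ (m * q) * (4 * m ^ 2 * q) := by gcongr
  have b7 : q ^ 2 ≤ 4 * S := by
    have := sq_nonneg (x - y)
    have := sq_nonneg (2 * x - n)
    have := sq_nonneg (2 * y - n)
    nlinarith
  have hS0 : 0 ≤ S := by nlinarith [sq_nonneg q]
  have hm3 : (1 : ℝ) ≤ m ^ 3 := one_le_pow₀ hm1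
  have hm34 : m ^ 3 ≤ m ^ 4 := pow_le_pow_right₀ hm1 (by norm_num)
  have : q * q ≤ m ^ 3 * q ^ 2 := by nlinarith [sq_nonneg q]
  calc _ ≤ 22 * m ^ 3 * q ^ 2 := by nlinarith
    _ ≤ 22 * m ^ 4 * (4 * S) := by gcongr
    _ ≤ enConst M * S := by
        rw [enConst, ← hm]
        have : 0 ≤ m ^ 4 * S := by positivity
        nlinarith

lemma norm_pair_le (p : Fin 2 → H) :
    (‖p 0‖ + ‖p 1‖) ^ 2 / 2 ≤ ‖p 0‖ ^ 2 + ‖p 1‖ ^ 2 := by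
  have := sq_nonneg (‖p 0‖ - ‖p 1‖)
  nlinarith

/-- The basic energy estimate, at frozen coefficients. -/
lemma abs_energy_pairing_le (hM : 0 ≤ M) (hc : c.Bound D M) (x y : H) :
    |inner ℝ (y + contract c.W (grad D x))
          (c.rhs (grad D y) (hess D x) + contract c.W (grad D y))
        + ∑ m, eps m * inner ℝ (contract (c.B m) (grad D x)) (contract (c.B m) (grad D y))
        + inner ℝ x y| ≤ enConst M * sizeSq (grad D x) x y := by
  set P : H → H := fun z => contract c.W (grad D z) with hP
  set Q : Fin 3 → H → H := fun m z => contract (c.B m) (grad D z) with hQ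
  set n := ‖D 0 x‖ + ‖D 1 x‖
  have hn0 : 0 ≤ n := by positivity
  set z := y + P x
  have hPadd : ∀ u v, P (u + v) = P u + P v := fun u v => by
    simp only [hP, ← contract_add]; congr 1; funext i; simp [grad]
  have hQadd : ∀ m u v, Q m (u + v) = Q m u + Q m v := fun m u v => by
    simp only [hQ, ← contract_add]; congr 1; funext i; simp [grad]
  have hPx : ‖P x‖ ≤ M * n := norm_contract_le hc.W.bound _
  have hQx : ∀ m, ‖Q m x‖ ≤ M * n := fun m => norm_contract_le (hc.B m).bound _
  have hzn : ‖z‖ ≤ ‖y‖ + M * n := (norm_add_le _ _).trans (by gcongr)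
  set e0 : H := P (P x) - ∑ i, ∑ j, c.W i (c.W j (D i (D j x))) with he0
  set e : Fin 3 → H := fun m => Q m (Q m x) - ∑ i, ∑ j, c.B m i (c.B m j (D i (D j x))) with he
  have he0n : ‖e0‖ ≤ 2 * M ^ 2 * n := norm_field_field_sub_le hM hc.W hc.W x
  have hen : ∀ m, ‖e m‖ ≤ 2 * M ^ 2 * n := fun m =>
    norm_field_field_sub_le hM (hc.B m) (hc.B m) x
  have hrhs : c.rhs (grad D y) (hess D x) + P y =
      -P z + (e0 - ∑ m, eps m • e m) + ∑ m, eps m • Q m (Q m x) := by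
    have e1 : P z = P y + P (P x) := hPadd _ _
    have e2 : ∑ m, eps m • Q m (Q m x) - ∑ m, eps m • e m =
        ∑ m, eps m • ∑ i, ∑ j, c.B m i (c.B m j (D i (D j x))) := by
      rw [← sum_sub_distrib]
      refine sum_congr rfl fun m _ => ?_
      rw [← smul_sub, he]; simp
    have e3 : c.rhs (grad D y) (hess D x) = (-2 : ℝ) • P y
      - ∑ i, ∑ j, c.W i (c.W j (D i (D j x)))
      + ∑ m, eps m • ∑ i, ∑ j, c.B m i (c.B m j (D i (D j x))) := rfl
    rw [e3, ← e2, e1, he0]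
    generalize P y = u1
    generalize P (P x) = u2
    generalize ∑ i, ∑ j, c.W i (c.W j (D i (D j x))) = u3
    generalize ∑ m, eps m • Q m (Q m x) = u4
    generalize ∑ m, eps m • e m = u5
    module
  have hT : ∀ m, |inner ℝ z (Q m (Q m x)) + inner ℝ (Q m x) (Q m y)| ≤
      2 * M * (‖z‖ * (M * n)) + M * (M * n) ^ 2 + (M * n) * (4 * M ^ 2 * n) := by
    intro m
    have a1 := abs_inner_field_le hc.skew (hc.B m) z (Q m x)
    have a2 := abs_inner_field_le hc.skew hc.W (Q m x) (Q m x)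
    have a3 := norm_field_comm_le hM hc.commD (hc.B m) hc.W (hc.commBW m) x
    change |inner ℝ z (Q m (Q m x)) + inner ℝ (Q m z) (Q m x)| ≤ _ at a1
    change |inner ℝ (Q m x) (P (Q m x)) + inner ℝ (P (Q m x)) (Q m x)| ≤ _ at a2
    change ‖Q m (P x) - P (Q m x)‖ ≤ 4 * M ^ 2 * n at a3
    rw [real_inner_comm (Q m x) (P (Q m x))] at a2
    have e1 : Q m y = Q m z - (Q m (P x) - P (Q m x)) - P (Q m x) := by
      have : Q m z = Q m y + Q m (P x) := hQadd m _ _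
      rw [this]; abel
    have e2 : inner ℝ z (Q m (Q m x)) + inner ℝ (Q m x) (Q m y) =
        (inner ℝ z (Q m (Q m x)) + inner ℝ (Q m z) (Q m x))
        - inner ℝ (Q m x) (Q m (P x) - P (Q m x)) - inner ℝ (Q m x) (P (Q m x)) := by
      rw [e1, inner_sub_right, inner_sub_right, real_inner_comm (Q m z) (Q m x)]; ring
    have a4 : |inner ℝ (Q m x) (Q m (P x) - P (Q m x))| ≤ (M * n) * (4 * M ^ 2 * n) := by
      refine (abs_real_inner_le_norm _ _).trans ?_
      gcongr
      exact hQx m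
    have a5 : |inner ℝ (Q m x) (P (Q m x))| ≤ M * (M * n) ^ 2 := by
      have : |inner ℝ (Q m x) (P (Q m x))| ≤ M * (‖Q m x‖ * ‖Q m x‖) := by
        rw [← two_mul, abs_mul, abs_two] at a2
        linarith
      refine this.trans ?_
      rw [sq]
      gcongr <;> exact hQx m
    have a6 : |inner ℝ z (Q m (Q m x)) + inner ℝ (Q m z) (Q m x)| ≤ 2 * M * (‖z‖ * (M * n)) := by
      refine a1.trans ?_
      gcongr
      exact hQx m
    rw [e2]
    refine (abs_sub _ _).trans ?_
    have := abs_sub (inner ℝ z (Q m (Q m x)) + inner ℝ (Q m z) (Q m x))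
      (inner ℝ (Q m x) (Q m (P x) - P (Q m x)))
    linarith
  have hPz : |inner ℝ z (P z)| ≤ M * ‖z‖ ^ 2 := by
    have a := abs_inner_field_le hc.skew hc.W z z
    change |inner ℝ z (P z) + inner ℝ (P z) z| ≤ _ at a
    rw [real_inner_comm z (P z), ← two_mul, abs_mul, abs_two] at a
    rw [sq]
    linarith
  have heq : inner ℝ z (c.rhs (grad D y) (hess D x) + P y)
        + ∑ m, eps m * inner ℝ (Q m x) (Q m y) + inner ℝ x y =
      -inner ℝ z (P z) + inner ℝ z (e0 - ∑ m, eps m • e m) + inner ℝ x y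
        + ∑ m, eps m * (inner ℝ z (Q m (Q m x)) + inner ℝ (Q m x) (Q m y)) := by
    rw [hrhs, inner_add_right, inner_add_right, inner_neg_right, inner_sum]
    simp only [inner_smul_right, mul_add, sum_add_distrib]
    ring
  have herr : ‖e0 - ∑ m, eps m • e m‖ ≤ 6 * M ^ 2 * n := by
    refine (norm_sub_le _ _).trans ?_
    have : ‖∑ m, eps m • e m‖ ≤ ∑ m, |eps m| * (2 * M ^ 2 * n) := by
      refine (norm_sum_le _ _).trans (sum_le_sum fun m _ => ?_)
      rw [norm_smul, norm_eq_abs]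
      gcongr
      exact hen m
    have h2 : ∑ m, |eps m| = 2 := by
      simp [sum_univ_three, eps]; norm_num
    rw [← Finset.sum_mul, h2] at this
    linarith
  have hsum : |∑ m, eps m * (inner ℝ z (Q m (Q m x)) + inner ℝ (Q m x) (Q m y))| ≤
      2 * (2 * M * (‖z‖ * (M * n)) + M * (M * n) ^ 2 + (M * n) * (4 * M ^ 2 * n)) := by
    have h2 : ∑ m, |eps m| = 2 := by
      simp [sum_univ_three, eps]; norm_num
    calc _ ≤ ∑ m, |eps m| *
          (2 * M * (‖z‖ * (M * n)) + M * (M * n) ^ 2 + (M * n) * (4 * M ^ 2 * n)) := by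
          refine (Finset.abs_sum_le_sum_abs _ _).trans (sum_le_sum fun m _ => ?_)
          rw [abs_mul]
          gcongr
          exact hT m
      _ = _ := by rw [← Finset.sum_mul, h2]
  change |inner ℝ z (c.rhs (grad D y) (hess D x) + P y)
        + ∑ m, eps m * inner ℝ (Q m x) (Q m y) + inner ℝ x y| ≤ _
  rw [heq]
  have hb := quad_bound hM (norm_nonneg x) (norm_nonneg y) hn0 (norm_nonneg z) hzn
    (S := sizeSq (grad D x) x y) (by
      have := norm_pair_le (grad D x)
      simp only [sizeSq]
      simp only [grad] at this ⊢
      linarith)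
  refine le_trans ?_ hb
  have t1 := abs_real_inner_le_norm z (e0 - ∑ m, eps m • e m)
  have t1' : ‖z‖ * ‖e0 - ∑ m, eps m • e m‖ ≤ ‖z‖ * (6 * M ^ 2 * n) := by gcongr
  have t2 := abs_real_inner_le_norm x y
  have s1 := abs_add_le (-inner ℝ z (P z) + inner ℝ z (e0 - ∑ m, eps m • e m) + inner ℝ x y)
    (∑ m, eps m * (inner ℝ z (Q m (Q m x)) + inner ℝ (Q m x) (Q m y)))
  have s2 := abs_add_le (-inner ℝ z (P z) + inner ℝ z (e0 - ∑ m, eps m • e m)) (inner ℝ x y)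
  have s3 := abs_add_le (-inner ℝ z (P z)) (inner ℝ z (e0 - ∑ m, eps m • e m))
  rw [abs_neg] at s3
  linarith

/-! ### Dependence of the energy on the coefficients, and coercivity -/

/-- Closeness of two sets of coefficients. -/
structure Coef.Close (c c' : Coef H) (δ : ℝ) : Prop where
  W : ∀ i x, ‖c.W i x - c'.W i x‖ ≤ δ * ‖x‖
  B : ∀ m i x, ‖c.B m i x - c'.B m i x‖ ≤ δ * ‖x‖

/-- Boundedness of the coefficients by `L`. -/
structure Coef.BddBy (c : Coef H) (L : ℝ) : Prop where
  W : ∀ i x, ‖c.W i x‖ ≤ L * ‖x‖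
  B : ∀ m i x, ‖c.B m i x‖ ≤ L * ‖x‖

lemma Coef.Bound.bddBy (h : c.Bound D M) : c.BddBy M := ⟨h.W.bound, fun m => (h.B m).bound⟩

lemma abs_sq_norm_sub_le {u v : H} {d b : ℝ} (h : ‖u - v‖ ≤ d) (hu : ‖u‖ ≤ b) (hv : ‖v‖ ≤ b) :
    |‖u‖ ^ 2 - ‖v‖ ^ 2| ≤ 2 * d * b := by
  have h1 : |‖u‖ - ‖v‖| ≤ d := (abs_norm_sub_norm_le u v).trans h
  have h2 : ‖u‖ + ‖v‖ ≤ 2 * b := by linarith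
  have hd : 0 ≤ d := (norm_nonneg _).trans h
  have h3 : 0 ≤ ‖u‖ + ‖v‖ := by positivity
  have h4 : (‖u‖ + ‖v‖) * |‖u‖ - ‖v‖| ≤ 2 * b * d := mul_le_mul h2 h1 (abs_nonneg _) (h3.trans h2)
  rw [sq_sub_sq, abs_mul, abs_of_nonneg h3]
  linarith

/-- The constant for the variation of the energy. -/
def varConst (M : ℝ) : ℝ := 20 * (1 + M)

lemma abs_energy_sub_le (hM : 0 ≤ M) {c' : Coef H} {δ : ℝ} (hδ : 0 ≤ δ) (hc : c.BddBy M)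
    (hc' : c'.BddBy M) (h : c.Close c' δ) (p : Fin 2 → H) (x y : H) :
    |c.energy p x y - c'.energy p x y| ≤ δ * (varConst M * sizeSq p x y) := by
  set n := ‖p 0‖ + ‖p 1‖ with hn
  have hn0 : 0 ≤ n := by positivity
  have hdiff : ∀ {A A' : Fin 2 → H →L[ℝ] H}, (∀ i x, ‖A i x - A' i x‖ ≤ δ * ‖x‖) →
      ‖contract A p - contract A' p‖ ≤ δ * n := by
    intro A A' hA
    have e : contract A p - contract A' p = (A 0 (p 0) - A' 0 (p 0)) + (A 1 (p 1) - A' 1 (p 1)) := by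
      simp only [contract, sum_univ_two]; abel
    rw [e]
    refine (norm_add_le _ _).trans ?_
    have := hA 0 (p 0)
    have := hA 1 (p 1)
    linarith
  have h1 : |‖y + contract c.W p‖ ^ 2 - ‖y + contract c'.W p‖ ^ 2| ≤
      2 * (δ * n) * (‖y‖ + M * n) := by
    refine abs_sq_norm_sub_le ?_ ?_ ?_
    · rw [add_sub_add_left_eq_sub]; exact hdiff h.W
    · exact (norm_add_le _ _).trans (by gcongr; exact norm_contract_le hc.W p)
    · exact (norm_add_le _ _).trans (by gcongr; exact norm_contract_le hc'.W p)
  have h2 : ∀ m, |‖contract (c.B m) p‖ ^ 2 - ‖contract (c'.B m) p‖ ^ 2| ≤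
      2 * (δ * n) * (M * n) := fun m =>
    abs_sq_norm_sub_le (hdiff (h.B m)) (norm_contract_le (hc.B m) p)
      (norm_contract_le (hc'.B m) p)
  have h3 : |∑ m, eps m * (‖contract (c.B m) p‖ ^ 2 - ‖contract (c'.B m) p‖ ^ 2)| ≤
      2 * (2 * (δ * n) * (M * n)) := by
    have h2' : ∑ m, |eps m| = 2 := by
      simp [sum_univ_three, eps]; norm_num
    calc _ ≤ ∑ m, |eps m| * (2 * (δ * n) * (M * n)) := by
          refine (Finset.abs_sum_le_sum_abs _ _).trans (sum_le_sum fun m _ => ?_)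
          rw [abs_mul]
          gcongr
          exact h2 m
      _ = _ := by rw [← Finset.sum_mul, h2']
  have e : c.energy p x y - c'.energy p x y =
      (‖y + contract c.W p‖ ^ 2 - ‖y + contract c'.W p‖ ^ 2) +
      ∑ m, eps m * (‖contract (c.B m) p‖ ^ 2 - ‖contract (c'.B m) p‖ ^ 2) := by
    simp only [Coef.energy, mul_sub, sum_sub_distrib]; ring
  rw [e]
  refine (abs_add_le _ _).trans ((add_le_add h1 h3).trans ?_)
  have hp := norm_pair_le p
  rw [← hn] at hp
  have hs : ‖y‖ ^ 2 + n ^ 2 / 2 ≤ sizeSq p x y := by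
    simp only [sizeSq]
    have := sq_nonneg ‖x‖
    linarith
  have hs0 := sizeSq_nonneg p x y
  have e2 : 2 * (δ * n) * (‖y‖ + M * n) + 2 * (2 * (δ * n) * (M * n)) =
      δ * (2 * n * ‖y‖ + 6 * M * n ^ 2) := by ring
  rw [e2]
  gcongr
  rw [varConst]
  have q1 : 2 * n * ‖y‖ ≤ 2 * sizeSq p x y := by nlinarith [sq_nonneg (n - 2 * ‖y‖)]
  have q2 : n ^ 2 ≤ 2 * sizeSq p x y := by nlinarith [sq_nonneg ‖y‖]
  have q3 : M * n ^ 2 ≤ M * (2 * sizeSq p x y) := by gcongr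
  nlinarith [mul_nonneg hM hs0]

lemma energy_le (hM : 0 ≤ M) (hc : c.BddBy M) (p : Fin 2 → H) (x y : H) :
    c.energy p x y ≤ 10 * (1 + M) ^ 2 * sizeSq p x y := by
  set n := ‖p 0‖ + ‖p 1‖ with hn
  have hn0 : 0 ≤ n := by positivity
  have h1 : ‖y + contract c.W p‖ ≤ ‖y‖ + M * n :=
    (norm_add_le _ _).trans (by gcongr; exact norm_contract_le hc.W p)
  have h2 : ∀ m, ‖contract (c.B m) p‖ ^ 2 ≤ (M * n) ^ 2 := fun m =>
    pow_le_pow_left₀ (norm_nonneg _) (norm_contract_le (hc.B m) p) 2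
  have h3 : ‖y + contract c.W p‖ ^ 2 ≤ (‖y‖ + M * n) ^ 2 :=
    pow_le_pow_left₀ (norm_nonneg _) h1 2
  have hp := norm_pair_le p
  rw [← hn] at hp
  have hsum : ∑ m, eps m * ‖contract (c.B m) p‖ ^ 2 ≤ (M * n) ^ 2 := by
    have := h2 1
    have := h2 2
    have := sq_nonneg ‖contract (c.B 0) p‖
    simp only [sum_univ_three, eps]
    simp
    linarith
  have hs : ‖x‖ ^ 2 + ‖y‖ ^ 2 + n ^ 2 / 2 ≤ sizeSq p x y := by
    simp only [sizeSq]; linarith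
  calc c.energy p x y ≤ (‖y‖ + M * n) ^ 2 + (M * n) ^ 2 + ‖x‖ ^ 2 := by
        simp only [Coef.energy]; linarith
    _ ≤ 2 * ‖y‖ ^ 2 + 3 * M ^ 2 * n ^ 2 + ‖x‖ ^ 2 := by
        nlinarith [sq_nonneg (‖y‖ - M * n)]
    _ ≤ 10 * (1 + M) ^ 2 * (‖x‖ ^ 2 + ‖y‖ ^ 2 + n ^ 2 / 2) := by
        have a1 : (1 : ℝ) ≤ (1 + M) ^ 2 := by nlinarith
        have a2 : M ^ 2 ≤ (1 + M) ^ 2 := by nlinarith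
        have b1 := mul_le_mul_of_nonneg_right a1 (sq_nonneg ‖x‖)
        have b2 := mul_le_mul_of_nonneg_right a1 (sq_nonneg ‖y‖)
        have b3 := mul_le_mul_of_nonneg_right a2 (sq_nonneg n)
        have := sq_nonneg ‖x‖
        have := sq_nonneg ‖y‖
        have := sq_nonneg n
        nlinarith
    _ ≤ _ := by gcongr

/-- The constant of the coercivity estimate. -/
def coerConst (c₀ L : ℝ) : ℝ := 2 + (1 + 8 * L ^ 2) * (1 + 1 / c₀)

lemma coerConst_pos {c₀ L : ℝ} (hc₀ : 0 < c₀) : 0 < coerConst c₀ L := by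
  unfold coerConst; positivity

/-- Coercivity of the energy under the stability condition. -/
lemma sizeSq_le_energy {c₀ L : ℝ} (hc₀ : 0 < c₀) (hc : c.BddBy L) (p : Fin 2 → H)
    (hst : c₀ * (‖p 0‖ ^ 2 + ‖p 1‖ ^ 2) ≤ ∑ m, eps m * ‖contract (c.B m) p‖ ^ 2) (x y : H) :
    sizeSq p x y ≤ coerConst c₀ L * c.energy p x y := by
  set n := ‖p 0‖ + ‖p 1‖ with hn
  have hn0 : 0 ≤ n := by positivity
  have hp := norm_pair_le p
  rw [← hn] at hp
  set z := y + contract c.W p with hz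
  set g := ‖p 0‖ ^ 2 + ‖p 1‖ ^ 2
  have hg0 : 0 ≤ g := by positivity
  have h1 : ‖y‖ ≤ ‖z‖ + L * n := by
    have e : y = z - contract c.W p := by rw [hz]; abel
    calc ‖y‖ = ‖z - contract c.W p‖ := by rw [← e]
      _ ≤ ‖z‖ + ‖contract c.W p‖ := norm_sub_le _ _
      _ ≤ _ := by gcongr; exact norm_contract_le hc.W p
  have h2 : ‖y‖ ^ 2 ≤ 2 * ‖z‖ ^ 2 + 4 * L ^ 2 * g := by
    have := pow_le_pow_left₀ (norm_nonneg y) h1 2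
    have h3 : (L * n) ^ 2 ≤ L ^ 2 * (2 * g) := by
      rw [mul_pow]; gcongr; linarith
    nlinarith [sq_nonneg (‖z‖ - L * n)]
  have hE : ‖z‖ ^ 2 + c₀ * g + ‖x‖ ^ 2 ≤ c.energy p x y := by
    simp only [Coef.energy]
    linarith
  have hE0 : 0 ≤ c.energy p x y := le_trans (by positivity) hE
  have hgE : g ≤ (1 / c₀) * c.energy p x y := by
    rw [one_div, ← div_eq_inv_mul, le_div_iff₀ hc₀]
    nlinarith [sq_nonneg ‖z‖, sq_nonneg ‖x‖]
  calc sizeSq p x y = ‖x‖ ^ 2 + ‖y‖ ^ 2 + g := rfl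
    _ ≤ 2 * (‖z‖ ^ 2 + c₀ * g + ‖x‖ ^ 2) + (1 + 4 * L ^ 2) * g := by
        nlinarith [sq_nonneg ‖x‖, mul_nonneg hc₀.le hg0]
    _ ≤ 2 * c.energy p x y + (1 + 4 * L ^ 2) * ((1 / c₀) * c.energy p x y) := by gcongr
    _ ≤ coerConst c₀ L * c.energy p x y := by
        rw [coerConst]
        have : 0 ≤ 1 / c₀ := by positivity
        have := mul_nonneg this hE0
        nlinarith [mul_nonneg (sq_nonneg L) this, mul_nonneg (sq_nonneg L) hE0]

end

section

/-! ### Integral inequalities on the line -/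

lemma le_integral_of_slope {F γ : ℝ → ℝ} {a b : ℝ} (hab : a ≤ b) (hF : ContinuousOn F (Icc a b))
    (hγ : ContinuousOn γ (Icc a b))
    (h : ∀ t ∈ Ico a b, ∀ ε > 0, ∀ᶠ t' in 𝓝[>] t, F t' - F t ≤ (γ t + ε) * (t' - t)) :
    F b - F a ≤ ∫ t in a..b, γ t := by
  set γ' : ℝ → ℝ := IccExtend hab ((Icc a b).domRestrict γ) with hγ'
  have hc : Continuous γ' := hγ.domRestrict.Icc_extend'
  have heq : ∀ t ∈ Icc a b, γ' t = γ t := fun t ht => by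
    rw [hγ', IccExtend_of_mem _ _ ht]; rfl
  have key := image_le_of_liminf_slope_right_le_deriv_boundary (f := F) (a := a) (b := b) hF
    (B := fun t => F a + ∫ τ in a..t, γ' τ) (B' := γ') (by simp)
    ((continuous_const.add (intervalIntegral.continuous_primitive
      (fun _ _ => hc.intervalIntegrable _ _) a)).continuousOn)
    (fun t _ => ((hc.integral_hasStrictDerivAt a t).hasDerivAt.const_add (F a)).hasDerivWithinAt)
    (fun t ht r hr => by
      have := h t ht ((r - γ' t) / 2) (by linarith)
      refine Eventually.frequently ?_
      filter_upwards [this, self_mem_nhdsWithin] with z hz hzt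
      have hpos : 0 < z - t := sub_pos.2 hzt
      rw [slope_def_field, div_lt_iff₀ hpos]
      rw [← heq t (Ico_subset_Icc_self ht)] at hz
      nlinarith) (right_mem_Icc.2 hab)
  have e : ∫ τ in a..b, γ' τ = ∫ τ in a..b, γ τ := by
    refine integral_congr fun t ht => ?_
    rw [uIcc_of_le hab] at ht
    exact heq t ht
  simp only [e] at key
  linarith

lemma abs_sub_le_integral_of_slope {F γ : ℝ → ℝ} {a b : ℝ} (hab : a ≤ b)
    (hF : ContinuousOn F (Icc a b)) (hγ : ContinuousOn γ (Icc a b))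
    (h : ∀ t ∈ Ico a b, ∀ ε > 0, ∀ᶠ t' in 𝓝[>] t, |F t' - F t| ≤ (γ t + ε) * (t' - t)) :
    |F b - F a| ≤ ∫ t in a..b, γ t := by
  rw [abs_le]
  constructor
  · have := le_integral_of_slope (F := fun t => -F t) hab hF.neg hγ (fun t ht ε hε => by
      filter_upwards [h t ht ε hε] with t' ht'
      have := (abs_le.1 ht').1
      linarith)
    linarith
  · exact le_integral_of_slope hab hF hγ (fun t ht ε hε => by
      filter_upwards [h t ht ε hε] with t' ht'
      exact (le_abs_self _).trans ht')

/-- Gronwall's inequality in integrated form. -/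
lemma gronwall_integral {F γ : ℝ → ℝ} {T K F₀ : ℝ} (hF : ContinuousOn F (Icc 0 T))
    (hγ : ContinuousOn γ (Icc 0 T)) (hγ0 : ∀ t ∈ Icc 0 T, 0 ≤ γ t) (hK : 0 ≤ K)
    (h : ∀ t ∈ Icc 0 T, F t ≤ F₀ + ∫ τ in (0 : ℝ)..t, (K * F τ + γ τ)) {t : ℝ} (ht : t ∈ Icc 0 T) :
    F t ≤ (F₀ + ∫ τ in (0 : ℝ)..t, γ τ) * exp (K * t) := by
  have hT : (0 : ℝ) ≤ T := ht.1.trans ht.2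
  set F' : ℝ → ℝ := IccExtend hT ((Icc 0 T).domRestrict F) with hF'
  set γ' : ℝ → ℝ := IccExtend hT ((Icc 0 T).domRestrict γ) with hγ'
  have hcF : Continuous F' := hF.domRestrict.Icc_extend'
  have hcγ : Continuous γ' := hγ.domRestrict.Icc_extend'
  have eF : ∀ t ∈ Icc 0 T, F' t = F t := fun t ht => by
    rw [hF', IccExtend_of_mem _ _ ht]; rfl
  have eγ : ∀ t ∈ Icc 0 T, γ' t = γ t := fun t ht => by
    rw [hγ', IccExtend_of_mem _ _ ht]; rfl
  set B : ℝ → ℝ := fun t => F₀ + ∫ τ in (0 : ℝ)..t, (K * F' τ + γ' τ) with hB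
  have hBd : ∀ t, HasDerivAt B (K * F' t + γ' t) t := fun t =>
    (((by fun_prop : Continuous fun τ => K * F' τ + γ' τ).integral_hasStrictDerivAt 0 t).hasDerivAt).const_add F₀
  set I : ℝ → ℝ := fun t => ∫ τ in (0 : ℝ)..t, γ' τ with hI
  have hId : ∀ t, HasDerivAt I (γ' t) t := fun t => (hcγ.integral_hasStrictDerivAt 0 t).hasDerivAt
  have hFB : ∀ t ∈ Icc 0 T, F t ≤ B t := by
    intro t ht
    refine (h t ht).trans (le_of_eq ?_)
    simp only [hB]
    congr 1
    refine integral_congr fun τ hτ => ?_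
    rw [uIcc_of_le ht.1] at hτ
    have hτ' : τ ∈ Icc 0 T := ⟨hτ.1, hτ.2.trans ht.2⟩
    simp only [eF τ hτ', eγ τ hτ']
  set Φ : ℝ → ℝ := fun t => B t * exp (-(K * t)) - I t with hΦ
  have hexp : ∀ t, HasDerivAt (fun t => exp (-(K * t))) (exp (-(K * t)) * (-K)) t :=
    fun t => by
      have := ((hasDerivAt_id t).const_mul K).neg.exp
      simpa using this
  have hΦd : ∀ t, HasDerivAt Φ ((K * F' t + γ' t) * exp (-(K * t))
      + B t * (exp (-(K * t)) * (-K)) - γ' t) t := fun t =>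
    ((hBd t).mul (hexp t)).sub (hId t)
  have hanti : AntitoneOn Φ (Icc 0 T) := by
    refine antitoneOn_of_deriv_nonpos (convex_Icc 0 T)
      (fun t _ => (hΦd t).continuousAt.continuousWithinAt)
      (fun t _ => (hΦd t).differentiableAt.differentiableWithinAt) fun t ht => ?_
    have ht' := interior_subset ht
    rw [(hΦd t).deriv, eF t ht', eγ t ht']
    have h1 : exp (-(K * t)) ≤ 1 := by
      rw [Real.exp_le_one_iff]
      have := mul_nonneg hK ht'.1
      linarith
    have h2 := hFB t ht'
    have h3 := hγ0 t ht'
    have h4 := Real.exp_pos (-(K * t))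
    have h5 : K * F t ≤ K * B t := by gcongr
    nlinarith [mul_le_mul_of_nonneg_right h5 h4.le, mul_le_mul_of_nonneg_left h1 h3]
  have h0 := hanti (left_mem_Icc.2 hT) ht ht.1
  simp only [hΦ, hB, hI, mul_zero, neg_zero, Real.exp_zero, integral_same,
    add_zero, mul_one, sub_zero] at h0
  have eI : I t = ∫ τ in (0 : ℝ)..t, γ τ := by
    simp only [hI]
    refine integral_congr fun τ hτ => ?_
    rw [uIcc_of_le ht.1] at hτ
    exact eγ τ ⟨hτ.1, hτ.2.trans ht.2⟩
  change B t * exp (-(K * t)) - I t ≤ F₀ at h0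
  rw [← eI]
  refine (hFB t ht).trans ?_
  have h4 := Real.exp_pos (K * t)
  have : B t = (B t * exp (-(K * t))) * exp (K * t) := by
    rw [mul_assoc, ← Real.exp_add]; simp
  rw [this]
  gcongr
  linarith

/-! ### Linear differential equations -/

/-- Global solvability of linear equations with bounded continuous coefficients. -/
lemma exists_linear_ode {E : Type*} [NormedAddCommGroup E] [NormedSpace ℝ E] [CompleteSpace E]
    {L : ℝ → E →L[ℝ] E} (hL : Continuous L) {K : ℝ} (hK : ∀ t, ‖L t‖ ≤ K) {G : ℝ → E}
    (hG : Continuous G) (u₀ : E) {T : ℝ} (hT : 0 ≤ T) :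
    ∃ u : ℝ → E, Continuous u ∧ ∀ t ∈ Icc 0 T, u t = u₀ + ∫ τ in (0 : ℝ)..t, (L τ (u τ) + G τ) := by
  have hK0 : 0 ≤ K := (norm_nonneg _).trans (hK 0)
  set μ : ℝ := 2 * K + 1 with hμ
  have hμ0 : 0 < μ := by positivity
  set X := C(Icc (0 : ℝ) T, E)
  set ext : X → ℝ → E := fun v => IccExtend hT v with hext
  have hextc : ∀ v, Continuous (ext v) := fun v => v.continuous.Icc_extend'
  set Ψ : X → ℝ → E := fun v t => exp (-(μ * t)) • u₀ + ∫ τ in (0 : ℝ)..t,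
    exp (-(μ * (t - τ))) • (L τ (ext v τ) + exp (-(μ * τ)) • G τ) with hΨ
  have hΨ' : ∀ v t, Ψ v t = exp (-(μ * t)) • (u₀ + ∫ τ in (0 : ℝ)..t,
      exp (μ * τ) • (L τ (ext v τ) + exp (-(μ * τ)) • G τ)) := by
    intro v t
    simp only [hΨ]
    rw [smul_add, ← intervalIntegral.integral_smul]
    congr 1
    refine integral_congr fun τ _ => ?_
    rw [← mul_smul (exp (-(μ * t))), ← Real.exp_add]
    congr 2
    ring
  have hcont : ∀ v : X, Continuous fun τ => exp (μ * τ) •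
      (L τ (ext v τ) + exp (-(μ * τ)) • G τ) := fun v => by
    have := hextc v
    have h1 : Continuous fun τ => L τ (ext v τ) := hL.clm_apply this
    fun_prop
  have hΨc : ∀ v, Continuous (Ψ v) := fun v => by
    have h1 := intervalIntegral.continuous_primitive
      (fun a b => (hcont v).intervalIntegrable (μ := volume) a b) 0
    have : Ψ v = fun t => exp (-(μ * t)) • (u₀ + ∫ τ in (0 : ℝ)..t,
      exp (μ * τ) • (L τ (ext v τ) + exp (-(μ * τ)) • G τ)) := funext (hΨ' v)
    rw [this]
    fun_prop
  set S : X → X := fun v => ⟨fun t => Ψ v t, (hΨc v).comp continuous_subtype_val⟩ with hS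
  have hcontr : ContractingWith (1 / 2) S := by
    refine ⟨by rw [← NNReal.coe_lt_coe]; norm_num, LipschitzWith.of_dist_le_mul fun v w => ?_⟩
    rw [dist_le (by positivity)]
    intro t
    simp only [hS, coe_mk]
    have ht0 : (0 : ℝ) ≤ t := t.2.1
    have hint : ∀ v : X, IntervalIntegrable (fun τ => exp (-(μ * (t - τ))) •
        (L τ (ext v τ) + exp (-(μ * τ)) • G τ)) volume 0 t := fun v => by
      have := hextc v
      have h1 : Continuous fun τ => L τ (ext v τ) := hL.clm_apply this
      exact Continuous.intervalIntegrable (by fun_prop) _ _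
    rw [dist_eq_norm, hΨ]
    rw [add_sub_add_left_eq_sub, ← intervalIntegral.integral_sub (hint v) (hint w)]
    have hb : ∀ τ ∈ Icc (0:ℝ) t, ‖exp (-(μ * (t - τ))) •
        (L τ (ext v τ) + exp (-(μ * τ)) • G τ) - exp (-(μ * (t - τ))) •
        (L τ (ext w τ) + exp (-(μ * τ)) • G τ)‖ ≤
        exp (-(μ * (t - τ))) * (K * dist v w) := by
      intro τ hτ
      rw [← smul_sub, add_sub_add_right_eq_sub, ← map_sub, norm_smul, norm_eq_abs,
        abs_of_pos (Real.exp_pos _)]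
      gcongr
      refine ((L τ).le_of_opNorm_le (hK τ) _).trans ?_
      gcongr
      rw [← dist_eq_norm]
      exact ContinuousMap.dist_apply_le_dist _
    refine (intervalIntegral.norm_integral_le_of_norm_le ht0
      (g := fun τ => exp (-(μ * (t - τ))) * (K * dist v w))
      (ae_of_all _ fun τ hτ => hb τ (Ioc_subset_Icc_self hτ))
      (Continuous.intervalIntegrable (by fun_prop) _ _)).trans ?_
    rw [intervalIntegral.integral_mul_const]
    have hI : ∫ τ in (0 : ℝ)..t, exp (-(μ * (t - τ))) = (1 - exp (-(μ * t))) / μ := by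
      have hd : ∀ τ ∈ uIcc (0 : ℝ) t, HasDerivAt (fun τ => exp (-(μ * (t - τ))) / μ)
          (exp (-(μ * (t - τ)))) τ := fun τ _ => by
        have h := ((((hasDerivAt_id τ).const_sub (t : ℝ)).const_mul μ).neg.exp).div_const μ
        convert! h using 1
        simp
        field_simp
      rw [intervalIntegral.integral_eq_sub_of_hasDerivAt hd
        (Continuous.intervalIntegrable (by fun_prop) _ _)]
      simp
      ring
    rw [hI]
    have h1 : (1 - exp (-(μ * t))) / μ ≤ 1 / μ := by
      gcongr
      have := Real.exp_pos (-(μ * t))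
      linarith
    calc _ ≤ 1 / μ * (K * dist v w) := by gcongr
      _ = (K / μ) * dist v w := by ring
      _ ≤ _ := by
        gcongr
        rw [div_le_iff₀ hμ0, hμ]
        push_cast
        linarith
  obtain ⟨v, hv⟩ : ∃ v : X, S v = v := ⟨_, hcontr.fixedPoint_isFixedPt⟩
  refine ⟨fun t => exp (μ * t) • ext v t, ?_, fun t ht => ?_⟩
  · have := hextc v
    fun_prop
  have hvt : ∀ t (ht : t ∈ Icc 0 T), ext v t = Ψ v t := fun t ht => by
    rw [hext]
    simp only
    rw [IccExtend_of_mem _ _ ht]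
    conv_lhs => rw [← hv]
    rfl
  change exp (μ * t) • ext v t = _
  rw [hvt t ht, hΨ', ← mul_smul, ← Real.exp_add, add_neg_cancel, Real.exp_zero, one_smul]
  congr 1
  refine integral_congr fun τ _ => ?_
  simp only
  rw [smul_add, ← mul_smul, ← Real.exp_add, add_neg_cancel, Real.exp_zero, one_smul, map_smul]

end

section

variable {H : Type*} [NormedAddCommGroup H] [InnerProductSpace ℝ H]

/-! ### Evolution of the energy -/

/-- The operator `∑ Aᵢ Dᵢ`. -/
def fieldOp (A D : Fin 2 → H →L[ℝ] H) : H →L[ℝ] H := ∑ i, (A i).comp (D i)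

lemma fieldOp_apply (A D : Fin 2 → H →L[ℝ] H) (x : H) :
    fieldOp A D x = contract A (grad D x) := by
  simp [fieldOp, contract, grad]

lemma hasDerivWithinAt_energy (c : Coef H) (D : Fin 2 → H →L[ℝ] H) {x y : ℝ → H} {x' y' : H}
    {s : Set ℝ} {t : ℝ} (hx : HasDerivWithinAt x x' s t) (hy : HasDerivWithinAt y y' s t) :
    HasDerivWithinAt (fun τ => c.energy (grad D (x τ)) (x τ) (y τ))
      (2 * (inner ℝ (y t + contract c.W (grad D (x t))) (y' + contract c.W (grad D x'))
        + ∑ m, eps m * inner ℝ (contract (c.B m) (grad D (x t))) (contract (c.B m) (grad D x'))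
        + inner ℝ (x t) x')) s t := by
  have h1 := (hy.add ((fieldOp c.W D).hasFDerivAt.comp_hasDerivWithinAt t hx)).norm_sq
  have h2 : ∀ m, HasDerivWithinAt (fun τ => eps m * ‖contract (c.B m) (grad D (x τ))‖ ^ 2)
      (eps m * (2 * inner ℝ (contract (c.B m) (grad D (x t))) (contract (c.B m) (grad D x')))) s t :=
    fun m => by
      have := (((fieldOp (c.B m) D).hasFDerivAt.comp_hasDerivWithinAt t hx).norm_sq).const_mul (eps m)
      simpa only [comp_def, fieldOp_apply] using this
  have h := (h1.add (HasDerivWithinAt.fun_sum fun m (_ : m ∈ Finset.univ) => h2 m)).add hx.norm_sq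
  simp only [comp_def, fieldOp_apply, Pi.add_apply] at h
  convert! h using 1
  simp only [mul_add, Finset.mul_sum]
  congr 2
  refine sum_congr rfl fun m _ => ?_
  ring

/-- The growth constant of the energy. -/
def slopeConst (M M' : ℝ) : ℝ := 2 * enConst M + M' * varConst M + (2 + 4 * M ^ 2)

lemma slopeConst_nonneg {M M' : ℝ} (hM : 0 ≤ M) (hM' : 0 ≤ M') : 0 ≤ slopeConst M M' := by
  unfold slopeConst enConst varConst
  positivity

lemma continuousOn_sizeSq {D : Fin 2 → H →L[ℝ] H} {x y : ℝ → H} {s : Set ℝ}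
    (hx : ContinuousOn x s) (hy : ContinuousOn y s) :
    ContinuousOn (fun τ => sizeSq (grad D (x τ)) (x τ) (y τ)) s := by
  simp only [sizeSq, grad]
  fun_prop

variable {D : Fin 2 → H →L[ℝ] H} {M M' T : ℝ} {c : ℝ → Coef H}

lemma continuousOn_energy (hM : 0 ≤ M) (hM' : 0 ≤ M') (hc : ∀ t, (c t).BddBy M)
    (hlip : ∀ t t', (c t).Close (c t') (M' * |t - t'|)) {x y : ℝ → H} {s : Set ℝ}
    (hx : ContinuousOn x s) (hy : ContinuousOn y s) :
    ContinuousOn (fun τ => (c τ).energy (grad D (x τ)) (x τ) (y τ)) s := by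
  intro t ht
  have h1 : Tendsto (fun τ => M' * |τ - t| * (varConst M * sizeSq (grad D (x τ)) (x τ) (y τ)))
      (𝓝[s] t) (𝓝 (M' * |t - t| * (varConst M * sizeSq (grad D (x t)) (x t) (y t)))) := by
    have h2 : Tendsto (fun τ => M' * |τ - t|) (𝓝[s] t) (𝓝 (M' * |t - t|)) :=
      ((by fun_prop : Continuous fun τ => M' * |τ - t|).tendsto t).mono_left nhdsWithin_le_nhds
    exact h2.mul ((continuousOn_sizeSq hx hy t ht).const_mul _)
  rw [sub_self, abs_zero, mul_zero, zero_mul] at h1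
  have h3 : Tendsto (fun τ => (c τ).energy (grad D (x τ)) (x τ) (y τ)
      - (c t).energy (grad D (x τ)) (x τ) (y τ)) (𝓝[s] t) (𝓝 0) :=
    squeeze_zero_norm (fun τ => abs_energy_sub_le hM (by positivity) (hc τ) (hc t) (hlip τ t) _ _ _) h1
  have h4 : Tendsto (fun τ => (c t).energy (grad D (x τ)) (x τ) (y τ)) (𝓝[s] t)
      (𝓝 ((c t).energy (grad D (x t)) (x t) (y t))) := by
    have : ContinuousOn (fun τ => (c t).energy (grad D (x τ)) (x τ) (y τ)) s := by
      simp only [Coef.energy, ← fieldOp_apply]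
      fun_prop
    exact this t ht
  have := h3.add h4
  simpa [ContinuousWithinAt] using this

/-- The energy inequality along a solution of the regularised system. -/
lemma abs_energy_sub_le_integral (hM : 0 ≤ M) (hM' : 0 ≤ M') (hc : ∀ t, (c t).Bound D M)
    (hlip : ∀ t t', (c t).Close (c t') (M' * |t - t'|)) {x y R : ℝ → H}
    (hR : ContinuousOn R (Icc 0 T))
    (hx : ∀ t ∈ Icc 0 T, HasDerivWithinAt x (y t) (Icc 0 T) t)
    (hy : ∀ t ∈ Icc 0 T, HasDerivWithinAt y
      ((c t).rhs (grad D (y t)) (hess D (x t)) + R t) (Icc 0 T) t)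
    {t₁ t₂ : ℝ} (h0 : 0 ≤ t₁) (h12 : t₁ ≤ t₂) (h2 : t₂ ≤ T) :
    |(c t₂).energy (grad D (x t₂)) (x t₂) (y t₂) - (c t₁).energy (grad D (x t₁)) (x t₁) (y t₁)| ≤
      ∫ τ in t₁..t₂, (slopeConst M M' * sizeSq (grad D (x τ)) (x τ) (y τ) + ‖R τ‖ ^ 2) := by
  have hsub : Icc t₁ t₂ ⊆ Icc 0 T := Icc_subset_Icc h0 h2
  have hxc : ContinuousOn x (Icc 0 T) := fun t ht => (hx t ht).continuousWithinAt
  have hyc : ContinuousOn y (Icc 0 T) := fun t ht => (hy t ht).continuousWithinAt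
  have hsz := continuousOn_sizeSq (D := D) hxc hyc
  refine abs_sub_le_integral_of_slope (F := fun τ => (c τ).energy (grad D (x τ)) (x τ) (y τ)) h12
    ((continuousOn_energy hM hM' (fun t => (hc t).bddBy) hlip hxc hyc).mono hsub)
    (((hsz.const_mul _).add (hR.norm.pow 2)).mono hsub) ?_
  intro t ht ε hε
  have htT : t ∈ Icc 0 T := hsub (Ico_subset_Icc_self ht)
  have htT' : t < T := ht.2.trans_le h2
  set z := y t + contract (c t).W (grad D (x t))
  set S := sizeSq (grad D (x t)) (x t) (y t) with hS
  have hnhds : 𝓝[>] t ≤ 𝓝[Icc 0 T] t := by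
    rw [← nhdsWithin_Ioo_eq_nhdsGT htT']
    exact nhdsWithin_mono _ fun u hu => ⟨htT.1.trans hu.1.le, hu.2.le⟩
  have hd := hasDerivWithinAt_energy (c t) D (hx t htT) (hy t htT)
  set d := 2 * (inner ℝ z ((c t).rhs (grad D (y t)) (hess D (x t)) + R t +
    contract (c t).W (grad D (y t)))
        + ∑ m, eps m * inner ℝ (contract ((c t).B m) (grad D (x t)))
          (contract ((c t).B m) (grad D (y t))) + inner ℝ (x t) (y t)) with hdd
  have hdle : |d| ≤ 2 * enConst M * S + (2 + 4 * M ^ 2) * S + ‖R t‖ ^ 2 := by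
    have h1 := abs_energy_pairing_le hM (hc t) (x t) (y t)
    have e : d = 2 * (inner ℝ z ((c t).rhs (grad D (y t)) (hess D (x t))
        + contract (c t).W (grad D (y t)))
        + ∑ m, eps m * inner ℝ (contract ((c t).B m) (grad D (x t)))
          (contract ((c t).B m) (grad D (y t))) + inner ℝ (x t) (y t)) + 2 * inner ℝ z (R t) := by
      rw [hdd]
      simp only [inner_add_right]
      ring
    have h3 := abs_real_inner_le_norm z (R t)
    have h4 : ‖z‖ ≤ ‖y t‖ + M * (‖D 0 (x t)‖ + ‖D 1 (x t)‖) :=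
      (norm_add_le _ _).trans (by
        gcongr
        exact norm_contract_le (hc t).W.bound (grad D (x t)))
    have h5 := norm_pair_le (grad D (x t))
    simp only [grad] at h5
    have h6 : ‖z‖ ^ 2 ≤ (2 + 4 * M ^ 2) * S := by
      set n := ‖D 0 (x t)‖ + ‖D 1 (x t)‖
      have h7 := pow_le_pow_left₀ (norm_nonneg z) h4 2
      have h8 : ‖y t‖ ^ 2 + n ^ 2 / 2 ≤ S := by
        simp only [hS, sizeSq, grad]
        have := sq_nonneg ‖x t‖
        linarith
      have h9 : M ^ 2 * (‖y t‖ ^ 2 + n ^ 2 / 2) ≤ M ^ 2 * S := by gcongr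
      have := mul_nonneg (sq_nonneg M) (sq_nonneg ‖y t‖)
      have := sq_nonneg (‖y t‖ - M * n)
      have := sq_nonneg n
      nlinarith
    rw [e]
    refine (abs_add_le _ _).trans ?_
    rw [abs_mul, abs_mul, abs_two]
    have h10 := sq_nonneg (‖z‖ - ‖R t‖)
    nlinarith
  have h1 : ∀ᶠ τ in 𝓝[>] t, |(c t).energy (grad D (x τ)) (x τ) (y τ)
      - (c t).energy (grad D (x t)) (x t) (y t)| ≤ (|d| + ε / 2) * (τ - t) := by
    have hl := (hasDerivWithinAt_iff_isLittleO.1 hd).mono hnhds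
    have := hl.def (by positivity : 0 < ε / 2)
    filter_upwards [this, self_mem_nhdsWithin] with τ hτ hτt
    have hpos : 0 < τ - t := sub_pos.2 hτt
    simp only [smul_eq_mul, norm_eq_abs, abs_of_pos hpos] at hτ
    have e : (c t).energy (grad D (x τ)) (x τ) (y τ) - (c t).energy (grad D (x t)) (x t) (y t) =
      ((c t).energy (grad D (x τ)) (x τ) (y τ) - (c t).energy (grad D (x t)) (x t) (y t)
        - (τ - t) * d) + (τ - t) * d := by ring
    rw [e]
    refine (abs_add_le _ _).trans ?_
    rw [abs_mul, abs_of_pos hpos]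
    linarith
  have h3 : ∀ᶠ τ in 𝓝[>] t, M' * (varConst M * sizeSq (grad D (x τ)) (x τ) (y τ)) <
      M' * (varConst M * S) + ε / 2 := by
    have hcont : Tendsto (fun τ => M' * (varConst M * sizeSq (grad D (x τ)) (x τ) (y τ)))
        (𝓝[>] t) (𝓝 (M' * (varConst M * S))) :=
      (((hsz t htT).const_mul _).const_mul _).mono_left hnhds
    exact hcont.eventually_lt_const (by linarith)
  filter_upwards [h1, h3, self_mem_nhdsWithin] with τ h1 h3 hτt
  have hpos : 0 < τ - t := sub_pos.2 hτt
  have h4 := abs_energy_sub_le hM (by positivity) (hc τ).bddBy (hc t).bddBy (hlip τ t)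
    (grad D (x τ)) (x τ) (y τ)
  rw [abs_of_pos hpos] at h4
  have e : (c τ).energy (grad D (x τ)) (x τ) (y τ) - (c t).energy (grad D (x t)) (x t) (y t) =
    ((c τ).energy (grad D (x τ)) (x τ) (y τ) - (c t).energy (grad D (x τ)) (x τ) (y τ)) +
    ((c t).energy (grad D (x τ)) (x τ) (y τ) - (c t).energy (grad D (x t)) (x t) (y t)) := by ring
  rw [e]
  refine (abs_add_le _ _).trans ?_
  have h5 : M' * (τ - t) * (varConst M * sizeSq (grad D (x τ)) (x τ) (y τ)) ≤
      (M' * (varConst M * S) + ε / 2) * (τ - t) := by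
    have := mul_le_mul_of_nonneg_right h3.le hpos.le
    linarith
  have h6 : (slopeConst M M' * S + ‖R t‖ ^ 2 + ε) * (τ - t) ≥
      ((M' * (varConst M * S) + ε / 2) + (|d| + ε / 2)) * (τ - t) := by
    have : slopeConst M M' * S + ‖R t‖ ^ 2 + ε ≥ (M' * (varConst M * S) + ε / 2) + (|d| + ε / 2) := by
      rw [slopeConst]; linarith
    exact mul_le_mul_of_nonneg_right this hpos.le
  linarith

/-- The energy estimate: growth of the size of a solution. -/
lemma sizeSq_le_of_energy (hM : 0 ≤ M) (hM' : 0 ≤ M') (hc : ∀ t, (c t).Bound D M)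
    (hlip : ∀ t t', (c t).Close (c t') (M' * |t - t'|)) {c₀ L L' : ℝ} (hc₀ : 0 < c₀) (hL : 0 ≤ L)
    (hcL : ∀ t, (c t).BddBy L) (hcL' : ∀ t, (c t).BddBy L')
    (hst : ∀ t, ∀ p : Fin 2 → H, c₀ * (‖p 0‖ ^ 2 + ‖p 1‖ ^ 2) ≤
      ∑ m, eps m * ‖contract ((c t).B m) p‖ ^ 2)
    {x y R : ℝ → H} (hR : ContinuousOn R (Icc 0 T))
    (hx : ∀ t ∈ Icc 0 T, HasDerivWithinAt x (y t) (Icc 0 T) t)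
    (hy : ∀ t ∈ Icc 0 T, HasDerivWithinAt y
      ((c t).rhs (grad D (y t)) (hess D (x t)) + R t) (Icc 0 T) t)
    {κ : ℝ} (hκ : 0 ≤ κ) {g : ℝ → ℝ} (hg : ContinuousOn g (Icc 0 T)) (hg0 : ∀ t ∈ Icc 0 T, 0 ≤ g t)
    (hRb : ∀ t ∈ Icc 0 T, ‖R t‖ ^ 2 ≤ κ * sizeSq (grad D (x t)) (x t) (y t) + g t)
    {t : ℝ} (ht : t ∈ Icc 0 T) :
    sizeSq (grad D (x t)) (x t) (y t) ≤ coerConst c₀ L *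
      (10 * (1 + L) ^ 2 * sizeSq (grad D (x 0)) (x 0) (y 0) + ∫ τ in (0 : ℝ)..t, g τ) *
        exp ((slopeConst M M' + κ) * coerConst c₀ L' * t) := by
  have hxc : ContinuousOn x (Icc 0 T) := fun t ht => (hx t ht).continuousWithinAt
  have hyc : ContinuousOn y (Icc 0 T) := fun t ht => (hy t ht).continuousWithinAt
  have hsz := continuousOn_sizeSq (D := D) hxc hyc
  have hs0 := slopeConst_nonneg hM hM'
  have hk0 : 0 ≤ slopeConst M M' + κ := by positivity
  have hC' := coerConst_pos (L := L') hc₀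
  have hC := coerConst_pos (L := L) hc₀
  set F : ℝ → ℝ := fun τ => (c τ).energy (grad D (x τ)) (x τ) (y τ) with hF
  have hFc : ContinuousOn F (Icc 0 T) :=
    continuousOn_energy hM hM' (fun t => (hc t).bddBy) hlip hxc hyc
  have hco : ∀ τ, sizeSq (grad D (x τ)) (x τ) (y τ) ≤ coerConst c₀ L' * F τ := fun τ =>
    sizeSq_le_energy hc₀ (hcL' τ) _ (hst τ _) _ _
  have hgr := gronwall_integral (F := F) (γ := g) (F₀ := F 0)
    (K := (slopeConst M M' + κ) * coerConst c₀ L') hFc hg hg0 (by positivity) (fun t ht => by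
      have h1 := (le_abs_self _).trans (abs_energy_sub_le_integral hM hM' hc hlip hR hx hy le_rfl
        ht.1 ht.2)
      have hsub : uIcc 0 t ⊆ Icc 0 T := by
        rw [uIcc_of_le ht.1]; exact Icc_subset_Icc le_rfl ht.2
      have h2 : ∫ τ in (0 : ℝ)..t, (slopeConst M M' * sizeSq (grad D (x τ)) (x τ) (y τ)
          + ‖R τ‖ ^ 2) ≤ ∫ τ in (0 : ℝ)..t,
            ((slopeConst M M' + κ) * coerConst c₀ L' * F τ + g τ) := by
        refine intervalIntegral.integral_mono_on ht.1
          (ContinuousOn.intervalIntegrable (((hsz.const_mul _).add (hR.norm.pow 2)).mono hsub))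
          (ContinuousOn.intervalIntegrable (((hFc.const_mul _).add hg).mono hsub)) fun τ hτ => ?_
        have hτ' : τ ∈ Icc 0 T := ⟨hτ.1, hτ.2.trans ht.2⟩
        have a1 := hRb τ hτ'
        have a2 := mul_le_mul_of_nonneg_left (hco τ) hk0
        nlinarith
      simp only [hF] at h1 h2 ⊢
      linarith) ht
  have h3 := sizeSq_le_energy hc₀ (hcL t) (grad D (x t)) (hst t _) (x t) (y t)
  have h4 : F 0 ≤ 10 * (1 + L) ^ 2 * sizeSq (grad D (x 0)) (x 0) (y 0) :=
    energy_le hL (hcL 0) _ _ _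
  calc _ ≤ coerConst c₀ L * F t := h3
    _ ≤ coerConst c₀ L * ((10 * (1 + L) ^ 2 * sizeSq (grad D (x 0)) (x 0) (y 0)
        + ∫ τ in (0 : ℝ)..t, g τ) * exp ((slopeConst M M' + κ) * coerConst c₀ L' * t)) := by
        gcongr
        refine hgr.trans ?_
        gcongr
    _ = _ := by ring

end

section

/-! ### Coefficient fields on the torus -/

/-- The coefficient fields of the linearised system at a fixed time. -/
structure Fields where
  /-- the mean velocity -/
  W : Fin 2 → C(Torus2, ℝ)
  /-- the velocity jump and the two magnetic fields -/
  B : Fin 3 → Fin 2 → C(Torus2, ℝ)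

/-- The multiplication operators of the fields. -/
def Fields.coef (a : Fields) : Coef Seq := ⟨fun i => mulSeq (a.W i), fun m i => mulSeq (a.B m i)⟩

/-- `H^r` bounds of the fields. -/
structure Fields.SobBound (r M : ℝ) (a : Fields) : Prop where
  W : ∀ i, hsq r (a.W i) ≤ ofReal M ^ 2
  B : ∀ m i, hsq r (a.B m i) ≤ ofReal M ^ 2

/-- Supremum bounds of the fields. -/
structure Fields.SupBound (L : ℝ) (a : Fields) : Prop where
  W : ∀ i, ‖a.W i‖ ≤ L
  B : ∀ m i, ‖a.B m i‖ ≤ L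

/-- Uniform distance of fields. -/
structure Fields.Near (a a' : Fields) (δ : ℝ) : Prop where
  W : ∀ i, ‖a.W i - a'.W i‖ ≤ δ
  B : ∀ m i, ‖a.B m i - a'.B m i‖ ≤ δ

/-- The stability condition. -/
def Fields.Stable (c₁ : ℝ) (a : Fields) : Prop :=
  ∀ x (ξ : Fin 2 → ℝ), c₁ * (ξ 0 ^ 2 + ξ 1 ^ 2) ≤ ∑ m, eps m * (∑ i, a.B m i x * ξ i) ^ 2

variable {r M L c₁ δ : ℝ} {a a' : Fields}

lemma Fields.Near.coef (h : a.Near a' δ) : a.coef.Close a'.coef δ where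
  W i x := by
    have := norm_mulSeq_apply_le (a.W i - a'.W i) x
    rw [mulSeq_sub] at this
    exact this.trans (by gcongr; exact h.W i)
  B m i x := by
    have := norm_mulSeq_apply_le (a.B m i - a'.B m i) x
    rw [mulSeq_sub] at this
    exact this.trans (by gcongr; exact h.B m i)

lemma Fields.SupBound.coef (h : a.SupBound L) : a.coef.BddBy L where
  W i x := (norm_mulSeq_apply_le _ x).trans (by gcongr; exact h.W i)
  B m i x := (norm_mulSeq_apply_le _ x).trans (by gcongr; exact h.B m i)

lemma enorm_tsum_coeff_le (hr : 5 / 2 ≤ r) {b : C(Torus2, ℝ)}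
    (hb : hsq r b ≤ ofReal M ^ 2) :
    ∑' k, ‖coeff b k‖ₑ ≤ ofReal wroot * ofReal M := by
  have h1 : (∑' k, ‖coeff b k‖ₑ) ^ 2 ≤ (ofReal wroot * ofReal M) ^ 2 := by
    refine le_trans ?_ (tsum_jap_coeff_le hr hb)
    gcongr with k
    have : (1 : ℝ≥0∞) ≤ ofReal (jap k) := by simpa using one_le_jap k
    calc ‖coeff b k‖ₑ = 1 * ‖coeff b k‖ₑ := (one_mul _).symm
      _ ≤ _ := by gcongr
  exact (ENNReal.pow_right_strictMono two_ne_zero).le_iff_le.1 h1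

lemma summable_coeff (hr : 5 / 2 ≤ r) {b : C(Torus2, ℝ)} (hb : hsq r b ≤ ofReal M ^ 2) :
    Summable (coeff b) := by
  have h : ∑' k, ‖coeff b k‖ₑ ≠ ⊤ :=
    ((enorm_tsum_coeff_le hr hb).trans_lt (by finiteness)).ne
  refine Summable.of_norm ?_
  have := ENNReal.summable_toReal h
  simpa using this

lemma norm_le_of_hsq (hr : 5 / 2 ≤ r) (hM : 0 ≤ M) {b : C(Torus2, ℝ)}
    (hb : hsq r b ≤ ofReal M ^ 2) : ‖b‖ ≤ wroot * M := by
  have hw := wroot_nonneg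
  rw [norm_le _ (by positivity)]
  intro x
  have hs : Summable (mFourierCoeff (toC b)) := summable_coeff hr hb
  have h := UnitAddTorus.hasSum_mFourier_series_apply_of_summable hs x
  have h1 := enorm_le_of_hasSum h
  have h2 : ∑' k, ‖mFourierCoeff (toC b) k • mFourier k x‖ₑ ≤
      ofReal (wroot * M) := by
    rw [ofReal_mul hw]
    refine le_trans (le_of_eq ?_) (enorm_tsum_coeff_le hr hb)
    refine tsum_congr fun k => ?_
    rw [enorm_smul]
    have : ‖mFourier k x‖ₑ = 1 := by
      rw [← ofReal_norm, norm_mFourier_apply]; simp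
    rw [this, mul_one]; rfl
  have h3 := h1.trans h2
  rw [← ofReal_norm, ENNReal.ofReal_le_ofReal_iff (by positivity)] at h3
  simpa [toC] using h3

/-- The bound for the operators attached to `H^r` fields. -/
def opConst (M : ℝ) : ℝ := 3 * wroot * M

lemma opConst_nonneg (hM : 0 ≤ M) : 0 ≤ opConst M := by
  have := wroot_nonneg
  unfold opConst; positivity

lemma Fields.SobBound.sup (hr : 5 / 2 ≤ r) (hM : 0 ≤ M) (h : a.SobBound r M) :
    a.SupBound (opConst M) := by
  have hw := wroot_nonneg
  have : wroot * M ≤ opConst M := by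
    unfold opConst
    have : 0 ≤ wroot * M := by positivity
    linarith
  exact ⟨fun i => (norm_le_of_hsq hr hM (h.W i)).trans this,
    fun m i => (norm_le_of_hsq hr hM (h.B m i)).trans this⟩

lemma Fields.SobBound.coef (hr : 5 / 2 ≤ r) (hM : 0 ≤ M) (h : a.SobBound r M) {N : ℝ}
    (hN : 1 ≤ N) : a.coef.Bound (dOp N) (opConst M) where
  skew := inner_dOp hN
  commD i j x := diag_comm (isBdd_dsym hN i) (isBdd_dsym hN j) x
  W := ⟨fun i => inner_mulSeq _, (h.sup hr hM).coef.W,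
    fun i j => norm_comm_dOp_le hr hM (h.W j) hN i⟩
  B m := ⟨fun i => inner_mulSeq _, (h.sup hr hM).coef.B m,
    fun i j => norm_comm_dOp_le hr hM (h.B m j) hN i⟩
  commBW m i j x := mulSeq_comm _ _ x

lemma norm_sq_Lp (f : Lp ℂ 2 torusMeasure) : ‖f‖ ^ 2 = ∫ x, ‖f x‖ ^ 2 ∂torusMeasure := by
  have h : inner ℝ f f = ∫ x, inner ℝ (f x) (f x) ∂torusMeasure := L2.inner_def f f
  rw [← real_inner_self_eq_norm_sq f, h]
  simp only [real_inner_self_eq_norm_sq]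

lemma integrable_norm_sq_Lp (f : Lp ℂ 2 torusMeasure) :
    Integrable (fun x => ‖f x‖ ^ 2) torusMeasure := by
  have := L2.integrable_inner (𝕜 := ℝ) f f
  simpa only [real_inner_self_eq_norm_sq] using this

lemma coeFn_sum_mulLp (b : Fin 2 → C(Torus2, ℝ)) (f : Fin 2 → Lp ℂ 2 torusMeasure) :
    ((∑ i, mulLp (b i) (f i) : Lp ℂ 2 torusMeasure) : Torus2 → ℂ) =ᵐ[torusMeasure]
      fun x => ∑ i, (b i x : ℂ) * f i x := by
  simp only [sum_univ_two]
  filter_upwards [Lp.coeFn_add (mulLp (b 0) (f 0)) (mulLp (b 1) (f 1)), coeFn_mulLp (b 0) (f 0),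
    coeFn_mulLp (b 1) (f 1)] with x h1 h2 h3
  rw [h1, Pi.add_apply, h2, h3]

/-- The stability condition, integrated. -/
lemma Fields.Stable.le_Lp (h : a.Stable c₁) (f : Fin 2 → Lp ℂ 2 torusMeasure) :
    c₁ * (‖f 0‖ ^ 2 + ‖f 1‖ ^ 2) ≤ ∑ m, eps m * ‖∑ i, mulLp (a.B m i) (f i)‖ ^ 2 := by
  have e : ∀ m, ‖∑ i, mulLp (a.B m i) (f i)‖ ^ 2 =
      ∫ x, ‖(∑ i, mulLp (a.B m i) (f i) : Lp ℂ 2 torusMeasure) x‖ ^ 2 ∂torusMeasure :=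
    fun m => norm_sq_Lp _
  simp only [e]
  rw [norm_sq_Lp, norm_sq_Lp, ← integral_add (integrable_norm_sq_Lp _) (integrable_norm_sq_Lp _),
    ← integral_const_mul]
  simp only [← integral_const_mul]
  rw [← integral_finsetSum _ fun m _ => (integrable_norm_sq_Lp _).const_mul _]
  refine integral_mono_ae (((integrable_norm_sq_Lp _).add (integrable_norm_sq_Lp _)).const_mul _)
    (integrable_finsetSum _ fun m _ => (integrable_norm_sq_Lp _).const_mul _) ?_
  filter_upwards [coeFn_sum_mulLp (a.B 0) f, coeFn_sum_mulLp (a.B 1) f,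
    coeFn_sum_mulLp (a.B 2) f] with x h0 h1 h2
  have hre := h x fun i => (f i x).re
  have him := h x fun i => (f i x).im
  simp only [sum_univ_three] at hre him ⊢
  rw [h0, h1, h2]
  simp only [sum_univ_two, ← Complex.normSq_eq_norm_sq, Complex.normSq_apply,
    add_re, Complex.add_im, Complex.mul_re, Complex.mul_im, ofReal_re,
    Complex.ofReal_im, zero_mul, sub_zero, add_zero] at hre him ⊢
  linarith

lemma Fields.Stable.le_contract (h : a.Stable c₁) (p : Fin 2 → Seq) :
    c₁ * (‖p 0‖ ^ 2 + ‖p 1‖ ^ 2) ≤ ∑ m, eps m * ‖contract (a.coef.B m) p‖ ^ 2 := by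
  have h1 := h.le_Lp fun i => fourierL.symm (p i)
  have e : ∀ m, ‖∑ i, mulLp (a.B m i) (fourierL.symm (p i))‖ = ‖contract (a.coef.B m) p‖ := by
    intro m
    rw [← norm_fourierL, map_sum]
    rfl
  simpa only [e, norm_fourierL_symm] using h1

/-- The first order coefficients. -/
def Fields.first (a : Fields) (i : Fin 2) : C(Torus2, ℝ) := (-2 : ℝ) • a.W i

/-- The second order coefficients. -/
def Fields.second (a : Fields) (i j : Fin 2) : C(Torus2, ℝ) :=
  -(a.W i * a.W j) + ∑ m, eps m • (a.B m i * a.B m j)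

lemma Fields.rhs_eq (a : Fields) (q : Fin 2 → Seq) (pp : Fin 2 → Fin 2 → Seq) :
    a.coef.rhs q pp = ∑ i, mulSeq (a.first i) (q i) + ∑ i, ∑ j, mulSeq (a.second i j) (pp i j) := by
  have h1 : ∀ i j, mulSeq (a.second i j) (pp i j) = -(mulSeq (a.W i) (mulSeq (a.W j) (pp i j))) +
      ∑ m, eps m • mulSeq (a.B m i) (mulSeq (a.B m j) (pp i j)) := by
    intro i j
    simp only [Fields.second, mulSeq_add, mulSeq_sum, mulSeq_smul, ContinuousLinearMap.add_apply,
      ContinuousLinearMap.sum_apply, ContinuousLinearMap.smul_apply, mulSeq_mul]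
    rw [show -(a.W i * a.W j) = (-1 : ℝ) • (a.W i * a.W j) by simp, mulSeq_smul,
      ContinuousLinearMap.smul_apply, mulSeq_mul]
    simp
  simp only [h1, sum_add_distrib, Finset.sum_neg_distrib]
  rw [Coef.rhs]
  have h2 : ∑ i, ∑ j, ∑ m, eps m • mulSeq (a.B m i) (mulSeq (a.B m j) (pp i j)) =
      ∑ m, eps m • ∑ i, ∑ j, mulSeq (a.B m i) (mulSeq (a.B m j) (pp i j)) := by
    simp only [Finset.smul_sum]
    rw [Finset.sum_comm' (t' := Finset.univ) (s' := fun _ => Finset.univ) (by simp)]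
    simp only [sum_univ_two, sum_univ_three]
    abel
  rw [h2]
  simp only [Fields.coef, Fields.first, contract, mulSeq_smul, ContinuousLinearMap.smul_apply,
    Finset.smul_sum]
  abel

end

section

/-! ### Integral and differential form of evolution equations -/

section Evolution

variable {E : Type*} [NormedAddCommGroup E] [NormedSpace ℝ E] [CompleteSpace E]

lemma hasDerivWithinAt_of_integral {T : ℝ} {u F : ℝ → E} {u₀ : E} (hF : ContinuousOn F (Icc 0 T))
    (h : ∀ t ∈ Icc 0 T, u t = u₀ + ∫ τ in (0 : ℝ)..t, F τ) {t : ℝ} (ht : t ∈ Icc 0 T) :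
    HasDerivWithinAt u (F t) (Icc 0 T) t := by
  have hT : (0 : ℝ) ≤ T := ht.1.trans ht.2
  set F' : ℝ → E := IccExtend hT ((Icc 0 T).domRestrict F) with hF'
  have hc : Continuous F' := hF.domRestrict.Icc_extend'
  have heq : ∀ t ∈ Icc 0 T, F' t = F t := fun t ht => by
    rw [hF', IccExtend_of_mem _ _ ht]; rfl
  have h1 : ∀ t ∈ Icc 0 T, u t = u₀ + ∫ τ in (0 : ℝ)..t, F' τ := fun t ht => by
    rw [h t ht]
    congr 1
    refine integral_congr fun τ hτ => ?_
    rw [uIcc_of_le ht.1] at hτ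
    exact (heq τ ⟨hτ.1, hτ.2.trans ht.2⟩).symm
  have h2 : HasDerivAt (fun t => u₀ + ∫ τ in (0 : ℝ)..t, F' τ) (F' t) t :=
    (hc.integral_hasStrictDerivAt 0 t).hasDerivAt.const_add u₀
  rw [← heq t ht]
  exact h2.hasDerivWithinAt.congr h1 (h1 t ht)

lemma integral_of_hasDerivWithinAt {T : ℝ} {u F : ℝ → E} (hF : ContinuousOn F (Icc 0 T))
    (h : ∀ t ∈ Icc 0 T, HasDerivWithinAt u (F t) (Icc 0 T) t) {t : ℝ} (ht : t ∈ Icc 0 T) :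
    u t = u 0 + ∫ τ in (0 : ℝ)..t, F τ := by
  have hsub : Icc 0 t ⊆ Icc 0 T := Icc_subset_Icc le_rfl ht.2
  have := intervalIntegral.integral_eq_sub_of_hasDeriv_right_of_le (f := u) (f' := F) ht.1
    (fun τ hτ => (h τ (hsub hτ)).continuousWithinAt.mono hsub)
    (fun τ hτ => ((h τ (hsub (Ioo_subset_Icc_self hτ))).hasDerivAt
      (Icc_mem_nhds hτ.1 (hτ.2.trans_le ht.2))).hasDerivWithinAt)
    (ContinuousOn.intervalIntegrable (by rw [uIcc_of_le ht.1]; exact hF.mono hsub))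
  rw [this]; abel

end Evolution

/-! ### The regularised problem -/

/-- A family of coefficient fields with uniform bounds. -/
structure Family (r M M' L c₁ : ℝ) (a : ℝ → Fields) : Prop where
  hr : 5 / 2 ≤ r
  hM : 0 ≤ M
  hM' : 0 ≤ M'
  hL : 0 ≤ L
  hc₁ : 0 < c₁
  sob : ∀ t, (a t).SobBound r M
  sup : ∀ t, (a t).SupBound L
  lip : ∀ t t', (a t).Near (a t') (M' * |t - t'|)
  stable : ∀ t, (a t).Stable c₁

/-- Multiplication as a continuous linear map in the coefficient. -/
def mulSeqCL : C(Torus2, ℝ) →L[ℝ] (Seq →L[ℝ] Seq) :=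
  mulSeqL.mkContinuous 1 fun a => by rw [one_mul]; exact norm_mulSeq_le a

lemma mulSeqCL_apply (a : C(Torus2, ℝ)) : mulSeqCL a = mulSeq a := rfl

variable {r M M' L c₁ : ℝ} {a : ℝ → Fields}

lemma continuous_of_lip {b : ℝ → C(Torus2, ℝ)} (h : ∀ t t', ‖b t - b t'‖ ≤ M' * |t - t'|) :
    Continuous b := by
  refine LipschitzWith.continuous (K := M'.toNNReal) (LipschitzWith.of_dist_le_mul fun t t' => ?_)
  rw [dist_eq_norm, Real.dist_eq]
  refine (h t t').trans ?_
  gcongr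
  exact Real.le_coe_toNNReal M'

namespace Family

lemma continuous_W (ha : Family r M M' L c₁ a) (i : Fin 2) : Continuous fun t => (a t).W i :=
  continuous_of_lip fun t t' => (ha.lip t t').W i

lemma continuous_B (ha : Family r M M' L c₁ a) (m : Fin 3) (i : Fin 2) :
    Continuous fun t => (a t).B m i :=
  continuous_of_lip fun t t' => (ha.lip t t').B m i

lemma continuous_first (ha : Family r M M' L c₁ a) (i : Fin 2) :
    Continuous fun t => (a t).first i := by
  have := ha.continuous_W i
  unfold Fields.first
  fun_prop

lemma continuous_second (ha : Family r M M' L c₁ a) (i j : Fin 2) :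
    Continuous fun t => (a t).second i j := by
  have h1 := ha.continuous_W
  have h2 := ha.continuous_B
  unfold Fields.second
  exact ((h1 i).mul (h1 j)).neg.add
    (continuous_finsetSum _ fun m _ => ((h2 m i).mul (h2 m j)).const_smul (eps m))

lemma continuousOn_rhs (ha : Family r M M' L c₁ a) {s : Set ℝ} {q : ℝ → Fin 2 → Seq}
    {pp : ℝ → Fin 2 → Fin 2 → Seq} (hq : ∀ i, ContinuousOn (fun t => q t i) s)
    (hpp : ∀ i j, ContinuousOn (fun t => pp t i j) s) :
    ContinuousOn (fun t => (a t).coef.rhs (q t) (pp t)) s := by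
  simp only [Fields.rhs_eq, ← mulSeqCL_apply]
  refine (continuousOn_finsetSum _ fun i _ => ?_).add
    (continuousOn_finsetSum _ fun i _ => continuousOn_finsetSum _ fun j _ => ?_)
  · exact (mulSeqCL.continuous.comp (ha.continuous_first i)).continuousOn.clm_apply (hq i)
  · exact (mulSeqCL.continuous.comp (ha.continuous_second i j)).continuousOn.clm_apply (hpp i j)

end Family

/-- The right-hand side as an operator of the state. -/
def rhsOp (D : Fin 2 → Seq →L[ℝ] Seq) (b : Fields) : Seq × Seq →L[ℝ] Seq :=
  (∑ i, (mulSeqCL (b.first i) ∘L D i) ∘L snd ℝ Seq Seq) +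
    ∑ i, ∑ j, (mulSeqCL (b.second i j) ∘L D i ∘L D j) ∘L fst ℝ Seq Seq

lemma rhsOp_apply (D : Fin 2 → Seq →L[ℝ] Seq) (b : Fields) (x y : Seq) :
    rhsOp D b (x, y) = b.coef.rhs (grad D y) (hess D x) := by
  rw [Fields.rhs_eq]
  simp [rhsOp, grad, hess, mulSeqCL_apply]

lemma Family.exists_regularised (ha : Family r M M' L c₁ a) (D : Fin 2 → Seq →L[ℝ] Seq) {T : ℝ}
    (hT : 0 ≤ T) {G : ℝ → Seq} (hG : ContinuousOn G (Icc 0 T)) (x₀ y₀ : Seq) :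
    ∃ x y : ℝ → Seq, x 0 = x₀ ∧ y 0 = y₀ ∧
      (∀ t ∈ Icc 0 T, HasDerivWithinAt x (y t) (Icc 0 T) t) ∧
      ∀ t ∈ Icc 0 T, HasDerivWithinAt y
        ((a t).coef.rhs (grad D (y t)) (hess D (x t)) + G t) (Icc 0 T) t := by
  have h1 := ha.continuous_first
  have h2 := ha.continuous_second
  set G' : ℝ → Seq := IccExtend hT ((Icc 0 T).domRestrict G) with hG'
  have hGc : Continuous G' := hG.domRestrict.Icc_extend'
  set P : ℝ → ℝ := fun t => projIcc 0 T hT t with hP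
  have hPc : Continuous P := continuous_subtype_val.comp continuous_projIcc
  have hPeq : ∀ t ∈ Icc 0 T, P t = t := fun t ht => by rw [hP]; simp [projIcc_of_mem hT ht]
  set A : ℝ → (Seq × Seq →L[ℝ] Seq × Seq) := fun t =>
    (snd ℝ Seq Seq).prod (rhsOp D (a (P t))) with hA
  have hop : Continuous fun t => rhsOp D (a t) := by
    unfold rhsOp
    fun_prop
  have hAc : Continuous A := by
    have h3 : Continuous fun t => rhsOp D (a (P t)) := hop.comp hPc
    have h4 := (prodₗᵢ ℝ (E := Seq × Seq) (F := Seq) (G := Seq)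
      (𝕜 := ℝ)).continuous.comp
      ((continuous_const (y := snd ℝ Seq Seq)).prodMk h3)
    exact h4
  obtain ⟨K, hK⟩ : ∃ K, ∀ t, ‖A t‖ ≤ K := by
    have h5 : BddAbove ((fun t => ‖(snd ℝ Seq Seq).prod (rhsOp D (a t))‖) ''
        Icc 0 T) := by
      refine isCompact_Icc.bddAbove_image ?_
      have h4 := (prodₗᵢ ℝ (E := Seq × Seq) (F := Seq) (G := Seq)
        (𝕜 := ℝ)).continuous.comp
        ((continuous_const (y := snd ℝ Seq Seq)).prodMk hop)
      exact h4.norm.continuousOn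
    obtain ⟨K, hK⟩ := h5
    exact ⟨K, fun t => hK ⟨P t, (projIcc 0 T hT t).2, rfl⟩⟩
  obtain ⟨u, huc, hu⟩ := exists_linear_ode hAc hK (G := fun t => ((0 : Seq), G' t))
    (by fun_prop) (x₀, y₀) hT
  have hd : ∀ t ∈ Icc 0 T, HasDerivWithinAt u (A t (u t) + ((0 : Seq), G' t)) (Icc 0 T) t := by
    intro t ht
    exact hasDerivWithinAt_of_integral (F := fun t => A t (u t) + ((0 : Seq), G' t))
      ((hAc.continuousOn.clm_apply huc.continuousOn).add (by fun_prop)) hu ht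
  have hu0 : u 0 = (x₀, y₀) := by
    have := hu 0 ⟨le_rfl, hT⟩
    simpa using this
  refine ⟨fun t => (u t).1, fun t => (u t).2, congrArg Prod.fst hu0, congrArg Prod.snd hu0, fun t ht => ?_,
    fun t ht => ?_⟩
  · have := (fst ℝ Seq Seq).hasFDerivAt.comp_hasDerivWithinAt t (hd t ht)
    convert! this using 1
    simp [hA]
  · have := (snd ℝ Seq Seq).hasFDerivAt.comp_hasDerivWithinAt t (hd t ht)
    convert! this using 1
    rw [← rhsOp_apply]
    simp [hA, hPeq t ht, hG', IccExtend_of_mem _ _ ht]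

/-! ### Commutation with the weight -/

/-- The constant in the commutation of the weight with the right-hand side. -/
def remConst (r M : ℝ) : ℝ :=
  4 * (commConst r * M) + 12 * (commConst r * (2 * 2 ^ r * wroot * M * M))

lemma remConst_nonneg (hr : 5 / 2 ≤ r) (hM : 0 ≤ M) : 0 ≤ remConst r M := by
  have := commConst_nonneg hr
  have := wroot_nonneg
  unfold remConst
  positivity

lemma norm_comm_first_le (hr : 5 / 2 ≤ r) (hM : 0 ≤ M) {b : Fields} (hb : b.SobBound r M) {n : ℝ}
    (hn : 1 ≤ n) (i : Fin 2) (u : Seq) :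
    ‖lamOp r n (mulSeq (b.first i) (vOp (r - 1) u)) - mulSeq (b.first i) (lamOp r n (vOp (r - 1) u))‖
      ≤ 2 * (commConst r * M) * ‖u‖ := by
  have h := norm_comm_lamOp_le hr hM (hb.W i) hn u
  have e : lamOp r n (mulSeq (b.first i) (vOp (r - 1) u))
      - mulSeq (b.first i) (lamOp r n (vOp (r - 1) u)) = (-2 : ℝ) •
      (lamOp r n (mulSeq (b.W i) (vOp (r - 1) u)) - mulSeq (b.W i) (lamOp r n (vOp (r - 1) u))) := by
    simp only [Fields.first, mulSeq_smul, smul_apply, map_smul, smul_sub]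
  rw [e, norm_smul]
  norm_num
  linarith

lemma norm_comm_second_le (hr : 5 / 2 ≤ r) (hM : 0 ≤ M) {b : Fields} (hb : b.SobBound r M) {n : ℝ}
    (hn : 1 ≤ n) (i j : Fin 2) (u : Seq) :
    ‖lamOp r n (mulSeq (b.second i j) (vOp (r - 1) u))
      - mulSeq (b.second i j) (lamOp r n (vOp (r - 1) u))‖
      ≤ 3 * (commConst r * (2 * 2 ^ r * wroot * M * M)) * ‖u‖ := by
  have hw := wroot_nonneg
  have hMM : 0 ≤ 2 * 2 ^ r * wroot * M * M := by positivity
  set K := commConst r * (2 * 2 ^ r * wroot * M * M) * ‖u‖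
  have h0 := norm_comm_lamOp_le hr hMM (hsq_mul_le hr hM (hb.W i) (hb.W j)) hn u
  have h1 := fun m => norm_comm_lamOp_le hr hMM (hsq_mul_le hr hM (hb.B m i) (hb.B m j)) hn u
  set X : C(Torus2, ℝ) → Seq := fun f =>
    lamOp r n (mulSeq f (vOp (r - 1) u)) - mulSeq f (lamOp r n (vOp (r - 1) u)) with hX
  have hadd : ∀ f g, X (f + g) = X f + X g := fun f g => by
    simp only [hX, mulSeq_add, add_apply, map_add]; abel
  have hsmul : ∀ (c : ℝ) f, X (c • f) = c • X f := fun c f => by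
    simp only [hX, mulSeq_smul, smul_apply, map_smul, smul_sub]
  have e : X (b.second i j) = (-1 : ℝ) • X (b.W i * b.W j) + (eps 0 • X (b.B 0 i * b.B 0 j) +
      eps 1 • X (b.B 1 i * b.B 1 j) + eps 2 • X (b.B 2 i * b.B 2 j)) := by
    rw [← hsmul, ← hsmul, ← hsmul, ← hsmul, ← hadd, ← hadd, ← hadd, Fields.second,
      sum_univ_three]
    congr 2
    simp
  change ‖X _‖ ≤ _
  rw [e]
  have a0 : ‖(-1 : ℝ) • X (b.W i * b.W j)‖ ≤ K := by
    rw [norm_smul]; norm_num; exact h0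
  have a1 : ‖eps 0 • X (b.B 0 i * b.B 0 j)‖ ≤ K := by
    rw [norm_smul]; simp [eps]; exact h1 0
  have a2 : ‖eps 1 • X (b.B 1 i * b.B 1 j)‖ ≤ 1 / 2 * K := by
    rw [norm_smul]; simp [eps]; exact h1 1
  have a3 : ‖eps 2 • X (b.B 2 i * b.B 2 j)‖ ≤ 1 / 2 * K := by
    rw [norm_smul]; simp [eps]; exact h1 2
  have s1 := norm_add_le ((-1 : ℝ) • X (b.W i * b.W j)) (eps 0 • X (b.B 0 i * b.B 0 j) +
      eps 1 • X (b.B 1 i * b.B 1 j) + eps 2 • X (b.B 2 i * b.B 2 j))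
  have s2 := norm_add_le (eps 0 • X (b.B 0 i * b.B 0 j) +
      eps 1 • X (b.B 1 i * b.B 1 j)) (eps 2 • X (b.B 2 i * b.B 2 j))
  have s3 := norm_add_le (eps 0 • X (b.B 0 i * b.B 0 j)) (eps 1 • X (b.B 1 i * b.B 1 j))
  linarith

/-- Commutation of the weight with the right-hand side. -/
lemma norm_comm_rhs_le (hr : 5 / 2 ≤ r) (hM : 0 ≤ M) {b : Fields} (hb : b.SobBound r M) {n : ℝ}
    (hn : 1 ≤ n) {q : Fin 2 → Seq} {pp : Fin 2 → Fin 2 → Seq} {X Y : ℝ}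
    (hq : ∀ i, ∃ u, q i = vOp (r - 1) u ∧ ‖u‖ ≤ Y)
    (hpp : ∀ i j, ∃ u, pp i j = vOp (r - 1) u ∧ ‖u‖ ≤ X) :
    ‖lamOp r n (b.coef.rhs q pp)
      - b.coef.rhs (fun i => lamOp r n (q i)) (fun i j => lamOp r n (pp i j))‖ ≤
      remConst r M * (Y + X) := by
  have hcc := commConst_nonneg hr
  have hw := wroot_nonneg
  have h1 : ∀ i, ‖lamOp r n (mulSeq (b.first i) (q i)) - mulSeq (b.first i) (lamOp r n (q i))‖ ≤
      2 * (commConst r * M) * Y := by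
    intro i
    obtain ⟨u, e, hu⟩ := hq i
    rw [e]
    refine (norm_comm_first_le hr hM hb hn i u).trans ?_
    gcongr
  have h2 : ∀ i j, ‖lamOp r n (mulSeq (b.second i j) (pp i j))
      - mulSeq (b.second i j) (lamOp r n (pp i j))‖ ≤
      3 * (commConst r * (2 * 2 ^ r * wroot * M * M)) * X := by
    intro i j
    obtain ⟨u, e, hu⟩ := hpp i j
    rw [e]
    refine (norm_comm_second_le hr hM hb hn i j u).trans ?_
    gcongr
  have hX : 0 ≤ X := by obtain ⟨u, -, hu⟩ := hpp 0 0; exact (norm_nonneg _).trans hu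
  have hY : 0 ≤ Y := by obtain ⟨u, -, hu⟩ := hq 0; exact (norm_nonneg _).trans hu
  rw [Fields.rhs_eq, Fields.rhs_eq, map_add, map_sum, map_sum]
  simp only [map_sum]
  rw [add_sub_add_comm, ← sum_sub_distrib, ← sum_sub_distrib]
  simp only [← sum_sub_distrib]
  refine (norm_add_le _ _).trans ?_
  have g1 := norm_sum_le Finset.univ fun i => lamOp r n (mulSeq (b.first i) (q i)) -
    mulSeq (b.first i) (lamOp r n (q i))
  have g2 : ‖∑ i, ∑ j, (lamOp r n (mulSeq (b.second i j) (pp i j))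
      - mulSeq (b.second i j) (lamOp r n (pp i j)))‖ ≤ ∑ i : Fin 2, ∑ j : Fin 2,
        3 * (commConst r * (2 * 2 ^ r * wroot * M * M)) * X :=
    (norm_sum_le _ _).trans (sum_le_sum fun i _ =>
      (norm_sum_le _ _).trans (sum_le_sum fun j _ => h2 i j))
  have g3 := g1.trans (sum_le_sum fun i _ => h1 i)
  simp only [Finset.sum_const, Finset.card_univ, Fintype.card_fin] at g2 g3
  have p1 : 0 ≤ commConst r * M * X := by positivity
  have p2 : 0 ≤ commConst r * (2 * 2 ^ r * wroot * M * M) * Y := by positivity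
  unfold remConst
  simp only [nsmul_eq_mul] at g2 g3
  push_cast at g2 g3
  nlinarith

end

section

/-! ### Uniform bounds for the regularised problem -/

/-- Solutions of the system with derivations `D` and source `G`. -/
structure Solves (a : ℝ → Fields) (D : Fin 2 → Seq →L[ℝ] Seq) (T : ℝ) (G x y : ℝ → Seq) :
    Prop where
  dx : ∀ t ∈ Icc 0 T, HasDerivWithinAt x (y t) (Icc 0 T) t
  dy : ∀ t ∈ Icc 0 T, HasDerivWithinAt y
    ((a t).coef.rhs (grad D (y t)) (hess D (x t)) + G t) (Icc 0 T) t

variable {r M M' L c₁ T : ℝ} {a : ℝ → Fields} {D : Fin 2 → Seq →L[ℝ] Seq} {G x y : ℝ → Seq}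

lemma Solves.cx (h : Solves a D T G x y) : ContinuousOn x (Icc 0 T) :=
  fun t ht => (h.dx t ht).continuousWithinAt

lemma Solves.cy (h : Solves a D T G x y) : ContinuousOn y (Icc 0 T) :=
  fun t ht => (h.dy t ht).continuousWithinAt

lemma jap_mul_dsym_le {N : ℝ} (hN : 1 ≤ N) (hr : 0 ≤ r) (i : Fin 2) (k : Freq) :
    jap k ^ (r - 1) * |dsym N i k| ≤ trunc N k ^ r := by
  have hj := jap_pos k
  by_cases hk : N ≤ jap k
  · rw [dsym_eq_zero hN i hk, abs_zero, mul_zero]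
    exact Real.rpow_nonneg (trunc_pos hN k).le _
  · rw [trunc, min_eq_left (by linarith)]
    calc _ ≤ jap k ^ (r - 1) * jap k := by gcongr; exact abs_dsym_le_jap N i k
      _ = _ := by rw [← rpow_add_one hj.ne']; congr 1; ring

lemma exists_dOp_eq {N : ℝ} (hN : 1 ≤ N) (hr : 1 ≤ r) (i : Fin 2) (z : Seq) :
    ∃ u, dOp N i z = vOp (r - 1) u ∧ ‖u‖ ≤ ‖lamOp r N z‖ := by
  have hr0 : 0 ≤ r := by linarith
  have hb : IsBdd fun k => ((jap k ^ (r - 1) * dsym N i k : ℝ) : ℂ) * I := ⟨N ^ r, fun k => by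
    have hj := jap_pos k
    rw [norm_mul, norm_I, mul_one, norm_real, norm_eq_abs, abs_mul,
      abs_of_pos (by positivity)]
    refine (jap_mul_dsym_le hN hr0 i k).trans ?_
    gcongr
    · exact (trunc_pos hN k).le
    · exact trunc_le N k⟩
  refine ⟨diag (fun k => ((jap k ^ (r - 1) * dsym N i k : ℝ) : ℂ) * I) z, ?_, ?_⟩
  · ext k
    have hj := jap_pos k
    rw [dOp_apply hN, vOp_apply (by linarith), diag_apply hb]
    have : jap k ^ (-(r - 1)) * jap k ^ (r - 1) = 1 := by
      rw [← rpow_add hj]; simp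
    have h2 : ((jap k ^ (-(r - 1)) : ℝ) : ℂ) * ((jap k ^ (r - 1) : ℝ) : ℂ) = 1 := by
      rw [← Complex.ofReal_mul, this, Complex.ofReal_one]
    push_cast at h2 ⊢
    linear_combination (-(dsym N i k : ℂ) * I * z k) * h2
  · have := Seq.norm_le_mul (x := diag (fun k => ((jap k ^ (r - 1) * dsym N i k : ℝ) : ℂ) * I) z)
      (y := lamOp r N z) zero_le_one fun k => ?_
    · simpa using this
    · have hj := jap_pos k
      rw [diag_apply hb, norm_lamOp_apply hr0 hN, norm_mul, norm_mul, norm_I, mul_one,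
        norm_real, norm_eq_abs, abs_mul, abs_of_pos (by positivity), one_mul]
      gcongr
      exact jap_mul_dsym_le hN hr0 i k

lemma lamOp_dOp {N n : ℝ} (hN : 1 ≤ N) (hn : 1 ≤ n) (hr : 0 ≤ r) (i : Fin 2) (z : Seq) :
    lamOp r n (dOp N i z) = dOp N i (lamOp r n z) := diag_comm (isBdd_lam hr hn) (isBdd_dsym hN i) z

lemma norm_lamOp_vOp_le {n : ℝ} (hn : 1 ≤ n) (hr : 0 ≤ r) (z : Seq) :
    ‖lamOp r n (vOp r z)‖ ≤ ‖z‖ := by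
  have := Seq.norm_le_mul (x := lamOp r n (vOp r z)) (y := z) zero_le_one fun k => ?_
  · simpa using this
  · have hj := jap_pos k
    rw [norm_lamOp_apply hr hn, norm_vOp_apply hr, ← mul_assoc]
    gcongr
    calc _ ≤ jap k ^ r * jap k ^ (-r) := by
          gcongr
          · exact (trunc_pos hn k).le
          · exact trunc_le_jap n k
      _ = 1 := by rw [← rpow_add hj]; simp

/-- The growth rate of the energy. -/
def growth (r M M' c₁ : ℝ) : ℝ :=
  (slopeConst (opConst M) M' + 8 * remConst r M ^ 2) * coerConst c₁ (opConst M)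

/-- The weighted size of a regularised state. -/
def regSize (r N : ℝ) (x y : Seq) : ℝ :=
  sizeSq (grad (dOp N) (lamOp r N x)) (lamOp r N x) (lamOp r N y)

lemma Family.continuousOn_rhs_grad (ha : Family r M M' L c₁ a) (D : Fin 2 → Seq →L[ℝ] Seq)
    {s : Set ℝ} (hx : ContinuousOn x s) (hy : ContinuousOn y s) :
    ContinuousOn (fun t => (a t).coef.rhs (grad D (y t)) (hess D (x t))) s := by
  refine ha.continuousOn_rhs (fun i => ?_) fun i j => ?_
  · exact (D i).continuous.comp_continuousOn hy
  · exact ((D i).continuous.comp (D j).continuous).comp_continuousOn hx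

lemma Family.regSize_le (ha : Family r M M' L c₁ a) {N : ℝ} (hN : 1 ≤ N) {g : ℝ → Seq}
    (hg : ContinuousOn g (Icc 0 T)) (h : Solves a (dOp N) T (fun t => vOp r (g t)) x y)
    {t : ℝ} (ht : t ∈ Icc 0 T) :
    regSize r N (x t) (y t) ≤ coerConst c₁ L *
      (10 * (1 + L) ^ 2 * regSize r N (x 0) (y 0) + ∫ τ in (0 : ℝ)..t, 2 * ‖g τ‖ ^ 2) *
        exp (growth r M M' c₁ * t) := by
  have hr := ha.hr
  have hr0 : 0 ≤ r := by linarith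
  set Λ := lamOp r N
  set R : ℝ → Seq := fun t => Λ ((a t).coef.rhs (grad (dOp N) (y t)) (hess (dOp N) (x t)))
    - (a t).coef.rhs (grad (dOp N) (Λ (y t))) (hess (dOp N) (Λ (x t))) + Λ (vOp r (g t)) with hR
  have hΛx : ContinuousOn (fun t => Λ (x t)) (Icc 0 T) := Λ.continuous.comp_continuousOn h.cx
  have hΛy : ContinuousOn (fun t => Λ (y t)) (Icc 0 T) := Λ.continuous.comp_continuousOn h.cy
  have hRc : ContinuousOn R (Icc 0 T) := by
    refine ((Λ.continuous.comp_continuousOn (ha.continuousOn_rhs_grad _ h.cx h.cy)).sub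
      (ha.continuousOn_rhs_grad _ hΛx hΛy)).add ?_
    exact (Λ.continuous.comp (vOp r).continuous).comp_continuousOn hg
  refine sizeSq_le_of_energy (opConst_nonneg ha.hM) ha.hM'
    (fun t => (ha.sob t).coef hr ha.hM hN) (fun t t' => (ha.lip t t').coef) ha.hc₁ ha.hL
    (fun t => (ha.sup t).coef) (fun t => ((ha.sob t).sup hr ha.hM).coef)
    (fun t p => (ha.stable t).le_contract p) (x := fun t => Λ (x t)) (y := fun t => Λ (y t))
    hRc (fun t ht => Λ.hasFDerivAt.comp_hasDerivWithinAt t (h.dx t ht)) (fun t ht => ?_)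
    (κ := 8 * remConst r M ^ 2) (by positivity) (g := fun t => 2 * ‖g t‖ ^ 2) (by fun_prop)
    (fun t _ => by positivity) (fun t _ => ?_) ht
  · have := Λ.hasFDerivAt.comp_hasDerivWithinAt t (h.dy t ht)
    convert! this using 1
    simp only [hR, map_add]
    abel
  · have hΛg := norm_lamOp_vOp_le hN hr0 (g t)
    have hcomm := norm_comm_rhs_le hr ha.hM (ha.sob t) hN (q := grad (dOp N) (y t))
      (pp := hess (dOp N) (x t)) (Y := ‖Λ (y t)‖)
      (X := ‖dOp N 0 (Λ (x t))‖ + ‖dOp N 1 (Λ (x t))‖)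
      (fun i => exists_dOp_eq hN (by linarith) i _) (fun i j => by
        obtain ⟨u, e, hu⟩ := exists_dOp_eq (r := r) hN (by linarith) i (dOp N j (x t))
        refine ⟨u, e, hu.trans ?_⟩
        rw [lamOp_dOp hN hN hr0]
        fin_cases j
        · exact le_add_of_nonneg_right (norm_nonneg _)
        · exact le_add_of_nonneg_left (norm_nonneg _))
    have e1 : (fun i => lamOp r N (grad (dOp N) (y t) i)) = grad (dOp N) (Λ (y t)) := by
      funext i; exact lamOp_dOp hN hN hr0 _ _
    have e2 : (fun i j => lamOp r N (hess (dOp N) (x t) i j)) = hess (dOp N) (Λ (x t)) := by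
      funext i j
      simp only [hess]
      rw [lamOp_dOp hN hN hr0, lamOp_dOp hN hN hr0]
    rw [e1, e2] at hcomm
    have hn := norm_pair_le (grad (dOp N) (Λ (x t)))
    simp only [grad] at hn
    set n := ‖dOp N 0 (Λ (x t))‖ + ‖dOp N 1 (Λ (x t))‖
    have hR1 : ‖R t‖ ≤ remConst r M * (‖Λ (y t)‖ + n) + ‖g t‖ :=
      (norm_add_le _ _).trans (add_le_add hcomm hΛg)
    have hk := remConst_nonneg hr ha.hM
    set k := remConst r M
    have hS : 2 * ‖Λ (y t)‖ ^ 2 + n ^ 2 ≤ 2 * sizeSq (grad (dOp N) (Λ (x t))) (Λ (x t)) (Λ (y t)) := by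
      simp only [sizeSq, grad]
      nlinarith [sq_nonneg ‖Λ (x t)‖]
    have h1 := pow_le_pow_left₀ (norm_nonneg _) hR1 2
    have h2 : (‖Λ (y t)‖ + n) ^ 2 ≤ 4 * sizeSq (grad (dOp N) (Λ (x t))) (Λ (x t)) (Λ (y t)) := by
      nlinarith [sq_nonneg (‖Λ (y t)‖ - n), sq_nonneg ‖Λ (y t)‖]
    have h3 := mul_le_mul_of_nonneg_left h2 (sq_nonneg k)
    nlinarith [sq_nonneg (k * (‖Λ (y t)‖ + n) - ‖g t‖)]

lemma Seq.norm_sq_add_three_le {u v w z : Seq}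
    (h : ∀ k, ‖u k‖ ^ 2 + (‖v k‖ ^ 2 + ‖w k‖ ^ 2) ≤ ‖z k‖ ^ 2) :
    ‖u‖ ^ 2 + (‖v‖ ^ 2 + ‖w‖ ^ 2) ≤ ‖z‖ ^ 2 := by
  rw [Seq.norm_sq, Seq.norm_sq, Seq.norm_sq, Seq.norm_sq,
    ← v.summable_sq.tsum_add w.summable_sq,
    ← u.summable_sq.tsum_add (v.summable_sq.add w.summable_sq)]
  exact (u.summable_sq.add (v.summable_sq.add w.summable_sq)).tsum_le_tsum h z.summable_sq

lemma regSize_vOp_le {N : ℝ} (hN : 1 ≤ N) (hr : 0 ≤ r) (Φ Θ : Seq) :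
    regSize r N (vOp (r + 1) Φ) (vOp r Θ) ≤ ‖Φ‖ ^ 2 + ‖Θ‖ ^ 2 := by
  have h1 := Seq.norm_sq_add_three_le (u := lamOp r N (vOp (r + 1) Φ))
    (v := dOp N 0 (lamOp r N (vOp (r + 1) Φ))) (w := dOp N 1 (lamOp r N (vOp (r + 1) Φ)))
    (z := Φ) fun k => by
      have hj := jap_pos k
      have ht := trunc_pos hN k
      rw [norm_dOp_apply hN, norm_dOp_apply hN, norm_lamOp_apply hr hN,
        norm_vOp_apply (by linarith)]
      have e : jap k ^ (-(r + 1)) = jap k ^ (-r) * (jap k)⁻¹ := by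
        rw [show -(r + 1) = -r - 1 by ring, Real.rpow_sub_one hj.ne', div_eq_mul_inv]
      have h2 : trunc N k ^ r * jap k ^ (-r) ≤ 1 := by
        calc _ ≤ jap k ^ r * jap k ^ (-r) := by gcongr; exact trunc_le_jap N k
          _ = 1 := by rw [← rpow_add hj]; simp
      have h3 : 1 + (dsym N 0 k ^ 2 + dsym N 1 k ^ 2) ≤ jap k ^ 2 := by
        have h4 : ∀ i, dsym N i k ^ 2 ≤ xi i k ^ 2 := fun i => by
          rw [dsym, mul_pow]
          have := pow_le_one₀ (n := 2) (cutoff_nonneg N k) (cutoff_le_one N k)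
          nlinarith [sq_nonneg (xi i k)]
        rw [jap_sq, sum_univ_two]
        linarith [h4 0, h4 1]
      rw [e]
      simp only [mul_pow, sq_abs]
      have h5 : (trunc N k ^ r) ^ 2 * (jap k ^ (-r)) ^ 2 ≤ 1 := by
        rw [← mul_pow]; exact pow_le_one₀ (by positivity) h2
      have h6 : (1 + (dsym N 0 k ^ 2 + dsym N 1 k ^ 2)) * (jap k)⁻¹ ^ 2 ≤ 1 := by
        rw [inv_pow, ← div_eq_mul_inv, div_le_one (by positivity)]; exact h3
      calc _ = ((trunc N k ^ r) ^ 2 * (jap k ^ (-r)) ^ 2) *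
            ((1 + (dsym N 0 k ^ 2 + dsym N 1 k ^ 2)) * (jap k)⁻¹ ^ 2) * ‖Φ k‖ ^ 2 := by ring
        _ ≤ 1 * 1 * ‖Φ k‖ ^ 2 := by gcongr
        _ = _ := by ring
  have h2 := pow_le_pow_left₀ (norm_nonneg _) (norm_lamOp_vOp_le hN hr Θ) 2
  simp only [regSize, sizeSq, grad]
  linarith

/-! ### Convergence of the regularised solutions -/

lemma cutoff_mono {N N' : ℝ} (hN : 0 < N) (h : N ≤ N') (k : Freq) : cutoff N k ≤ cutoff N' k := by
  have hj := jap_pos k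
  unfold cutoff
  gcongr

lemma jap_le_rpow_mul {N : ℝ} (hN : 1 ≤ N) (hr : 1 ≤ r) {k : Freq} (hk : N / 2 ≤ jap k) :
    jap k ≤ (N / 2) ^ (1 - r) * jap k ^ r := by
  have hj := jap_pos k
  calc jap k = jap k ^ (1 - r) * jap k ^ r := by rw [← rpow_add hj]; simp
    _ ≤ _ := by
      gcongr ?_ * _
      exact Real.rpow_le_rpow_of_nonpos (by positivity) hk (by linarith)

lemma abs_dsym_sub_dsym_le {N N' : ℝ} (hN : 1 ≤ N) (h : N ≤ N') (hr : 1 ≤ r) (i : Fin 2) (k : Freq) :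
    |dsym N' i k - dsym N i k| ≤ (N / 2) ^ (1 - r) * trunc N' k ^ r := by
  have hN' : 1 ≤ N' := hN.trans h
  have hj := jap_pos k
  have ht := trunc_pos hN' k
  by_cases h1 : jap k ≤ N / 2
  · rw [dsym_eq hN i h1, dsym_eq hN' i (by linarith), sub_self, abs_zero]
    positivity
  by_cases h2 : N' ≤ jap k
  · rw [dsym_eq_zero hN' i h2, dsym_eq_zero hN i (h.trans h2), sub_self, abs_zero]
    positivity
  rw [trunc, min_eq_left (by linarith)]
  refine le_trans ?_ (jap_le_rpow_mul hN hr (by linarith))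
  rw [dsym, dsym, ← mul_sub, abs_mul, abs_of_nonneg (sub_nonneg.2 (cutoff_mono (by linarith) h k))]
  have := cutoff_nonneg N k
  have := cutoff_le_one N' k
  calc _ ≤ jap k * 1 := by
        gcongr
        · exact sub_nonneg.2 (cutoff_mono (by linarith) h k)
        · exact abs_xi_le i k
        · linarith
    _ = _ := mul_one _

lemma abs_dsym_mul_sub_le {N N' : ℝ} (hN : 1 ≤ N) (h : N ≤ N') (hr : 1 ≤ r) (i j : Fin 2) (k : Freq) :
    |dsym N' i k * dsym N' j k - dsym N i k * dsym N j k| ≤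
      (N / 2) ^ (1 - r) * trunc N' k ^ r * |dsym N' j k| := by
  have hN' : 1 ≤ N' := hN.trans h
  have hj := jap_pos k
  have ht := trunc_pos hN' k
  by_cases h1 : jap k ≤ N / 2
  · rw [dsym_eq hN i h1, dsym_eq hN' i (by linarith), dsym_eq hN j h1, dsym_eq hN' j (by linarith),
      sub_self, abs_zero]
    positivity
  by_cases h2 : N' ≤ jap k
  · rw [dsym_eq_zero hN' i h2, dsym_eq_zero hN i (h.trans h2)]
    simp only [zero_mul, sub_self, abs_zero]
    positivity
  have hc := cutoff_mono (by linarith) h k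
  have hc0 := cutoff_nonneg N k
  have hc1 := cutoff_le_one N' k
  have e : dsym N' i k * dsym N' j k - dsym N i k * dsym N j k =
      xi i k * xi j k * (cutoff N' k ^ 2 - cutoff N k ^ 2) := by simp only [dsym]; ring
  rw [trunc, min_eq_left (by linarith), e, abs_mul, abs_mul,
    abs_of_nonneg (a := cutoff N' k ^ 2 - cutoff N k ^ 2) (by nlinarith), dsym, abs_mul,
    abs_of_nonneg (hc0.trans hc)]
  have h3 := jap_le_rpow_mul hN hr (k := k) (by linarith)
  calc |xi i k| * |xi j k| * (cutoff N' k ^ 2 - cutoff N k ^ 2)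
      ≤ jap k * |xi j k| * cutoff N' k := by
        gcongr
        · nlinarith
        · exact abs_xi_le i k
        · nlinarith
    _ ≤ ((N / 2) ^ (1 - r) * jap k ^ r) * |xi j k| * cutoff N' k := by
        gcongr
        exact hc0.trans hc
    _ = _ := by ring

lemma norm_dOp_sub_le {N N' : ℝ} (hN : 1 ≤ N) (h : N ≤ N') (hr : 1 ≤ r) (i : Fin 2) (z : Seq) :
    ‖dOp N' i z - dOp N i z‖ ≤ (N / 2) ^ (1 - r) * ‖lamOp r N' z‖ := by
  have hN' : 1 ≤ N' := hN.trans h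
  refine Seq.norm_le_mul (by positivity) fun k => ?_
  rw [lp.coeFn_sub, Pi.sub_apply, dOp_apply hN', dOp_apply hN, norm_lamOp_apply (by linarith) hN',
    ← sub_mul, ← sub_mul, norm_mul, norm_mul, norm_I, mul_one, ← Complex.ofReal_sub,
    norm_real, ← mul_assoc]
  gcongr
  exact abs_dsym_sub_dsym_le hN h hr i k

lemma norm_dOp_dOp_sub_le {N N' : ℝ} (hN : 1 ≤ N) (h : N ≤ N') (hr : 1 ≤ r) (i j : Fin 2)
    (z : Seq) : ‖dOp N' i (dOp N' j z) - dOp N i (dOp N j z)‖ ≤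
      (N / 2) ^ (1 - r) * ‖dOp N' j (lamOp r N' z)‖ := by
  have hN' : 1 ≤ N' := hN.trans h
  refine Seq.norm_le_mul (by positivity) fun k => ?_
  rw [lp.coeFn_sub, Pi.sub_apply, dOp_apply hN', dOp_apply hN', dOp_apply hN, dOp_apply hN,
    norm_dOp_apply hN', norm_lamOp_apply (by linarith) hN']
  have e : (dsym N' i k : ℂ) * I * ((dsym N' j k : ℂ) * I * z k) -
      (dsym N i k : ℂ) * I * ((dsym N j k : ℂ) * I * z k) =
      -(((dsym N' i k * dsym N' j k - dsym N i k * dsym N j k : ℝ) : ℂ) * z k) := by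
    push_cast
    linear_combination ((dsym N' i k : ℂ) * dsym N' j k * z k -
      (dsym N i k : ℂ) * dsym N j k * z k) * I_sq
  rw [e, norm_neg, norm_mul, norm_real, norm_eq_abs]
  calc _ ≤ ((N / 2) ^ (1 - r) * trunc N' k ^ r * |dsym N' j k|) * ‖z k‖ := by
        gcongr; exact abs_dsym_mul_sub_le hN h hr i j k
    _ = _ := by ring

/-- The norm of the right-hand side operator. -/
def rhsConst (L : ℝ) : ℝ := 4 * L + 12 * L ^ 2

lemma norm_rhs_le {b : Fields} (hL : 0 ≤ L) (hb : b.SupBound L) {q : Fin 2 → Seq}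
    {pp : Fin 2 → Fin 2 → Seq} {X Y : ℝ} (hq : ∀ i, ‖q i‖ ≤ Y) (hpp : ∀ i j, ‖pp i j‖ ≤ X) :
    ‖b.coef.rhs q pp‖ ≤ rhsConst L * (Y + X) := by
  have hX : 0 ≤ X := (norm_nonneg _).trans (hpp 0 0)
  have hY : 0 ≤ Y := (norm_nonneg _).trans (hq 0)
  have h1 : ∀ i, ‖mulSeq (b.first i) (q i)‖ ≤ 2 * L * Y := fun i => by
    refine (norm_mulSeq_apply_le _ _).trans ?_
    gcongr
    · rw [Fields.first, norm_smul]; norm_num; exact hb.W i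
    · exact hq i
  have hs : ∀ i j, ‖b.second i j‖ ≤ 3 * L ^ 2 := fun i j => by
    have hm : ∀ f g : C(Torus2, ℝ), ‖f‖ ≤ L → ‖g‖ ≤ L → ‖f * g‖ ≤ L ^ 2 := fun f g hf hg => by
      refine (norm_mul_le _ _).trans ?_
      rw [sq]; gcongr
    have a0 := hm _ _ (hb.W i) (hb.W j)
    have a1 := fun m => hm _ _ (hb.B m i) (hb.B m j)
    rw [Fields.second, sum_univ_three]
    have b0 : ‖eps 0 • (b.B 0 i * b.B 0 j)‖ ≤ L ^ 2 := by
      rw [norm_smul]; simp [eps]; exact a1 0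
    have b1 : ‖eps 1 • (b.B 1 i * b.B 1 j)‖ ≤ 1 / 2 * L ^ 2 := by
      rw [norm_smul]; simp [eps]; exact a1 1
    have b2 : ‖eps 2 • (b.B 2 i * b.B 2 j)‖ ≤ 1 / 2 * L ^ 2 := by
      rw [norm_smul]; simp [eps]; exact a1 2
    have s1 := norm_add_le (-(b.W i * b.W j)) (eps 0 • (b.B 0 i * b.B 0 j) +
      eps 1 • (b.B 1 i * b.B 1 j) + eps 2 • (b.B 2 i * b.B 2 j))
    have s2 := norm_add_le (eps 0 • (b.B 0 i * b.B 0 j) +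
      eps 1 • (b.B 1 i * b.B 1 j)) (eps 2 • (b.B 2 i * b.B 2 j))
    have s3 := norm_add_le (eps 0 • (b.B 0 i * b.B 0 j)) (eps 1 • (b.B 1 i * b.B 1 j))
    rw [norm_neg] at s1
    linarith
  have h2 : ∀ i j, ‖mulSeq (b.second i j) (pp i j)‖ ≤ 3 * L ^ 2 * X := fun i j => by
    refine (norm_mulSeq_apply_le _ _).trans ?_
    gcongr
    · exact hs i j
    · exact hpp i j
  rw [Fields.rhs_eq]
  simp only [sum_univ_two]
  have n1 := norm_add_le (mulSeq (b.first 0) (q 0)) (mulSeq (b.first 1) (q 1))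
  have n2 := norm_add_le (mulSeq (b.second 0 0) (pp 0 0)) (mulSeq (b.second 0 1) (pp 0 1))
  have n3 := norm_add_le (mulSeq (b.second 1 0) (pp 1 0)) (mulSeq (b.second 1 1) (pp 1 1))
  refine (norm_add_le _ _).trans ?_
  have n4 := norm_add_le (mulSeq (b.second 0 0) (pp 0 0) + mulSeq (b.second 0 1) (pp 0 1))
    (mulSeq (b.second 1 0) (pp 1 0) + mulSeq (b.second 1 1) (pp 1 1))
  have := h1 0
  have := h1 1
  have := h2 0 0
  have := h2 0 1
  have := h2 1 0
  have := h2 1 1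
  have p1 : 0 ≤ L * X := by positivity
  have p2 : 0 ≤ L ^ 2 * Y := by positivity
  unfold rhsConst
  nlinarith

lemma rhs_sub (c : Coef Seq) (q q' : Fin 2 → Seq) (pp pp' : Fin 2 → Fin 2 → Seq) :
    c.rhs q pp - c.rhs q' pp' = c.rhs (q - q') (pp - pp') := by
  simp only [Coef.rhs, contract, Pi.sub_apply, map_sub, sum_sub_distrib, smul_sub]
  abel

/-- A stability estimate for the regularised system at the lowest level of regularity. -/
lemma Family.norm_sq_le_of_small (ha : Family r M M' L c₁ a) {N : ℝ} (hN : 1 ≤ N)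
    (h : Solves a (dOp N) T G x y) (hG : ContinuousOn G (Icc 0 T)) {δ : ℝ}
    (hδ : ∀ t ∈ Icc 0 T, ‖G t‖ ≤ δ) (hx0 : x 0 = 0) (hy0 : y 0 = 0) {t : ℝ} (ht : t ∈ Icc 0 T) :
    ‖x t‖ ^ 2 + ‖y t‖ ^ 2 ≤ coerConst c₁ L * (T * δ ^ 2) *
      exp (slopeConst (opConst M) M' * coerConst c₁ (opConst M) * T) := by
  have hr := ha.hr
  have hT : 0 ≤ T := ht.1.trans ht.2
  have h1 := sizeSq_le_of_energy (opConst_nonneg ha.hM) ha.hM'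
    (fun t => (ha.sob t).coef hr ha.hM hN) (fun t t' => (ha.lip t t').coef) ha.hc₁ ha.hL
    (fun t => (ha.sup t).coef) (fun t => ((ha.sob t).sup hr ha.hM).coef)
    (fun t p => (ha.stable t).le_contract p) hG h.dx h.dy (κ := 0) le_rfl (g := fun _ => δ ^ 2)
    continuousOn_const (fun _ _ => by positivity) (fun t ht => by
      rw [zero_mul, zero_add]
      exact pow_le_pow_left₀ (norm_nonneg _) (hδ t ht) 2) ht
  have hC := coerConst_pos (L := L) ha.hc₁
  have hC' := coerConst_pos (L := opConst M) ha.hc₁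
  have hs := slopeConst_nonneg (opConst_nonneg ha.hM) ha.hM'
  have e : sizeSq (grad (dOp N) (x 0)) (x 0) (y 0) = 0 := by
    rw [hx0, hy0]; simp [sizeSq, grad]
  have e2 : ∫ _ in (0 : ℝ)..t, δ ^ 2 = t * δ ^ 2 := by simp
  rw [e, e2, mul_zero, zero_add, add_zero] at h1
  have h2 : ‖x t‖ ^ 2 + ‖y t‖ ^ 2 ≤ sizeSq (grad (dOp N) (x t)) (x t) (y t) :=
    le_add_of_nonneg_right (by positivity)
  refine h2.trans (h1.trans ?_)
  gcongr
  · exact ht.2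
  · exact ht.2

/-- The error caused by the regularisation. -/
lemma Family.norm_rhs_sub_le (ha : Family r M M' L c₁ a) {N N' : ℝ} (hN : 1 ≤ N) (h : N ≤ N')
    {B : ℝ} {x y : Seq} (hB : regSize r N' x y ≤ B ^ 2) (hB0 : 0 ≤ B) (t : ℝ) :
    ‖(a t).coef.rhs (grad (dOp N') y) (hess (dOp N') x) -
      (a t).coef.rhs (grad (dOp N) y) (hess (dOp N) x)‖ ≤
      rhsConst L * (2 * ((N / 2) ^ (1 - r) * B)) := by
  have hr := ha.hr
  rw [rhs_sub, two_mul]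
  simp only [regSize, sizeSq, grad] at hB
  have p : 0 ≤ (N / 2) ^ (1 - r) := by positivity
  have hx0 : ‖dOp N' 0 (lamOp r N' x)‖ ≤ B := abs_le_of_sq_le_sq' (by
    nlinarith [sq_nonneg ‖lamOp r N' x‖, sq_nonneg ‖lamOp r N' y‖,
      sq_nonneg ‖dOp N' 1 (lamOp r N' x)‖]) hB0 |>.2
  have hx1 : ‖dOp N' 1 (lamOp r N' x)‖ ≤ B := abs_le_of_sq_le_sq' (by
    nlinarith [sq_nonneg ‖lamOp r N' x‖, sq_nonneg ‖lamOp r N' y‖,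
      sq_nonneg ‖dOp N' 0 (lamOp r N' x)‖]) hB0 |>.2
  have hy : ‖lamOp r N' y‖ ≤ B := abs_le_of_sq_le_sq' (by
    nlinarith [sq_nonneg ‖lamOp r N' x‖, sq_nonneg ‖dOp N' 0 (lamOp r N' x)‖,
      sq_nonneg ‖dOp N' 1 (lamOp r N' x)‖]) hB0 |>.2
  refine norm_rhs_le ha.hL (ha.sup t) (fun i => ?_) fun i j => ?_
  · refine (norm_dOp_sub_le (r := r) hN h (by linarith) i y).trans ?_
    gcongr
  · refine (norm_dOp_dOp_sub_le (r := r) hN h (by linarith) i j x).trans ?_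
    gcongr
    fin_cases j
    · exact hx0
    · exact hx1

end

section

/-! ### The limit of the regularised solutions -/

/-- `∂ᵢ⟨∇⟩^{-σ}`. -/
def dV (σ : ℝ) (i : Fin 2) : Seq →L[ℝ] Seq :=
  diag fun k => ((xi i k * jap k ^ (-σ) : ℝ) : ℂ) * I

/-- `∂ᵢ∂ⱼ⟨∇⟩^{-σ}`. -/
def hV (σ : ℝ) (i j : Fin 2) : Seq →L[ℝ] Seq :=
  diag fun k => ((-(xi i k * xi j k * jap k ^ (-σ)) : ℝ) : ℂ)

lemma norm_dVsym_le {σ : ℝ} (hσ : 1 ≤ σ) (i : Fin 2) (k : Freq) :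
    ‖((xi i k * jap k ^ (-σ) : ℝ) : ℂ) * I‖ ≤ 1 := by
  have hj := jap_pos k
  rw [norm_mul, norm_I, mul_one, norm_real, norm_eq_abs, abs_mul,
    abs_of_pos (a := jap k ^ (-σ)) (by positivity)]
  calc _ ≤ jap k * jap k ^ (-σ) := by gcongr; exact abs_xi_le i k
    _ = jap k ^ (-(σ - 1)) := by
      rw [mul_comm, ← rpow_add_one hj.ne']; congr 1; ring
    _ ≤ 1 := jap_rpow_le_one (by linarith) k

lemma norm_hVsym_le {σ : ℝ} (hσ : 2 ≤ σ) (i j : Fin 2) (k : Freq) :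
    ‖((-(xi i k * xi j k * jap k ^ (-σ)) : ℝ) : ℂ)‖ ≤ 1 := by
  have hj := jap_pos k
  rw [norm_real, norm_eq_abs, abs_neg, abs_mul, abs_mul,
    abs_of_pos (a := jap k ^ (-σ)) (by positivity)]
  calc _ ≤ jap k * jap k * jap k ^ (-σ) := by gcongr <;> exact abs_xi_le _ k
    _ = jap k ^ (-(σ - 2)) := by
      rw [mul_comm, ← mul_assoc, ← rpow_add_one hj.ne', ← rpow_add_one hj.ne']
      congr 1; ring
    _ ≤ 1 := jap_rpow_le_one (by linarith) k

lemma dV_apply {σ : ℝ} (hσ : 1 ≤ σ) (i : Fin 2) (z : Seq) (k : Freq) :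
    dV σ i z k = ((xi i k * jap k ^ (-σ) : ℝ) : ℂ) * I * z k :=
  diag_apply ⟨1, norm_dVsym_le hσ i⟩ z k

lemma hV_apply {σ : ℝ} (hσ : 2 ≤ σ) (i j : Fin 2) (z : Seq) (k : Freq) :
    hV σ i j z k = ((-(xi i k * xi j k * jap k ^ (-σ)) : ℝ) : ℂ) * z k :=
  diag_apply ⟨1, norm_hVsym_le hσ i j⟩ z k

lemma norm_dV_le {σ : ℝ} (hσ : 1 ≤ σ) (i : Fin 2) (z : Seq) : ‖dV σ i z‖ ≤ ‖z‖ := by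
  simpa [dV] using norm_diag_apply_le (norm_dVsym_le hσ i) z

lemma norm_hV_le {σ : ℝ} (hσ : 2 ≤ σ) (i j : Fin 2) (z : Seq) : ‖hV σ i j z‖ ≤ ‖z‖ := by
  have := norm_diag_apply_le (norm_hVsym_le hσ i j) z
  rw [one_mul] at this
  exact this

/-- The right-hand side of the limit system in terms of the weighted unknowns. -/
def fullRhs (r : ℝ) (b : Fields) (Φ Θ : Seq) : Seq :=
  b.coef.rhs (fun i => dV r i Θ) (fun i j => hV (r + 1) i j Φ)

variable {r M M' L c₁ T : ℝ} {a : ℝ → Fields}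

lemma norm_dV_sub_dOp_le {N : ℝ} (hN : 1 ≤ N) (hr : 1 ≤ r) (i : Fin 2) (z : Seq) :
    ‖dV r i z - dOp N i (vOp r z)‖ ≤ (N / 2) ^ (1 - r) * ‖z‖ := by
  refine Seq.norm_le_mul (by positivity) fun k => ?_
  have hj := jap_pos k
  rw [lp.coeFn_sub, Pi.sub_apply, dV_apply hr, dOp_apply hN, vOp_apply (by linarith)]
  have e : ((xi i k * jap k ^ (-r) : ℝ) : ℂ) * I * z k -
      (dsym N i k : ℂ) * I * (((jap k ^ (-r) : ℝ) : ℂ) * z k) =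
      (((xi i k - dsym N i k) * jap k ^ (-r) : ℝ) : ℂ) * I * z k := by push_cast; ring
  rw [e, norm_mul, norm_mul, norm_I, mul_one, norm_real, norm_eq_abs, abs_mul,
    abs_of_pos (a := jap k ^ (-r)) (by positivity)]
  gcongr
  by_cases h1 : jap k ≤ N / 2
  · rw [dsym_eq hN i h1, sub_self, abs_zero, zero_mul]; positivity
  · have h2 : |xi i k - dsym N i k| ≤ (N / 2) ^ (1 - r) * jap k ^ r := by
      refine le_trans ?_ (jap_le_rpow_mul hN hr (by linarith))
      have e : xi i k - dsym N i k = xi i k * (1 - cutoff N k) := by rw [dsym]; ring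
      have h3 := cutoff_nonneg N k
      have h4 := cutoff_le_one N k
      rw [e, abs_mul, abs_of_nonneg (a := 1 - cutoff N k) (by linarith)]
      have := abs_xi_le i k
      nlinarith [abs_nonneg (xi i k)]
    calc _ ≤ ((N / 2) ^ (1 - r) * jap k ^ r) * jap k ^ (-r) := by gcongr
      _ = _ := by rw [mul_assoc, ← rpow_add hj]; simp

lemma norm_hV_sub_dOp_le {N : ℝ} (hN : 1 ≤ N) (hr : 1 ≤ r) (i j : Fin 2) (z : Seq) :
    ‖hV (r + 1) i j z - dOp N i (dOp N j (vOp (r + 1) z))‖ ≤ (N / 2) ^ (1 - r) * ‖z‖ := by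
  refine Seq.norm_le_mul (by positivity) fun k => ?_
  have hj := jap_pos k
  rw [lp.coeFn_sub, Pi.sub_apply, hV_apply (by linarith), dOp_apply hN, dOp_apply hN,
    vOp_apply (by linarith)]
  have e : ((-(xi i k * xi j k * jap k ^ (-(r + 1))) : ℝ) : ℂ) * z k -
      (dsym N i k : ℂ) * I * ((dsym N j k : ℂ) * I *
        (((jap k ^ (-(r + 1)) : ℝ) : ℂ) * z k)) =
      ((-((xi i k * xi j k - dsym N i k * dsym N j k) * jap k ^ (-(r + 1))) : ℝ) : ℂ) * z k := by
    push_cast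
    linear_combination (-(dsym N i k : ℂ) * dsym N j k * ((jap k ^ (-(r + 1)) : ℝ) : ℂ) * z k) *
      I_sq
  rw [e, norm_mul, norm_real, norm_eq_abs, abs_neg, abs_mul,
    abs_of_pos (a := jap k ^ (-(r + 1))) (by positivity)]
  gcongr
  by_cases h1 : jap k ≤ N / 2
  · rw [dsym_eq hN i h1, dsym_eq hN j h1, sub_self, abs_zero, zero_mul]; positivity
  · have h2 : |xi i k * xi j k - dsym N i k * dsym N j k| ≤ (N / 2) ^ (1 - r) * jap k ^ r * jap k := by
      have e : xi i k * xi j k - dsym N i k * dsym N j k =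
        xi i k * xi j k * (1 - cutoff N k ^ 2) := by rw [dsym, dsym]; ring
      have h3 := cutoff_nonneg N k
      have h4 := cutoff_le_one N k
      have h5 : 0 ≤ 1 - cutoff N k ^ 2 := by nlinarith
      rw [e, abs_mul, abs_mul, abs_of_nonneg h5]
      calc |xi i k| * |xi j k| * (1 - cutoff N k ^ 2) ≤ jap k * jap k * 1 := by
            gcongr
            · exact abs_xi_le i k
            · exact abs_xi_le j k
            · nlinarith
        _ ≤ ((N / 2) ^ (1 - r) * jap k ^ r) * jap k * 1 := by
            gcongr
            exact jap_le_rpow_mul hN hr (by linarith)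
        _ = _ := by ring
    calc _ ≤ ((N / 2) ^ (1 - r) * jap k ^ r * jap k) * jap k ^ (-(r + 1)) := by gcongr
      _ = (N / 2) ^ (1 - r) * (jap k ^ (r + 1) * jap k ^ (-(r + 1))) := by
        rw [rpow_add_one hj.ne']; ring
      _ = _ := by rw [← rpow_add hj]; simp

/-- The error of the regularised right-hand side. -/
lemma norm_fullRhs_sub_le (hr : 1 ≤ r) (hL : 0 ≤ L) {b : Fields} (hb : b.SupBound L) {N : ℝ}
    (hN : 1 ≤ N) {B : ℝ} {Φ Θ : Seq} (hΦ : ‖Φ‖ ≤ B) (hΘ : ‖Θ‖ ≤ B) :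
    ‖fullRhs r b Φ Θ - b.coef.rhs (grad (dOp N) (vOp r Θ)) (hess (dOp N) (vOp (r + 1) Φ))‖ ≤
      rhsConst L * (2 * ((N / 2) ^ (1 - r) * B)) := by
  rw [fullRhs, rhs_sub, two_mul]
  refine norm_rhs_le hL hb (fun i => ?_) fun i j => ?_
  · exact (norm_dV_sub_dOp_le hN hr i Θ).trans (by gcongr)
  · exact (norm_hV_sub_dOp_le hN hr i j Φ).trans (by gcongr)

lemma norm_fullRhs_le (hr : 1 ≤ r) (hL : 0 ≤ L) {b : Fields} (hb : b.SupBound L) {B : ℝ}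
    {Φ Θ : Seq} (hΦ : ‖Φ‖ ≤ B) (hΘ : ‖Θ‖ ≤ B) :
    ‖fullRhs r b Φ Θ‖ ≤ rhsConst L * (B + B) :=
  norm_rhs_le hL hb (fun i => (norm_dV_le hr i Θ).trans hΘ)
    fun i j => (norm_hV_le (by linarith) i j Φ).trans hΦ

lemma tendsto_regularisation_error (hr : 1 < r) (C B : ℝ) :
    Tendsto (fun n : ℕ => C * (2 * ((((n : ℝ) + 1) / 2) ^ (1 - r) * B))) atTop (𝓝 0) := by
  have h1 : Tendsto (fun n : ℕ => ((n : ℝ) + 1) / 2) atTop atTop :=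
    (tendsto_atTop_add_const_right _ _ tendsto_natCast_atTop_atTop).atTop_div_const (by norm_num)
  have h2 : Tendsto (fun n : ℕ => (((n : ℝ) + 1) / 2) ^ (1 - r)) atTop (𝓝 0) := by
    have := (tendsto_rpow_neg_atTop (y := r - 1) (by linarith)).comp h1
    simpa [comp_def, neg_sub] using this
  have h3 := ((h2.mul_const B).const_mul 2).const_mul C
  simpa using h3

/-- Interchange of two limits. -/
lemma tendsto_of_approx {E ι : Type*} [SeminormedAddCommGroup E] {l : Filter ι} {z : ι → E} {z' : E}
    {u : ℕ → ι → E} {u' : ℕ → E} {η : ℕ → ℝ} (hη : Tendsto η atTop (𝓝 0))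
    (h1 : ∀ m, ∀ᶠ n in l, ‖z n - u m n‖ ≤ η m) (h2 : ∀ m, Tendsto (u m) l (𝓝 (u' m)))
    (h3 : ∀ m, ‖z' - u' m‖ ≤ η m) : Tendsto z l (𝓝 z') := by
  rw [Metric.tendsto_nhds]
  intro ε hε
  obtain ⟨m, hm⟩ := (hη.eventually (gt_mem_nhds (by positivity : (0 : ℝ) < ε / 3))).exists
  filter_upwards [h1 m, (Metric.tendsto_nhds.1 (h2 m)) (ε / 3) (by positivity)] with n hn hn'
  rw [dist_eq_norm] at hn' ⊢
  have e : z n - z' = (z n - u m n) + (u m n - u' m) - (z' - u' m) := by abel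
  rw [e]
  have s1 := norm_sub_le ((z n - u m n) + (u m n - u' m)) (z' - u' m)
  have s2 := norm_add_le (z n - u m n) (u m n - u' m)
  linarith [h3 m]

/-- Passage to the limit in the weighted bounds. -/
lemma exists_weighted_limit (hr : 0 ≤ r) {x y : ℕ → Seq} {x' y' : Seq}
    (hx : Tendsto x atTop (𝓝 x')) (hy : Tendsto y atTop (𝓝 y')) {B : ℝ}
    (hB : ∀ n : ℕ, regSize r (n + 1) (x n) (y n) ≤ B) :
    ∃ Φ Θ, x' = vOp (r + 1) Φ ∧ y' = vOp r Θ ∧ ‖Φ‖ ^ 2 + ‖Θ‖ ^ 2 ≤ B := by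
  have hB0 : 0 ≤ B := (sizeSq_nonneg _ _ _).trans (hB 0)
  have hN : ∀ n : ℕ, (1 : ℝ) ≤ n + 1 := fun n => by
    have : (0 : ℝ) ≤ n := n.cast_nonneg
    linarith
  have hcoord : ∀ {z : ℕ → Seq} {z' : Seq}, Tendsto z atTop (𝓝 z') → ∀ k,
      Tendsto (fun n => ‖z n k‖) atTop (𝓝 ‖z' k‖) := fun {z z'} hz k => by
    refine Tendsto.norm ?_
    rw [tendsto_iff_norm_sub_tendsto_zero] at hz ⊢
    exact squeeze_zero (fun _ => norm_nonneg _) (fun n => Seq.norm_apply_le (z n - z') k) hz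
  have key : ∀ s : Finset Freq, ∑ k ∈ s, ((jap k ^ (r + 1) * ‖x' k‖) ^ 2) +
      ∑ k ∈ s, (jap k ^ r * ‖y' k‖) ^ 2 ≤ B := by
    intro s
    have hlim : Tendsto (fun n => ∑ k ∈ s, ((jap k ^ (r + 1) * ‖x n k‖) ^ 2) +
      ∑ k ∈ s, (jap k ^ r * ‖y n k‖) ^ 2) atTop (𝓝 (∑ k ∈ s, ((jap k ^ (r + 1) * ‖x' k‖) ^ 2) +
      ∑ k ∈ s, (jap k ^ r * ‖y' k‖) ^ 2)) :=
      (tendsto_finsetSum _ fun k _ => ((hcoord hx k).const_mul _).pow 2).add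
        (tendsto_finsetSum _ fun k _ => ((hcoord hy k).const_mul _).pow 2)
    refine le_of_tendsto hlim ?_
    have hev : ∀ᶠ n : ℕ in atTop, ∀ k ∈ s, jap k ≤ ((n : ℝ) + 1) / 2 := by
      rw [eventually_all_finset]
      intro k _
      exact ((tendsto_atTop_add_const_right _ _ tendsto_natCast_atTop_atTop).atTop_div_const
        (by norm_num)).eventually_ge_atTop _
    filter_upwards [hev] with n hn
    refine le_trans ?_ (hB n)
    have h0 := Seq.sum_le_norm_sq (lamOp r (n + 1) (x n)) s
    have h1 := Seq.sum_le_norm_sq (dOp (n + 1) 0 (lamOp r (n + 1) (x n))) s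
    have h2 := Seq.sum_le_norm_sq (dOp (n + 1) 1 (lamOp r (n + 1) (x n))) s
    have h3 := Seq.sum_le_norm_sq (lamOp r (n + 1) (y n)) s
    have e1 : ∑ k ∈ s, (jap k ^ (r + 1) * ‖x n k‖) ^ 2 =
        ∑ k ∈ s, ‖lamOp r (n + 1) (x n) k‖ ^ 2 +
        (∑ k ∈ s, ‖dOp (n + 1) 0 (lamOp r (n + 1) (x n)) k‖ ^ 2 +
        ∑ k ∈ s, ‖dOp (n + 1) 1 (lamOp r (n + 1) (x n)) k‖ ^ 2) := by
      rw [← sum_add_distrib, ← sum_add_distrib]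
      refine sum_congr rfl fun k hk => ?_
      have hj := jap_pos k
      have hk' := hn k hk
      rw [norm_dOp_apply (hN n), norm_dOp_apply (hN n), norm_lamOp_apply hr (hN n),
        dsym_eq (hN n) _ hk', dsym_eq (hN n) _ hk', trunc, min_eq_left (by linarith [hN n])]
      simp only [mul_pow, sq_abs]
      rw [rpow_add_one hj.ne', mul_pow, jap_sq, sum_univ_two]
      ring
    have e2 : ∑ k ∈ s, (jap k ^ r * ‖y n k‖) ^ 2 = ∑ k ∈ s, ‖lamOp r (n + 1) (y n) k‖ ^ 2 := by
      refine sum_congr rfl fun k hk => ?_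
      have hk' := hn k hk
      rw [norm_lamOp_apply hr (hN n), trunc, min_eq_left (by linarith [hN n])]
    rw [e1, e2]
    simp only [regSize, sizeSq, grad]
    linarith
  have hw : ∀ (σ : ℝ) (k : Freq) (z : ℂ), ‖((jap k ^ σ : ℝ) : ℂ) * z‖ = jap k ^ σ * ‖z‖ :=
    fun σ k z => by
      have hj := jap_pos k
      rw [norm_mul, norm_real, norm_of_nonneg (by positivity)]
  have hm1 : Memℓp (fun k => ((jap k ^ (r + 1) : ℝ) : ℂ) * x' k) 2 := memℓp_of_bound (C := B) fun s => by
    simp only [hw]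
    exact le_trans (le_add_of_nonneg_right (by positivity)) (key s)
  have hm2 : Memℓp (fun k => ((jap k ^ r : ℝ) : ℂ) * y' k) 2 := memℓp_of_bound (C := B) fun s => by
    simp only [hw]
    exact le_trans (le_add_of_nonneg_left (by positivity)) (key s)
  have hinv : ∀ (σ : ℝ) (k : Freq) (z : ℂ),
      ((jap k ^ (-σ) : ℝ) : ℂ) * (((jap k ^ σ : ℝ) : ℂ) * z) = z := fun σ k z => by
    have hj := jap_pos k
    rw [← mul_assoc, ← Complex.ofReal_mul, ← rpow_add hj]
    simp
  refine ⟨mkSeq fun k => ((jap k ^ (r + 1) : ℝ) : ℂ) * x' k,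
    mkSeq fun k => ((jap k ^ r : ℝ) : ℂ) * y' k, ?_, ?_, ?_⟩
  · ext k
    rw [vOp_apply (by linarith), mkSeq_apply hm1, hinv]
  · ext k
    rw [vOp_apply hr, mkSeq_apply hm2, hinv]
  · have h1 := (mkSeq fun k => ((jap k ^ (r + 1) : ℝ) : ℂ) * x' k).summable_sq.hasSum
    have h2 := (mkSeq fun k => ((jap k ^ r : ℝ) : ℂ) * y' k).summable_sq.hasSum
    rw [← Seq.norm_sq] at h1 h2
    refine le_of_tendsto (h1.add h2) (.of_forall fun s => ?_)
    simp only [mkSeq_apply hm1, mkSeq_apply hm2, hw, sum_add_distrib]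
    exact key s

/-- Solutions of the limit system in terms of the weighted unknowns. -/
structure FullSol (r : ℝ) (a : ℝ → Fields) (T : ℝ) (g Φ Θ : ℝ → Seq) : Prop where
  bdd : ∃ B, ∀ t ∈ Icc 0 T, ‖Φ t‖ ≤ B ∧ ‖Θ t‖ ≤ B
  dx : ∀ t ∈ Icc 0 T, HasDerivWithinAt (fun t => vOp (r + 1) (Φ t)) (vOp r (Θ t)) (Icc 0 T) t
  dy : ∀ t ∈ Icc 0 T, HasDerivWithinAt (fun t => vOp r (Θ t))
    (fullRhs r (a t) (Φ t) (Θ t) + vOp r (g t)) (Icc 0 T) t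

lemma Family.continuousOn_fullRhs (ha : Family r M M' L c₁ a) {Φ Θ : ℝ → Seq} {B : ℝ} {s : Set ℝ}
    (hB : ∀ t ∈ s, ‖Φ t‖ ≤ B ∧ ‖Θ t‖ ≤ B)
    (hx : ContinuousOn (fun t => vOp (r + 1) (Φ t)) s) (hy : ContinuousOn (fun t => vOp r (Θ t)) s) :
    ContinuousOn (fun t => fullRhs r (a t) (Φ t) (Θ t)) s := by
  have hr := ha.hr
  intro t ht
  refine tendsto_of_approx (tendsto_regularisation_error (by linarith) (rhsConst L) B)
    (u := fun m t => (a t).coef.rhs (grad (dOp (m + 1)) (vOp r (Θ t)))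
      (hess (dOp (m + 1)) (vOp (r + 1) (Φ t)))) (fun m => ?_)
    (fun m => ha.continuousOn_rhs_grad (dOp (m + 1)) hx hy t ht) fun m => ?_
  · filter_upwards [self_mem_nhdsWithin] with τ hτ
    exact norm_fullRhs_sub_le (by linarith) ha.hL (ha.sup τ) (by simp) (hB τ hτ).1 (hB τ hτ).2
  · exact norm_fullRhs_sub_le (by linarith) ha.hL (ha.sup t) (by simp) (hB t ht).1 (hB t ht).2

/-- The regularised solutions differ little. -/
lemma Family.norm_sub_le_of_solves (ha : Family r M M' L c₁ a) {N N' : ℝ} (hN : 1 ≤ N) (h : N ≤ N')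
    {G x y x' y' : ℝ → Seq} (hs : Solves a (dOp N) T G x y) (hs' : Solves a (dOp N') T G x' y')
    (hx0 : x' 0 = x 0) (hy0 : y' 0 = y 0) {B : ℝ} (hB0 : 0 ≤ B)
    (hB : ∀ t ∈ Icc 0 T, regSize r N' (x' t) (y' t) ≤ B ^ 2) {t : ℝ} (ht : t ∈ Icc 0 T) :
    ‖x' t - x t‖ ^ 2 + ‖y' t - y t‖ ^ 2 ≤
      coerConst c₁ L * (T * (rhsConst L * (2 * ((N / 2) ^ (1 - r) * B))) ^ 2) *
      exp (slopeConst (opConst M) M' * coerConst c₁ (opConst M) * T) := by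
  set F : ℝ → Seq := fun t => (a t).coef.rhs (grad (dOp N') (y' t)) (hess (dOp N') (x' t)) -
      (a t).coef.rhs (grad (dOp N) (y' t)) (hess (dOp N) (x' t))
  have hsol : Solves a (dOp N) T F (fun t => x' t - x t) (fun t => y' t - y t) := by
    refine ⟨fun t ht => (hs'.dx t ht).sub (hs.dx t ht), fun t ht => ?_⟩
    convert! (hs'.dy t ht).sub (hs.dy t ht) using 1
    have e1 : grad (dOp N) (y' t - y t) = grad (dOp N) (y' t) - grad (dOp N) (y t) := by
      funext i; simp [grad]
    have e2 : hess (dOp N) (x' t - x t) = hess (dOp N) (x' t) - hess (dOp N) (x t) := by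
      funext i j; simp [hess]
    rw [e1, e2, ← rhs_sub]
    have key : ∀ A B C G : Seq, A - B + (C - A) = C + G - (B + G) := fun A B C G => by abel
    exact key _ _ _ _
  exact ha.norm_sq_le_of_small hN hsol
    ((ha.continuousOn_rhs_grad _ hs'.cx hs'.cy).sub (ha.continuousOn_rhs_grad _ hs'.cx hs'.cy))
    (fun t ht => ha.norm_rhs_sub_le hN h (hB t ht) hB0 t) (by simp [hx0]) (by simp [hy0]) ht

lemma vOp_injective {σ : ℝ} (hσ : 0 ≤ σ) : Function.Injective (vOp σ) := fun u v huv => by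
  ext k
  have := congrArg (fun z : Seq => z k) huv
  simp only [vOp_apply hσ] at this
  have hj := jap_pos k
  have hne : ((jap k ^ (-σ) : ℝ) : ℂ) ≠ 0 := by
    rw [Complex.ofReal_ne_zero]; positivity
  exact mul_left_cancel₀ hne this

lemma exists_tendstoUniformlyOn {z : ℕ → ℝ → Seq} {s : Set ℝ} (h : UniformCauchySeqOn z atTop s) :
    ∃ z', TendstoUniformlyOn z z' atTop s := by
  have hpt : ∀ t ∈ s, ∃ w, Tendsto (fun n => z n t) atTop (𝓝 w) := fun t ht =>
    cauchySeq_tendsto_of_complete (h.cauchySeq ht)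
  choose! z' hz' using hpt
  exact ⟨z', h.tendstoUniformlyOn_of_tendsto hz'⟩

set_option maxHeartbeats 1600000 in
/-- Existence for continuous sources. -/
lemma Family.exists_fullSol (ha : Family r M M' L c₁ a) (hT : 0 ≤ T) {g : ℝ → Seq}
    (hg : ContinuousOn g (Icc 0 T)) (Φ₀ Θ₀ : Seq) :
    ∃ Φ Θ, FullSol r a T g Φ Θ ∧ Φ 0 = Φ₀ ∧ Θ 0 = Θ₀ ∧ ∀ t ∈ Icc 0 T,
      ‖Φ t‖ ^ 2 + ‖Θ t‖ ^ 2 ≤ coerConst c₁ L *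
      (10 * (1 + L) ^ 2 * (‖Φ₀‖ ^ 2 + ‖Θ₀‖ ^ 2) + ∫ τ in (0 : ℝ)..T, 2 * ‖g τ‖ ^ 2) *
        exp (growth r M M' c₁ * T) := by
  have hr := ha.hr
  have hr0 : 0 ≤ r := by linarith
  have hN : ∀ n : ℕ, (1 : ℝ) ≤ n + 1 := fun n => by simp
  have hVg : ContinuousOn (fun t => vOp r (g t)) (Icc 0 T) := (vOp r).continuous.comp_continuousOn hg
  set B2 := coerConst c₁ L *
      (10 * (1 + L) ^ 2 * (‖Φ₀‖ ^ 2 + ‖Θ₀‖ ^ 2) + ∫ τ in (0 : ℝ)..T, 2 * ‖g τ‖ ^ 2) *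
        exp (growth r M M' c₁ * T) with hB2
  choose x y hx0 hy0 hdx hdy using fun n : ℕ => ha.exists_regularised (dOp (n + 1)) hT hVg
    (vOp (r + 1) Φ₀) (vOp r Θ₀)
  have hsol : ∀ n : ℕ, Solves a (dOp (n + 1)) T (fun t => vOp r (g t)) (x n) (y n) :=
    fun n => ⟨hdx n, hdy n⟩
  have hgr : 0 ≤ growth r M M' c₁ := by
    have := slopeConst_nonneg (opConst_nonneg ha.hM) ha.hM'
    have := coerConst_pos (L := opConst M) ha.hc₁
    unfold growth; positivity
  have hC := coerConst_pos (L := L) ha.hc₁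
  have hbound : ∀ n : ℕ, ∀ t ∈ Icc 0 T, regSize r (n + 1) (x n t) (y n t) ≤ B2 := by
    intro n t ht
    refine (ha.regSize_le (hN n) hg (hsol n) ht).trans ?_
    rw [hx0, hy0]
    have h1 := regSize_vOp_le (hN n) hr0 Φ₀ Θ₀
    have h2 : ∫ τ in (0 : ℝ)..t, 2 * ‖g τ‖ ^ 2 ≤ ∫ τ in (0 : ℝ)..T, 2 * ‖g τ‖ ^ 2 := by
      refine intervalIntegral.integral_mono_interval le_rfl ht.1 ht.2
        (.of_forall fun τ => by positivity) ?_
      refine ContinuousOn.intervalIntegrable ?_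
      rw [uIcc_of_le hT]; fun_prop
    have h3 : 0 ≤ ∫ τ in (0 : ℝ)..T, 2 * ‖g τ‖ ^ 2 :=
      intervalIntegral.integral_nonneg hT fun τ _ => by positivity
    rw [hB2]
    gcongr
    exact ht.2
  have hB0 : 0 ≤ B2 := (sizeSq_nonneg _ _ _).trans (hbound 0 0 ⟨le_rfl, hT⟩)
  set B := sqrt B2
  have hBsq : B ^ 2 = B2 := sq_sqrt hB0
  have hBn : 0 ≤ B := sqrt_nonneg _
  -- the Cauchy property
  set E : ℕ → ℝ := fun n => coerConst c₁ L *
      (T * (rhsConst L * (2 * ((((n : ℝ) + 1) / 2) ^ (1 - r) * B))) ^ 2) *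
      exp (slopeConst (opConst M) M' * coerConst c₁ (opConst M) * T) with hE
  have hElim : Tendsto E atTop (𝓝 0) := by
    have := ((((tendsto_regularisation_error (r := r) (by linarith) (rhsConst L) B).pow 2).const_mul
      T).const_mul (coerConst c₁ L)).mul_const
      (exp (slopeConst (opConst M) M' * coerConst c₁ (opConst M) * T))
    simpa [hE] using this
  have hdiff : ∀ n m : ℕ, n ≤ m → ∀ t ∈ Icc 0 T,
      ‖x m t - x n t‖ ^ 2 + ‖y m t - y n t‖ ^ 2 ≤ E n := by
    intro n m hnm t ht
    exact ha.norm_sub_le_of_solves (hN n) (by gcongr) (hsol n) (hsol m) (by rw [hx0, hx0])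
      (by rw [hy0, hy0]) hBn (fun t ht => by rw [hBsq]; exact hbound m t ht) ht
  have hcauchy : ∀ {z : ℕ → ℝ → Seq}, (∀ n m : ℕ, n ≤ m → ∀ t ∈ Icc 0 T,
      ‖z m t - z n t‖ ^ 2 ≤ E n) → ∃ z' : ℝ → Seq, TendstoUniformlyOn z z' atTop (Icc 0 T) := by
    intro z hz
    refine exists_tendstoUniformlyOn ?_
    rw [Metric.uniformCauchySeqOn_iff]
    intro ε hε
    obtain ⟨n₀, hn₀⟩ := eventually_atTop.1
      (hElim.eventually (gt_mem_nhds (by positivity : (0 : ℝ) < (ε / 2) ^ 2)))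
    refine ⟨n₀, fun m hm n hn t ht => ?_⟩
    have h1 := abs_lt_of_sq_lt_sq ((hz n₀ m hm t ht).trans_lt (hn₀ n₀ le_rfl)) (by positivity)
    have h2 := abs_lt_of_sq_lt_sq ((hz n₀ n hn t ht).trans_lt (hn₀ n₀ le_rfl)) (by positivity)
    rw [abs_norm, ← dist_eq_norm] at h1 h2
    have := dist_triangle_right (z m t) (z n t) (z n₀ t)
    linarith
  obtain ⟨x', hx'⟩ := hcauchy (z := x) fun n m h t ht =>
    le_trans (le_add_of_nonneg_right (by positivity)) (hdiff n m h t ht)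
  obtain ⟨y', hy'⟩ := hcauchy (z := y) fun n m h t ht =>
    le_trans (le_add_of_nonneg_left (by positivity)) (hdiff n m h t ht)
  have hw : ∀ t ∈ Icc 0 T, ∃ Φ Θ, x' t = vOp (r + 1) Φ ∧ y' t = vOp r Θ ∧ ‖Φ‖ ^ 2 + ‖Θ‖ ^ 2 ≤ B2 :=
    fun t ht => exists_weighted_limit hr0 (hx'.tendsto_at ht) (hy'.tendsto_at ht)
      fun n => hbound n t ht
  choose! Φ Θ hΦΘ using hw
  have hxc : ContinuousOn (fun t => vOp (r + 1) (Φ t)) (Icc 0 T) :=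
    (hx'.continuousOn (Eventually.of_forall fun n => (hsol n).cx).frequently).congr
      fun t ht => ((hΦΘ t ht).1).symm
  have hyc : ContinuousOn (fun t => vOp r (Θ t)) (Icc 0 T) :=
    (hy'.continuousOn (Eventually.of_forall fun n => (hsol n).cy).frequently).congr
      fun t ht => ((hΦΘ t ht).2.1).symm
  have hΦB : ∀ t ∈ Icc 0 T, ‖Φ t‖ ≤ B ∧ ‖Θ t‖ ≤ B := fun t ht => by
    have h := (hΦΘ t ht).2.2
    rw [← hBsq] at h
    have h1 := sq_nonneg ‖Φ t‖
    have h2 := sq_nonneg ‖Θ t‖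
    exact ⟨(abs_le_of_sq_le_sq' (by linarith) hBn).2, (abs_le_of_sq_le_sq' (by linarith) hBn).2⟩
  have hRc := ha.continuousOn_fullRhs hΦB hxc hyc
  have hlimR : ∀ t ∈ Icc 0 T, Tendsto (fun n : ℕ => (a t).coef.rhs (grad (dOp (n + 1)) (y n t))
      (hess (dOp (n + 1)) (x n t))) atTop (𝓝 (fullRhs r (a t) (Φ t) (Θ t))) := by
    intro t ht
    refine tendsto_of_approx (tendsto_regularisation_error (r := r) (by linarith) (rhsConst L) B)
      (u := fun m n => (a t).coef.rhs (grad (dOp (m + 1)) (y n t)) (hess (dOp (m + 1)) (x n t)))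
      (u' := fun m => (a t).coef.rhs (grad (dOp (m + 1)) (y' t)) (hess (dOp (m + 1)) (x' t)))
      (fun m => ?_) (fun m => ?_) fun m => ?_
    · filter_upwards [eventually_ge_atTop m] with n hn
      exact ha.norm_rhs_sub_le (hN m) (by gcongr) (by rw [hBsq]; exact hbound n t ht) hBn t
    · simp only [← rhsOp_apply]
      exact ((rhsOp (dOp (m + 1)) (a t)).continuous.tendsto _).comp
        ((hx'.tendsto_at ht).prodMk_nhds (hy'.tendsto_at ht))
    · obtain ⟨e1, e2, -⟩ := hΦΘ t ht
      rw [e1, e2]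
      exact norm_fullRhs_sub_le (by linarith) ha.hL (ha.sup t) (hN m) (hΦB t ht).1 (hΦB t ht).2
  -- the integral equations
  have hix : ∀ t ∈ Icc 0 T, vOp (r + 1) (Φ t) =
      vOp (r + 1) Φ₀ + ∫ τ in (0 : ℝ)..t, vOp r (Θ τ) := by
    intro t ht
    rw [← (hΦΘ t ht).1]
    have h1 : ∀ n : ℕ, x n t = vOp (r + 1) Φ₀ + ∫ τ in (0 : ℝ)..t, y n τ := fun n => by
      rw [integral_of_hasDerivWithinAt (hsol n).cy (hsol n).dx ht, hx0]
    refine tendsto_nhds_unique (hx'.tendsto_at ht) ?_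
    simp only [h1]
    refine Tendsto.const_add _ ?_
    have hsub : uIcc 0 t ⊆ Icc 0 T := by rw [uIcc_of_le ht.1]; exact Icc_subset_Icc le_rfl ht.2
    refine ((hy'.mono hsub).congr_right fun τ hτ =>
      (hΦΘ τ (hsub hτ)).2.1).tendsto_intervalIntegral_of_continuousOn
      (.of_forall fun n => (hsol n).cy.mono hsub)
  have hiy : ∀ t ∈ Icc 0 T, vOp r (Θ t) =
      vOp r Θ₀ + ∫ τ in (0 : ℝ)..t, (fullRhs r (a τ) (Φ τ) (Θ τ) + vOp r (g τ)) := by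
    intro t ht
    rw [← (hΦΘ t ht).2.1]
    have h1 : ∀ n : ℕ, y n t = vOp r Θ₀ + ∫ τ in (0 : ℝ)..t, ((a τ).coef.rhs
        (grad (dOp (n + 1)) (y n τ)) (hess (dOp (n + 1)) (x n τ)) + vOp r (g τ)) := fun n => by
      rw [integral_of_hasDerivWithinAt
        ((ha.continuousOn_rhs_grad _ (hsol n).cx (hsol n).cy).add hVg) (hsol n).dy ht, hy0]
      rfl
    refine tendsto_nhds_unique (hy'.tendsto_at ht) ?_
    simp only [h1]
    refine Tendsto.const_add _ ?_
    have hsub : Icc 0 t ⊆ Icc 0 T := Icc_subset_Icc le_rfl ht.2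
    set K0 := rhsConst L * (2 * ((((0 : ℕ) + 1 : ℝ) / 2) ^ (1 - r) * B))
    obtain ⟨Kg, hKg⟩ := isCompact_Icc.exists_bound_of_continuousOn hVg
    obtain ⟨K1, hK1⟩ : ∃ K1, ∀ n : ℕ, ∀ τ ∈ Icc 0 T, ‖(a τ).coef.rhs (grad (dOp ((0 : ℕ) + 1)) (y n τ))
        (hess (dOp ((0 : ℕ) + 1)) (x n τ))‖ ≤ K1 := by
      have hop : Continuous fun t => rhsOp (dOp ((0 : ℕ) + 1)) (a t) := by
        have h1 := ha.continuous_first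
        have h2 := ha.continuous_second
        unfold rhsOp
        fun_prop
      obtain ⟨K, hK⟩ := isCompact_Icc.exists_bound_of_continuousOn (hop.continuousOn (s := Icc 0 T))
      obtain ⟨X0, hX0⟩ := isCompact_Icc.exists_bound_of_continuousOn (hsol 0).cx
      obtain ⟨Y0, hY0⟩ := isCompact_Icc.exists_bound_of_continuousOn (hsol 0).cy
      refine ⟨K * (max (sqrt (E 0) + X0) (sqrt (E 0) + Y0)), fun n τ hτ => ?_⟩
      rw [← rhsOp_apply]
      refine ((rhsOp _ (a τ)).le_opNorm _).trans ?_
      have d := hdiff 0 n (Nat.zero_le n) τ hτ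
      have dx : ‖x n τ - x 0 τ‖ ≤ sqrt (E 0) := Real.le_sqrt_of_sq_le
        (le_trans (le_add_of_nonneg_right (by positivity)) d)
      have dy : ‖y n τ - y 0 τ‖ ≤ sqrt (E 0) := Real.le_sqrt_of_sq_le
        (le_trans (le_add_of_nonneg_left (by positivity)) d)
      have sx := norm_add_le (x n τ - x 0 τ) (x 0 τ)
      have sy := norm_add_le (y n τ - y 0 τ) (y 0 τ)
      rw [sub_add_cancel] at sx sy
      have : 0 ≤ K := (norm_nonneg _).trans (hK τ hτ)
      gcongr
      · exact hK τ hτ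
      · rw [Prod.norm_def]
        exact max_le_max (by linarith [hX0 τ hτ]) (by linarith [hY0 τ hτ])
    refine intervalIntegral.tendsto_integral_filter_of_dominated_convergence (μ := volume)
      (fun _ => K0 + K1 + Kg) ?_ ?_ ?_ ?_
    · refine .of_forall fun n => ?_
      rw [uIoc_of_le ht.1]
      exact ((((ha.continuousOn_rhs_grad _ (hsol n).cx (hsol n).cy).add hVg).mono hsub).mono
        Ioc_subset_Icc_self).aestronglyMeasurable measurableSet_Ioc
    · refine .of_forall fun n => Eventually.of_forall fun τ hτ => ?_
      rw [uIoc_of_le ht.1] at hτ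
      have hτ' := hsub (Ioc_subset_Icc_self hτ)
      have b1 := ha.norm_rhs_sub_le (N := ((0 : ℕ) : ℝ) + 1) (N' := (n : ℝ) + 1) (by simp) (by simp)
        (by rw [hBsq]; exact hbound n τ hτ') hBn τ
      have b2 := hK1 n τ hτ'
      have b3 := hKg τ hτ'
      refine (norm_add_le _ _).trans (add_le_add ?_ b3)
      have s := norm_add_le ((a τ).coef.rhs (grad (dOp (n + 1)) (y n τ)) (hess (dOp (n + 1)) (x n τ)) -
        (a τ).coef.rhs (grad (dOp ((0 : ℕ) + 1)) (y n τ)) (hess (dOp ((0 : ℕ) + 1)) (x n τ)))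
        ((a τ).coef.rhs (grad (dOp ((0 : ℕ) + 1)) (y n τ)) (hess (dOp ((0 : ℕ) + 1)) (x n τ)))
      rw [sub_add_cancel] at s
      exact s.trans (add_le_add b1 b2)
    · exact intervalIntegrable_const
    · refine .of_forall fun τ hτ => ?_
      rw [uIoc_of_le ht.1] at hτ
      exact (hlimR τ (hsub (Ioc_subset_Icc_self hτ))).add_const _
  have h0 : (0 : ℝ) ∈ Icc 0 T := ⟨le_rfl, hT⟩
  refine ⟨Φ, Θ, ⟨⟨B, hΦB⟩, fun t ht => ?_, fun t ht => ?_⟩, ?_, ?_, fun t ht => (hΦΘ t ht).2.2⟩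
  · exact hasDerivWithinAt_of_integral hyc hix ht
  · exact hasDerivWithinAt_of_integral (F := fun t => fullRhs r (a t) (Φ t) (Θ t) + vOp r (g t))
      (hRc.add hVg) hiy ht
  · apply vOp_injective (by linarith : 0 ≤ r + 1)
    simpa using hix 0 h0
  · apply vOp_injective hr0
    simpa using hiy 0 h0

end

section

variable {r M M' L c₁ T : ℝ} {a : ℝ → Fields} {g Φ Θ : ℝ → Seq}

/-! ### Uniqueness -/

lemma fullRhs_sub (r : ℝ) (b : Fields) (Φ Θ Φ' Θ' : Seq) :
    fullRhs r b Φ Θ - fullRhs r b Φ' Θ' = fullRhs r b (Φ - Φ') (Θ - Θ') := by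
  rw [fullRhs, fullRhs, rhs_sub, fullRhs]
  congr 1
  · funext i; simp
  · funext i j; simp

lemma FullSol.sub {g' Φ' Θ' : ℝ → Seq} (h : FullSol r a T g Φ Θ) (h' : FullSol r a T g' Φ' Θ') :
    FullSol r a T (g - g') (Φ - Φ') (Θ - Θ') := by
  obtain ⟨B, hB⟩ := h.bdd
  obtain ⟨B', hB'⟩ := h'.bdd
  refine ⟨⟨B + B', fun t ht => ⟨?_, ?_⟩⟩, fun t ht => ?_, fun t ht => ?_⟩
  · exact (norm_sub_le _ _).trans (add_le_add (hB t ht).1 (hB' t ht).1)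
  · exact (norm_sub_le _ _).trans (add_le_add (hB t ht).2 (hB' t ht).2)
  · convert! (h.dx t ht).sub (h'.dx t ht) using 1
    · funext τ; simp
    · simp
  · convert! (h.dy t ht).sub (h'.dy t ht) using 1
    · funext τ; simp
    · rw [Pi.sub_apply, Pi.sub_apply, Pi.sub_apply, ← fullRhs_sub, map_sub]
      abel

lemma FullSol.cx (h : FullSol r a T g Φ Θ) : ContinuousOn (fun t => vOp (r + 1) (Φ t)) (Icc 0 T) :=
  fun t ht => (h.dx t ht).continuousWithinAt

lemma FullSol.cy (h : FullSol r a T g Φ Θ) : ContinuousOn (fun t => vOp r (Θ t)) (Icc 0 T) :=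
  fun t ht => (h.dy t ht).continuousWithinAt

/-- A solution of the limit system solves the regularised one up to a small error. -/
lemma FullSol.solves (h : FullSol r a T g Φ Θ) (N : ℝ) :
    Solves a (dOp N) T (fun t => fullRhs r (a t) (Φ t) (Θ t) -
      (a t).coef.rhs (grad (dOp N) (vOp r (Θ t))) (hess (dOp N) (vOp (r + 1) (Φ t))) + vOp r (g t))
      (fun t => vOp (r + 1) (Φ t)) (fun t => vOp r (Θ t)) := by
  refine ⟨h.dx, fun t ht => (h.dy t ht).congr_deriv ?_⟩
  have key : ∀ A B C : Seq, A + B = C + (A - C + B) := fun A B C => by abel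
  exact key _ _ _

lemma FullSol.eq_zero (ha : Family r M M' L c₁ a) (h : FullSol r a T 0 Φ Θ) (h1 : Φ 0 = 0)
    (h2 : Θ 0 = 0) {t : ℝ} (ht : t ∈ Icc 0 T) : Φ t = 0 ∧ Θ t = 0 := by
  have hr := ha.hr
  obtain ⟨B, hB⟩ := h.bdd
  have hRc := ha.continuousOn_fullRhs hB h.cx h.cy
  have hle : ∀ m : ℕ, ‖vOp (r + 1) (Φ t)‖ ^ 2 + ‖vOp r (Θ t)‖ ^ 2 ≤ coerConst c₁ L *
      (T * (rhsConst L * (2 * ((((m : ℝ) + 1) / 2) ^ (1 - r) * B))) ^ 2) *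
      exp (slopeConst (opConst M) M' * coerConst c₁ (opConst M) * T) := by
    intro m
    have hs := h.solves (m + 1)
    refine ha.norm_sq_le_of_small (by simp) hs ?_ (fun t ht => ?_) (by simp [h1]) (by simp [h2]) ht
    · exact (hRc.sub (ha.continuousOn_rhs_grad _ h.cx h.cy)).add
        (by simpa using continuousOn_const)
    · simpa using norm_fullRhs_sub_le (by linarith) ha.hL (ha.sup t)
        (by simp : (1 : ℝ) ≤ m + 1) (hB t ht).1 (hB t ht).2
  have hlim := ((((tendsto_regularisation_error (r := r) (by linarith) (rhsConst L) B).pow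
    2).const_mul T).const_mul (coerConst c₁ L)).mul_const
      (exp (slopeConst (opConst M) M' * coerConst c₁ (opConst M) * T))
  have h3 := ge_of_tendsto' hlim hle
  norm_num at h3
  have h4 := sq_nonneg ‖vOp (r + 1) (Φ t)‖
  have h5 := sq_nonneg ‖vOp r (Θ t)‖
  have h6 : ‖vOp (r + 1) (Φ t)‖ = 0 := by
    apply pow_eq_zero_iff two_ne_zero |>.1; linarith
  have h7 : ‖vOp r (Θ t)‖ = 0 := by
    apply pow_eq_zero_iff two_ne_zero |>.1; linarith
  constructor
  · apply vOp_injective (by linarith : 0 ≤ r + 1)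
    rw [norm_eq_zero.1 h6, map_zero]
  · apply vOp_injective (by linarith : 0 ≤ r)
    rw [norm_eq_zero.1 h7, map_zero]

/-! ### Strong continuity -/

/-- Strong convergence of Fourier multipliers. -/
lemma tendsto_diag {m : ℕ → Freq → ℂ} {m' : Freq → ℂ} {C : ℝ} (hm : ∀ n k, ‖m n k‖ ≤ C)
    (h : ∀ k, Tendsto (fun n => m n k) atTop (𝓝 (m' k))) (z : Seq) :
    Tendsto (fun n => diag (m n) z) atTop (𝓝 (diag m' z)) := by
  have hm' : ∀ k, ‖m' k‖ ≤ C := fun k => le_of_tendsto (h k).norm (.of_forall fun n => hm n k)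
  rw [tendsto_iff_norm_sub_tendsto_zero]
  have h1 : Tendsto (fun n => ‖diag (m n) z - diag m' z‖ ^ 2) atTop (𝓝 0) := by
    simp only [Seq.norm_sq]
    have h2 : (0 : ℝ) = ∑' k : Freq, (0 : ℝ) := tsum_zero.symm
    rw [h2]
    refine tendsto_tsum_of_dominated_convergence (bound := fun k => (2 * C) ^ 2 * ‖z k‖ ^ 2)
      (z.summable_sq.mul_left _) (fun k => ?_) (.of_forall fun n k => ?_)
    · have h3 : Tendsto (fun n => ‖(m n k - m' k) * z k‖ ^ 2) atTop (𝓝 (‖(m' k - m' k) * z k‖ ^ 2)) :=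
        ((((h k).sub_const _).mul_const _).norm).pow 2
      simp only [sub_self, zero_mul, norm_zero] at h3
      norm_num at h3
      refine (h3.congr fun n => ?_)
      rw [lp.coeFn_sub, Pi.sub_apply, diag_apply ⟨C, hm n⟩, diag_apply ⟨C, hm'⟩, ← sub_mul,
        norm_mul]
    · rw [lp.coeFn_sub, Pi.sub_apply, diag_apply ⟨C, hm n⟩, diag_apply ⟨C, hm'⟩, ← sub_mul,
        norm_mul, norm_of_nonneg (by positivity), mul_pow]
      gcongr
      have := norm_sub_le (m n k) (m' k)
      linarith [hm n k, hm' k]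
  have h4 := h1.sqrt
  simpa using h4

lemma tendsto_trunc (k : Freq) : Tendsto (fun n : ℕ => trunc ((n : ℝ) + 1) k) atTop (𝓝 (jap k)) := by
  refine tendsto_const_nhds.congr' ?_
  have : Tendsto (fun n : ℕ => (n : ℝ) + 1) atTop atTop :=
    tendsto_atTop_add_const_right _ _ tendsto_natCast_atTop_atTop
  filter_upwards [this.eventually_ge_atTop (jap k)] with n hn
  rw [trunc, min_eq_left hn]

lemma norm_trunc_jap_le {n : ℝ} (hn : 1 ≤ n) (hr : 0 ≤ r) (k : Freq) :
    ‖((trunc n k ^ r * jap k ^ (-r) : ℝ) : ℂ)‖ ≤ 1 := by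
  have hj := jap_pos k
  have ht := trunc_pos hn k
  rw [norm_real, norm_of_nonneg (by positivity)]
  calc _ ≤ jap k ^ r * jap k ^ (-r) := by gcongr; exact trunc_le_jap n k
    _ = 1 := by rw [← rpow_add hj]; simp

lemma lamOp_vOp {n : ℝ} (hn : 1 ≤ n) (hr : 0 ≤ r) (z : Seq) :
    lamOp r n (vOp r z) = diag (fun k => ((trunc n k ^ r * jap k ^ (-r) : ℝ) : ℂ)) z := by
  ext k
  rw [lamOp_apply hr hn, vOp_apply hr, diag_apply ⟨1, norm_trunc_jap_le hn hr⟩]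
  push_cast; ring

lemma tendsto_lamOp_vOp (hr : 0 ≤ r) (z : Seq) :
    Tendsto (fun n : ℕ => lamOp r ((n : ℝ) + 1) (vOp r z)) atTop (𝓝 z) := by
  have h := tendsto_diag (m := fun (n : ℕ) k => ((trunc ((n : ℝ) + 1) k ^ r * jap k ^ (-r) : ℝ) : ℂ))
    (m' := fun _ => 1) (C := 1) (fun n k => norm_trunc_jap_le (by simp) hr k) (fun k => ?_) z
  · rw [diag_one] at h
    refine h.congr fun n => (lamOp_vOp (by simp) hr z).symm
  · have hj := jap_pos k
    have h1 : Tendsto (fun n : ℕ => trunc ((n : ℝ) + 1) k ^ r * jap k ^ (-r)) atTop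
        (𝓝 (jap k ^ r * jap k ^ (-r))) :=
      ((tendsto_trunc k).rpow_const (Or.inl hj.ne')).mul_const _
    rw [← rpow_add hj, add_neg_cancel, rpow_zero] at h1
    exact_mod_cast (Complex.continuous_ofReal.tendsto 1).comp h1

lemma vOp_vOp {σ τ : ℝ} (hσ : 0 ≤ σ) (hτ : 0 ≤ τ) (z : Seq) : vOp σ (vOp τ z) = vOp (σ + τ) z := by
  ext k
  have hj := jap_pos k
  rw [vOp_apply hσ, vOp_apply hτ, vOp_apply (by positivity), ← mul_assoc, ← Complex.ofReal_mul,
    ← rpow_add hj]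
  congr 3; ring

/-- Weak continuity. -/
lemma continuousOn_inner_of_bdd {σ : ℝ} (hσ : 0 ≤ σ) {Ψ : ℝ → Seq} {s : Set ℝ} {B : ℝ}
    (hB : ∀ t ∈ s, ‖Ψ t‖ ≤ B) (hc : ContinuousOn (fun t => vOp σ (Ψ t)) s) (v : Seq) :
    ContinuousOn (fun t => inner ℝ (Ψ t) v) s := by
  have hv := (tendsto_iff_norm_sub_tendsto_zero.1 (tendsto_lamOp_vOp hσ v)).const_mul B
  rw [mul_zero] at hv
  have hsymm : ∀ (x y : Seq), inner ℝ (vOp σ x) y = inner ℝ x (vOp σ y) :=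
    fun x y => inner_diag_real ⟨1, norm_vsym_le hσ⟩ x y
  intro t ht
  have key : ∀ m : ℕ, ∀ τ ∈ s, ‖inner ℝ (Ψ τ) v -
      inner ℝ (vOp σ (Ψ τ)) (lamOp σ ((m : ℝ) + 1) v)‖ ≤
      B * ‖lamOp σ ((m : ℝ) + 1) (vOp σ v) - v‖ := by
    intro m τ hτ
    have e : vOp σ (lamOp σ ((m : ℝ) + 1) v) = lamOp σ ((m : ℝ) + 1) (vOp σ v) :=
      diag_comm ⟨1, norm_vsym_le hσ⟩ (isBdd_lam hσ (by simp)) v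
    rw [hsymm, e, ← inner_sub_right, norm_sub_rev]
    refine (norm_inner_le_norm _ _).trans ?_
    gcongr
    exact hB τ hτ
  refine tendsto_of_approx hv
    (u := fun m t => inner ℝ (vOp σ (Ψ t)) (lamOp σ ((m : ℝ) + 1) v))
    (fun m => ?_) (fun m => ?_) fun m => key m t ht
  · filter_upwards [self_mem_nhdsWithin] with τ hτ using key m τ hτ
  · exact Tendsto.inner (𝕜 := ℝ) (hc t ht) tendsto_const_nhds

/-- The bilinear form of the energy. -/
def Coef.bilin (c : Coef Seq) (p : Fin 2 → Seq) (x y : Seq) (p' : Fin 2 → Seq) (x' y' : Seq) : ℝ :=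
  inner ℝ (y + contract c.W p) (y' + contract c.W p') +
    ∑ m, eps m * inner ℝ (contract (c.B m) p) (contract (c.B m) p') + inner ℝ x x'

lemma Coef.energy_sub (c : Coef Seq) (p p' : Fin 2 → Seq) (x x' y y' : Seq) :
    c.energy (p - p') (x - x') (y - y') =
      c.energy p x y - 2 * c.bilin p x y p' x' y' + c.energy p' x' y' := by
  have e1 : y - y' + (contract c.W p - contract c.W p') =
      (y + contract c.W p) - (y' + contract c.W p') := by abel
  simp only [Coef.energy, Coef.bilin, contract_sub, e1, norm_sub_sq_real, sum_univ_three]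
  ring

lemma Coef.bilin_self (c : Coef Seq) (p : Fin 2 → Seq) (x y : Seq) :
    c.bilin p x y p x y = c.energy p x y := by
  simp only [Coef.energy, Coef.bilin, real_inner_self_eq_norm_sq]

/-- The gradient of the weighted unknown. -/
def gradV (z : Seq) : Fin 2 → Seq := fun i => dV 1 i z

lemma sizeSq_gradV (z w : Seq) : sizeSq (gradV z) (vOp 1 z) w = ‖z‖ ^ 2 + ‖w‖ ^ 2 := by
  have h : ‖vOp 1 z‖ ^ 2 + (‖dV 1 0 z‖ ^ 2 + ‖dV 1 1 z‖ ^ 2) = ‖z‖ ^ 2 := by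
    rw [Seq.norm_sq, Seq.norm_sq, Seq.norm_sq, Seq.norm_sq,
      ← (dV 1 0 z).summable_sq.tsum_add (dV 1 1 z).summable_sq,
      ← (vOp 1 z).summable_sq.tsum_add ((dV 1 0 z).summable_sq.add (dV 1 1 z).summable_sq)]
    refine tsum_congr fun k => ?_
    have hj := jap_pos k
    rw [norm_vOp_apply zero_le_one, dV_apply le_rfl, dV_apply le_rfl]
    simp only [norm_mul, norm_I, mul_one, norm_real, norm_eq_abs, mul_pow,
      sq_abs]
    rw [Real.rpow_neg_one]
    have : (jap k)⁻¹ ^ 2 * jap k ^ 2 = 1 := by field_simp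
    rw [jap_sq, sum_univ_two] at this
    linear_combination ‖z k‖ ^ 2 * this
  unfold sizeSq gradV
  linarith

lemma norm_dsym_jap_le (N : ℝ) (i : Fin 2) (k : Freq) :
    ‖((dsym N i k * jap k ^ (-(1 : ℝ)) : ℝ) : ℂ) * I‖ ≤ 1 := by
  have hj := jap_pos k
  rw [norm_mul, norm_I, mul_one, norm_real, norm_eq_abs, abs_mul,
    abs_of_pos (a := jap k ^ (-(1 : ℝ))) (by positivity), Real.rpow_neg_one,
    ← div_eq_mul_inv, div_le_one hj]
  exact abs_dsym_le_jap _ i k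

lemma exists_dOp_vOp {N σ : ℝ} (hN : 1 ≤ N) (hσ : 1 ≤ σ) (i : Fin 2) (z : Seq) :
    ∃ u, dOp N i (vOp σ z) = vOp (σ - 1) u ∧ ‖u‖ ≤ ‖z‖ := by
  have hb := norm_dsym_jap_le N i
  refine ⟨diag (fun k => ((dsym N i k * jap k ^ (-(1 : ℝ)) : ℝ) : ℂ) * I) z, ?_,
    (norm_diag_apply_le hb z).trans_eq (one_mul _)⟩
  ext k
  have hj := jap_pos k
  rw [dOp_apply hN, vOp_apply (by linarith), vOp_apply (by linarith), diag_apply ⟨1, hb⟩]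
  have : jap k ^ (-σ) = jap k ^ (-(σ - 1)) * jap k ^ (-(1 : ℝ)) := by
    rw [← rpow_add hj]; congr 1; ring
  rw [this]; push_cast; ring

/-- The energy of the weighted unknowns is Lipschitz in time. -/
lemma FullSol.exists_lipschitz (ha : Family r M M' L c₁ a) (hg : ContinuousOn g (Icc 0 T))
    (h : FullSol r a T g Φ Θ) : ∃ K, ∀ t₁ ∈ Icc 0 T, ∀ t₂ ∈ Icc 0 T, t₁ ≤ t₂ →
      |(a t₂).coef.energy (gradV (Φ t₂)) (vOp 1 (Φ t₂)) (Θ t₂) -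
        (a t₁).coef.energy (gradV (Φ t₁)) (vOp 1 (Φ t₁)) (Θ t₁)| ≤ K * (t₂ - t₁) := by
  have hr := ha.hr
  have hr0 : 0 ≤ r := by linarith
  obtain ⟨B, hB⟩ := h.bdd
  obtain ⟨Bg, hBg⟩ := isCompact_Icc.exists_bound_of_continuousOn hg
  have hRc := ha.continuousOn_fullRhs hB h.cx h.cy
  set ν : ℕ → ℝ := fun n => (n : ℝ) + 1 with hν
  set Nn : ℕ → ℝ := fun n => 2 * ν n ^ (r / (r - 1)) with hNn
  have hν1 : ∀ n, 1 ≤ ν n := fun n => by simp [hν]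
  have hN1 : ∀ n, 1 ≤ Nn n := fun n => by
    have := Real.one_le_rpow (hν1 n) (div_nonneg hr0 (by linarith : 0 ≤ r - 1))
    simp only [hNn]; linarith
  have hNp : ∀ n, (Nn n / 2) ^ (1 - r) * ν n ^ r = 1 := fun n => by
    have h0 : 0 < ν n := by linarith [hν1 n]
    have h1 : r - 1 ≠ 0 := by linarith
    simp only [hNn]
    rw [mul_div_cancel_left₀ _ (two_ne_zero), ← rpow_mul h0.le, ← rpow_add h0]
    have : r / (r - 1) * (1 - r) + r = 0 := by field_simp; ring
    rw [this, rpow_zero]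
  have hN_lim : Tendsto Nn atTop atTop := by
    have h1 : Tendsto ν atTop atTop := tendsto_atTop_add_const_right _ _ tendsto_natCast_atTop_atTop
    exact ((tendsto_rpow_atTop (div_pos (by linarith) (by linarith))).comp h1).const_mul_atTop
      (by norm_num)
  set Λ : ℕ → Seq →L[ℝ] Seq := fun n => lamOp r (ν n)
  set x : ℝ → Seq := fun t => vOp (r + 1) (Φ t) with hx
  set y : ℝ → Seq := fun t => vOp r (Θ t)
  have hk := remConst_nonneg hr ha.hM
  have hrc : 0 ≤ rhsConst L := by have := ha.hL; unfold rhsConst; positivity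
  -- the weighted remainder
  set R : ℕ → ℝ → Seq := fun n t => Λ n (fullRhs r (a t) (Φ t) (Θ t) + vOp r (g t)) -
    (a t).coef.rhs (grad (dOp (Nn n)) (Λ n (y t))) (hess (dOp (Nn n)) (Λ n (x t))) with hR
  have hsol : ∀ n, Solves a (dOp (Nn n)) T (R n) (fun t => Λ n (x t)) (fun t => Λ n (y t)) := by
    intro n
    refine ⟨fun t ht => (Λ n).hasFDerivAt.comp_hasDerivWithinAt t (h.dx t ht), fun t ht => ?_⟩
    convert! (Λ n).hasFDerivAt.comp_hasDerivWithinAt t (h.dy t ht) using 1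
    simp only [hR]
    abel
  have hRcont : ∀ n, ContinuousOn (R n) (Icc 0 T) := by
    intro n
    refine ((Λ n).continuous.comp_continuousOn (hRc.add
      ((vOp r).continuous.comp_continuousOn hg))).sub (ha.continuousOn_rhs_grad _ ?_ ?_)
    · exact (Λ n).continuous.comp_continuousOn h.cx
    · exact (Λ n).continuous.comp_continuousOn h.cy
  set KR := rhsConst L * (2 * B) + remConst r M * (B + B) + Bg
  have hRb : ∀ n, ∀ t ∈ Icc 0 T, ‖R n t‖ ≤ KR := by
    intro n t ht
    have hBt := hB t ht
    have hB0 : 0 ≤ B := (norm_nonneg _).trans hBt.1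
    have hq : ∀ i, ∃ u, grad (dOp (Nn n)) (y t) i = vOp (r - 1) u ∧ ‖u‖ ≤ B := fun i => by
      obtain ⟨u, hu, hn⟩ := exists_dOp_vOp (hN1 n) (by linarith : 1 ≤ r) i (Θ t)
      exact ⟨u, hu, hn.trans hBt.2⟩
    have hpp : ∀ i j, ∃ u, hess (dOp (Nn n)) (x t) i j = vOp (r - 1) u ∧ ‖u‖ ≤ B := fun i j => by
      obtain ⟨u, hu, hn⟩ := exists_dOp_vOp (hN1 n) (by linarith : 1 ≤ r + 1) j (Φ t)
      rw [add_sub_cancel_right] at hu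
      obtain ⟨u', hu', hn'⟩ := exists_dOp_vOp (hN1 n) (by linarith : 1 ≤ r) i u
      exact ⟨u', by rw [← hu', ← hu]; rfl, hn'.trans (hn.trans hBt.1)⟩
    have hcomm := norm_comm_rhs_le hr ha.hM (ha.sob t) (hν1 n) hq hpp
    have e1 : (fun i => lamOp r (ν n) (grad (dOp (Nn n)) (y t) i)) =
        grad (dOp (Nn n)) (Λ n (y t)) := by
      funext i; exact lamOp_dOp (hN1 n) (hν1 n) hr0 _ _
    have e2 : (fun i j => lamOp r (ν n) (hess (dOp (Nn n)) (x t) i j)) =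
        hess (dOp (Nn n)) (Λ n (x t)) := by
      funext i j
      simp only [hess]
      rw [lamOp_dOp (hN1 n) (hν1 n) hr0, lamOp_dOp (hN1 n) (hν1 n) hr0]
    rw [e1, e2] at hcomm
    have herr := norm_fullRhs_sub_le (r := r) (by linarith) ha.hL (ha.sup t) (hN1 n) hBt.1 hBt.2
    have hΛn : ∀ z, ‖Λ n z‖ ≤ ν n ^ r * ‖z‖ := fun z => norm_diag_apply_le (fun k => by
      have ht := trunc_pos (hν1 n) k
      rw [norm_real, norm_of_nonneg (by positivity)]
      gcongr
      exact trunc_le _ k) z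
    have h1 : ‖Λ n (fullRhs r (a t) (Φ t) (Θ t) -
        (a t).coef.rhs (grad (dOp (Nn n)) (y t)) (hess (dOp (Nn n)) (x t)))‖ ≤
        rhsConst L * (2 * B) := by
      refine (hΛn _).trans ?_
      have h0 : 0 ≤ ν n ^ r := Real.rpow_nonneg (by linarith [hν1 n]) _
      calc _ ≤ ν n ^ r * (rhsConst L * (2 * ((Nn n / 2) ^ (1 - r) * B))) := by gcongr
        _ = rhsConst L * (2 * B) * ((Nn n / 2) ^ (1 - r) * ν n ^ r) := by ring
        _ = _ := by rw [hNp, mul_one]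
    have h2 : ‖Λ n (vOp r (g t))‖ ≤ Bg := (norm_lamOp_vOp_le (hν1 n) hr0 _).trans (hBg t ht)
    have e : R n t = Λ n (fullRhs r (a t) (Φ t) (Θ t) -
        (a t).coef.rhs (grad (dOp (Nn n)) (y t)) (hess (dOp (Nn n)) (x t))) +
        (Λ n ((a t).coef.rhs (grad (dOp (Nn n)) (y t)) (hess (dOp (Nn n)) (x t))) -
        (a t).coef.rhs (grad (dOp (Nn n)) (Λ n (y t))) (hess (dOp (Nn n)) (Λ n (x t)))) +
        Λ n (vOp r (g t)) := by
      simp only [hR, map_add, map_sub]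
      abel
    rw [e]
    exact (norm_add_le _ _).trans (add_le_add ((norm_add_le _ _).trans (add_le_add h1 hcomm)) h2)
  -- boundedness of the weighted size
  have hdΛ : ∀ n i t, dOp (Nn n) i (Λ n (x t)) = diag (fun k =>
      ((dsym (Nn n) i k * jap k ^ (-(1 : ℝ)) : ℝ) : ℂ) * I *
        ((trunc (ν n) k ^ r * jap k ^ (-r) : ℝ) : ℂ)) (Φ t) ∧ ∀ k,
      ‖((dsym (Nn n) i k * jap k ^ (-(1 : ℝ)) : ℝ) : ℂ) * I *
        ((trunc (ν n) k ^ r * jap k ^ (-r) : ℝ) : ℂ)‖ ≤ 1 := by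
    intro n i t
    have hb : ∀ k, ‖((dsym (Nn n) i k * jap k ^ (-(1 : ℝ)) : ℝ) : ℂ) * I *
        ((trunc (ν n) k ^ r * jap k ^ (-r) : ℝ) : ℂ)‖ ≤ 1 := fun k => by
      have hj := jap_pos k
      have h1 := norm_trunc_jap_le (hν1 n) hr0 k
      rw [norm_mul]
      exact mul_le_one₀ (norm_dsym_jap_le _ i k) (norm_nonneg _) h1
    refine ⟨?_, hb⟩
    ext k
    have hj := jap_pos k
    rw [dOp_apply (hN1 n), lamOp_apply hr0 (hν1 n), diag_apply ⟨1, hb⟩]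
    simp only [hx]
    rw [vOp_apply (by linarith)]
    have : jap k ^ (-(r + 1)) = jap k ^ (-r) * jap k ^ (-(1 : ℝ)) := by
      rw [← rpow_add hj]; congr 1; ring
    rw [this]; push_cast; ring
  have hxB : ∀ n, ∀ t ∈ Icc 0 T, ‖Λ n (x t)‖ ≤ B := by
    intro n t ht
    have e : x t = vOp r (vOp 1 (Φ t)) := (vOp_vOp hr0 zero_le_one _).symm
    rw [e]
    exact (norm_lamOp_vOp_le (hν1 n) hr0 _).trans ((norm_vOp_le zero_le_one _).trans (hB t ht).1)
  have hyB : ∀ n, ∀ t ∈ Icc 0 T, ‖Λ n (y t)‖ ≤ B := fun n t ht =>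
    (norm_lamOp_vOp_le (hν1 n) hr0 _).trans (hB t ht).2
  have hdB : ∀ n i, ∀ t ∈ Icc 0 T, ‖dOp (Nn n) i (Λ n (x t))‖ ≤ B := fun n i t ht => by
    obtain ⟨e, hb⟩ := hdΛ n i t
    rw [e]
    have := norm_diag_apply_le hb (Φ t)
    rw [one_mul] at this
    exact this.trans (hB t ht).1
  have hsz : ∀ n, ∀ t ∈ Icc 0 T,
      sizeSq (grad (dOp (Nn n)) (Λ n (x t))) (Λ n (x t)) (Λ n (y t)) ≤ 4 * B ^ 2 := by
    intro n t ht
    have := pow_le_pow_left₀ (norm_nonneg _) (hxB n t ht) 2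
    have := pow_le_pow_left₀ (norm_nonneg _) (hyB n t ht) 2
    have := pow_le_pow_left₀ (norm_nonneg _) (hdB n 0 t ht) 2
    have := pow_le_pow_left₀ (norm_nonneg _) (hdB n 1 t ht) 2
    simp only [sizeSq, grad]
    linarith
  have hs0 := slopeConst_nonneg (opConst_nonneg ha.hM) ha.hM'
  set K := slopeConst (opConst M) M' * (4 * B ^ 2) + KR ^ 2 with hK
  have hlip : ∀ n, ∀ t₁ ∈ Icc 0 T, ∀ t₂ ∈ Icc 0 T, t₁ ≤ t₂ →
      |(a t₂).coef.energy (grad (dOp (Nn n)) (Λ n (x t₂))) (Λ n (x t₂)) (Λ n (y t₂)) -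
        (a t₁).coef.energy (grad (dOp (Nn n)) (Λ n (x t₁))) (Λ n (x t₁)) (Λ n (y t₁))| ≤
        K * (t₂ - t₁) := by
    intro n t₁ h1 t₂ h2 h12
    have hsub : Icc t₁ t₂ ⊆ Icc 0 T := Icc_subset_Icc h1.1 h2.2
    refine (abs_energy_sub_le_integral (opConst_nonneg ha.hM) ha.hM'
      (fun t => (ha.sob t).coef hr ha.hM (hN1 n)) (fun t t' => (ha.lip t t').coef) (hRcont n)
      (hsol n).dx (hsol n).dy h1.1 h12 h2.2).trans ?_
    have h3 : ∫ _ in t₁..t₂, K = K * (t₂ - t₁) := by simp; ring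
    rw [← h3]
    have hcs := continuousOn_sizeSq (D := dOp (Nn n)) (hsol n).cx (hsol n).cy
    refine intervalIntegral.integral_mono_on h12 ?_ intervalIntegrable_const fun τ hτ => ?_
    · refine ContinuousOn.intervalIntegrable ?_
      rw [uIcc_of_le h12]
      exact ((hcs.const_mul _).add ((hRcont n).norm.pow 2)).mono hsub
    · have hτ' := hsub hτ
      have b1 := hsz n τ hτ'
      have b2 := pow_le_pow_left₀ (norm_nonneg _) (hRb n τ hτ') 2
      have := mul_le_mul_of_nonneg_left b1 hs0
      simp only [hK]
      linarith
  have hlim : ∀ t, Tendsto (fun n => (a t).coef.energy (grad (dOp (Nn n)) (Λ n (x t))) (Λ n (x t))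
      (Λ n (y t))) atTop (𝓝 ((a t).coef.energy (gradV (Φ t)) (vOp 1 (Φ t)) (Θ t))) := by
    intro t
    have l1 : Tendsto (fun n => Λ n (x t)) atTop (𝓝 (vOp 1 (Φ t))) := by
      have e : x t = vOp r (vOp 1 (Φ t)) := (vOp_vOp hr0 zero_le_one _).symm
      rw [e]
      exact tendsto_lamOp_vOp hr0 _
    have l2 : Tendsto (fun n => Λ n (y t)) atTop (𝓝 (Θ t)) := tendsto_lamOp_vOp hr0 _
    have l3 : ∀ i, Tendsto (fun n => dOp (Nn n) i (Λ n (x t))) atTop (𝓝 (dV 1 i (Φ t))) := by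
      intro i
      have e : ∀ n, dOp (Nn n) i (Λ n (x t)) = _ := fun n => (hdΛ n i t).1
      simp only [e]
      refine tendsto_diag (C := 1) (fun n k => (hdΛ n i t).2 k) (fun k => ?_) _
      have hj := jap_pos k
      have t1 : Tendsto (fun n => trunc (ν n) k ^ r * jap k ^ (-r)) atTop
          (𝓝 (jap k ^ r * jap k ^ (-r))) :=
        ((tendsto_trunc k).rpow_const (Or.inl hj.ne')).mul_const _
      rw [← rpow_add hj, add_neg_cancel, rpow_zero] at t1
      have t2 : Tendsto (fun n => dsym (Nn n) i k * jap k ^ (-(1 : ℝ))) atTop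
          (𝓝 (xi i k * jap k ^ (-(1 : ℝ)))) := by
        refine tendsto_const_nhds.congr' ?_
        filter_upwards [(hN_lim.atTop_div_const (by norm_num : (0 : ℝ) < 2)).eventually_ge_atTop
          (jap k)] with n hn
        rw [dsym_eq (hN1 n) i hn]
      have t3 := (Complex.continuous_ofReal.tendsto _).comp t1
      have t4 := (((Complex.continuous_ofReal.tendsto _).comp t2).mul_const I).mul t3
      simpa [comp_def] using t4
    simp only [Coef.energy, contract, grad, gradV]
    refine ((((l2.add (tendsto_finsetSum _ fun i _ =>
      (((a t).coef.W i).continuous.tendsto _).comp (l3 i))).norm).pow 2).add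
      (tendsto_finsetSum _ fun m _ => Tendsto.const_mul _ (((tendsto_finsetSum _ fun i _ =>
      (((a t).coef.B m i).continuous.tendsto _).comp (l3 i)).norm).pow 2))).add ((l1.norm).pow 2)
  refine ⟨K, fun t₁ h1 t₂ h2 h12 => ?_⟩
  exact le_of_tendsto' ((hlim t₂).sub (hlim t₁)).abs fun n => hlip n t₁ h1 t₂ h2 h12

/-- Strong continuity of the weighted unknowns. -/
lemma FullSol.continuousOn (ha : Family r M M' L c₁ a) (hg : ContinuousOn g (Icc 0 T))
    (h : FullSol r a T g Φ Θ) : ContinuousOn Φ (Icc 0 T) ∧ ContinuousOn Θ (Icc 0 T) := by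
  have hr := ha.hr
  have hr0 : 0 ≤ r := by linarith
  obtain ⟨B, hB⟩ := h.bdd
  obtain ⟨K, hK⟩ := h.exists_lipschitz ha hg
  have hwΦ := fun v => continuousOn_inner_of_bdd (by linarith : 0 ≤ r + 1) (fun t ht => (hB t ht).1)
    h.cx v
  have hwΘ := fun v => continuousOn_inner_of_bdd hr0 (fun t ht => (hB t ht).2) h.cy v
  have key : ∀ t₀ ∈ Icc 0 T, Tendsto (fun t => ‖Φ t - Φ t₀‖ ^ 2 + ‖Θ t - Θ t₀‖ ^ 2)
      (𝓝[Icc 0 T] t₀) (𝓝 0) := by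
    intro t₀ ht₀
    set c := (a t₀).coef with hc
    set E : ℝ → ℝ := fun t => (a t).coef.energy (gradV (Φ t)) (vOp 1 (Φ t)) (Θ t) with hE
    have hE1 : Tendsto E (𝓝[Icc 0 T] t₀) (𝓝 (E t₀)) := by
      rw [tendsto_iff_norm_sub_tendsto_zero]
      have hlim : Tendsto (fun t => K * |t - t₀|) (𝓝[Icc 0 T] t₀) (𝓝 0) :=
        (Continuous.tendsto' (by fun_prop) _ _ (by simp)).mono_left nhdsWithin_le_nhds
      refine squeeze_zero' (.of_forall fun _ => norm_nonneg _) ?_ hlim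
      filter_upwards [self_mem_nhdsWithin] with t ht
      rcases le_total t t₀ with htt | htt
      · rw [norm_eq_abs, abs_sub_comm, abs_sub_comm t, abs_of_nonneg (a := t₀ - t) (by linarith)]
        exact hK t ht t₀ ht₀ htt
      · rw [norm_eq_abs, abs_of_nonneg (a := t - t₀) (by linarith)]
        exact hK t₀ ht₀ t ht htt
    have hE2 : Tendsto (fun t => c.energy (gradV (Φ t)) (vOp 1 (Φ t)) (Θ t) - E t)
        (𝓝[Icc 0 T] t₀) (𝓝 0) := by
      have hlim : Tendsto (fun t => M' * |t₀ - t| * (varConst (opConst M) * (2 * B ^ 2)))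
          (𝓝[Icc 0 T] t₀) (𝓝 0) :=
        (Continuous.tendsto' (by fun_prop) _ _ (by simp)).mono_left nhdsWithin_le_nhds
      refine squeeze_zero_norm' ?_ hlim
      filter_upwards [self_mem_nhdsWithin] with t ht
      have hM' := ha.hM'
      have hv : 0 ≤ varConst (opConst M) := by
        have := opConst_nonneg ha.hM
        unfold varConst; positivity
      refine (abs_energy_sub_le (opConst_nonneg ha.hM) (by positivity)
        ((ha.sob t₀).sup hr ha.hM).coef ((ha.sob t).sup hr ha.hM).coef (ha.lip t₀ t).coef _ _ _).trans ?_
      rw [sizeSq_gradV]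
      have := pow_le_pow_left₀ (norm_nonneg _) (hB t ht).1 2
      have := pow_le_pow_left₀ (norm_nonneg _) (hB t ht).2 2
      gcongr
      linarith
    have hbil : Tendsto (fun t => c.bilin (gradV (Φ t)) (vOp 1 (Φ t)) (Θ t) (gradV (Φ t₀))
        (vOp 1 (Φ t₀)) (Θ t₀)) (𝓝[Icc 0 T] t₀) (𝓝 (E t₀)) := by
      have hadj : ∀ (A : Seq →L[ℝ] Seq) (v : Seq), ContinuousOn (fun t => inner ℝ (A (Φ t)) v)
          (Icc 0 T) := fun A v => by
        simp only [← ContinuousLinearMap.adjoint_inner_right]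
        exact hwΦ _
      have hcon : ∀ (A : Fin 2 → Seq →L[ℝ] Seq) (v : Seq),
          ContinuousOn (fun t => inner ℝ (contract A (gradV (Φ t))) v) (Icc 0 T) := fun A v => by
        simp only [contract, gradV, sum_inner]
        exact continuousOn_finsetSum _ fun i _ => hadj (A i ∘L dV 1 i) v
      have hco : ContinuousOn (fun t => c.bilin (gradV (Φ t)) (vOp 1 (Φ t)) (Θ t) (gradV (Φ t₀))
        (vOp 1 (Φ t₀)) (Θ t₀)) (Icc 0 T) := by
        simp only [Coef.bilin, inner_add_left]
        exact (((hwΘ _).add (hcon _ _)).add (continuousOn_finsetSum _ fun m _ =>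
          (hcon _ _).const_mul (eps m))).add (hadj (vOp 1) _)
      have := hco t₀ ht₀
      rw [ContinuousWithinAt, Coef.bilin_self] at this
      exact this
    have hdiff : Tendsto (fun t => coerConst c₁ L * c.energy (gradV (Φ t) - gradV (Φ t₀))
        (vOp 1 (Φ t) - vOp 1 (Φ t₀)) (Θ t - Θ t₀)) (𝓝[Icc 0 T] t₀) (𝓝 0) := by
      have h1 := ((((hE2.add hE1).sub (hbil.const_mul 2)).add_const (E t₀))).const_mul
        (coerConst c₁ L)
      have e : coerConst c₁ L * (0 + E t₀ - 2 * E t₀ + E t₀) = 0 := by ring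
      rw [e] at h1
      refine h1.congr fun t => ?_
      rw [Coef.energy_sub]
      simp only [hE, hc]
      ring
    refine squeeze_zero (fun t => by positivity) (fun t => ?_) hdiff
    have h1 := sizeSq_le_energy ha.hc₁ (ha.sup t₀).coef (gradV (Φ t - Φ t₀))
      ((ha.stable t₀).le_contract _) (vOp 1 (Φ t - Φ t₀)) (Θ t - Θ t₀)
    rw [sizeSq_gradV] at h1
    have e : gradV (Φ t - Φ t₀) = gradV (Φ t) - gradV (Φ t₀) := by
      funext i; simp [gradV]
    rw [e, map_sub] at h1
    exact h1
  have hz : ∀ z : ℝ → Seq, (∀ t t₀, ‖z t - z t₀‖ ^ 2 ≤ ‖Φ t - Φ t₀‖ ^ 2 + ‖Θ t - Θ t₀‖ ^ 2) →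
      ContinuousOn z (Icc 0 T) := fun z hz t₀ ht₀ => tendsto_iff_norm_sub_tendsto_zero.2 (by
    simpa using (squeeze_zero (fun t => sq_nonneg _) (fun t => hz t t₀) (key t₀ ht₀)).sqrt)
  exact ⟨hz Φ fun _ _ => le_add_of_nonneg_right (sq_nonneg _),
    hz Θ fun _ _ => le_add_of_nonneg_left (sq_nonneg _)⟩

end

section

variable {r M M' L c₁ T : ℝ} {a : ℝ → Fields} {g Φ Θ : ℝ → Seq}

/-! ### Square integrable sources -/

/-- Solutions of the limit system in integrated form. -/
structure MildSol (r : ℝ) (a : ℝ → Fields) (T : ℝ) (g Φ Θ : ℝ → Seq) : Prop where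
  cΦ : ContinuousOn Φ (Icc 0 T)
  cΘ : ContinuousOn Θ (Icc 0 T)
  ex : ∀ t ∈ Icc 0 T, vOp (r + 1) (Φ t) = vOp (r + 1) (Φ 0) + ∫ τ in (0 : ℝ)..t, vOp r (Θ τ)
  ey : ∀ t ∈ Icc 0 T, vOp r (Θ t) = vOp r (Θ 0) +
    ((∫ τ in (0 : ℝ)..t, fullRhs r (a τ) (Φ τ) (Θ τ)) + vOp r (∫ τ in (0 : ℝ)..t, g τ))

lemma Family.continuousOn_fullRhs' (ha : Family r M M' L c₁ a) {s : Set ℝ}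
    (hΦ : ContinuousOn Φ s) (hΘ : ContinuousOn Θ s) :
    ContinuousOn (fun t => fullRhs r (a t) (Φ t) (Θ t)) s :=
  ha.continuousOn_rhs (fun i => (dV r i).continuous.comp_continuousOn hΘ)
    fun i j => (hV (r + 1) i j).continuous.comp_continuousOn hΦ

lemma FullSol.mildSol (ha : Family r M M' L c₁ a) (hg : ContinuousOn g (Icc 0 T))
    (h : FullSol r a T g Φ Θ) : MildSol r a T g Φ Θ := by
  obtain ⟨h1, h2⟩ := h.continuousOn ha hg
  have hR := ha.continuousOn_fullRhs' h1 h2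
  have hVg : ContinuousOn (fun t => vOp r (g t)) (Icc 0 T) := (vOp r).continuous.comp_continuousOn hg
  refine ⟨h1, h2, fun t ht => integral_of_hasDerivWithinAt h.cy h.dx ht, fun t ht => ?_⟩
  have hsub : uIcc 0 t ⊆ Icc 0 T := by
    rw [uIcc_of_le ht.1]; exact Icc_subset_Icc le_rfl ht.2
  have h3 := integral_of_hasDerivWithinAt (F := fun t => fullRhs r (a t) (Φ t) (Θ t) + vOp r (g t))
    (hR.add hVg) h.dy ht
  rw [h3, intervalIntegral.integral_add (hR.mono hsub).intervalIntegrable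
    (hVg.mono hsub).intervalIntegrable,
    intervalIntegral_comp_comm _ (hg.mono hsub).intervalIntegrable]

lemma bdd_of_continuousOn (hΦ : ContinuousOn Φ (Icc 0 T)) (hΘ : ContinuousOn Θ (Icc 0 T)) :
    ∃ B, ∀ t ∈ Icc 0 T, ‖Φ t‖ ≤ B ∧ ‖Θ t‖ ≤ B := by
  obtain ⟨B, hB⟩ := isCompact_Icc.exists_bound_of_continuousOn hΦ
  obtain ⟨B', hB'⟩ := isCompact_Icc.exists_bound_of_continuousOn hΘ
  exact ⟨max B B', fun t ht => ⟨(hB t ht).trans (le_max_left _ _),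
    (hB' t ht).trans (le_max_right _ _)⟩⟩

lemma MildSol.sub (ha : Family r M M' L c₁ a) {Φ' Θ' : ℝ → Seq} (h : MildSol r a T g Φ Θ)
    (h' : MildSol r a T g Φ' Θ') : FullSol r a T 0 (Φ - Φ') (Θ - Θ') := by
  have hR := ha.continuousOn_fullRhs' h.cΦ h.cΘ
  have hR' := ha.continuousOn_fullRhs' h'.cΦ h'.cΘ
  have hV : ContinuousOn (fun t => vOp r (Θ t)) (Icc 0 T) := (vOp r).continuous.comp_continuousOn h.cΘ
  have hV' : ContinuousOn (fun t => vOp r (Θ' t)) (Icc 0 T) :=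
    (vOp r).continuous.comp_continuousOn h'.cΘ
  refine ⟨bdd_of_continuousOn (h.cΦ.sub h'.cΦ) (h.cΘ.sub h'.cΘ), fun t ht => ?_, fun t ht => ?_⟩
  · have := hasDerivWithinAt_of_integral (u := fun t => vOp (r + 1) ((Φ - Φ') t))
      (F := fun t => vOp r (Θ t) - vOp r (Θ' t))
      (u₀ := vOp (r + 1) (Φ 0) - vOp (r + 1) (Φ' 0)) (hV.sub hV') (fun t ht => ?_) ht
    · simpa using this
    · have hsub : uIcc 0 t ⊆ Icc 0 T := by
        rw [uIcc_of_le ht.1]; exact Icc_subset_Icc le_rfl ht.2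
      rw [intervalIntegral.integral_sub (hV.mono hsub).intervalIntegrable
        (hV'.mono hsub).intervalIntegrable, Pi.sub_apply, map_sub, h.ex t ht, h'.ex t ht]
      abel
  · have := hasDerivWithinAt_of_integral (u := fun t => vOp r ((Θ - Θ') t))
      (F := fun t => fullRhs r (a t) (Φ t) (Θ t) - fullRhs r (a t) (Φ' t) (Θ' t))
      (u₀ := vOp r (Θ 0) - vOp r (Θ' 0)) (hR.sub hR') (fun t ht => ?_) ht
    · simpa [fullRhs_sub] using this
    · have hsub : uIcc 0 t ⊆ Icc 0 T := by
        rw [uIcc_of_le ht.1]; exact Icc_subset_Icc le_rfl ht.2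
      rw [intervalIntegral.integral_sub (hR.mono hsub).intervalIntegrable
        (hR'.mono hsub).intervalIntegrable, Pi.sub_apply, map_sub, h.ey t ht, h'.ey t ht]
      abel

lemma MildSol.unique (ha : Family r M M' L c₁ a) {Φ' Θ' : ℝ → Seq} (h : MildSol r a T g Φ Θ)
    (h' : MildSol r a T g Φ' Θ') (h1 : Φ 0 = Φ' 0) (h2 : Θ 0 = Θ' 0) {t : ℝ} (ht : t ∈ Icc 0 T) :
    Φ t = Φ' t ∧ Θ t = Θ' t := by
  obtain ⟨e1, e2⟩ := (h.sub ha h').eq_zero ha (by simp [h1]) (by simp [h2]) ht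
  exact ⟨sub_eq_zero.1 e1, sub_eq_zero.1 e2⟩

lemma FullSol.norm_sq_le (ha : Family r M M' L c₁ a) (hT : 0 ≤ T) (hg : ContinuousOn g (Icc 0 T))
    (h : FullSol r a T g Φ Θ) {t : ℝ} (ht : t ∈ Icc 0 T) :
    ‖Φ t‖ ^ 2 + ‖Θ t‖ ^ 2 ≤ coerConst c₁ L *
      (10 * (1 + L) ^ 2 * (‖Φ 0‖ ^ 2 + ‖Θ 0‖ ^ 2) + ∫ τ in (0 : ℝ)..T, 2 * ‖g τ‖ ^ 2) *
        exp (growth r M M' c₁ * T) := by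
  obtain ⟨Φ', Θ', h', h1, h2, hb⟩ := ha.exists_fullSol hT hg (Φ 0) (Θ 0)
  obtain ⟨e1, e2⟩ := (h.mildSol ha hg).unique ha (h'.mildSol ha hg) h1.symm h2.symm ht
  rw [e1, e2]
  exact hb t ht

lemma norm_sq_toLp {μ : Measure ℝ} {g : ℝ → Seq} (hg : MemLp g 2 μ) :
    ‖hg.toLp‖ ^ 2 = ∫ t, ‖g t‖ ^ 2 ∂μ := by
  have h : inner ℝ (hg.toLp g) (hg.toLp g) =
      ∫ x, inner ℝ ((hg.toLp g) x) ((hg.toLp g) x) ∂μ := L2.inner_def _ _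
  rw [← real_inner_self_eq_norm_sq, h]
  refine integral_congr_ae ?_
  filter_upwards [hg.coeFn_toLp] with t ht
  rw [ht, real_inner_self_eq_norm_sq]

/-- Approximation of square integrable sources by continuous ones. -/
lemma exists_continuous_approx (hT : 0 ≤ T) (hg : MemLp g 2 (volume.restrict (Ioc 0 T))) :
    ∃ f : ℕ → ℝ → Seq, (∀ n, Continuous (f n)) ∧
      Tendsto (fun n => ∫ τ in (0 : ℝ)..T, ‖f n τ‖ ^ 2) atTop (𝓝 (∫ τ in (0 : ℝ)..T, ‖g τ‖ ^ 2)) ∧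
      (∀ ε > 0, ∃ n₀, ∀ m ≥ n₀, ∀ n ≥ n₀, ∫ τ in (0 : ℝ)..T, ‖f m τ - f n τ‖ ^ 2 ≤ ε) ∧
      ∀ t ∈ Icc 0 T, Tendsto (fun n => ∫ τ in (0 : ℝ)..t, f n τ) atTop
        (𝓝 (∫ τ in (0 : ℝ)..t, g τ)) := by
  set μ := volume.restrict (Ioc (0 : ℝ) T) with hμ
  have hex : ∀ n : ℕ, ∃ f : BoundedContinuousFunction ℝ Seq,
      eLpNorm (g - ⇑f) 2 μ ≤ ofReal (1 / ((n : ℝ) + 1)) ∧ MemLp f 2 μ := fun n =>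
    hg.exists_boundedContinuous_eLpNorm_sub_le (by norm_num) (by
      simp only [ne_eq, ENNReal.ofReal_eq_zero, not_le]; positivity)
  choose f hf1 hf2 using hex
  have hlimL : Tendsto (fun n => (hf2 n).toLp) atTop (𝓝 hg.toLp) := by
    rw [tendsto_iff_norm_sub_tendsto_zero]
    refine squeeze_zero (fun _ => norm_nonneg _) (fun n => ?_) tendsto_one_div_add_atTop_nhds_zero_nat
    rw [norm_sub_rev, ← MemLp.toLp_sub, Lp.norm_toLp]
    exact ENNReal.toReal_le_of_le_ofReal (by positivity) (hf1 n)
  refine ⟨fun n => f n, fun n => (f n).continuous, ?_, fun ε hε => ?_, fun t ht => ?_⟩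
  · have := hlimL.norm.pow 2
    simp only [norm_sq_toLp] at this
    simpa only [integral_of_le hT] using this
  · have hc := Metric.cauchySeq_iff.1 hlimL.cauchySeq (sqrt ε) (Real.sqrt_pos.2 hε)
    obtain ⟨n₀, hn₀⟩ := hc
    refine ⟨n₀, fun m hm n hn => ?_⟩
    have h1 := (hn₀ m hm n hn).le
    rw [dist_eq_norm, ← MemLp.toLp_sub] at h1
    have h2 := pow_le_pow_left₀ (norm_nonneg _) h1 2
    rw [norm_sq_toLp, sq_sqrt hε.le] at h2
    simpa only [integral_of_le hT, Pi.sub_apply] using h2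
  · have hsub : Ioc 0 t ⊆ Ioc 0 T := Ioc_subset_Ioc le_rfl ht.2
    have hL1 : Tendsto (fun n => eLpNorm (⇑(f n) - g) 1 μ) atTop (𝓝 0) := by
      have h2 : Tendsto (fun n : ℕ => ofReal (1 / ((n : ℝ) + 1)) *
          μ univ ^ (1 / (1 : ℝ≥0∞).toReal - 1 / (2 : ℝ≥0∞).toReal)) atTop (𝓝 0) := by
        have h3 := ENNReal.tendsto_ofReal tendsto_one_div_add_atTop_nhds_zero_nat
        rw [ENNReal.ofReal_zero] at h3
        have h4 := ENNReal.Tendsto.mul_const (b := μ univ ^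
          (1 / (1 : ℝ≥0∞).toReal - 1 / (2 : ℝ≥0∞).toReal)) h3 (Or.inr (by
            refine ENNReal.rpow_ne_top_of_nonneg (by norm_num) (measure_ne_top _ _)))
        simpa using h4
      refine tendsto_of_tendsto_of_tendsto_of_le_of_le tendsto_const_nhds h2 (fun _ => zero_le)
        fun n => ?_
      refine (eLpNorm_le_eLpNorm_mul_rpow_measure_univ (by norm_num : (1 : ℝ≥0∞) ≤ 2)
        ((hf2 n).1.sub hg.1)).trans ?_
      gcongr
      rw [eLpNorm_sub_comm]
      exact hf1 n
    have h1 := tendsto_setIntegral_of_L1' g hg.1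
      (.of_forall fun n => (hf2 n).integrable (by norm_num)) hL1 (Ioc 0 t)
    simp only [hμ, Measure.restrict_restrict measurableSet_Ioc, inter_eq_left.2 hsub] at h1
    simpa only [integral_of_le ht.1] using h1

set_option maxHeartbeats 800000 in
/-- Existence for square integrable sources. -/
lemma Family.exists_mildSol (ha : Family r M M' L c₁ a) (hT : 0 ≤ T)
    (hg : MemLp g 2 (volume.restrict (Ioc 0 T))) (Φ₀ Θ₀ : Seq) :
    ∃ Φ Θ, MildSol r a T g Φ Θ ∧ Φ 0 = Φ₀ ∧ Θ 0 = Θ₀ ∧ ∀ t ∈ Icc 0 T,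
      ‖Φ t‖ ^ 2 + ‖Θ t‖ ^ 2 ≤ coerConst c₁ L *
      (10 * (1 + L) ^ 2 * (‖Φ₀‖ ^ 2 + ‖Θ₀‖ ^ 2) + 2 * ∫ τ in (0 : ℝ)..T, ‖g τ‖ ^ 2) *
        exp (growth r M M' c₁ * T) := by
  have hr := ha.hr
  have hr0 : 0 ≤ r := by linarith
  have h0 : (0 : ℝ) ∈ Icc 0 T := ⟨le_rfl, hT⟩
  obtain ⟨f, hfc, hfn, hfcauchy, hfi⟩ := exists_continuous_approx hT hg
  choose P Q hPQ hP0 hQ0 hPQb using fun n => ha.exists_fullSol hT (hfc n).continuousOn Φ₀ Θ₀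
  have hcont := fun n => (hPQ n).continuousOn ha (hfc n).continuousOn
  have hmild := fun n => (hPQ n).mildSol ha (hfc n).continuousOn
  have hC := coerConst_pos (L := L) ha.hc₁
  set K := coerConst c₁ L * 2 * exp (growth r M M' c₁ * T) with hK
  have hK0 : 0 < K := by positivity
  have hd : ∀ m n, ∀ t ∈ Icc 0 T, ‖P m t - P n t‖ ^ 2 + ‖Q m t - Q n t‖ ^ 2 ≤
      K * ∫ τ in (0 : ℝ)..T, ‖f m τ - f n τ‖ ^ 2 := by
    intro m n t ht
    have h1 := ((hPQ m).sub (hPQ n)).norm_sq_le ha hT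
      ((hfc m).continuousOn.sub (hfc n).continuousOn) ht
    have e1 : (P m - P n) 0 = 0 := by simp [hP0]
    have e2 : (Q m - Q n) 0 = 0 := by simp [hQ0]
    rw [e1, e2] at h1
    simp only [intervalIntegral.integral_const_mul, Pi.sub_apply, norm_zero] at h1
    refine h1.trans (le_of_eq ?_)
    rw [hK]; ring
  have hcauchy : ∀ {z : ℕ → ℝ → Seq}, (∀ m n, ∀ t ∈ Icc 0 T,
      ‖z m t - z n t‖ ^ 2 ≤ K * ∫ τ in (0 : ℝ)..T, ‖f m τ - f n τ‖ ^ 2) →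
      ∃ z' : ℝ → Seq, TendstoUniformlyOn z z' atTop (Icc 0 T) := by
    intro z hz
    refine exists_tendstoUniformlyOn ?_
    rw [Metric.uniformCauchySeqOn_iff]
    intro ε hε
    obtain ⟨n₀, hn₀⟩ := hfcauchy ((ε / 2) ^ 2 / K) (by positivity)
    refine ⟨n₀, fun m hm n hn t ht => ?_⟩
    have h1 := (hz m n t ht).trans (mul_le_mul_of_nonneg_left (hn₀ m hm n hn) hK0.le)
    rw [mul_div_cancel₀ _ hK0.ne'] at h1
    have h2 := (abs_le_of_sq_le_sq' h1 (by positivity)).2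
    rw [dist_eq_norm]
    linarith
  obtain ⟨Φ, hΦ⟩ := hcauchy (z := P) fun m n t ht =>
    le_trans (le_add_of_nonneg_right (by positivity)) (hd m n t ht)
  obtain ⟨Θ, hΘ⟩ := hcauchy (z := Q) fun m n t ht =>
    le_trans (le_add_of_nonneg_left (by positivity)) (hd m n t ht)
  have hΦc : ContinuousOn Φ (Icc 0 T) :=
    hΦ.continuousOn (Eventually.of_forall fun n => (hcont n).1).frequently
  have hΘc : ContinuousOn Θ (Icc 0 T) :=
    hΘ.continuousOn (Eventually.of_forall fun n => (hcont n).2).frequently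
  have hΦ0 : Φ 0 = Φ₀ := tendsto_nhds_unique (hΦ.tendsto_at h0) (by simp [hP0])
  have hΘ0 : Θ 0 = Θ₀ := tendsto_nhds_unique (hΘ.tendsto_at h0) (by simp [hQ0])
  refine ⟨Φ, Θ, ⟨hΦc, hΘc, fun t ht => ?_, fun t ht => ?_⟩, hΦ0, hΘ0, fun t ht => ?_⟩
  · have hsub : uIcc 0 t ⊆ Icc 0 T := by
      rw [uIcc_of_le ht.1]; exact Icc_subset_Icc le_rfl ht.2
    have hV : TendstoUniformlyOn (fun n τ => vOp r (Q n τ)) (fun τ => vOp r (Θ τ)) atTop (uIcc 0 t) :=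
      (vOp r).uniformContinuous.comp_tendstoUniformlyOn (hΘ.mono hsub)
    have h1 := hV.tendsto_intervalIntegral_of_continuousOn (μ := volume) (.of_forall
      fun n => (vOp r).continuous.comp_continuousOn ((hcont n).2.mono hsub))
    refine tendsto_nhds_unique (((vOp (r + 1)).continuous.tendsto _).comp (hΦ.tendsto_at ht)) ?_
    have e : ∀ n, vOp (r + 1) (P n t) = vOp (r + 1) Φ₀ + ∫ τ in (0 : ℝ)..t, vOp r (Q n τ) :=
      fun n => by rw [(hmild n).ex t ht, hP0]
    simp only [comp_def, e, hΦ0]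
    exact h1.const_add _
  · have hsub : uIcc 0 t ⊆ Icc 0 T := by
      rw [uIcc_of_le ht.1]; exact Icc_subset_Icc le_rfl ht.2
    have hrc : 0 ≤ rhsConst L := by have := ha.hL; unfold rhsConst; positivity
    have hR : TendstoUniformlyOn (fun n τ => fullRhs r (a τ) (P n τ) (Q n τ))
        (fun τ => fullRhs r (a τ) (Φ τ) (Θ τ)) atTop (uIcc 0 t) := by
      rw [Metric.tendstoUniformlyOn_iff]
      intro ε hε
      set δ := ε / (2 * rhsConst L + 1) / 2 with hδ
      have hδ0 : 0 < δ := by positivity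
      filter_upwards [Metric.tendstoUniformlyOn_iff.1 (hΦ.mono hsub) δ hδ0,
        Metric.tendstoUniformlyOn_iff.1 (hΘ.mono hsub) δ hδ0] with n h1 h2 τ hτ
      have h3 := h1 τ hτ
      have h4 := h2 τ hτ
      rw [dist_eq_norm] at h3 h4 ⊢
      rw [fullRhs_sub]
      refine (norm_fullRhs_le (by linarith) ha.hL (ha.sup τ) h3.le h4.le).trans_lt ?_
      have e : ε = (2 * rhsConst L + 1) * (2 * δ) := by rw [hδ]; field_simp
      rw [e]
      nlinarith
    have h1 := hR.tendsto_intervalIntegral_of_continuousOn (μ := volume) (.of_forall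
      fun n => (ha.continuousOn_fullRhs' (hcont n).1 (hcont n).2).mono hsub)
    refine tendsto_nhds_unique (((vOp r).continuous.tendsto _).comp (hΘ.tendsto_at ht)) ?_
    have e : ∀ n, vOp r (Q n t) = vOp r Θ₀ + ((∫ τ in (0 : ℝ)..t, fullRhs r (a τ) (P n τ) (Q n τ)) +
        vOp r (∫ τ in (0 : ℝ)..t, f n τ)) :=
      fun n => by rw [(hmild n).ey t ht, hQ0]
    simp only [comp_def, e, hΘ0]
    exact (h1.add (((vOp r).continuous.tendsto _).comp (hfi t ht))).const_add _
  · refine le_of_tendsto_of_tendsto' (((hΦ.tendsto_at ht).norm.pow 2).add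
      ((hΘ.tendsto_at ht).norm.pow 2)) ((((hfn.const_mul 2).const_add _).const_mul _).mul_const _)
      fun n => ?_
    have := hPQb n t ht
    rwa [intervalIntegral.integral_const_mul] at this

end

section

/-! ### Fourier synthesis -/

/-- The Fourier coefficients of a continuous function. -/
def analysisL : C(Torus2, ℂ) →L[ℝ] Seq :=
  (fourierL : Lp ℂ 2 torusMeasure →L[ℝ] Seq) ∘L
    (toLp 2 torusMeasure ℂ).restrictScalars ℝ

lemma analysisL_apply (f : C(Torus2, ℂ)) (k : Freq) :
    analysisL f k = mFourierCoeff f k := by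
  change fourierL (toLp 2 torusMeasure ℂ f) k = _
  rw [fourierL_apply]
  exact UnitAddTorus.mFourierCoeff_toLp f k

lemma analysisL_injective : Function.Injective analysisL :=
  fourierL.injective.comp (ContinuousMap.toLp_injective (p := 2) (𝕜 := ℂ) torusMeasure)

lemma analysisL_mul (a : C(Torus2, ℝ)) (f : C(Torus2, ℂ)) :
    analysisL (toC a * f) = mulSeq a (analysisL f) := by
  change fourierL (toLp 2 torusMeasure ℂ (toC a * f)) =
    mulSeq a (fourierL (toLp 2 torusMeasure ℂ f))
  rw [mulSeq_fourierL]
  congr 1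
  refine Lp.ext ?_
  filter_upwards [coeFn_toLp (p := 2) (𝕜 := ℂ) torusMeasure (toC a * f),
    coeFn_toLp (p := 2) (𝕜 := ℂ) torusMeasure f,
    coeFn_mulLp a (toLp 2 torusMeasure ℂ f)] with x h1 h2 h3
  rw [h1, h3, h2]
  rfl

/-- A square summable multiplier. -/
abbrev SqSummable (m : Freq → ℂ) : Prop := Summable fun k => ‖m k‖ ^ 2

lemma SqSummable.summable_mul {m : Freq → ℂ} (hm : SqSummable m) (z : Seq) :
    Summable fun k => ‖m k‖ * ‖z k‖ := by
  refine Summable.of_nonneg_of_le (fun k => by positivity) (fun k => ?_)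
    ((hm.add z.summable_sq))
  nlinarith [sq_nonneg (‖m k‖ - ‖z k‖), sq_nonneg ‖m k‖, sq_nonneg ‖z k‖]

lemma SqSummable.tsum_mul_le {m : Freq → ℂ} (hm : SqSummable m) (z : Seq) :
    ∑' k, ‖m k‖ * ‖z k‖ ≤ sqrt (∑' k, ‖m k‖ ^ 2) * ‖z‖ := by
  refine (hm.summable_mul z).tsum_le_of_sum_le fun s => ?_
  refine (Real.sum_mul_le_sqrt_mul_sqrt s _ _).trans ?_
  gcongr
  · exact hm.sum_le_tsum s fun k _ => by positivity
  · exact Real.sqrt_le_iff.2 ⟨norm_nonneg _, z.sum_le_norm_sq s⟩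

lemma norm_mFourier (k : Freq) : ‖(mFourier k : C(Torus2, ℂ))‖ = 1 :=
  UnitAddTorus.mFourier_norm

lemma SqSummable.summable_smul {m : Freq → ℂ} (hm : SqSummable m) (z : Seq) :
    Summable fun k => (m k * z k) • (mFourier k : C(Torus2, ℂ)) := by
  refine Summable.of_norm ?_
  simp only [norm_smul, norm_mul, norm_mFourier, mul_one]
  exact hm.summable_mul z

/-- The synthesis operator `z ↦ ∑ m(k) z(k) e_k`, for a square summable multiplier. -/
def synthOf {m : Freq → ℂ} (hm : SqSummable m) : Seq →L[ℝ] C(Torus2, ℂ) :=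
  LinearMap.mkContinuous
    { toFun := fun z => ∑' k, (m k * z k) • (mFourier k : C(Torus2, ℂ))
      map_add' := fun z w => by
        rw [← (hm.summable_smul z).tsum_add (hm.summable_smul w)]
        refine tsum_congr fun k => ?_
        rw [lp.coeFn_add, Pi.add_apply, mul_add]
        exact add_smul (m k * z k) (m k * w k) (mFourier k : C(Torus2, ℂ))
      map_smul' := fun c z => by
        rw [RingHom.id_apply, ← (hm.summable_smul z).tsum_const_smul]
        refine tsum_congr fun k => ?_
        rw [lp.coeFn_smul, Pi.smul_apply, mul_smul_comm, smul_assoc] }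
    (sqrt (∑' k, ‖m k‖ ^ 2)) (fun z => by
      refine le_trans (norm_tsum_le_tsum_norm ?_) (le_trans (le_of_eq ?_) (hm.tsum_mul_le z))
      · simp only [norm_smul, norm_mul, norm_mFourier, mul_one]
        exact hm.summable_mul z
      · simp only [norm_smul, norm_mul, norm_mFourier, mul_one])

variable {m m' : Freq → ℂ} (hm : SqSummable m) (hm' : SqSummable m')

lemma hasSum_synthOf (z : Seq) :
    HasSum (fun k => (m k * z k) • (mFourier k : C(Torus2, ℂ))) (synthOf hm z) :=
  (hm.summable_smul z).hasSum

lemma hasSum_synthOf_apply (z : Seq) (x : Torus2) :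
    HasSum (fun k => m k * z k * mFourier k x) (synthOf hm z x) := by
  have := (evalCLM ℂ x).hasSum (hasSum_synthOf hm z)
  simpa using this

lemma analysisL_mFourier (k l : Freq) (c : ℂ) :
    analysisL (c • (mFourier k : C(Torus2, ℂ))) l = if l = k then c else 0 := by
  have h : analysisL (c • (mFourier k : C(Torus2, ℂ))) =
      (torusBasis.repr (c • torusBasis k) : Seq) := by
    change fourierL (toLp 2 torusMeasure ℂ (c • mFourier k)) = _
    rw [map_smul]
    have e : torusBasis k = toLp 2 torusMeasure ℂ (mFourier k) := by
      have := congrFun UnitAddTorus.coe_mFourierBasis (k : Fin 2 → ℤ)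
      exact this
    rw [e]
    rfl
  rw [h, map_smul, HilbertBasis.repr_self]
  by_cases hl : l = k
  · subst hl; simp
  · simp [hl]

lemma isBdd_of_sqSummable (hm : SqSummable m) : IsBdd m := by
  refine ⟨sqrt (∑' k, ‖m k‖ ^ 2), fun k => Real.le_sqrt_of_sq_le ?_⟩
  exact Summable.le_tsum (f := fun k => ‖m k‖ ^ 2) hm k fun j _ => by positivity

lemma analysisL_synthOf (z : Seq) : analysisL (synthOf hm z) = diag m z := by
  ext l
  have h := analysisL.hasSum (hasSum_synthOf hm z)
  have h2 : HasSum (fun k => analysisL ((m k * z k) • (mFourier k : C(Torus2, ℂ))) l)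
      (analysisL (synthOf hm z) l) := by
    have hev : Continuous fun w : Seq => w l := by
      refine (LipschitzWith.of_dist_le_mul (K := 1) fun u v => ?_).continuous
      rw [dist_eq_norm, dist_eq_norm, NNReal.coe_one, one_mul]
      exact Seq.norm_apply_le (u - v) l
    exact h.map (⟨⟨fun w : Seq => w l, rfl⟩, fun _ _ => rfl⟩ : Seq →+ ℂ) hev
  simp only [analysisL_mFourier] at h2
  rw [diag_apply (isBdd_of_sqSummable hm)]
  refine h2.unique ?_
  convert! hasSum_ite_eq l (m l * z l) using 1
  funext k
  by_cases hk : l = k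
  · subst hk; simp
  · simp [hk, Ne.symm hk]

/-! ### Derivatives of synthesised functions -/

lemma mFourier_add_single (k : Freq) (i : Fin 2) (x : Torus2) (ρ : ℝ) :
    mFourier k (x + Pi.single i (ρ : UnitAddCircle)) =
      mFourier k x * fourier (k i) (ρ : UnitAddCircle) := by
  have h1 : mFourier k (x + Pi.single i (ρ : UnitAddCircle)) =
      mFourier k x * mFourier k (Pi.single i (ρ : UnitAddCircle)) := by
    simp only [mFourier, coe_mk, Fin.prod_univ_two, Pi.add_apply,
      fourier_apply, smul_add, AddCircle.toCircle_add, Circle.coe_mul]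
    ring
  rw [h1]
  congr 1
  simp only [mFourier, coe_mk, Fin.prod_univ_two]
  fin_cases i <;> simp

lemma hasDerivAt_mFourier_add (k : Freq) (i : Fin 2) (x : Torus2) (ρ : ℝ) :
    HasDerivAt (fun ρ : ℝ => mFourier k (x + Pi.single i (ρ : UnitAddCircle)))
      ((xi i k : ℂ) * I *
        mFourier k (x + Pi.single i (ρ : UnitAddCircle))) ρ := by
  simp only [mFourier_add_single]
  have h := (hasDerivAt_fourier (1 : ℝ) (k i) ρ).const_mul (mFourier k x)
  convert! h using 1
  simp only [xi]
  push_cast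
  ring

lemma hasDerivAt_synthOf (i : Fin 2) (hd : ∀ k, m' k = (xi i k : ℂ) * I * m k) (z : Seq)
    (x : Torus2) :
    HasDerivAt (fun ρ : ℝ => synthOf hm z (x + Pi.single i (ρ : UnitAddCircle)))
      (synthOf hm' z x) 0 := by
  let G : Freq → ℝ → ℂ := fun k ρ =>
    m k * z k * mFourier k (x + Pi.single i (ρ : UnitAddCircle))
  let G' : Freq → ℝ → ℂ := fun k ρ => m k * z k * ((xi i k : ℂ) * I *
    mFourier k (x + Pi.single i (ρ : UnitAddCircle)))
  have hle : ∀ k (ρ : ℝ), ‖G' k ρ‖ ≤ ‖m' k‖ * ‖z k‖ := by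
    intro k ρ
    simp only [G', hd, norm_mul, norm_mFourier_apply, mul_one]
    apply le_of_eq; ring
  have hG : ∀ k ρ, HasDerivAt (G k) (G' k ρ) ρ := fun k ρ =>
    (hasDerivAt_mFourier_add k i x ρ).const_mul _
  have hs : ∀ ρ : ℝ, HasSum (fun k => G k ρ)
      (synthOf hm z (x + Pi.single i (ρ : UnitAddCircle))) :=
    fun ρ => hasSum_synthOf_apply hm z _
  have hs' : HasSum (fun k => G' k 0) (synthOf hm' z x) := by
    convert! hasSum_synthOf_apply hm' z x using 2 with k
    simp only [G', hd, AddCircle.coe_zero, Pi.single_zero, add_zero]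
    ring
  have h : HasDerivAt (fun ρ => ∑' k, G k ρ) (∑' k, G' k 0) 0 :=
    hasDerivAt_tsum (hm'.summable_mul z) hG hle (hs 0).summable 0
  rw [hs'.tsum_eq] at h
  exact h.congr_of_eventuallyEq (.of_forall fun ρ => (hs ρ).tsum_eq.symm)

/-- Partial derivatives of the real part of a synthesised function. -/
lemma surfPartial_re_synthOf (i : Fin 2) (hd : ∀ k, m' k = (xi i k : ℂ) * I * m k) (z : Seq) :
    surfPartial i (fun x => (synthOf hm z x).re) = fun x => (synthOf hm' z x).re := by
  funext x
  have h := hasDerivAt_synthOf hm hm' i hd z x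
  exact (reCLM.hasFDerivAt.comp_hasDerivAt (0 : ℝ) h).deriv

/-- Partial derivatives of a real function with a synthesis formula. -/
lemma surfPartial_of_synthOf (i : Fin 2) (hd : ∀ k, m' k = (xi i k : ℂ) * I * m k) {z : Seq}
    {φ : Torus2 → ℝ} (hφ : ∀ x, synthOf hm z x = φ x) (x : Torus2) :
    synthOf hm' z x = (surfPartial i φ x : ℂ) := by
  have h := hasDerivAt_synthOf hm hm' i hd z x
  have h1 : HasDerivAt (fun ρ : ℝ => φ (x + Pi.single i (ρ : UnitAddCircle)))
      (synthOf hm' z x).re 0 := by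
    have := reCLM.hasFDerivAt.comp_hasDerivAt (0 : ℝ) h
    simpa [comp_def, hφ] using this
  have h2 := h1.ofReal_comp
  simp only [← hφ] at h2
  rw [h.unique h2, surfPartial, h1.deriv]

/-! ### Sobolev functions and their coefficients -/

/-- The symbol of `⟨∇⟩^{-σ}`. -/
def vsym (σ : ℝ) (k : Freq) : ℂ := ((jap k ^ (-σ) : ℝ) : ℂ)

/-- The symbol of `∂ᵢ⟨∇⟩^{-σ}`. -/
def dvsym (σ : ℝ) (i : Fin 2) (k : Freq) : ℂ := ((xi i k * jap k ^ (-σ) : ℝ) : ℂ) * I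

/-- The symbol of `∂ᵢ∂ⱼ⟨∇⟩^{-σ}`. -/
def hvsym (σ : ℝ) (i j : Fin 2) (k : Freq) : ℂ := ((-(xi i k * xi j k * jap k ^ (-σ)) : ℝ) : ℂ)

lemma sqSummable_of_le {σ : ℝ} (hσ : 1 < σ) (h : ∀ k, ‖m k‖ ≤ jap k ^ (-σ)) : SqSummable m := by
  refine Summable.of_nonneg_of_le (fun k => by positivity) (fun k => ?_)
    (summable_jap_rpow (p := 2 * σ) (by linarith))
  have hj := jap_pos k
  refine (pow_le_pow_left₀ (norm_nonneg _) (h k) 2).trans (le_of_eq ?_)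
  rw [← Real.rpow_natCast, ← rpow_mul hj.le]
  congr 1; push_cast; ring

lemma sqSummable_vsym {σ : ℝ} (hσ : 1 < σ) : SqSummable (vsym σ) :=
  sqSummable_of_le hσ fun k => by
    have hj := jap_pos k
    rw [vsym, norm_real, norm_of_nonneg (by positivity)]

lemma sqSummable_dvsym {σ : ℝ} (hσ : 2 < σ) (i : Fin 2) : SqSummable (dvsym σ i) :=
  sqSummable_of_le (σ := σ - 1) (by linarith) fun k => by
    have hj := jap_pos k
    rw [dvsym, norm_mul, norm_I, mul_one, norm_real, norm_eq_abs, abs_mul,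
      abs_of_pos (a := jap k ^ (-σ)) (by positivity)]
    calc _ ≤ jap k * jap k ^ (-σ) := by gcongr; exact abs_xi_le i k
      _ = _ := by rw [mul_comm, ← rpow_add_one hj.ne']; congr 1; ring

lemma sqSummable_hvsym {σ : ℝ} (hσ : 3 < σ) (i j : Fin 2) : SqSummable (hvsym σ i j) :=
  sqSummable_of_le (σ := σ - 2) (by linarith) fun k => by
    have hj := jap_pos k
    rw [hvsym, norm_real, norm_eq_abs, abs_neg, abs_mul, abs_mul,
      abs_of_pos (a := jap k ^ (-σ)) (by positivity)]
    calc _ ≤ jap k * jap k * jap k ^ (-σ) := by gcongr <;> exact abs_xi_le _ k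
      _ = _ := by
        rw [mul_comm, ← mul_assoc, ← rpow_add_one hj.ne', ← rpow_add_one hj.ne']
        congr 1; ring

lemma dvsym_eq (σ : ℝ) (i : Fin 2) (k : Freq) :
    dvsym σ i k = (xi i k : ℂ) * I * vsym σ k := by
  simp only [dvsym, vsym]; push_cast; ring

lemma hvsym_eq (σ : ℝ) (i j : Fin 2) (k : Freq) :
    hvsym σ i j k = (xi i k : ℂ) * I * dvsym σ j k := by
  simp only [hvsym, dvsym]; push_cast
  linear_combination (-((xi i k : ℂ) * xi j k * ((jap k ^ (-σ) : ℝ) : ℂ))) * I_sq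

lemma toSob_apply {σ : ℝ} {φ : Torus2 → ℝ} (h : MemH σ φ) (k : Freq) :
    toSob σ φ k = ((jap k ^ σ : ℝ) : ℂ) * coeff φ k := by
  rw [toSob, dif_pos h.2, ← japanese_eq]
  rfl

lemma vOp_toSob {σ : ℝ} (hσ : 0 ≤ σ) {φ : Torus2 → ℝ} (h : MemH σ φ) (k : Freq) :
    vOp σ (toSob σ φ) k = coeff φ k := by
  have hj := jap_pos k
  rw [vOp_apply hσ, toSob_apply h, ← mul_assoc, ← Complex.ofReal_mul, ← rpow_add hj]
  simp

/-- A Sobolev function is synthesised from its coefficients. -/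
lemma synthOf_toSob {σ : ℝ} (hσ : 1 < σ) {φ : Torus2 → ℝ} (h : MemH σ φ) (x : Torus2) :
    synthOf (sqSummable_vsym hσ) (toSob σ φ) x = φ x := by
  have e : synthOf (sqSummable_vsym hσ) (toSob σ φ) = toC ⟨φ, h.1⟩ := by
    apply analysisL_injective
    rw [analysisL_synthOf]
    ext k
    rw [analysisL_apply]
    exact vOp_toSob (by linarith) h k
  rw [e]; rfl

/-- The reflection `z ↦ conj z(-k)`. -/
def reflect : Seq →L[ℝ] Seq :=
  LinearMap.mkContinuous
    { toFun := fun z => ⟨fun k => star (z (-k)), by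
        refine memℓp_of_bound (C := ‖z‖ ^ 2) fun s => ?_
        have := z.sum_le_norm_sq (s.map (Equiv.neg Freq).toEmbedding)
        simpa using this⟩
      map_add' := fun z w => by ext k; exact star_add (z (-k)) (w (-k))
      map_smul' := fun c z => by ext k; exact (star_smul c (z (-k))).trans (by rw [star_trivial]; rfl) }
    1 (fun z => by
      rw [one_mul]
      refine Seq.norm_le_of_sum (norm_nonneg _) fun s => ?_
      have := z.sum_le_norm_sq (s.map (Equiv.neg Freq).toEmbedding)
      simpa using this)

/-- The coefficients of the real part. -/
def symmPart : Seq →L[ℝ] Seq := (1 / 2 : ℝ) • (ContinuousLinearMap.id ℝ Seq + reflect)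

lemma coeff_re (f : C(Torus2, ℂ)) (k : Freq) :
    coeff (fun x => (f x).re) k =
      (1 / 2 : ℝ) • (mFourierCoeff f k + star (mFourierCoeff f (-k))) := by
  have hint : ∀ (l : Freq) (g : C(Torus2, ℂ)), Integrable (fun x => mFourier l x * g x)
      torusMeasure := fun l g =>
    (mFourier l * g).continuous.integrable_of_hasCompactSupport
      (of_compactSpace _)
  have hint' : ∀ l : Freq, Integrable (fun x => mFourier l x * star (f x))
      torusMeasure := fun l => hint l (star f)
  have e : star (mFourierCoeff f (-k)) =
      ∫ x, mFourier (-k) x * star (f x) ∂torusMeasure := by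
    rw [mFourierCoeff_eq]
    change (starRingEnd ℂ) _ = _
    rw [← integral_conj]
    refine integral_congr_ae (.of_forall fun x => ?_)
    simp [mFourier_neg]
  rw [e, mFourierCoeff_eq, coeff_eq, ← integral_add (hint _ f) (hint' _), ← integral_smul]
  refine integral_congr_ae (.of_forall fun x => ?_)
  simp only [real_smul]
  have : ((f x).re : ℂ) = (f x + star (f x)) / 2 := by
    rw [Complex.star_def, Complex.add_conj]; simp
  rw [this]
  push_cast; ring

/-- The real part of a synthesised function is a Sobolev function. -/
lemma memH_re_synthOf {σ : ℝ} (hσ : 1 < σ) (z : Seq) :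
    MemH σ (fun x => (synthOf (sqSummable_vsym hσ) z x).re) ∧
      toSob σ (fun x => (synthOf (sqSummable_vsym hσ) z x).re) = symmPart z := by
  have hc : ∀ k, sobCoeff σ (fun x => (synthOf (sqSummable_vsym hσ) z x).re) k = symmPart z k := by
    intro k
    have hj := jap_pos k
    rw [sobCoeff, coeff_re, ← analysisL_apply, ← analysisL_apply, analysisL_synthOf, japanese_eq,
      diag_apply (isBdd_of_sqSummable (sqSummable_vsym hσ)),
      diag_apply (isBdd_of_sqSummable (sqSummable_vsym hσ))]
    have e : symmPart z k = (1 / 2 : ℝ) • (z k + star (z (-k))) := rfl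
    rw [e, vsym, vsym, jap_neg]
    have h1 : ((jap k ^ σ : ℝ) : ℂ) * ((jap k ^ (-σ) : ℝ) : ℂ) = 1 := by
      rw [← Complex.ofReal_mul, ← rpow_add hj]; simp
    simp only [real_smul, star_mul', Complex.star_def, Complex.conj_ofReal]
    linear_combination (((1 / 2 : ℝ) : ℂ) * (z k + (starRingEnd ℂ) (z (-k)))) * h1
  have hmem : Memℓp (sobCoeff σ (fun x => (synthOf (sqSummable_vsym hσ) z x).re)) 2 := by
    rw [funext hc]; exact lp.memℓp _
  refine ⟨⟨continuous_re.comp (ContinuousMap.continuous _), hmem⟩, ?_⟩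
  ext k
  rw [toSob, dif_pos hmem]
  exact hc k

end

section

variable {r M M' L c₁ T : ℝ} {a : ℝ → Fields} {g φ θ : ℝ → Torus2 → ℝ} {γ Φ Θ : ℝ → Seq}

/-! ### Solutions as functions on the torus -/

/-- The inverse of `toSob`. -/
def synth {σ : ℝ} (hσ : 1 < σ) : Seq →L[ℝ] C(Torus2, ℂ) := synthOf (sqSummable_vsym hσ)

/-- The right-hand side of the second equation as a function on the torus. -/
def rhsC (hr : 2 < r) (b : Fields) (Φ Θ : Seq) : C(Torus2, ℂ) :=
  ∑ i, toC (b.first i) * synthOf (sqSummable_dvsym hr i) Θ +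
    ∑ i, ∑ j, toC (b.second i j) *
      synthOf (sqSummable_hvsym (σ := r + 1) (by linarith) i j) Φ

lemma analysisL_synth {σ : ℝ} (hσ : 1 < σ) (z : Seq) : analysisL (synth hσ z) = vOp σ z :=
  analysisL_synthOf _ z

lemma analysisL_rhsC (hr : 2 < r) (b : Fields) (Φ Θ : Seq) :
    analysisL (rhsC hr b Φ Θ) = fullRhs r b Φ Θ := by
  rw [fullRhs, Fields.rhs_eq]
  simp only [rhsC, map_add, map_sum, analysisL_mul, analysisL_synthOf]
  rfl

lemma continuous_toC : Continuous toC := by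
  refine (LipschitzWith.of_dist_le_mul (K := 1) fun a b => ?_).continuous
  rw [NNReal.coe_one, one_mul, dist_le dist_nonneg]
  intro x
  have := ContinuousMap.dist_apply_le_dist (f := a) (g := b) x
  rw [Real.dist_eq] at this
  change dist (a x : ℂ) (b x : ℂ) ≤ _
  rwa [Complex.dist_eq, ← Complex.ofReal_sub, norm_real]

lemma Family.continuousOn_rhsC (ha : Family r M M' L c₁ a) (hr : 2 < r) {s : Set ℝ}
    (hΦ : ContinuousOn Φ s) (hΘ : ContinuousOn Θ s) :
    ContinuousOn (fun t => rhsC hr (a t) (Φ t) (Θ t)) s := by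
  refine ContinuousOn.add (continuousOn_finsetSum _ fun i _ => ?_)
    (continuousOn_finsetSum _ fun i _ => continuousOn_finsetSum _ fun j _ => ?_)
  · exact (continuous_toC.comp (ha.continuous_first i)).continuousOn.mul
      ((synthOf _).continuous.comp_continuousOn hΘ)
  · exact (continuous_toC.comp (ha.continuous_second i j)).continuousOn.mul
      ((synthOf _).continuous.comp_continuousOn hΦ)

/-- The right-hand side of the second equation, pointwise. -/
def linR (b : Fields) (g φ θ : Torus2 → ℝ) (x : Torus2) : ℝ :=
  ∑ i, b.first i x * surfPartial i θ x +
    ∑ i, ∑ j, b.second i j x * surfPartial i (surfPartial j φ) x + g x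

lemma rhsC_apply_eq (hr : 2 < r) (b : Fields) {φ θ : Torus2 → ℝ} (hφ : MemH (r + 1) φ)
    (hθ : MemH r θ) (g : Torus2 → ℝ) (x : Torus2) :
    rhsC hr b (toSob (r + 1) φ) (toSob r θ) x + (g x : ℂ) = (linR b g φ θ x : ℂ) := by
  have h1 : ∀ i x, synthOf (sqSummable_dvsym hr i) (toSob r θ) x = (surfPartial i θ x : ℂ) :=
    fun i x => surfPartial_of_synthOf (sqSummable_vsym (by linarith)) _ i (dvsym_eq r i)
      (synthOf_toSob (by linarith) hθ) x
  have h2 : ∀ j x, synthOf (sqSummable_dvsym (σ := r + 1) (by linarith) j) (toSob (r + 1) φ) x =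
      (surfPartial j φ x : ℂ) :=
    fun j x => surfPartial_of_synthOf (sqSummable_vsym (by linarith)) _ j (dvsym_eq _ j)
      (synthOf_toSob (by linarith) hφ) x
  have h3 : ∀ i j x, synthOf (sqSummable_hvsym (σ := r + 1) (by linarith) i j)
      (toSob (r + 1) φ) x = (surfPartial i (surfPartial j φ) x : ℂ) :=
    fun i j x => surfPartial_of_synthOf _ _ i (hvsym_eq _ i j) (h2 j) x
  have e : ∀ (b : C(Torus2, ℝ)) (f : C(Torus2, ℂ)), (toC b * f) x = (b x : ℂ) * f x := fun b f => rfl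
  simp only [rhsC, linR, ContinuousMap.add_apply, ContinuousMap.sum_apply, e, h1, h3]
  push_cast
  rfl

/-- Solutions of the linearised system. -/
structure LinSol (r T : ℝ) (a : ℝ → Fields) (g φ θ : ℝ → Torus2 → ℝ) : Prop where
  mem_φ : MemCH T (r + 1) φ
  mem_θ : MemCH T r θ
  eq_φ : ∀ t ∈ Icc 0 T, ∀ x, HasDerivWithinAt (fun τ => φ τ x) (θ t x) (Icc 0 T) t
  integrable : ∀ x, IntervalIntegrable (fun τ => linR (a τ) (g τ) (φ τ) (θ τ) x) volume 0 T
  eq_θ : ∀ t ∈ Icc 0 T, ∀ x,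
    θ t x = θ 0 x + ∫ τ in (0 : ℝ)..t, linR (a τ) (g τ) (φ τ) (θ τ) x

lemma uIcc_zero_subset {t : ℝ} (ht : t ∈ Icc 0 T) : uIcc 0 t ⊆ Icc 0 T := by
  rw [uIcc_of_le ht.1]; exact Icc_subset_Icc le_rfl ht.2

lemma intervalIntegrable_of_memLp {t : ℝ} (hγ : MemLp γ 2 (volume.restrict (Ioc 0 T)))
    (ht : t ∈ Icc 0 T) : IntervalIntegrable γ volume 0 t := by
  rw [intervalIntegrable_iff_integrableOn_Ioc_of_le ht.1]
  exact IntegrableOn.mono_set (hγ.integrable (by norm_num)) (Ioc_subset_Ioc_right ht.2)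

/-- Mild solutions through evaluation at the points of the torus. -/
lemma Family.mildSol_iff (ha : Family r M M' L c₁ a) (hr : 2 < r)
    (hγ : MemLp γ 2 (volume.restrict (Ioc 0 T)))
    (hΦ : ContinuousOn Φ (Icc 0 T)) (hΘ : ContinuousOn Θ (Icc 0 T)) :
    MildSol r a T γ Φ Θ ↔ ∀ t ∈ Icc 0 T, ∀ x,
      (synth (σ := r + 1) (by linarith) (Φ t) x = synth (σ := r + 1) (by linarith) (Φ 0) x +
        ∫ τ in (0 : ℝ)..t, synth (σ := r) (by linarith) (Θ τ) x) ∧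
      (synth (σ := r) (by linarith) (Θ t) x = synth (σ := r) (by linarith) (Θ 0) x +
        ∫ τ in (0 : ℝ)..t, (rhsC hr (a τ) (Φ τ) (Θ τ) x +
          synth (σ := r) (by linarith) (γ τ) x)) := by
  have hr1 : 1 < r := by linarith
  have hr2 : 1 < r + 1 := by linarith
  have hcR := ha.continuousOn_rhsC hr hΦ hΘ
  have hcS : ContinuousOn (fun τ => synth hr1 (Θ τ)) (Icc 0 T) :=
    (synth hr1).continuous.comp_continuousOn hΘ
  have hev : ∀ (F : ℝ → C(Torus2, ℂ)) (t : ℝ), IntervalIntegrable F volume 0 t → ∀ x,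
      (∫ τ in (0 : ℝ)..t, F τ) x = ∫ τ in (0 : ℝ)..t, F τ x := fun F t hF x =>
    ((evalCLM ℝ x : C(Torus2, ℂ) →L[ℝ] ℂ).intervalIntegral_comp_comm hF).symm
  have key1 : ∀ t ∈ Icc 0 T, (vOp (r + 1) (Φ t) = vOp (r + 1) (Φ 0) +
      ∫ τ in (0 : ℝ)..t, vOp r (Θ τ)) ↔ ∀ x, synth hr2 (Φ t) x = synth hr2 (Φ 0) x +
        ∫ τ in (0 : ℝ)..t, synth hr1 (Θ τ) x := by
    intro t ht
    have hS : IntervalIntegrable (fun τ => synth hr1 (Θ τ)) volume 0 t :=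
      (hcS.mono (uIcc_zero_subset ht)).intervalIntegrable
    have e : vOp (r + 1) (Φ 0) + ∫ τ in (0 : ℝ)..t, vOp r (Θ τ) =
        analysisL (synth hr2 (Φ 0) + ∫ τ in (0 : ℝ)..t, synth hr1 (Θ τ)) := by
      rw [map_add, analysisL_synth, ← intervalIntegral_comp_comm _ hS]
      simp only [analysisL_synth]
    rw [e, ← analysisL_synth hr2, analysisL_injective.eq_iff, ContinuousMap.ext_iff]
    simp only [ContinuousMap.add_apply, hev _ _ hS]
  have key2 : ∀ t ∈ Icc 0 T, (vOp r (Θ t) = vOp r (Θ 0) +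
      ((∫ τ in (0 : ℝ)..t, fullRhs r (a τ) (Φ τ) (Θ τ)) + vOp r (∫ τ in (0 : ℝ)..t, γ τ))) ↔
      ∀ x, synth hr1 (Θ t) x = synth hr1 (Θ 0) x +
        ∫ τ in (0 : ℝ)..t, (rhsC hr (a τ) (Φ τ) (Θ τ) x + synth hr1 (γ τ) x) := by
    intro t ht
    have hS : IntervalIntegrable (fun τ => rhsC hr (a τ) (Φ τ) (Θ τ)) volume 0 t :=
      (hcR.mono (uIcc_zero_subset ht)).intervalIntegrable
    have hG := intervalIntegrable_of_memLp hγ ht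
    have hG' : IntervalIntegrable (fun τ => synth hr1 (γ τ)) volume 0 t :=
      ⟨(synth hr1).integrable_comp hG.1, (synth hr1).integrable_comp hG.2⟩
    have e : vOp r (Θ 0) + ((∫ τ in (0 : ℝ)..t, fullRhs r (a τ) (Φ τ) (Θ τ)) +
        vOp r (∫ τ in (0 : ℝ)..t, γ τ)) = analysisL (synth hr1 (Θ 0) +
          ∫ τ in (0 : ℝ)..t, (rhsC hr (a τ) (Φ τ) (Θ τ) + synth hr1 (γ τ))) := by
      rw [map_add, analysisL_synth, ← intervalIntegral_comp_comm _ (hS.add hG')]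
      simp only [analysisL_rhsC, analysisL_synth, map_add]
      rw [intervalIntegral.integral_add, intervalIntegral_comp_comm _ hG]
      · exact ((ha.continuousOn_fullRhs' hΦ hΘ).mono (uIcc_zero_subset ht)).intervalIntegrable
      · exact ⟨(vOp r).integrable_comp hG.1, (vOp r).integrable_comp hG.2⟩
    rw [e, ← analysisL_synth hr1, analysisL_injective.eq_iff, ContinuousMap.ext_iff]
    simp only [ContinuousMap.add_apply]
    refine forall_congr' fun x => ?_
    rw [hev _ _ (hS.add hG')]
    simp only [ContinuousMap.add_apply]
  constructor
  · exact fun h t ht x => ⟨(key1 t ht).1 (h.ex t ht) x, (key2 t ht).1 (h.ey t ht) x⟩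
  · exact fun h => ⟨hΦ, hΘ, fun t ht => (key1 t ht).2 fun x => (h t ht x).1,
      fun t ht => (key2 t ht).2 fun x => (h t ht x).2⟩

lemma continuousOn_apply {F : ℝ → C(Torus2, ℂ)} {s : Set ℝ} (hF : ContinuousOn F s) (x : Torus2) :
    ContinuousOn (fun t => F t x) s :=
  (continuous_eval_const x).comp_continuousOn hF

lemma continuousOn_of_memCH {σ : ℝ} (hσ : 1 < σ) (h : MemCH T σ φ) (x : Torus2) :
    ContinuousOn (fun t => φ t x) (Icc 0 T) := by
  refine (continuous_re.comp_continuousOn (continuousOn_apply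
    ((synth hσ).continuous.comp_continuousOn h.2) x)).congr fun t ht => ?_
  have := synthOf_toSob hσ (h.1 t ht) x
  simp [synth, this]

lemma ae_rhs_eq (hr : 2 < r) (hφ : MemCH T (r + 1) φ) (hθ : MemCH T r θ)
    (hg : ∀ᵐ t ∂volume.restrict (Ioc 0 T), MemH r (g t)) {t : ℝ} (ht : t ∈ Icc 0 T) (x : Torus2) :
    ∀ᵐ τ ∂volume.restrict (uIoc 0 t), rhsC hr (a τ) (toSob (r + 1) (φ τ)) (toSob r (θ τ)) x +
      synth (σ := r) (by linarith) (toSob r (g τ)) x =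
        ((linR (a τ) (g τ) (φ τ) (θ τ) x : ℝ) : ℂ) := by
  have hs : Ioc 0 t ⊆ Ioc 0 T := Ioc_subset_Ioc_right ht.2
  rw [uIoc_of_le ht.1]
  filter_upwards [ae_restrict_of_ae_restrict_of_subset hs hg, ae_restrict_mem measurableSet_Ioc]
    with τ h1 h2
  have hτ : τ ∈ Icc 0 T := ⟨h2.1.le, h2.2.trans ht.2⟩
  rw [← rhsC_apply_eq hr (a τ) (hφ.1 τ hτ) (hθ.1 τ hτ) (g τ) x]
  congr 1
  exact synthOf_toSob (by linarith) h1 x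

lemma LinSol.mildSol (ha : Family r M M' L c₁ a)
    (hγ : MemLp (fun t => toSob r (g t)) 2 (volume.restrict (Ioc 0 T)))
    (hg : ∀ᵐ t ∂volume.restrict (Ioc 0 T), MemH r (g t)) (h : LinSol r T a g φ θ) :
    MildSol r a T (fun t => toSob r (g t)) (fun t => toSob (r + 1) (φ t))
      (fun t => toSob r (θ t)) := by
  have hr : 2 < r := by linarith [ha.hr]
  rw [ha.mildSol_iff hr hγ h.mem_φ.2 h.mem_θ.2]
  intro t ht x
  have h0 : (0 : ℝ) ∈ Icc 0 T := ⟨le_rfl, ht.1.trans ht.2⟩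
  have sφ : ∀ τ ∈ Icc 0 T, synth (σ := r + 1) (by linarith) (toSob (r + 1) (φ τ)) x = φ τ x :=
    fun τ hτ => synthOf_toSob (by linarith) (h.mem_φ.1 τ hτ) x
  have sθ : ∀ τ ∈ Icc 0 T, synth (σ := r) (by linarith) (toSob r (θ τ)) x = θ τ x :=
    fun τ hτ => synthOf_toSob (by linarith) (h.mem_θ.1 τ hτ) x
  constructor
  · rw [sφ t ht, sφ 0 h0, integral_of_hasDerivWithinAt
      (continuousOn_of_memCH (by linarith) h.mem_θ x) (fun τ hτ => h.eq_φ τ hτ x) ht,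
      integral_congr (g := fun τ => ((θ τ x : ℝ) : ℂ))
        fun τ hτ => sθ τ (uIcc_zero_subset ht hτ), intervalIntegral.integral_ofReal]
    push_cast; rfl
  · rw [sθ t ht, sθ 0 h0, h.eq_θ t ht x, intervalIntegral.integral_congr_ae_restrict
      (ae_rhs_eq hr h.mem_φ h.mem_θ hg ht x), intervalIntegral.integral_ofReal]
    push_cast; rfl

lemma norm_reflect_le (z : Seq) : ‖reflect z‖ ≤ ‖z‖ := by
  refine (reflect.le_opNorm z).trans ?_
  rw [← one_mul ‖z‖, ← mul_assoc, mul_one]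
  gcongr
  exact LinearMap.mkContinuous_norm_le _ zero_le_one _

lemma norm_symmPart_le (z : Seq) : ‖symmPart z‖ ≤ ‖z‖ := by
  have e : symmPart z = (1 / 2 : ℝ) • (z + reflect z) := rfl
  rw [e, norm_smul, norm_of_nonneg (by norm_num)]
  linarith [norm_add_le z (reflect z), norm_reflect_le z]

/-- The real part of a mild solution solves the linearised system. -/
lemma MildSol.linSol (ha : Family r M M' L c₁ a) (hr1 : 1 < r) (hr2 : 1 < r + 1)
    (hγ : MemLp (fun t => toSob r (g t)) 2 (volume.restrict (Ioc 0 T)))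
    (hg : ∀ᵐ t ∂volume.restrict (Ioc 0 T), MemH r (g t)) (hT : 0 ≤ T)
    (h : MildSol r a T (fun t => toSob r (g t)) Φ Θ) :
    LinSol r T a g (fun t x => (synth hr2 (Φ t) x).re) (fun t x => (synth hr1 (Θ t) x).re) := by
  have hr : 2 < r := by linarith [ha.hr]
  have hiff := (ha.mildSol_iff hr hγ h.cΦ h.cΘ).1 h
  have mφ : MemCH T (r + 1) (fun t x => (synth hr2 (Φ t) x).re) :=
    ⟨fun t _ => (memH_re_synthOf hr2 (Φ t)).1, (symmPart.continuous.comp_continuousOn h.cΦ).congr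
      fun t _ => (memH_re_synthOf hr2 (Φ t)).2⟩
  have mθ : MemCH T r (fun t x => (synth hr1 (Θ t) x).re) :=
    ⟨fun t _ => (memH_re_synthOf hr1 (Θ t)).1, (symmPart.continuous.comp_continuousOn h.cΘ).congr
      fun t _ => (memH_re_synthOf hr1 (Θ t)).2⟩
  have hcΘ : ∀ x, ContinuousOn (fun t => synth hr1 (Θ t) x) (Icc 0 T) := fun x =>
    continuousOn_apply ((synth hr1).continuous.comp_continuousOn h.cΘ) x
  have hre : ∀ {F : ℝ → ℂ} {t : ℝ}, IntervalIntegrable F volume 0 t →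
      (∫ τ in (0 : ℝ)..t, F τ).re = ∫ τ in (0 : ℝ)..t, (F τ).re := fun hF =>
    (reCLM.intervalIntegral_comp_comm hF).symm
  have hI : ∀ t ∈ Icc 0 T, ∀ x, IntervalIntegrable (fun τ => rhsC hr (a τ) (Φ τ) (Θ τ) x +
      synth hr1 (toSob r (g τ)) x) volume 0 t := by
    intro t ht x
    refine IntervalIntegrable.add (((continuousOn_apply (ha.continuousOn_rhsC hr h.cΦ h.cΘ) x).mono
      (uIcc_zero_subset ht)).intervalIntegrable) ?_
    have hG := intervalIntegrable_of_memLp hγ ht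
    let A : Seq →L[ℝ] ℂ := (evalCLM ℝ x : C(Torus2, ℂ) →L[ℝ] ℂ) ∘L synth hr1
    exact ⟨A.integrable_comp hG.1, A.integrable_comp hG.2⟩
  have hR : ∀ (t : ℝ) (x : Torus2), (rhsC hr (a t) (Φ t) (Θ t) x).re =
      linR (a t) 0 (fun x => (synth hr2 (Φ t) x).re) (fun x => (synth hr1 (Θ t) x).re) x := by
    intro t x
    have e : ∀ (b : C(Torus2, ℝ)) (f : C(Torus2, ℂ)), ((toC b * f) x).re = b x * (f x).re :=
      fun b f => Complex.re_ofReal_mul _ _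
    have h1 : ∀ i, surfPartial i (fun x => (synth hr1 (Θ t) x).re) = _ := fun i =>
      surfPartial_re_synthOf _ (sqSummable_dvsym hr i) i (dvsym_eq r i) _
    have h2 : ∀ i, surfPartial i (fun x => (synth hr2 (Φ t) x).re) = _ := fun i =>
      surfPartial_re_synthOf _ (sqSummable_dvsym (by linarith) i) i (dvsym_eq _ i) _
    have h3 : ∀ i j, surfPartial i (fun x => (synthOf (sqSummable_dvsym (σ := r + 1)
        (by linarith) j) (Φ t) x).re) = _ := fun i j =>
      surfPartial_re_synthOf _ (sqSummable_hvsym (by linarith) i j) i (hvsym_eq _ i j) _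
    simp only [rhsC, linR, ContinuousMap.add_apply, ContinuousMap.sum_apply, add_re,
      Complex.re_sum, e, h1, h2, h3, Pi.zero_apply, add_zero]
  have hae : ∀ t ∈ Icc 0 T, ∀ x, ∀ᵐ τ ∂volume.restrict (uIoc 0 t),
      (rhsC hr (a τ) (Φ τ) (Θ τ) x + synth hr1 (toSob r (g τ)) x).re =
      linR (a τ) (g τ) (fun x => (synth hr2 (Φ τ) x).re) (fun x => (synth hr1 (Θ τ) x).re) x := by
    intro t ht x
    have hs : Ioc 0 t ⊆ Ioc 0 T := Ioc_subset_Ioc_right ht.2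
    rw [uIoc_of_le ht.1]
    filter_upwards [ae_restrict_of_ae_restrict_of_subset hs hg] with τ h1
    rw [add_re, hR, show synth hr1 (toSob r (g τ)) x = (g τ x : ℂ) from
      synthOf_toSob hr1 h1 x, ofReal_re]
    simp [linR]
  refine ⟨mφ, mθ, fun t ht x => ?_, fun x => ?_, fun t ht x => ?_⟩
  · exact reCLM.hasFDerivAt.comp_hasDerivWithinAt t
      (hasDerivWithinAt_of_integral (hcΘ x) (fun τ hτ => (hiff τ hτ x).1) ht)
  · have hTT : T ∈ Icc 0 T := ⟨hT, le_rfl⟩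
    have := hI T hTT x
    refine IntervalIntegrable.congr_ae ?_ (hae T hTT x)
    exact ⟨reCLM.integrable_comp this.1, reCLM.integrable_comp this.2⟩
  · rw [(hiff t ht x).2, add_re, hre (hI t ht x),
      intervalIntegral.integral_congr_ae_restrict (hae t ht x)]

/-- Well-posedness of the linearised system. -/
lemma Family.exists_linSol (ha : Family r M M' L c₁ a) (hT : 0 ≤ T)
    (hγ : MemLp (fun t => toSob r (g t)) 2 (volume.restrict (Ioc 0 T)))
    (hg : ∀ᵐ t ∂volume.restrict (Ioc 0 T), MemH r (g t)) {φ₀ θ₀ : Torus2 → ℝ}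
    (hφ₀ : MemH (r + 1) φ₀) (hθ₀ : MemH r θ₀) :
    ∃ φ θ, LinSol r T a g φ θ ∧ φ 0 = φ₀ ∧ θ 0 = θ₀ ∧
      (∀ φ' θ', LinSol r T a g φ' θ' → φ' 0 = φ₀ → θ' 0 = θ₀ →
        ∀ t ∈ Icc 0 T, φ' t = φ t ∧ θ' t = θ t) ∧
      ∀ t ∈ Icc 0 T, ‖toSob r (θ t)‖ ^ 2 + ‖toSob (r + 1) (φ t)‖ ^ 2 ≤ coerConst c₁ L *
        (10 * (1 + L) ^ 2 * (‖toSob r θ₀‖ ^ 2 + ‖toSob (r + 1) φ₀‖ ^ 2) +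
          2 * ∫ τ in (0 : ℝ)..T, ‖toSob r (g τ)‖ ^ 2) * exp (growth r M M' c₁ * T) := by
  have hr1 : 1 < r := by linarith [ha.hr]
  have hr2 : 1 < r + 1 := by linarith [ha.hr]
  obtain ⟨Φ, Θ, h, hΦ, hΘ, hb⟩ := ha.exists_mildSol hT hγ (toSob (r + 1) φ₀) (toSob r θ₀)
  have hs := h.linSol ha hr1 hr2 hγ hg hT
  have eφ : (fun x => (synth hr2 (Φ 0) x).re) = φ₀ := by
    funext x
    rw [hΦ, synth, synthOf_toSob hr2 hφ₀ x, ofReal_re]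
  have eθ : (fun x => (synth hr1 (Θ 0) x).re) = θ₀ := by
    funext x
    rw [hΘ, synth, synthOf_toSob hr1 hθ₀ x, ofReal_re]
  refine ⟨_, _, hs, eφ, eθ, fun φ' θ' h' h1 h2 t ht => ?_, fun t ht => ?_⟩
  · obtain ⟨u1, u2⟩ := (h'.mildSol ha hγ hg).unique ha h (by rw [h1, hΦ]) (by rw [h2, hΘ]) ht
    constructor
    · funext x
      rw [← u1, synth, synthOf_toSob hr2 (h'.mem_φ.1 t ht) x, ofReal_re]
    · funext x
      rw [← u2, synth, synthOf_toSob hr1 (h'.mem_θ.1 t ht) x, ofReal_re]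
  · have e1 : toSob r (fun x => (synth hr1 (Θ t) x).re) = symmPart (Θ t) :=
      (memH_re_synthOf hr1 (Θ t)).2
    have e2 : toSob (r + 1) (fun x => (synth hr2 (Φ t) x).re) = symmPart (Φ t) :=
      (memH_re_synthOf hr2 (Φ t)).2
    rw [e1, e2]
    have l1 := norm_symmPart_le (Θ t)
    have l2 := norm_symmPart_le (Φ t)
    calc _ ≤ ‖Θ t‖ ^ 2 + ‖Φ t‖ ^ 2 := by gcongr
      _ ≤ _ := by
        rw [add_comm, add_comm (‖toSob r θ₀‖ ^ 2)]
        exact hb t ht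

end

section

/-! ### Coercivity of the energy functional -/

lemma multiplier_eq {m : Freq → ℂ} {φ : Torus2 → ℝ} {z : Seq} (h : ∀ k, z k = m k * coeff φ k) :
    multiplier m φ = fourierL.symm z := by
  have h1 : HasSum (fun k => z k • torusBasis k) (fourierL.symm z) := torusBasis.hasSum_repr_symm z
  have e : ∀ k, torusBasis k = toLp 2 torusMeasure ℂ (mFourier k) :=
    fun k => congrFun UnitAddTorus.coe_mFourierBasis (k : Fin 2 → ℤ)
  rw [← h1.tsum_eq]
  exact tsum_congr fun k => by rw [h, e]

variable {r L c₁ : ℝ} {a : Fields} {φ θ : Torus2 → ℝ}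

lemma bessel_eq (h : MemH r θ) : bessel r θ = fourierL.symm (toSob r θ) :=
  multiplier_eq fun k => by rw [toSob_apply h, japanese_eq]

lemma besselPartial_eq (h : MemH (r + 1) φ) (i : Fin 2) :
    besselPartial r i φ = fourierL.symm (dV 1 i (toSob (r + 1) φ)) := by
  refine multiplier_eq fun k => ?_
  have hj := jap_pos k
  rw [dV_apply le_rfl, toSob_apply h, japanese_eq]
  have e : jap k ^ (-1 : ℝ) * jap k ^ (r + 1) = jap k ^ r := by
    rw [← rpow_add hj]; congr 1; ring
  have e' : ((jap k ^ (-1 : ℝ) : ℝ) : ℂ) * ((jap k ^ (r + 1) : ℝ) : ℂ) = ((jap k ^ r : ℝ) : ℂ) := by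
    rw [← e]; push_cast; rfl
  rw [← e']
  simp only [xi]
  push_cast
  ring

/-- The energy functional of given coefficient fields. -/
def Fields.energy (a : Fields) (r : ℝ) (θ φ : Torus2 → ℝ) : ℝ :=
  (∫ x, ‖bessel r θ x + ∑ i, (a.W i x : ℂ) * besselPartial r i φ x‖ ^ 2 ∂torusMeasure) +
    ∑ m, eps m * ∫ x, ‖∑ i, (a.B m i x : ℂ) * besselPartial r i φ x‖ ^ 2 ∂torusMeasure

lemma Fields.energy_eq (a : Fields) (hφ : MemH (r + 1) φ) (hθ : MemH r θ) :
    a.energy r θ φ = a.coef.energy (fun i => dV 1 i (toSob (r + 1) φ)) 0 (toSob r θ) := by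
  have h0 : ∀ (b : Fin 2 → C(Torus2, ℝ)), ∑ i, mulLp (b i) (besselPartial r i φ) =
      fourierL.symm (contract (fun i => mulSeq (b i)) fun i => dV 1 i (toSob (r + 1) φ)) := by
    intro b
    rw [contract, map_sum]
    refine sum_congr rfl fun i _ => ?_
    rw [mulSeq_apply, ContinuousLinearEquiv.symm_apply_apply, besselPartial_eq hφ]
  have h1 : ∀ b : Fin 2 → C(Torus2, ℝ),
      ∫ x, ‖∑ i, (b i x : ℂ) * besselPartial r i φ x‖ ^ 2 ∂torusMeasure =
      ‖contract (fun i => mulSeq (b i)) fun i => dV 1 i (toSob (r + 1) φ)‖ ^ 2 := by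
    intro b
    rw [← norm_fourierL_symm, ← h0, norm_sq_Lp]
    refine integral_congr_ae ?_
    filter_upwards [coeFn_sum_mulLp b fun i => besselPartial r i φ] with x hx
    rw [hx]
  have h2 : ∫ x, ‖bessel r θ x + ∑ i, (a.W i x : ℂ) * besselPartial r i φ x‖ ^ 2 ∂torusMeasure =
      ‖toSob r θ + contract (fun i => mulSeq (a.W i)) fun i => dV 1 i (toSob (r + 1) φ)‖ ^ 2 := by
    rw [← norm_fourierL_symm, map_add, ← h0, norm_sq_Lp, ← bessel_eq hθ]
    refine integral_congr_ae ?_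
    filter_upwards [coeFn_sum_mulLp a.W fun i => besselPartial r i φ,
      Lp.coeFn_add (bessel r θ) (∑ i, mulLp (a.W i) (besselPartial r i φ))] with x hx hx'
    rw [hx', Pi.add_apply, hx]
  rw [Fields.energy, Coef.energy, h2]
  simp only [h1, norm_zero]
  simp [Fields.coef]

lemma norm_sq_analysisL (φ : C(Torus2, ℝ)) :
    ‖analysisL (toC φ)‖ ^ 2 = ∫ x, φ x ^ 2 ∂torusMeasure := by
  have e : ‖analysisL (toC φ)‖ = ‖toLp 2 torusMeasure ℂ (toC φ)‖ := norm_fourierL _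
  rw [e, norm_sq_Lp]
  refine integral_congr_ae ?_
  filter_upwards [coeFn_toLp (p := 2) (𝕜 := ℂ) torusMeasure (toC φ)] with x hx
  rw [hx]
  change ‖((φ x : ℝ) : ℂ)‖ ^ 2 = _
  rw [norm_real, norm_eq_abs, sq_abs]

/-- Interpolation of the Sobolev norm between the gradient and the mass. -/
lemma norm_toSob_sq_le (hr : 0 ≤ r) (hφ : MemH (r + 1) φ) :
    ‖toSob (r + 1) φ‖ ^ 2 ≤ 2 * (‖dV 1 0 (toSob (r + 1) φ)‖ ^ 2 + ‖dV 1 1 (toSob (r + 1) φ)‖ ^ 2) +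
      2 ^ (r + 1) * ∫ x, φ x ^ 2 ∂torusMeasure := by
  rw [show ∫ x, φ x ^ 2 ∂torusMeasure = ‖analysisL (toC ⟨φ, hφ.1⟩)‖ ^ 2 from
    (norm_sq_analysisL ⟨φ, hφ.1⟩).symm]
  set z := toSob (r + 1) φ with hz
  set w := analysisL (toC ⟨φ, hφ.1⟩)
  have hwk : ∀ k, w k = coeff φ k := fun k => analysisL_apply _ k
  have hpt : ∀ k, ‖z k‖ ^ 2 ≤ 2 * (‖dV 1 0 z k‖ ^ 2 + ‖dV 1 1 z k‖ ^ 2) +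
      2 ^ (r + 1) * ‖w k‖ ^ 2 := by
    intro k
    have hj := jap_pos k
    rw [dV_apply le_rfl, dV_apply le_rfl, hwk, hz, toSob_apply hφ]
    simp only [norm_mul, norm_I, mul_one, norm_real, norm_eq_abs,
      mul_pow, sq_abs]
    set q := ‖coeff φ k‖ ^ 2
    have hq : 0 ≤ q := by positivity
    have hsq := jap_sq k
    rw [sum_univ_two] at hsq
    have e0 : (jap k ^ (-1 : ℝ)) ^ 2 * jap k ^ 2 = 1 := by
      rw [Real.rpow_neg_one, ← mul_pow, inv_mul_cancel₀ hj.ne', one_pow]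
    have e1 : (jap k ^ (r + 1)) ^ 2 = (jap k ^ 2) ^ (r + 1) := by
      rw [← Real.rpow_natCast, ← rpow_mul hj.le, ← Real.rpow_natCast, ← rpow_mul hj.le,
        mul_comm]
    rw [e1]
    have hi : (jap k ^ (-1 : ℝ)) ^ 2 = (jap k ^ 2)⁻¹ := eq_inv_of_mul_eq_one_left e0
    rw [hi]
    have ht1 : 1 ≤ jap k ^ 2 := one_le_pow₀ (one_le_jap k)
    have hx : xi 0 k ^ 2 + xi 1 k ^ 2 = jap k ^ 2 - 1 := by linarith
    generalize jap k ^ 2 = t at *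
    have ht : 0 < t := by linarith
    have main : t ^ (r + 1) ≤ 2 * ((t - 1) * t⁻¹ * t ^ (r + 1)) + 2 ^ (r + 1) := by
      have e2 : (t - 1) * t⁻¹ = 1 - t⁻¹ := by field_simp
      rw [e2]
      rcases le_total 2 t with h | h
      · have : t⁻¹ ≤ 2⁻¹ := inv_anti₀ two_pos h
        have hp : 0 ≤ t ^ (r + 1) := by positivity
        have hp2 : (0 : ℝ) ≤ 2 ^ (r + 1) := by positivity
        nlinarith
      · have h3 : t ^ (r + 1) ≤ 2 ^ (r + 1) := Real.rpow_le_rpow ht.le h (by linarith)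
        have h4 : 0 ≤ (1 - t⁻¹) * t ^ (r + 1) :=
          mul_nonneg (by linarith [inv_le_one_of_one_le₀ ht1]) (by positivity)
        linarith
    calc t ^ (r + 1) * q ≤ (2 * ((t - 1) * t⁻¹ * t ^ (r + 1)) + 2 ^ (r + 1)) * q := by gcongr
      _ = _ := by rw [← hx]; ring
  have hsum : HasSum (fun k => 2 * (‖dV 1 0 z k‖ ^ 2 + ‖dV 1 1 z k‖ ^ 2) +
      2 ^ (r + 1) * ‖w k‖ ^ 2) (2 * (‖dV 1 0 z‖ ^ 2 + ‖dV 1 1 z‖ ^ 2) + 2 ^ (r + 1) * ‖w‖ ^ 2) := by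
    have h : ∀ y : Seq, HasSum (fun k => ‖y k‖ ^ 2) (‖y‖ ^ 2) := fun y => by
      rw [y.norm_sq]; exact y.summable_sq.hasSum
    exact (((h _).add (h _)).mul_left 2).add ((h w).mul_left _)
  rw [Seq.norm_sq z, ← hsum.tsum_eq]
  exact Summable.tsum_le_tsum hpt (Seq.summable_sq z) hsum.summable

lemma coercive_aux {A B D E F G c P : ℝ} (h1 : A + B ≤ c * E) (h2 : D ≤ 2 * B + P * G)
    (hA : 0 ≤ A) (hB : 0 ≤ B) (hF : 0 ≤ F) (hG : 0 ≤ G) (hc : 0 < c) (hP : 0 ≤ P) :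
    A + D ≤ (2 * c + P) * (E + F + G) := by
  have hE : 0 ≤ E := nonneg_of_mul_nonneg_right (le_trans (by positivity) h1) hc
  nlinarith [mul_nonneg hP hE, mul_nonneg hP hF, mul_nonneg hc.le hF, mul_nonneg hc.le hG]

lemma Fields.coercive_coef (hc₁ : 0 < c₁) (hL : a.SupBound L) (hs : a.Stable c₁)
    (p : Fin 2 → Seq) (y : Seq) :
    ‖y‖ ^ 2 + (‖p 0‖ ^ 2 + ‖p 1‖ ^ 2) ≤ coerConst c₁ L * a.coef.energy p 0 y := by
  have h := sizeSq_le_energy hc₁ hL.coef p (hs.le_contract p) 0 y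
  have e : sizeSq p 0 y = ‖y‖ ^ 2 + (‖p 0‖ ^ 2 + ‖p 1‖ ^ 2) := by
    rw [sizeSq, norm_zero, zero_pow two_ne_zero, zero_add]
  exact e ▸ h

/-- Coercivity of the energy functional. -/
lemma Fields.coercive (hr : 0 ≤ r) (hc₁ : 0 < c₁) (hL : a.SupBound L) (hs : a.Stable c₁)
    (hφ : MemH (r + 1) φ) (hθ : MemH r θ) :
    ‖toSob r θ‖ ^ 2 + ‖toSob (r + 1) φ‖ ^ 2 ≤ (2 * coerConst c₁ L + 2 ^ (r + 1)) *
      (a.energy r θ φ + (∫ x, θ x ^ 2 ∂torusMeasure) + ∫ x, φ x ^ 2 ∂torusMeasure) := by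
  have h1 := a.coercive_coef hc₁ hL hs (fun i => dV 1 i (toSob (r + 1) φ)) (toSob r θ)
  rw [← a.energy_eq hφ hθ] at h1
  exact coercive_aux h1 (norm_toSob_sq_le hr hφ) (sq_nonneg _)
    (add_nonneg (sq_nonneg _) (sq_nonneg _)) (integral_nonneg fun x => sq_nonneg _)
    (integral_nonneg fun x => sq_nonneg _) (coerConst_pos hc₁) (by positivity)

end

section

/-! ### Smooth functions and weak derivatives in the slab -/

/-- Smoothness of a function on `𝕋² × ℝ`. -/
def SmoothB (φ : Bulk → ℝ) : Prop := ContDiff ℝ ∞ fun y : Fin 3 → ℝ => φ (bulkProj y)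

lemma bulkProj_add (y y' : Fin 3 → ℝ) : bulkProj (y + y') = bulkProj y + bulkProj y' := by
  refine Prod.ext (funext fun i => ?_) rfl
  simp [bulkProj]

lemma bulkProj_surjective : Function.Surjective bulkProj := by
  intro p
  choose y hy using fun i => QuotientAddGroup.mk_surjective (p.1 i)
  refine ⟨![y 0, y 1, p.2], Prod.ext (funext fun i => ?_) rfl⟩
  fin_cases i
  · exact hy 0
  · exact hy 1

lemma continuous_bulkProj : Continuous bulkProj := by
  refine Continuous.prodMk (continuous_pi fun i => ?_) (continuous_apply 2)
  exact (AddCircle.continuous_mk' 1).comp (continuous_apply _)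

variable {φ : Bulk → ℝ} {Ω : Set Bulk}

lemma bulkPartial_bulkProj (h : SmoothB φ) (i : Fin 3) (y : Fin 3 → ℝ) :
    bulkPartial i φ (bulkProj y) =
      fderiv ℝ (fun y : Fin 3 → ℝ => φ (bulkProj y)) y (Pi.single i 1) := by
  have hd : DifferentiableAt ℝ (fun y : Fin 3 → ℝ => φ (bulkProj y)) y :=
    (h.differentiable (by simp)) y
  rw [← hd.lineDeriv_eq_fderiv, lineDeriv, bulkPartial]
  congr 1
  funext ρ
  rw [← bulkProj_add, ← Pi.single_smul]
  simp

lemma bulkPartial_comp (h : SmoothB φ) (i : Fin 3) :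
    (fun y : Fin 3 → ℝ => bulkPartial i φ (bulkProj y)) =
      fun y => fderiv ℝ (fun y : Fin 3 → ℝ => φ (bulkProj y)) y (Pi.single i 1) :=
  funext fun y => bulkPartial_bulkProj h i y

lemma SmoothB.bulkPartial (h : SmoothB φ) (i : Fin 3) : SmoothB (bulkPartial i φ) := by
  rw [SmoothB, bulkPartial_comp h]
  exact (ContDiff.fderiv_right (m := ∞) h (by simp)).clm_apply contDiff_const

lemma bulkPartial_comm (h : SmoothB φ) (i j : Fin 3) :
    bulkPartial i (bulkPartial j φ) = bulkPartial j (bulkPartial i φ) := by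
  have hd : Differentiable ℝ (fderiv ℝ fun y : Fin 3 → ℝ => φ (bulkProj y)) :=
    (ContDiff.fderiv_right (m := ∞) h (by simp)).differentiable (by simp)
  funext p
  obtain ⟨y, rfl⟩ := bulkProj_surjective p
  have key : ∀ i j, bulkPartial i (bulkPartial j φ) (bulkProj y) =
      fderiv ℝ (fderiv ℝ fun y : Fin 3 → ℝ => φ (bulkProj y)) y (Pi.single i 1) (Pi.single j 1) := by
    intro i j
    rw [bulkPartial_bulkProj (h.bulkPartial j), bulkPartial_comp h,
      fderiv_clm_apply (hd y) (differentiableAt_const _)]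
    simp
  rw [key, key]
  exact (ContDiff.contDiffAt h).isSymmSndFDerivAt (by
    simpa using ENat.LEInfty.out) _ _

lemma SmoothB.iterate (h : SmoothB φ) (j : Fin 3) (n : ℕ) :
    SmoothB ((CurrentVortex.bulkPartial j)^[n] φ) := by
  induction n with
  | zero => exact h
  | succ n ih =>
    rw [Function.iterate_succ_apply']
    exact ih.bulkPartial j

lemma bulkPartial_iterate (h : SmoothB φ) (i j : Fin 3) (n : ℕ) :
    bulkPartial i ((bulkPartial j)^[n] φ) = (bulkPartial j)^[n] (bulkPartial i φ) := by
  induction n with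
  | zero => rfl
  | succ n ih =>
    rw [Function.iterate_succ_apply', Function.iterate_succ_apply', ← ih,
      bulkPartial_comm (h.iterate j n)]

lemma multiPartial_add_single (h : SmoothB φ) (α : Fin 3 → ℕ) (i : Fin 3) :
    multiPartial (α + Pi.single i 1) φ = multiPartial α (bulkPartial i φ) := by
  fin_cases i
  · simp only [multiPartial, Pi.add_apply, Fin.zero_eta, Pi.single_eq_same, Fin.isValue, ne_eq,
      one_ne_zero, not_false_eq_true, Pi.single_eq_of_ne, add_zero, Fin.reduceEq,
      Function.iterate_succ_apply]
    rw [bulkPartial_iterate (h.iterate 2 _), bulkPartial_iterate h]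
  · simp only [multiPartial, Pi.add_apply, Fin.mk_one, Pi.single_eq_same, Fin.isValue, ne_eq,
      zero_ne_one, not_false_eq_true, Pi.single_eq_of_ne, add_zero, Fin.reduceEq,
      Function.iterate_succ_apply]
    rw [bulkPartial_iterate h]
  · simp only [multiPartial, Pi.add_apply, Fin.reduceFinMk, Pi.single_eq_same, Fin.isValue, ne_eq,
      Fin.reduceEq, not_false_eq_true, Pi.single_eq_of_ne, add_zero, Function.iterate_succ_apply]

lemma tsupport_bulkPartial_subset (i : Fin 3) : tsupport (bulkPartial i φ) ⊆ tsupport φ := by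
  refine closure_minimal (fun p hp => ?_) (isClosed_tsupport φ)
  by_contra hn
  apply hp
  have h1 : φ =ᶠ[𝓝 p] 0 := notMem_tsupport_iff_eventuallyEq.1 hn
  have hc : Tendsto (fun ρ : ℝ => p + bulkProj (Pi.single i ρ)) (𝓝 0) (𝓝 p) := by
    have : Continuous fun ρ : ℝ => p + bulkProj (Pi.single i ρ) :=
      continuous_const.add (continuous_bulkProj.comp
        (single ℝ (fun _ : Fin 3 => ℝ) i).continuous)
    have h0 := this.tendsto 0
    have e : bulkProj (0 : Fin 3 → ℝ) = 0 := by
      refine Prod.ext (funext fun i => ?_) rfl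
      simp [bulkProj]
    simpa [e] using h0
  have h2 : (fun ρ : ℝ => φ (p + bulkProj (Pi.single i ρ))) =ᶠ[𝓝 0] fun _ => 0 := hc.eventually h1
  rw [bulkPartial, h2.deriv_eq, deriv_const]

lemma IsTest.bulkPartial (h : IsTest Ω φ) (i : Fin 3) : IsTest Ω (bulkPartial i φ) :=
  ⟨SmoothB.bulkPartial h.1 i,
    h.2.1.mono' ((subset_tsupport _).trans (tsupport_bulkPartial_subset i)),
    (tsupport_bulkPartial_subset i).trans h.2.2⟩

lemma IsWeakDeriv.integral_bulkPartial {α : Fin 3 → ℕ} {i : Fin 3} {u v w : Bulk → ℝ}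
    (h : IsWeakDeriv Ω α u v) (h' : IsWeakDeriv Ω (α + Pi.single i 1) u w) (hφ : IsTest Ω φ) :
    ∫ p in Ω, v p * CurrentVortex.bulkPartial i φ p ∂bulkMeasure =
      -∫ p in Ω, w p * φ p ∂bulkMeasure := by
  have h1 := h.2.2 _ (hφ.bulkPartial i)
  have h2 := h'.2.2 _ hφ
  rw [multiPartial_add_single hφ.1, h1] at h2
  simp only [Pi.add_apply, sum_add_distrib] at h2
  rw [Finset.sum_pi_single' i 1 Finset.univ] at h2
  simp only [Finset.mem_univ, if_true, pow_succ, mul_assoc] at h2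
  have h3 := mul_left_cancel₀ (pow_ne_zero _ (by norm_num)) h2
  rw [h3]; ring

end

section

/-! ### Test functions adapted to a graph -/

/-- Smoothness of a function on the torus. -/
structure SmoothT (b : Torus2 → ℝ) : Prop where
  cont : Continuous b
  smooth : ContDiff ℝ ∞ fun y : Fin 3 → ℝ => b (bulkProj y).1

variable {b b' F : Torus2 → ℝ} {ς : ℝ} {ψ : ℝ → ℝ}

lemma SmoothT.mul (h : SmoothT b) (h' : SmoothT b') : SmoothT fun x => b x * b' x :=
  ⟨h.cont.mul h'.cont, h.smooth.mul h'.smooth⟩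

lemma SmoothT.const_mul (c : ℝ) (h : SmoothT b) : SmoothT fun x => c * b x :=
  ⟨continuous_const.mul h.cont, contDiff_const.mul h.smooth⟩

lemma bulkProj_single_castSucc (i : Fin 2) (ρ : ℝ) :
    bulkProj (Pi.single i.castSucc ρ) = (Pi.single i (ρ : UnitAddCircle), 0) := by
  refine Prod.ext (funext fun j => ?_) ?_
  · fin_cases i <;> fin_cases j <;> simp [bulkProj, Pi.single_apply]
  · fin_cases i <;> simp [bulkProj, Pi.single_apply]

lemma bulkProj_single_last (ρ : ℝ) : bulkProj (Pi.single 2 ρ) = (0, ρ) := by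
  refine Prod.ext (funext fun j => ?_) ?_
  · fin_cases j <;> simp [bulkProj, Pi.single_apply]
  · simp [bulkProj]

lemma SmoothT.hasDerivAt (h : SmoothT b) (i : Fin 2) (x : Torus2) :
    HasDerivAt (fun ρ : ℝ => b (x + Pi.single i (ρ : UnitAddCircle))) (surfPartial i b x) 0 := by
  obtain ⟨y, hy⟩ := bulkProj_surjective (x, 0)
  have h1 : Differentiable ℝ fun ρ : ℝ => b (bulkProj (y + Pi.single i.castSucc ρ)).1 := by
    have hl : Differentiable ℝ fun ρ : ℝ => y + Pi.single i.castSucc ρ :=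
      ((single ℝ (fun _ : Fin 3 => ℝ) i.castSucc).differentiable).const_add y
    exact (h.smooth.differentiable (by simp)).comp hl
  have e : (fun ρ : ℝ => b (bulkProj (y + Pi.single i.castSucc ρ)).1) =
      fun ρ : ℝ => b (x + Pi.single i (ρ : UnitAddCircle)) := by
    funext ρ
    rw [bulkProj_add, hy, bulkProj_single_castSucc]
    rfl
  rw [e] at h1
  exact (h1 0).hasDerivAt

/-- The test function `b(x) ψ(ς (x₃ - F(x)))`. -/
def shearTest (ς : ℝ) (b F : Torus2 → ℝ) (ψ : ℝ → ℝ) (p : Bulk) : ℝ :=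
  b p.1 * ψ (ς * (p.2 - F p.1))

lemma smoothB_shearTest (hb : SmoothT b) (hF : SmoothT F) (hψ : ContDiff ℝ ∞ ψ) :
    SmoothB (shearTest ς b F ψ) := by
  have h2 : ContDiff ℝ ∞ fun y : Fin 3 → ℝ => (bulkProj y).2 := contDiff_apply ℝ ℝ (2 : Fin 3)
  exact hb.smooth.mul (hψ.comp (contDiff_const.mul (h2.sub hF.smooth)))

lemma bulkPartial_two_shearTest (hψ : ContDiff ℝ ∞ ψ) :
    bulkPartial 2 (shearTest ς b F ψ) = shearTest ς (fun x => ς * b x) F (deriv ψ) := by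
  funext p
  have h1 : HasDerivAt (fun ρ : ℝ => ς * (p.2 + ρ - F p.1)) ς 0 := by
    simpa using (((hasDerivAt_id (0 : ℝ)).const_add p.2).sub_const (F p.1)).const_mul ς
  have h2 : HasDerivAt ψ (deriv ψ (ς * (p.2 - F p.1))) (ς * (p.2 + 0 - F p.1)) := by
    rw [add_zero]
    exact (hψ.differentiable (by simp) _).hasDerivAt
  have h3 := (h2.comp 0 h1).const_mul (b p.1)
  have e : (fun ρ : ℝ => shearTest ς b F ψ (p + bulkProj (Pi.single 2 ρ))) =
      fun ρ => b p.1 * (ψ ∘ fun ρ : ℝ => ς * (p.2 + ρ - F p.1)) ρ := by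
    funext ρ
    rw [bulkProj_single_last]
    simp [shearTest]
  rw [bulkPartial, e, h3.deriv, shearTest]
  ring

lemma bulkPartial_castSucc_shearTest (hb : SmoothT b) (hF : SmoothT F) (hψ : ContDiff ℝ ∞ ψ)
    (i : Fin 2) : bulkPartial i.castSucc (shearTest ς b F ψ) = fun p =>
      shearTest ς (surfPartial i b) F ψ p -
        bulkPartial 2 (shearTest ς (fun x => b x * surfPartial i F x) F ψ) p := by
  funext p
  have h1 : HasDerivAt (fun ρ : ℝ => ς * (p.2 - F (p.1 + Pi.single i (ρ : UnitAddCircle))))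
      (ς * (-surfPartial i F p.1)) 0 := ((hF.hasDerivAt i p.1).const_sub p.2).const_mul ς
  have h2 : HasDerivAt ψ (deriv ψ (ς * (p.2 - F p.1)))
      (ς * (p.2 - F (p.1 + Pi.single i ((0 : ℝ) : UnitAddCircle)))) := by
    simp only [AddCircle.coe_zero, Pi.single_zero, add_zero]
    exact (hψ.differentiable (by simp) _).hasDerivAt
  have h3 := (hb.hasDerivAt i p.1).mul (h2.comp 0 h1)
  have e : (fun ρ : ℝ => shearTest ς b F ψ (p + bulkProj (Pi.single i.castSucc ρ))) =
      (fun ρ : ℝ => b (p.1 + Pi.single i (ρ : UnitAddCircle))) *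
        (ψ ∘ fun ρ : ℝ => ς * (p.2 - F (p.1 + Pi.single i (ρ : UnitAddCircle)))) := by
    funext ρ
    rw [bulkProj_single_castSucc]
    simp [shearTest]
  rw [bulkPartial, e, h3.deriv, bulkPartial_two_shearTest hψ]
  simp [shearTest]
  ring

/-- The geometry of the collar of width `c` of a graph inside a region. -/
structure Collar (f : Torus2 → ℝ) (ς c : ℝ) (Ω : Set Bulk) : Prop where
  cont : Continuous f
  sign : ς = 1 ∨ ς = -1
  pos : 0 < c
  meas : MeasurableSet Ω
  mem : ∀ x, ∀ z ∈ Ioo 0 c, (x, f x + ς * z) ∈ Ω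

variable {f : Torus2 → ℝ} {c η : ℝ} {Ω : Set Bulk}

lemma Collar.sq (h : Collar f ς c Ω) : ς * ς = 1 := by
  rcases h.sign with e | e <;> rw [e] <;> norm_num

lemma Collar.abs (h : Collar f ς c Ω) : |ς| = 1 := by
  rcases h.sign with e | e <;> rw [e] <;> norm_num

/-- The smooth functions of the collar variable with room `η`. -/
structure Profile (c η : ℝ) (ψ : ℝ → ℝ) : Prop where
  pos : 0 < η
  smooth : ContDiff ℝ ∞ ψ
  compact : HasCompactSupport ψ
  room : ∀ z ∈ tsupport ψ, ∀ δ, |δ| < η → z + δ ∈ Ioo 0 c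

lemma Profile.deriv (h : Profile c η ψ) : Profile c η (deriv ψ) where
  pos := h.pos
  smooth := ((contDiff_infty_iff_deriv (𝕜 := ℝ)).1 h.smooth).2
  compact := h.compact.deriv
  room z hz := h.room z (tsupport_deriv_subset hz)

lemma exists_profile (hψ : ContDiff ℝ ∞ ψ) (hc : HasCompactSupport ψ) (hs : tsupport ψ ⊆ Ioo 0 c) :
    ∃ η, Profile c η ψ := by
  obtain ⟨η, hη, h⟩ := IsCompact.exists_thickening_subset_open hc isOpen_Ioo hs
  refine ⟨η, hη, hψ, hc, fun z hz δ hδ => h ?_⟩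
  rw [Metric.mem_thickening_iff]
  exact ⟨z, hz, by simpa [Real.dist_eq] using hδ⟩

lemma isTest_shearTest (h : Collar f ς c Ω) (hψ : Profile c η ψ) (hb : SmoothT b)
    (hF : SmoothT F) (hd : ∀ x, |F x - f x| < η) :
    IsTest Ω (shearTest ς b F ψ) := by
  set K : Set Bulk := (fun q : Bulk => (q.1, F q.1 + ς * q.2)) '' (univ ×ˢ tsupport ψ)
  have hKc : IsCompact K := by
    refine (isCompact_univ.prod hψ.compact).image ?_
    have := hF.cont
    fun_prop
  have hsub : Function.support (shearTest ς b F ψ) ⊆ K := by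
    intro p hp
    have : ψ (ς * (p.2 - F p.1)) ≠ 0 := right_ne_zero_of_mul hp
    refine ⟨(p.1, ς * (p.2 - F p.1)), ⟨mem_univ _, subset_tsupport _ this⟩, Prod.ext rfl ?_⟩
    have := h.sq
    simp only
    linear_combination (p.2 - F p.1) * this
  have hts : tsupport (shearTest ς b F ψ) ⊆ K := closure_minimal hsub hKc.isClosed
  refine ⟨smoothB_shearTest hb hF hψ.smooth, HasCompactSupport.of_support_subset_isCompact hKc hsub,
    hts.trans ?_⟩
  rintro _ ⟨⟨x, z⟩, ⟨-, hz⟩, rfl⟩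
  have := h.mem x _ (hψ.room z hz (ς * (F x - f x)) (by rw [abs_mul, h.abs, one_mul]; exact hd x))
  convert! this using 2
  linear_combination (f x - F x) * h.sq

variable {u : Bulk → ℝ} {α : Fin 3 → ℕ} {va vi v3 : Bulk → ℝ} {i : Fin 2}

lemma integrable_mul_shearTest {v : Bulk → ℝ} (hv : MemLp v 2 (bulkMeasure.restrict Ω))
    (h : Collar f ς c Ω) (hψ : Profile c η ψ) (hb : SmoothT b) (hF : SmoothT F)
    (hd : ∀ x, |F x - f x| < η) :
    Integrable (fun p => v p * shearTest ς b F ψ p) (bulkMeasure.restrict Ω) := by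
  have hc : Continuous (shearTest ς b F ψ) := by
    have h1 := hb.cont
    have h2 := hF.cont
    have h3 := hψ.smooth.continuous
    unfold shearTest
    fun_prop
  exact MemLp.integrable_mul (p := 2) (q := 2) hv ((hc.memLp_of_hasCompactSupport
    (isTest_shearTest h hψ hb hF hd).2.1).mono_measure Measure.restrict_le_self)

lemma integral_normal (h : Collar f ς c Ω) (hα : IsWeakDeriv Ω α u va)
    (h3 : IsWeakDeriv Ω (α + Pi.single 2 1) u v3) (hψ : Profile c η ψ) (hb : SmoothT b)
    (hF : SmoothT F) (hd : ∀ x, |F x - f x| < η) :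
    ∫ p in Ω, va p * shearTest ς (fun x => ς * b x) F (deriv ψ) p ∂bulkMeasure =
      -∫ p in Ω, v3 p * shearTest ς b F ψ p ∂bulkMeasure := by
  rw [← bulkPartial_two_shearTest hψ.smooth]
  exact hα.integral_bulkPartial h3 (isTest_shearTest h hψ hb hF hd)

lemma integral_tangential (h : Collar f ς c Ω) (hα : IsWeakDeriv Ω α u va)
    (hi : IsWeakDeriv Ω (α + Pi.single i.castSucc 1) u vi)
    (h3 : IsWeakDeriv Ω (α + Pi.single 2 1) u v3) (hψ : Profile c η ψ) (hb : SmoothT b)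
    (hb' : SmoothT (surfPartial i b)) (hF : SmoothT F) (hF' : SmoothT (surfPartial i F))
    (hd : ∀ x, |F x - f x| < η) :
    ∫ p in Ω, va p * shearTest ς (surfPartial i b) F ψ p ∂bulkMeasure =
      -((∫ p in Ω, vi p * shearTest ς b F ψ p ∂bulkMeasure) +
        ∫ p in Ω, v3 p * shearTest ς (fun x => b x * surfPartial i F x) F ψ p ∂bulkMeasure) := by
  have h1 := hα.integral_bulkPartial hi (isTest_shearTest h hψ hb hF hd)
  have h2 := hα.integral_bulkPartial h3 (isTest_shearTest h hψ (hb.mul hF') hF hd)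
  rw [bulkPartial_castSucc_shearTest hb hF hψ.smooth] at h1
  simp only [mul_sub] at h1
  rw [integral_sub (integrable_mul_shearTest hα.2.1 h hψ hb' hF hd), h2] at h1
  · linarith
  · rw [bulkPartial_two_shearTest hψ.smooth]
    exact integrable_mul_shearTest hα.2.1 h hψ.deriv ((hb.mul hF').const_mul ς) hF hd

/-! ### Trigonometric polynomials -/

/-- The real part of a trigonometric polynomial. -/
def trig (s : Finset Freq) (a : Freq → ℂ) (x : Torus2) : ℝ :=
  (∑ k ∈ s, a k * mFourier k x).re

lemma smoothT_trig (s : Finset Freq) (a : Freq → ℂ) : SmoothT (trig s a) where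
  cont := by
    refine continuous_re.comp (continuous_finsetSum _ fun k _ => ?_)
    exact continuous_const.mul (mFourier k).continuous
  smooth := by
    refine reCLM.contDiff.comp (ContDiff.sum fun k _ => contDiff_const.mul ?_)
    have e : (fun y : Fin 3 → ℝ => mFourier k (bulkProj y).1) =
        fun y : Fin 3 → ℝ => ∏ i : Fin 2, Complex.exp (2 * Real.pi * I * (k i) * (y i.castSucc)) := by
      funext y
      simp [mFourier, bulkProj]
    rw [e]
    refine contDiff_prod fun i _ => ContDiff.cexp (contDiff_const.mul ?_)
    exact Complex.ofRealCLM.contDiff.comp (contDiff_apply ℝ ℝ i.castSucc)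

lemma surfPartial_trig (s : Finset Freq) (a : Freq → ℂ) (i : Fin 2) :
    surfPartial i (trig s a) = trig s fun k => (xi i k : ℂ) * I * a k := by
  funext x
  have h : HasDerivAt (fun ρ : ℝ => ∑ k ∈ s, a k *
      mFourier k (x + Pi.single i (ρ : UnitAddCircle)))
      (∑ k ∈ s, a k * ((xi i k : ℂ) * I *
        mFourier k (x + Pi.single i ((0 : ℝ) : UnitAddCircle)))) 0 :=
    HasDerivAt.fun_sum fun k _ => (hasDerivAt_mFourier_add k i x 0).const_mul _
  have h2 := (reCLM.hasFDerivAt.comp_hasDerivAt (0 : ℝ) h).deriv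
  refine h2.trans ?_
  simp only [AddCircle.coe_zero, Pi.single_zero, add_zero, Complex.reCLM_apply, trig]
  congr 1
  exact sum_congr rfl fun k _ => by ring

end

section

/-! ### Flattening the collar of the graph -/

variable {f : Torus2 → ℝ} {ς c η : ℝ} {Ω : Set Bulk} {ψ χ : ℝ → ℝ} {b F : Torus2 → ℝ}

/-- The map flattening the graph. -/
def shearMap (f : Torus2 → ℝ) (ς : ℝ) (q : Bulk) : Bulk := (q.1, f q.1 + ς * q.2)

/-- The measure of the flat collar. -/
abbrev collarMeasure (c : ℝ) : Measure Bulk := torusMeasure.prod (volume.restrict (Ioo 0 c))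

lemma collarMeasure_eq (c : ℝ) : collarMeasure c = bulkMeasure.restrict (univ ×ˢ Ioo 0 c) := by
  rw [collarMeasure, ← Measure.prod_restrict, Measure.restrict_univ]

lemma Collar.shearMap_shearMap (h : Collar f ς c Ω) (q : Bulk) :
    shearMap (fun x => -(ς * f x)) ς (shearMap f ς q) = q := by
  refine Prod.ext rfl ?_
  simp only [shearMap]
  linear_combination q.2 * h.sq

lemma Collar.shearMap_shearMap' (h : Collar f ς c Ω) (q : Bulk) :
    shearMap f ς (shearMap (fun x => -(ς * f x)) ς q) = q := by
  refine Prod.ext rfl ?_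
  simp only [shearMap]
  linear_combination (q.2 - f q.1) * h.sq

lemma continuous_shearMap (hf : Continuous f) : Continuous (shearMap f ς) := by
  unfold shearMap; fun_prop

lemma Collar.measurableEmbedding (h : Collar f ς c Ω) : MeasurableEmbedding (shearMap f ς) := by
  have hf := h.cont
  exact (Homeomorph.mk ⟨shearMap f ς, shearMap (fun x => -(ς * f x)) ς, h.shearMap_shearMap,
    h.shearMap_shearMap'⟩ (continuous_shearMap hf)
    (continuous_shearMap (f := fun x => -(ς * f x)) (by fun_prop))).measurableEmbedding

lemma Collar.measurePreserving (h : Collar f ς c Ω) :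
    MeasurePreserving (shearMap f ς) bulkMeasure bulkMeasure := by
  have hf := h.cont
  refine MeasurePreserving.skew_product (g := fun x z => f x + ς * z)
    (MeasurePreserving.id torusMeasure) (Continuous.measurable (by fun_prop))
    (.of_forall fun x => ?_)
  have h1 : MeasurePreserving (fun z : ℝ => ς * z) volume volume := by
    rcases h.sign with e | e
    · simp only [e, one_mul]; exact MeasurePreserving.id volume
    · simpa [e] using Measure.measurePreserving_neg (volume : Measure ℝ)
  exact ((measurePreserving_add_left volume (f x)).comp h1).map_eq

lemma Collar.collarMeasure_le (h : Collar f ς c Ω) :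
    collarMeasure c ≤ bulkMeasure.restrict (shearMap f ς ⁻¹' Ω) := by
  rw [collarMeasure_eq]
  exact Measure.restrict_mono (fun q hq => h.mem q.1 q.2 hq.2) le_rfl

lemma Collar.memLp (h : Collar f ς c Ω) {v : Bulk → ℝ} (hv : MemLp v 2 (bulkMeasure.restrict Ω)) :
    MemLp (v ∘ shearMap f ς) 2 (collarMeasure c) :=
  (hv.comp_measurePreserving (h.measurePreserving.restrict_preimage h.meas)).mono_measure
    h.collarMeasure_le

lemma Collar.eLpNorm_le (h : Collar f ς c Ω) {v : Bulk → ℝ}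
    (hv : MemLp v 2 (bulkMeasure.restrict Ω)) :
    eLpNorm (v ∘ shearMap f ς) 2 (collarMeasure c) ≤ eLpNorm v 2 (bulkMeasure.restrict Ω) :=
  (eLpNorm_mono_measure _ h.collarMeasure_le).trans (eLpNorm_comp_measurePreserving hv.1
    (h.measurePreserving.restrict_preimage h.meas)).le

lemma Collar.integral_eq (h : Collar f ς c Ω) (hχ : Profile c η χ)
    (hd : ∀ x, |F x - f x| < η) (v : Bulk → ℝ) :
    ∫ p in Ω, v p * shearTest ς b F χ p ∂bulkMeasure =
      ∫ q, v (shearMap f ς q) * (b q.1 * χ (q.2 + ς * (f q.1 - F q.1))) ∂collarMeasure c := by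
  have e : ∀ q, shearTest ς b F χ (shearMap f ς q) = b q.1 * χ (q.2 + ς * (f q.1 - F q.1)) := by
    intro q
    rw [shearTest, shearMap]
    congr 2
    linear_combination q.2 * h.sq
  rw [← h.measurePreserving.setIntegral_preimage_emb h.measurableEmbedding]
  simp only [e]
  rw [collarMeasure_eq]
  refine setIntegral_eq_of_subset_of_forall_diff_eq_zero
    (h.measurableEmbedding.measurable h.meas) (fun q hq => h.mem q.1 q.2 hq.2) fun q hq => ?_
  have h0 : χ (q.2 + ς * (f q.1 - F q.1)) = 0 := by
    by_contra hne
    have := hχ.room _ (subset_tsupport _ hne) (ς * (F q.1 - f q.1))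
      (by rw [abs_mul, h.abs, one_mul]; exact hd q.1)
    refine hq.2 ⟨mem_univ _, ?_⟩
    convert! this using 1
    ring
  rw [h0, mul_zero, mul_zero]

variable {ι : Type*} {l : Filter ι}

lemma tendsto_integral_shear [l.IsCountablyGenerated] {V : Bulk → ℝ} (hV : Integrable V (collarMeasure c))
    (hχ : Continuous χ) (hχc : HasCompactSupport χ) (hb : Continuous b) (hf : Continuous f)
    {B G : ι → Torus2 → ℝ} (hBc : ∀ n, Continuous (B n)) (hGc : ∀ n, Continuous (G n))
    (hB : TendstoUniformly B b l) (hG : TendstoUniformly G f l) :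
    Tendsto (fun n => ∫ q, V q * (B n q.1 * χ (q.2 + ς * (f q.1 - G n q.1))) ∂collarMeasure c) l
      (𝓝 (∫ q, V q * (b q.1 * χ q.2) ∂collarMeasure c)) := by
  obtain ⟨C, hC⟩ := hχc.exists_bound_of_continuous hχ
  obtain ⟨D, hD⟩ := isCompact_univ.exists_bound_of_continuousOn hb.continuousOn
  refine tendsto_integral_filter_of_dominated_convergence (fun q => ‖V q‖ * ((D + 1) * C)) ?_ ?_
    (hV.norm.mul_const _) ?_
  · refine .of_forall fun n => hV.1.mul (Continuous.aestronglyMeasurable ?_)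
    have := hBc n
    have := hGc n
    fun_prop
  · filter_upwards [tendstoUniformly_iff.1 hB 1 one_pos] with n hn
    refine .of_forall fun q => ?_
    rw [norm_mul, norm_mul]
    have h1 : ‖B n q.1‖ ≤ D + 1 := by
      have h2 := hn q.1
      have h3 := hD q.1 (mem_univ _)
      rw [dist_eq_norm] at h2
      have := norm_sub_norm_le (B n q.1) (b q.1)
      rw [norm_sub_rev] at this
      linarith
    gcongr
    · exact (norm_nonneg _).trans h1
    · exact hC _
  · refine .of_forall fun q => Tendsto.const_mul _ ((hB.tendsto_at q.1).mul ?_)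
    have h1 : Tendsto (fun n => q.2 + ς * (f q.1 - G n q.1)) l (𝓝 (q.2 + ς * (f q.1 - f q.1))) :=
      ((hG.tendsto_at q.1).const_sub _ |>.const_mul _).const_add _
    rw [sub_self, mul_zero, add_zero] at h1
    exact (hχ.tendsto _).comp h1

/-! ### Approximation of the graph -/

/-- The coefficients of `f`, as synthesised from `H^{r+1}`. -/
def graphCoeff (r : ℝ) (f : Torus2 → ℝ) (k : Freq) : ℂ := vsym (r + 1) k * toSob (r + 1) f k

lemma tendstoUniformly_trig {m : Freq → ℂ} (hm : SqSummable m) (z : Seq) :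
    TendstoUniformly (fun s : Finset Freq => trig s fun k => m k * z k)
      (fun x => (synthOf hm z x).re) atTop := by
  have h1 := hasSum_synthOf hm z
  have h2 := ContinuousMap.tendsto_iff_tendstoUniformly.1 h1
  refine tendstoUniformly_iff.2 fun ε hε => ?_
  filter_upwards [tendstoUniformly_iff.1 h2 ε hε] with s hs x
  refine lt_of_le_of_lt ?_ (hs x)
  rw [Real.dist_eq, dist_eq_norm]
  refine le_trans (le_of_eq ?_) (Complex.abs_re_le_norm _)
  rw [Complex.sub_re, trig]
  simp

variable {r : ℝ}

lemma tendstoUniformly_graph (hr : 1 < r) (hf : MemH (r + 1) f) :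
    TendstoUniformly (fun s : Finset Freq => trig s (graphCoeff r f)) f atTop := by
  convert! tendstoUniformly_trig (sqSummable_vsym (σ := r + 1) (by linarith)) (toSob (r + 1) f)
    using 1
  funext x
  rw [synthOf_toSob (by linarith) hf x, ofReal_re]

lemma surfPartial_eq_synthOf (hr : 1 < r) (hf : MemH (r + 1) f) (i : Fin 2) (x : Torus2) :
    (surfPartial i f x : ℂ) =
      synthOf (sqSummable_dvsym (σ := r + 1) (by linarith) i) (toSob (r + 1) f) x :=
  (surfPartial_of_synthOf (sqSummable_vsym (by linarith)) _ i (dvsym_eq _ i)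
    (synthOf_toSob (by linarith) hf) x).symm

lemma tendstoUniformly_surfPartial_graph (hr : 1 < r) (hf : MemH (r + 1) f) (i : Fin 2) :
    TendstoUniformly (fun s : Finset Freq => surfPartial i (trig s (graphCoeff r f)))
      (surfPartial i f) atTop := by
  convert! tendstoUniformly_trig (sqSummable_dvsym (σ := r + 1) (by linarith) i) (toSob (r + 1) f)
    using 1
  · funext s
    rw [surfPartial_trig]
    congr 1
    funext k
    rw [graphCoeff, dvsym_eq]
    ring
  · funext x
    rw [← surfPartial_eq_synthOf hr hf, ofReal_re]

lemma continuous_surfPartial (hr : 1 < r) (hf : MemH (r + 1) f) (i : Fin 2) :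
    Continuous (surfPartial i f) := by
  have : surfPartial i f = fun x =>
      (synthOf (sqSummable_dvsym (σ := r + 1) (by linarith) i) (toSob (r + 1) f) x).re := by
    funext x
    rw [← surfPartial_eq_synthOf hr hf, ofReal_re]
  rw [this]
  exact continuous_re.comp (ContinuousMap.continuous _)

lemma TendstoUniformly.mul_left {B : ι → Torus2 → ℝ} {g : Torus2 → ℝ} (hb : Continuous b)
    (h : TendstoUniformly B g l) :
    TendstoUniformly (fun n x => b x * B n x) (fun x => b x * g x) l := by
  obtain ⟨D, hD⟩ := isCompact_univ.exists_bound_of_continuousOn hb.continuousOn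
  have hD0 : 0 ≤ D := (norm_nonneg _).trans (hD 0 (mem_univ _))
  refine tendstoUniformly_iff.2 fun ε hε => ?_
  filter_upwards [tendstoUniformly_iff.1 h (ε / (D + 1)) (by positivity)] with n hn x
  have h1 := hn x
  have h2 := hD x (mem_univ _)
  rw [dist_eq_norm] at h1 ⊢
  rw [← mul_sub, norm_mul]
  calc ‖b x‖ * ‖g x - B n x‖ ≤ D * ‖g x - B n x‖ := by gcongr
    _ ≤ D * (ε / (D + 1)) := by gcongr
    _ < ε := by
      rw [mul_div_assoc', div_lt_iff₀ (by positivity)]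
      nlinarith

/-! ### Weak derivatives in the flat collar -/

variable {u : Bulk → ℝ} {α : Fin 3 → ℕ} {va vi v3 : Bulk → ℝ} {i : Fin 2}

instance (c : ℝ) : IsFiniteMeasure (collarMeasure c) := by
  unfold collarMeasure; infer_instance

lemma Collar.tendsto (h : Collar f ς c Ω) (hr : 1 < r) (hf : MemH (r + 1) f)
    (hχ : Profile c η χ) {v : Bulk → ℝ} (hv : MemLp v 2 (bulkMeasure.restrict Ω))
    (hb : Continuous b) {B : Finset Freq → Torus2 → ℝ} (hBc : ∀ n, Continuous (B n))
    (hB : TendstoUniformly B b atTop) :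
    Tendsto (fun s => ∫ p in Ω, v p * shearTest ς (B s) (trig s (graphCoeff r f)) χ p ∂bulkMeasure)
      atTop (𝓝 (∫ q, v (shearMap f ς q) * (b q.1 * χ q.2) ∂collarMeasure c)) := by
  refine (tendsto_integral_shear (ς := ς) ((h.memLp hv).integrable (by norm_num))
    hχ.smooth.continuous hχ.compact hb h.cont hBc (fun s => (smoothT_trig s _).cont) hB
    (tendstoUniformly_graph hr hf)).congr' ?_
  filter_upwards [tendstoUniformly_iff.1 (tendstoUniformly_graph hr hf) η hχ.pos] with s hs
  exact (h.integral_eq hχ (fun x => by rw [abs_sub_comm]; exact hs x) v).symm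

lemma Collar.eventually (hψ : Profile c η ψ) (hr : 1 < r) (hf : MemH (r + 1) f) :
    ∀ᶠ s in (atTop : Filter (Finset Freq)), ∀ x, |trig s (graphCoeff r f) x - f x| < η := by
  filter_upwards [tendstoUniformly_iff.1 (tendstoUniformly_graph hr hf) η hψ.pos] with s hs x
  rw [abs_sub_comm]
  exact hs x

lemma tendstoUniformly_const (b : Torus2 → ℝ) (l : Filter ι) :
    TendstoUniformly (fun _ : ι => b) b l :=
  tendstoUniformly_iff.2 fun ε hε => Eventually.of_forall fun _ x => by rwa [dist_self]

lemma Collar.weak_normal (h : Collar f ς c Ω) (hr : 1 < r) (hf : MemH (r + 1) f)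
    (hα : IsWeakDeriv Ω α u va) (h3 : IsWeakDeriv Ω (α + Pi.single 2 1) u v3)
    (hψ : Profile c η ψ) (hb : SmoothT b) :
    ∫ q, va (shearMap f ς q) * (b q.1 * deriv ψ q.2) ∂collarMeasure c =
      -∫ q, (ς * v3 (shearMap f ς q)) * (b q.1 * ψ q.2) ∂collarMeasure c := by
  have hb' := hb.const_mul ς
  have h1 := h.tendsto hr hf hψ.deriv hα.2.1 hb.cont (fun _ => hb.cont)
    (tendstoUniformly_const b atTop)
  have h2 := h.tendsto hr hf hψ h3.2.1 hb'.cont (fun _ => hb'.cont)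
    (tendstoUniformly_const _ atTop)
  rw [← integral_neg]
  refine tendsto_nhds_unique h1 ?_
  convert! h2.neg.congr' ?_ using 2
  · rw [← integral_neg]
    congr 1
    funext q
    ring
  · filter_upwards [Collar.eventually hψ hr hf] with s hs
    rw [← integral_normal h hα h3 hψ hb' (smoothT_trig s _) hs]
    have e : (fun x => ς * (ς * b x)) = b := by
      funext x
      linear_combination b x * h.sq
    rw [e]

lemma Collar.integrable (h : Collar f ς c Ω) {v : Bulk → ℝ}
    (hv : MemLp v 2 (bulkMeasure.restrict Ω)) (hψ : Profile c η ψ) (hb : Continuous b) :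
    Integrable (fun q => v (shearMap f ς q) * (b q.1 * ψ q.2)) (collarMeasure c) := by
  have h1 := hψ.smooth.continuous
  obtain ⟨C, hC⟩ := hψ.compact.exists_bound_of_continuous h1
  obtain ⟨D, hD⟩ := isCompact_univ.exists_bound_of_continuousOn hb.continuousOn
  refine ((h.memLp hv).integrable (by norm_num)).mul_bdd (c := D * C)
    (Continuous.aestronglyMeasurable (by fun_prop)) (.of_forall fun q => ?_)
  rw [norm_mul]
  have h2 := hD q.1 (mem_univ _)
  exact mul_le_mul h2 (hC _) (norm_nonneg _) ((norm_nonneg _).trans h2)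

lemma Collar.weak_tangential (h : Collar f ς c Ω) (hr : 1 < r) (hf : MemH (r + 1) f)
    (hα : IsWeakDeriv Ω α u va) (hi : IsWeakDeriv Ω (α + Pi.single i.castSucc 1) u vi)
    (h3 : IsWeakDeriv Ω (α + Pi.single 2 1) u v3)
    (hψ : Profile c η ψ) (hb : SmoothT b) (hb' : SmoothT (surfPartial i b)) :
    ∫ q, va (shearMap f ς q) * (surfPartial i b q.1 * ψ q.2) ∂collarMeasure c =
      -∫ q, (vi (shearMap f ς q) + surfPartial i f q.1 * v3 (shearMap f ς q)) *
        (b q.1 * ψ q.2) ∂collarMeasure c := by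
  have hf' := continuous_surfPartial hr hf i
  have hF' : ∀ s : Finset Freq, SmoothT (surfPartial i (trig s (graphCoeff r f))) := fun s => by
    rw [surfPartial_trig]; exact smoothT_trig _ _
  have h1 := h.tendsto hr hf hψ hα.2.1 hb'.cont (fun _ => hb'.cont) (tendstoUniformly_const _ atTop)
  have h2 := h.tendsto hr hf hψ hi.2.1 hb.cont (fun _ => hb.cont) (tendstoUniformly_const _ atTop)
  have h4 := h.tendsto hr hf hψ h3.2.1 (hb.cont.mul hf') (fun s => hb.cont.mul (hF' s).cont)
    (TendstoUniformly.mul_left hb.cont (tendstoUniformly_surfPartial_graph hr hf i))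
  refine tendsto_nhds_unique h1 ?_
  have e : ∫ q, (vi (shearMap f ς q) + surfPartial i f q.1 * v3 (shearMap f ς q)) *
        (b q.1 * ψ q.2) ∂collarMeasure c =
      (∫ q, vi (shearMap f ς q) * (b q.1 * ψ q.2) ∂collarMeasure c) +
      ∫ q, v3 (shearMap f ς q) * (b q.1 * surfPartial i f q.1 * ψ q.2) ∂collarMeasure c := by
    have hI : Integrable (fun q => v3 (shearMap f ς q) * (b q.1 * surfPartial i f q.1 * ψ q.2))
        (collarMeasure c) := h.integrable h3.2.1 hψ (hb.cont.mul hf')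
    rw [← integral_add (h.integrable hi.2.1 hψ hb.cont) hI]
    congr 1
    funext q
    ring
  rw [e]
  refine (h2.add h4).neg.congr' ?_
  filter_upwards [Collar.eventually hψ hr hf] with s hs
  exact (integral_tangential h hα hi h3 hψ hb hb' (smoothT_trig s _) (hF' s) hs).symm

lemma Collar.weak_zero (h : Collar f ς c Ω) (hr : 1 < r) (hf : MemH (r + 1) f) {v : Bulk → ℝ}
    (h0 : IsWeakDeriv Ω 0 u v) (hψ : Profile c η ψ) (hb : SmoothT b) :
    ∫ q, u (shearMap f ς q) * (b q.1 * ψ q.2) ∂collarMeasure c =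
      ∫ q, v (shearMap f ς q) * (b q.1 * ψ q.2) ∂collarMeasure c := by
  have h1 := h.tendsto hr hf hψ h0.1 hb.cont (fun _ => hb.cont) (tendstoUniformly_const _ atTop)
  have h2 := h.tendsto hr hf hψ h0.2.1 hb.cont (fun _ => hb.cont) (tendstoUniformly_const _ atTop)
  refine tendsto_nhds_unique h1 (h2.congr' ?_)
  filter_upwards [Collar.eventually hψ hr hf] with s hs
  have := h0.2.2 _ (isTest_shearTest h hψ hb (smoothT_trig s _) hs)
  simpa [multiPartial] using this.symm

end

section

/-! ### Weak derivatives on an interval -/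

variable {c : ℝ} {φ φ' : ℝ → ℂ}

lemma setIntegral_test {g : ℝ → ℂ} (h : ∀ z ∉ Ioo 0 c, g z = 0) :
    ∫ z in Ioo 0 c, g z = ∫ z, g z :=
  setIntegral_eq_integral_of_forall_compl_eq_zero h

lemma setIntegral_test_real {g : ℝ → ℝ} (h : ∀ z ∉ Ioo 0 c, g z = 0) :
    ∫ z in Ioo 0 c, g z = ∫ z, g z :=
  setIntegral_eq_integral_of_forall_compl_eq_zero h

lemma ae_eq_zero_of_test (hφ : IntegrableOn φ (Ioo 0 c))
    (h : ∀ ψ : ℝ → ℝ, ContDiff ℝ ∞ ψ → HasCompactSupport ψ → tsupport ψ ⊆ Ioo 0 c →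
      ∫ z in Ioo 0 c, ψ z • φ z = 0) : ∀ᵐ z ∂volume.restrict (Ioo 0 c), φ z = 0 := by
  rw [ae_restrict_iff' measurableSet_Ioo]
  refine isOpen_Ioo.ae_eq_zero_of_integral_contDiff_smul_eq_zero hφ.locallyIntegrableOn
    fun ψ h1 h2 h3 => ?_
  rw [← h ψ h1 h2 h3, setIntegral_test fun z hz => ?_]
  rw [image_eq_zero_of_notMem_tsupport fun h' => hz (h3 h'), zero_smul]

lemma primitive_eq (z : ℝ) (hz : z ∈ Ioo 0 c) :
    ∫ τ in (0 : ℝ)..z, φ' τ = ∫ τ in Ioo 0 c, (Iic z).indicator φ' τ := by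
  rw [integral_of_le hz.1.le, setIntegral_indicator measurableSet_Iic]
  congr 2
  ext τ
  simp only [mem_Ioc, mem_inter_iff, mem_Ioo, mem_Iic]
  constructor
  · rintro ⟨h1, h2⟩; exact ⟨⟨h1, lt_of_le_of_lt h2 hz.2⟩, h2⟩
  · rintro ⟨⟨h1, -⟩, h2⟩; exact ⟨h1, h2⟩

/-- Integration by parts against a primitive. -/
lemma integral_deriv_smul_primitive (hφ' : IntegrableOn φ' (Ioo 0 c)) {ψ : ℝ → ℝ}
    (hψ : ContDiff ℝ ∞ ψ) (hc : HasCompactSupport ψ) (hs : tsupport ψ ⊆ Ioo 0 c) :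
    ∫ z in Ioo 0 c, deriv ψ z • ∫ τ in (0 : ℝ)..z, φ' τ = -∫ z in Ioo 0 c, ψ z • φ' z := by
  have hdc : Continuous (deriv ψ) := hψ.continuous_deriv (by simp)
  obtain ⟨C, hC⟩ := hc.deriv.exists_bound_of_continuous hdc
  have hI : Integrable (Function.uncurry fun z τ : ℝ => deriv ψ z • (Iic z).indicator φ' τ)
      ((volume.restrict (Ioo 0 c)).prod (volume.restrict (Ioo 0 c))) := by
    have h1 : Integrable (fun q : ℝ × ℝ => φ' q.2)
        ((volume.restrict (Ioo 0 c)).prod (volume.restrict (Ioo 0 c))) := hφ'.comp_snd _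
    have hm : MeasurableSet {q : ℝ × ℝ | q.2 ≤ q.1} := measurableSet_le measurable_snd measurable_fst
    have h2 := (h1.indicator hm).bdd_mul (c := C) (f := fun q : ℝ × ℝ => ((deriv ψ q.1 : ℝ) : ℂ))
      (Continuous.aestronglyMeasurable (by fun_prop))
      (.of_forall fun q => by rw [norm_real]; exact hC q.1)
    refine h2.congr (.of_forall fun q => ?_)
    simp only [Function.uncurry, real_smul]
    congr 1
  have e1 : ∫ z in Ioo 0 c, deriv ψ z • ∫ τ in (0 : ℝ)..z, φ' τ =
      ∫ z in Ioo 0 c, ∫ τ in Ioo 0 c, deriv ψ z • (Iic z).indicator φ' τ := by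
    refine setIntegral_congr_fun measurableSet_Ioo fun z hz => ?_
    rw [primitive_eq z hz, integral_smul]
  rw [e1, integral_integral_swap hI, ← integral_neg]
  refine setIntegral_congr_fun measurableSet_Ioo fun τ hτ => ?_
  have e2 : ∀ z, deriv ψ z • (Iic z).indicator φ' τ = (Ici τ).indicator (fun z => deriv ψ z) z • φ' τ := by
    intro z
    by_cases h : τ ≤ z
    · rw [indicator_of_mem (show τ ∈ Iic z from h), indicator_of_mem (show z ∈ Ici τ from h)]
    · rw [indicator_of_notMem (show τ ∉ Iic z from h), indicator_of_notMem (show z ∉ Ici τ from h)]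
      simp
  simp only [e2]
  rw [integral_smul_const, setIntegral_indicator measurableSet_Ici]
  have e3 : Ioo 0 c ∩ Ici τ = Ico τ c := by
    ext z
    simp only [mem_inter_iff, mem_Ioo, mem_Ici, mem_Ico]
    exact ⟨fun h => ⟨h.2, h.1.2⟩, fun h => ⟨⟨lt_of_lt_of_le hτ.1 h.1, h.2⟩, h.1⟩⟩
  have e4 : ψ c = 0 := image_eq_zero_of_notMem_tsupport fun h' => lt_irrefl c (hs h').2
  rw [e3, integral_Ico_eq_integral_Ioc, ← integral_of_le hτ.2.le,
    intervalIntegral.integral_deriv_eq_sub (fun z _ => hψ.differentiable (by simp) z)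
      (hdc.intervalIntegrable _ _), e4, zero_sub, neg_smul]

/-- Functions with an integrable weak derivative are primitives. -/
lemma exists_primitive (hc : 0 < c) (hφ : IntegrableOn φ (Ioo 0 c)) (hφ' : IntegrableOn φ' (Ioo 0 c))
    (h : ∀ ψ : ℝ → ℝ, ContDiff ℝ ∞ ψ → HasCompactSupport ψ → tsupport ψ ⊆ Ioo 0 c →
      ∫ z in Ioo 0 c, deriv ψ z • φ z = -∫ z in Ioo 0 c, ψ z • φ' z) :
    ∃ C, ∀ᵐ z ∂volume.restrict (Ioo 0 c), φ z = C + ∫ τ in (0 : ℝ)..z, φ' τ := by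
  have hint : IntervalIntegrable φ' volume 0 c := by
    rw [intervalIntegrable_iff_integrableOn_Ioo_of_le hc.le]; exact hφ'
  have hΦ : IntegrableOn (fun z => ∫ τ in (0 : ℝ)..z, φ' τ) (Ioo 0 c) := by
    have := intervalIntegral.continuousOn_primitive_interval (μ := volume) (f := φ') (a := 0) (b := c)
      (by rw [uIcc_of_le hc.le, integrableOn_Icc_iff_integrableOn_Ioo]; exact hφ')
    rw [uIcc_of_le hc.le] at this
    exact (this.integrableOn_compact isCompact_Icc).mono_set Ioo_subset_Icc_self
  set D : ℝ → ℂ := fun z => φ z - ∫ τ in (0 : ℝ)..z, φ' τ with hD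
  have hDi : IntegrableOn D (Ioo 0 c) := hφ.sub hΦ
  have hsm : ∀ {χ : ℝ → ℝ} {g : ℝ → ℂ}, Continuous χ → HasCompactSupport χ →
      IntegrableOn g (Ioo 0 c) → IntegrableOn (fun z => χ z • g z) (Ioo 0 c) := by
    intro χ g h1 h2 h3
    obtain ⟨B, hB⟩ := h2.exists_bound_of_continuous h1
    exact Integrable.bdd_smul (C := B) h3 h1.aestronglyMeasurable (.of_forall hB)
  have hDψ : ∀ ψ : ℝ → ℝ, ContDiff ℝ ∞ ψ → HasCompactSupport ψ → tsupport ψ ⊆ Ioo 0 c →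
      ∫ z in Ioo 0 c, deriv ψ z • D z = 0 := by
    intro ψ h1 h2 h3
    have hdc : Continuous (deriv ψ) := h1.continuous_deriv (by simp)
    simp only [hD, smul_sub]
    rw [integral_sub (hsm hdc h2.deriv hφ) (hsm hdc h2.deriv hΦ), h ψ h1 h2 h3,
      integral_deriv_smul_primitive hφ' h1 h2 h3, sub_self]
  let β : ContDiffBump (c / 2) := ⟨c / 8, c / 4, by positivity, by linarith⟩
  set ψ₀ : ℝ → ℝ := β.normed volume with hψ₀
  have s0 : ContDiff ℝ ∞ ψ₀ := β.contDiff_normed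
  have c0 : HasCompactSupport ψ₀ := β.hasCompactSupport_normed
  have t0 : tsupport ψ₀ ⊆ Ioo 0 c := by
    rw [hψ₀, β.tsupport_normed_eq, Real.closedBall_eq_Icc]
    exact fun z hz => ⟨by linarith [hz.1, show β.rOut = c / 4 from rfl],
      by linarith [hz.2, show β.rOut = c / 4 from rfl]⟩
  have i0 : ∫ z, ψ₀ z = 1 := β.integral_normed
  have htest : ∀ χ : ℝ → ℝ, tsupport χ ⊆ Ioo 0 c → ∀ z ∉ Ioo 0 c, χ z = 0 := fun χ hχ z hz =>
    image_eq_zero_of_notMem_tsupport fun h' => hz (hχ h')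
  refine ⟨∫ z in Ioo 0 c, ψ₀ z • D z, ?_⟩
  set C := ∫ z in Ioo 0 c, ψ₀ z • D z
  have hCi : IntegrableOn (fun _ : ℝ => C) (Ioo 0 c) := integrableOn_const (by simp)
  have key := ae_eq_zero_of_test (φ := fun z => D z - C) (c := c) (hDi.sub hCi) ?_
  · filter_upwards [key] with z hz
    rw [hD, sub_eq_zero] at hz
    rw [← hz]; ring
  intro χ s1 c1 t1
  set m := ∫ z, χ z
  set κ : ℝ → ℝ := fun z => χ z - m * ψ₀ z with hκ
  have sκ : ContDiff ℝ ∞ κ := s1.sub (contDiff_const.mul s0)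
  set K := tsupport χ ∪ tsupport ψ₀
  have hKc : IsCompact K := c1.isCompact.union c0.isCompact
  have hKs : K ⊆ Ioo 0 c := union_subset t1 t0
  have hKne : K.Nonempty := by
    refine ⟨c / 2, Or.inr (subset_tsupport _ ?_)⟩
    have : (0 : ℝ) < β.normed volume (c / 2) := by
      rw [ContDiffBump.normed_def]
      exact div_pos (by rw [β.one_of_mem_closedBall (by simp [β.rIn_pos.le])]; exact one_pos)
        β.integral_pos
    exact this.ne'
  have ha := hKs (hKc.sInf_mem hKne)
  have hb := hKs (hKc.sSup_mem hKne)
  have hκ0 : ∀ z ∉ K, κ z = 0 := by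
    intro z hz
    rw [hκ]
    simp only
    rw [image_eq_zero_of_notMem_tsupport fun h' => hz (Or.inl h'),
      image_eq_zero_of_notMem_tsupport fun h' => hz (Or.inr h')]
    ring
  have hKab : K ⊆ Icc (sInf K) (sSup K) := fun z hz =>
    ⟨csInf_le hKc.bddBelow hz, le_csSup hKc.bddAbove hz⟩
  have iχ : Integrable χ := s1.continuous.integrable_of_hasCompactSupport c1
  have iψ : Integrable ψ₀ := s0.continuous.integrable_of_hasCompactSupport c0
  set ψ : ℝ → ℝ := fun z => ∫ τ in (0 : ℝ)..z, κ τ with hψ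
  have hder : ∀ z, HasDerivAt ψ (κ z) z := fun z =>
    intervalIntegral.integral_hasDerivAt_right (sκ.continuous.intervalIntegrable _ _)
      sκ.continuous.stronglyMeasurable.stronglyMeasurableAtFilter sκ.continuous.continuousAt
  have hdψ : deriv ψ = κ := funext fun z => (hder z).deriv
  have hsupp : Function.support ψ ⊆ Icc (sInf K) (sSup K) := by
    intro z hz
    by_contra hn
    apply hz
    rw [mem_Icc, not_and_or, not_le, not_le] at hn
    rcases hn with hn | hn
    · refine (integral_congr (g := fun _ => 0) fun τ hτ => ?_).trans (by simp)
      refine hκ0 τ fun hK' => ?_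
      have h1 := (hKab hK').1
      have h2 : τ ≤ max 0 z := hτ.2
      exact absurd (h1.trans h2) (not_le.2 (max_lt ha.1 hn))
    · have hsub : Function.support κ ⊆ Ioc 0 z := by
        intro τ hτ
        have hτK : τ ∈ K := by
          by_contra h'; exact hτ (hκ0 τ h')
        exact ⟨(hKs hτK).1, (hKab hτK).2.trans hn.le⟩
      rw [hψ]
      simp only
      rw [intervalIntegral.integral_eq_integral_of_support_subset hsub, hκ,
        integral_sub iχ (iψ.const_mul m), integral_const_mul, i0, mul_one, sub_self]
  have hts : tsupport ψ ⊆ Icc (sInf K) (sSup K) := closure_minimal hsupp isClosed_Icc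
  have sψ : ContDiff ℝ ∞ ψ := by
    rw [contDiff_infty_iff_deriv, hdψ]
    exact ⟨fun z => (hder z).differentiableAt, sκ⟩
  have h0 := hDψ ψ sψ (HasCompactSupport.of_support_subset_isCompact isCompact_Icc hsupp)
    (hts.trans fun z hz => ⟨lt_of_lt_of_le ha.1 hz.1, lt_of_le_of_lt hz.2 hb.2⟩)
  rw [hdψ, hκ] at h0
  have j1 := hsm s1.continuous c1 hDi
  have j2 := hsm s0.continuous c0 hDi
  simp only [sub_smul, mul_smul] at h0
  have j3 : IntegrableOn (fun z => m • ψ₀ z • D z) (Ioo 0 c) := j2.smul m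
  rw [integral_sub j1 j3, integral_smul] at h0
  simp only [smul_sub]
  rw [integral_sub j1 (hsm s1.continuous c1 hCi), integral_smul_const,
    setIntegral_test_real (htest χ t1)]
  exact h0

lemma sq_lintegral_le {μ : Measure ℝ} {g : ℝ → ℝ≥0∞} (hg : AEMeasurable g μ) :
    (∫⁻ z, g z ∂μ) ^ 2 ≤ μ univ * ∫⁻ z, g z ^ 2 ∂μ := by
  have h := ENNReal.lintegral_mul_le_Lp_mul_Lq μ Real.HolderConjugate.two_two hg
    (aemeasurable_const (b := (1 : ℝ≥0∞)))
  simp only [Pi.mul_apply, mul_one, ENNReal.one_rpow, lintegral_const, one_mul] at h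
  have h2 := ENNReal.rpow_le_rpow h (z := 2) (by norm_num)
  rw [ENNReal.mul_rpow_of_nonneg _ _ (by norm_num), ← ENNReal.rpow_mul, ← ENNReal.rpow_mul] at h2
  norm_num at h2
  rwa [mul_comm]

/-- Pointwise bound of a primitive. -/
lemma enorm_primitive_sq_le (hφ' : IntegrableOn φ' (Ioo 0 c)) {C : ℂ} {z δ : ℝ} (hδ : 0 < δ)
    (hδc : δ ≤ c / 2) (hz : z ∈ Ico 0 c) :
    ofReal δ * ‖C + ∫ τ in (0 : ℝ)..z, φ' τ‖ₑ ^ 2 ≤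
      2 * (∫⁻ y in Ioo 0 c, ‖C + ∫ τ in (0 : ℝ)..y, φ' τ‖ₑ ^ 2) +
        2 * ofReal δ ^ 2 * ∫⁻ y in Ioo 0 c, ‖φ' y‖ₑ ^ 2 := by
  set φ : ℝ → ℂ := fun z => C + ∫ τ in (0 : ℝ)..z, φ' τ with hφ
  obtain ⟨a, ha, haz⟩ : ∃ a, Ioo a (a + δ) ⊆ Ioo 0 c ∧ z ∈ Icc a (a + δ) := by
    rcases le_total z (c / 2) with h | h
    · exact ⟨z, Ioo_subset_Ioo hz.1 (by linarith), le_rfl, by linarith⟩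
    · exact ⟨z - δ, Ioo_subset_Ioo (by linarith) (by linarith [hz.2]), by linarith, by linarith⟩
  have hint : ∀ y ∈ Icc 0 c, IntervalIntegrable φ' volume 0 y := by
    intro y hy
    rw [intervalIntegrable_iff_integrableOn_Ioo_of_le hy.1]
    exact hφ'.mono_set (Ioo_subset_Ioo_right hy.2)
  have hvol : volume (Ioo a (a + δ)) = ofReal δ := by
    rw [Real.volume_Ioo]; congr 1; ring
  have hpt : ∀ y ∈ Ioo a (a + δ), ‖φ z‖ₑ ^ 2 ≤ 2 * ‖φ y‖ₑ ^ 2 +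
      2 * (ofReal δ * ∫⁻ τ in Ioo 0 c, ‖φ' τ‖ₑ ^ 2) := by
    intro y hy
    have hy' := ha hy
    have e : φ z = φ y + ∫ τ in y..z, φ' τ := by
      rw [hφ]
      simp only
      rw [← intervalIntegral.integral_interval_sub_left (hint z ⟨hz.1, hz.2.le⟩)
        (hint y (Ioo_subset_Icc_self hy'))]
      ring
    have h1 : ‖∫ τ in y..z, φ' τ‖ₑ ≤ ∫⁻ τ in Ioo a (a + δ), ‖φ' τ‖ₑ := by
      have e1 : ‖∫ τ in y..z, φ' τ‖ₑ = ‖∫ τ in uIoc y z, φ' τ‖ₑ := by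
        rw [← ofReal_norm, ← ofReal_norm, intervalIntegral.norm_intervalIntegral_eq]
      rw [e1]
      refine (enorm_integral_le_lintegral_enorm _).trans ?_
      rw [Measure.restrict_congr_set (Ioo_ae_eq_Icc (a := a) (b := a + δ) (μ := volume))]
      exact lintegral_mono_set (uIoc_subset_uIcc.trans
        (uIcc_subset_Icc (Ioo_subset_Icc_self hy) haz))
    have h2 : (∫⁻ τ in Ioo a (a + δ), ‖φ' τ‖ₑ) ^ 2 ≤
        ofReal δ * ∫⁻ τ in Ioo 0 c, ‖φ' τ‖ₑ ^ 2 := by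
      refine (sq_lintegral_le (hφ'.mono_set ha).aestronglyMeasurable.enorm).trans ?_
      rw [Measure.restrict_apply_univ, hvol]
      gcongr
    rw [e]
    calc ‖φ y + ∫ τ in y..z, φ' τ‖ₑ ^ 2 ≤ (‖φ y‖ₑ + ‖∫ τ in y..z, φ' τ‖ₑ) ^ 2 := by
          gcongr; exact enorm_add_le _ _
      _ ≤ 2 * ‖φ y‖ₑ ^ 2 + 2 * ‖∫ τ in y..z, φ' τ‖ₑ ^ 2 := by
          have := ENNReal_tsum_add_sq_le (ι := Unit) (fun _ => ‖φ y‖ₑ)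
            fun _ => ‖∫ τ in y..z, φ' τ‖ₑ
          simpa using this
      _ ≤ _ := by
          gcongr
          exact (pow_le_pow_left' h1 2).trans h2
  have hI : ∫⁻ _ in Ioo a (a + δ), ‖φ z‖ₑ ^ 2 ≤ ∫⁻ y in Ioo a (a + δ), (2 * ‖φ y‖ₑ ^ 2 +
      2 * (ofReal δ * ∫⁻ τ in Ioo 0 c, ‖φ' τ‖ₑ ^ 2)) :=
    setLIntegral_mono_ae' measurableSet_Ioo (.of_forall hpt)
  rw [setLIntegral_const, hvol, lintegral_add_right _ measurable_const, setLIntegral_const, hvol,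
    lintegral_const_mul' _ _ (by simp)] at hI
  calc _ = ‖φ z‖ₑ ^ 2 * ofReal δ := mul_comm _ _
    _ ≤ _ := hI
    _ ≤ 2 * (∫⁻ y in Ioo 0 c, ‖φ y‖ₑ ^ 2) +
      2 * (ofReal δ * ∫⁻ τ in Ioo 0 c, ‖φ' τ‖ₑ ^ 2) * ofReal δ := by
        gcongr
    _ = _ := by ring

end

section

/-! ### Fourier coefficients in the flat collar -/

variable {f : Torus2 → ℝ} {ς c η r : ℝ} {Ω : Set Bulk} {V V' : Bulk → ℝ}

/-- The Fourier coefficients of the slices of a function on the collar. -/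
def sliceCoeff (V : Bulk → ℝ) (k : Freq) (z : ℝ) : ℂ := coeff (fun x => V (x, z)) k

lemma integrable_mul_mFourier {μ : Measure ℝ} (hV : Integrable V (torusMeasure.prod μ)) (k : Freq) :
    Integrable (fun q : Bulk => mFourier k q.1 * (V q : ℂ)) (torusMeasure.prod μ) := by
  refine (hV.ofReal (𝕜 := ℂ)).bdd_mul (c := 1) (Continuous.aestronglyMeasurable (by fun_prop))
    (.of_forall fun q => (norm_mFourier_apply k q.1).le)

lemma integrable_sliceCoeff (hV : Integrable V (collarMeasure c)) (k : Freq) :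
    IntegrableOn (sliceCoeff V k) (Ioo 0 c) :=
  (integrable_mul_mFourier hV (-k)).integral_prod_right

lemma trig_singleton (k : Freq) (x : Torus2) :
    (trig {k} (fun _ => 1) x : ℂ) + I * (trig {k} (fun _ => -I) x : ℂ) =
      mFourier k x := by
  simp only [trig, Finset.sum_singleton]
  apply Complex.ext <;> simp

lemma integral_smul_sliceCoeff (hV : Integrable V (collarMeasure c)) {ψ : ℝ → ℝ} (hψ : Continuous ψ)
    (hc : HasCompactSupport ψ) (k : Freq) :
    ∫ z in Ioo 0 c, ψ z • sliceCoeff V k z =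
      ((∫ q, V q * (trig {-k} (fun _ => 1) q.1 * ψ q.2) ∂collarMeasure c : ℝ) : ℂ) + I *
        ((∫ q, V q * (trig {-k} (fun _ => -I) q.1 * ψ q.2) ∂collarMeasure c : ℝ) : ℂ) := by
  obtain ⟨B, hB⟩ := hc.exists_bound_of_continuous hψ
  have hi : ∀ a, Integrable (fun q => V q * (trig {-k} a q.1 * ψ q.2)) (collarMeasure c) := by
    intro a
    have ht := (smoothT_trig {-k} a).cont
    obtain ⟨D, hD⟩ := isCompact_univ.exists_bound_of_continuousOn ht.continuousOn
    refine hV.mul_bdd (c := D * B) (Continuous.aestronglyMeasurable (by fun_prop))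
      (.of_forall fun q => ?_)
    rw [norm_mul]
    have h2 := hD q.1 (mem_univ _)
    exact mul_le_mul h2 (hB _) (norm_nonneg _) ((norm_nonneg _).trans h2)
  have hI : Integrable (fun q : Bulk => (ψ q.2 : ℂ) * (mFourier (-k) q.1 * (V q : ℂ)))
      (collarMeasure c) :=
    (integrable_mul_mFourier hV (-k)).bdd_mul (c := B) (Continuous.aestronglyMeasurable (by fun_prop))
      (.of_forall fun q => by rw [norm_real]; exact hB q.2)
  rw [← integral_complex_ofReal, ← integral_complex_ofReal, ← integral_const_mul,
    ← integral_add (hi _).ofReal ((hi _).ofReal.const_mul _)]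
  have e : ∀ q : Bulk, ((V q * (trig {-k} (fun _ => 1) q.1 * ψ q.2) : ℝ) : ℂ) + I *
      ((V q * (trig {-k} (fun _ => -I) q.1 * ψ q.2) : ℝ) : ℂ) =
      (ψ q.2 : ℂ) * (mFourier (-k) q.1 * (V q : ℂ)) := by
    intro q
    rw [← trig_singleton]
    push_cast; ring
  simp only [e]
  refine Eq.trans ?_ (integral_prod_symm _ hI).symm
  refine integral_congr_ae (.of_forall fun z => ?_)
  simp only [sliceCoeff, coeff_eq, real_smul]
  rw [← integral_const_mul]

variable {u : Bulk → ℝ} {α : Fin 3 → ℕ} {va vi v3 : Bulk → ℝ} {i : Fin 2}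

/-- The normal derivative of the slice coefficients. -/
lemma Collar.exists_primitive (h : Collar f ς c Ω) (hr : 1 < r) (hf : MemH (r + 1) f)
    (hα : IsWeakDeriv Ω α u va) (h3 : IsWeakDeriv Ω (α + Pi.single 2 1) u v3) (k : Freq) :
    ∃ C, ∀ᵐ z ∂volume.restrict (Ioo 0 c), sliceCoeff (va ∘ shearMap f ς) k z =
      C + ∫ τ in (0 : ℝ)..z, sliceCoeff (fun q => ς * v3 (shearMap f ς q)) k τ := by
  have i1 := (h.memLp hα.2.1).integrable (by norm_num)
  have i2 : Integrable (fun q => ς * v3 (shearMap f ς q)) (collarMeasure c) :=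
    ((h.memLp h3.2.1).integrable (by norm_num)).const_mul ς
  refine CurrentVortex.exists_primitive h.pos (integrable_sliceCoeff i1 k)
    (integrable_sliceCoeff i2 k) fun ψ h1 h2 h3' => ?_
  obtain ⟨η, hη⟩ := exists_profile h1 h2 h3'
  rw [integral_smul_sliceCoeff i1 hη.deriv.smooth.continuous hη.deriv.compact,
    integral_smul_sliceCoeff i2 h1.continuous h2]
  simp only [Function.comp_apply]
  rw [h.weak_normal hr hf hα h3 hη (smoothT_trig _ _), h.weak_normal hr hf hα h3 hη (smoothT_trig _ _)]
  push_cast; ring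

/-- The tangential derivatives of the slice coefficients. -/
lemma Collar.tangential (h : Collar f ς c Ω) (hr : 1 < r) (hf : MemH (r + 1) f)
    (hα : IsWeakDeriv Ω α u va) (hi : IsWeakDeriv Ω (α + Pi.single i.castSucc 1) u vi)
    (h3 : IsWeakDeriv Ω (α + Pi.single 2 1) u v3) (k : Freq) :
    ∀ᵐ z ∂volume.restrict (Ioo 0 c), (xi i k : ℂ) * I *
      sliceCoeff (va ∘ shearMap f ς) k z = sliceCoeff (fun q => vi (shearMap f ς q) +
        surfPartial i f q.1 * v3 (shearMap f ς q)) k z := by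
  have i1 := (h.memLp hα.2.1).integrable (by norm_num)
  have hf' := continuous_surfPartial hr hf i
  obtain ⟨D, hD⟩ := isCompact_univ.exists_bound_of_continuousOn hf'.continuousOn
  have i2 : Integrable (fun q => vi (shearMap f ς q) + surfPartial i f q.1 * v3 (shearMap f ς q))
      (collarMeasure c) :=
    ((h.memLp hi.2.1).integrable (by norm_num)).add (((h.memLp h3.2.1).integrable
      (by norm_num)).bdd_mul (c := D) (Continuous.aestronglyMeasurable (by fun_prop))
      (.of_forall fun q => hD q.1 (mem_univ _)))
  have key := ae_eq_zero_of_test (φ := fun z => (xi i k : ℂ) * I *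
      sliceCoeff (va ∘ shearMap f ς) k z - sliceCoeff (fun q => vi (shearMap f ς q) +
        surfPartial i f q.1 * v3 (shearMap f ς q)) k z)
    (((integrable_sliceCoeff i1 k).const_mul _).sub (integrable_sliceCoeff i2 k))
    fun ψ h1 h2 h3' => ?_
  · filter_upwards [key] with z hz
    exact sub_eq_zero.1 hz
  obtain ⟨η, hη⟩ := exists_profile h1 h2 h3'
  have hsm : ∀ {g : ℝ → ℂ}, IntegrableOn g (Ioo 0 c) → IntegrableOn (fun z => ψ z • g z) (Ioo 0 c) := by
    intro g hg
    obtain ⟨B, hB⟩ := h2.exists_bound_of_continuous h1.continuous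
    exact Integrable.bdd_smul (C := B) hg h1.continuous.aestronglyMeasurable (.of_forall hB)
  have e0 : ∀ z, ψ z • ((xi i k : ℂ) * I * sliceCoeff (va ∘ shearMap f ς) k z) =
      (xi i k : ℂ) * I * (ψ z • sliceCoeff (va ∘ shearMap f ς) k z) := fun z =>
    mul_smul_comm _ _ _ |>.symm
  simp only [smul_sub, e0]
  rw [integral_sub ((hsm (integrable_sliceCoeff i1 k)).const_mul _)
    (hsm (integrable_sliceCoeff i2 k)), integral_const_mul,
    integral_smul_sliceCoeff i1 h1.continuous h2, integral_smul_sliceCoeff i2 h1.continuous h2]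
  have d1 : surfPartial i (trig {-k} fun _ => 1) =
      fun x => xi i k * trig {-k} (fun _ => -I) x := by
    rw [surfPartial_trig]
    funext x
    simp [trig, xi_neg]
  have d2 : surfPartial i (trig {-k} fun _ => -I) =
      fun x => (-xi i k) * trig {-k} (fun _ => 1) x := by
    rw [surfPartial_trig]
    funext x
    simp [trig, xi_neg, mul_assoc]
  have w1 := h.weak_tangential hr hf hα hi h3 hη (smoothT_trig {-k} fun _ => 1)
    (d1 ▸ (smoothT_trig _ _).const_mul _)
  have w2 := h.weak_tangential hr hf hα hi h3 hη (smoothT_trig {-k} fun _ => -I)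
    (d2 ▸ (smoothT_trig _ _).const_mul _)
  rw [d1] at w1
  rw [d2] at w2
  have e1 : ∀ (t : ℝ) (a : Freq → ℂ), ∫ q, va (shearMap f ς q) * (t * trig {-k} a q.1 * ψ q.2)
      ∂collarMeasure c = t * ∫ q, va (shearMap f ς q) * (trig {-k} a q.1 * ψ q.2)
      ∂collarMeasure c := by
    intro t a
    rw [← integral_const_mul]
    congr 1
    funext q
    ring
  rw [e1] at w1 w2
  rw [eq_neg_iff_add_eq_zero, add_comm, ← eq_neg_iff_add_eq_zero] at w1 w2
  rw [w1, w2]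
  simp only [Function.comp_apply]
  push_cast
  linear_combination ((xi i k : ℂ) * ((∫ q, va (shearMap f ς q) *
    (trig {-k} (fun _ => -I) q.1 * ψ q.2) ∂collarMeasure c : ℝ) : ℂ)) * I_sq

lemma Collar.sliceCoeff_zero (h : Collar f ς c Ω) (hr : 1 < r) (hf : MemH (r + 1) f)
    {v : Bulk → ℝ} (h0 : IsWeakDeriv Ω 0 u v) (k : Freq) :
    ∀ᵐ z ∂volume.restrict (Ioo 0 c), sliceCoeff (u ∘ shearMap f ς) k z =
      sliceCoeff (v ∘ shearMap f ς) k z := by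
  have i1 := (h.memLp h0.1).integrable (by norm_num)
  have i2 := (h.memLp h0.2.1).integrable (by norm_num)
  have i3 : Integrable (fun q => (u ∘ shearMap f ς) q - (v ∘ shearMap f ς) q) (collarMeasure c) :=
    i1.sub i2
  have key := ae_eq_zero_of_test (φ := fun z => sliceCoeff (u ∘ shearMap f ς) k z -
      sliceCoeff (v ∘ shearMap f ς) k z)
    ((integrable_sliceCoeff i1 k).sub (integrable_sliceCoeff i2 k)) fun ψ h1 h2 h3' => ?_
  · filter_upwards [key] with z hz
    exact sub_eq_zero.1 hz
  obtain ⟨η, hη⟩ := exists_profile h1 h2 h3'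
  obtain ⟨B, hB⟩ := h2.exists_bound_of_continuous h1.continuous
  have hsm : ∀ {g : ℝ → ℂ}, IntegrableOn g (Ioo 0 c) → IntegrableOn (fun z => ψ z • g z) (Ioo 0 c) :=
    fun hg => Integrable.bdd_smul (C := B) hg h1.continuous.aestronglyMeasurable
      (.of_forall hB)
  simp only [smul_sub]
  rw [integral_sub (hsm (integrable_sliceCoeff i1 k)) (hsm (integrable_sliceCoeff i2 k)),
    integral_smul_sliceCoeff i1 h1.continuous h2, integral_smul_sliceCoeff i2 h1.continuous h2]
  simp only [Function.comp_apply]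
  rw [h.weak_zero hr hf h0 hη (smoothT_trig _ _), h.weak_zero hr hf h0 hη (smoothT_trig _ _), sub_self]

end

section

/-! ### Sobolev norms in the flat collar -/

variable {f : Torus2 → ℝ} {ς c r σ : ℝ} {Ω : Set Bulk} {V V' : Bulk → ℝ}

/-- The squared `L²(0,c; H^σ)` norm. -/
def colNorm (c σ : ℝ) (V : Bulk → ℝ) : ℝ≥0∞ := ∫⁻ z in Ioo 0 c, hsq σ fun x => V (x, z)

lemma aemeasurable_sliceCoeff (hV : Integrable V (collarMeasure c)) (k : Freq) :
    AEMeasurable (fun z => ‖sliceCoeff V k z‖ₑ) (volume.restrict (Ioo 0 c)) :=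
  (integrable_sliceCoeff hV k).aestronglyMeasurable.enorm

lemma aemeasurable_hsq (hV : Integrable V (collarMeasure c)) (σ : ℝ) :
    AEMeasurable (fun z => hsq σ fun x => V (x, z)) (volume.restrict (Ioo 0 c)) :=
  AEMeasurable.ennreal_tsum fun k => ((aemeasurable_sliceCoeff hV k).const_mul _).pow_const 2

lemma colNorm_eq (hV : Integrable V (collarMeasure c)) (σ : ℝ) :
    colNorm c σ V = ∑' k, ofReal (jap k ^ σ) ^ 2 *
      ∫⁻ z in Ioo 0 c, ‖sliceCoeff V k z‖ₑ ^ 2 := by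
  have h1 := fun k => aemeasurable_sliceCoeff hV k
  rw [colNorm]
  change ∫⁻ z in Ioo 0 c, ∑' k, (ofReal (jap k ^ σ) * ‖sliceCoeff V k z‖ₑ) ^ 2 = _
  rw [lintegral_tsum fun k => ((h1 k).const_mul _).pow_const 2]
  refine tsum_congr fun k => ?_
  rw [← lintegral_const_mul'' _ ((h1 k).pow_const 2)]
  exact lintegral_congr fun z => mul_pow _ _ 2

lemma ae_memLp_slice (hV : MemLp V 2 (collarMeasure c)) :
    ∀ᵐ z ∂volume.restrict (Ioo 0 c), MemLp (fun x => V (x, z)) 2 torusMeasure := by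
  have h1 := (hV.integrable (by norm_num)).prod_left_ae
  have h2 := (hV.integrable_sq).prod_left_ae
  filter_upwards [h1, h2] with z hz1 hz2
  exact (memLp_two_iff_integrable_sq hz1.1).2 hz2

lemma hsq_zero_eq {φ : Torus2 → ℝ} (hφ : MemLp φ 2 torusMeasure) :
    hsq 0 φ = ∫⁻ x, ‖φ x‖ₑ ^ 2 ∂torusMeasure := by
  have hC : MemLp (fun x => (φ x : ℂ)) 2 torusMeasure := hφ.ofReal
  set w := fourierL (hC.toLp _) with hw
  have hk : ∀ k, w k = coeff φ k := by
    intro k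
    rw [hw, fourierL_apply, mFourierCoeff_eq, coeff_eq]
    refine integral_congr_ae ?_
    filter_upwards [hC.coeFn_toLp] with x hx
    rw [hx]
  have h1 : hsq 0 φ = ‖w‖ₑ ^ 2 := by
    rw [Seq.enorm_sq]
    simp [hsq, wsq, hk]
  have h2 : ‖w‖ₑ = eLpNorm (fun x => (φ x : ℂ)) 2 torusMeasure := by
    rw [← ofReal_norm, hw, norm_fourierL, Lp.norm_toLp, ENNReal.ofReal_toReal hC.eLpNorm_ne_top]
  rw [h1, h2]
  have h3 := eLpNorm_nnreal_pow_eq_lintegral (f := fun x => (φ x : ℂ)) (μ := torusMeasure) (p := 2)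
    two_ne_zero
  have h4 : ∀ x, ‖(φ x : ℂ)‖ₑ = ‖φ x‖ₑ := fun x => by
    rw [← ofReal_norm, ← ofReal_norm, norm_real]
  simpa [h4] using h3

lemma colNorm_zero_le (hV : MemLp V 2 (collarMeasure c)) :
    colNorm c 0 V = eLpNorm V 2 (collarMeasure c) ^ 2 := by
  have h3 := eLpNorm_nnreal_pow_eq_lintegral (f := V) (μ := collarMeasure c) (p := 2) two_ne_zero
  have h4 : eLpNorm V 2 (collarMeasure c) ^ 2 = ∫⁻ q, ‖V q‖ₑ ^ 2 ∂collarMeasure c := by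
    simpa using h3
  rw [h4, lintegral_prod_symm _ (hV.1.enorm.pow_const 2), colNorm]
  refine lintegral_congr_ae ?_
  filter_upwards [ae_memLp_slice hV] with z hz
  exact hsq_zero_eq hz

lemma coeff_add' {φ θ : Torus2 → ℝ} (hφ : Integrable φ torusMeasure) (hθ : Integrable θ torusMeasure)
    (k : Freq) : coeff (fun x => φ x + θ x) k = coeff φ k + coeff θ k := by
  have hi : ∀ {g : Torus2 → ℝ}, Integrable g torusMeasure →
      Integrable (fun x => mFourier (-k) x * (g x : ℂ)) torusMeasure := fun hg =>
    (hg.ofReal (𝕜 := ℂ)).bdd_mul (c := 1) (Continuous.aestronglyMeasurable (by fun_prop))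
      (.of_forall fun q => (norm_mFourier_apply (-k) q).le)
  rw [coeff_eq, coeff_eq, coeff_eq, ← integral_add (hi hφ) (hi hθ)]
  congr 1
  funext x
  push_cast; ring

/-- The constant of the product estimate. -/
def prodConst (r : ℝ) (A : ℝ≥0∞) : ℝ≥0∞ := 4 * ofReal (2 ^ r) ^ 2 * wconst (5 / 4) * A

lemma wsq_coeff_mul_le (hr : 5 / 2 ≤ r) (h0 : 0 ≤ σ) (hσ : σ ≤ r) (a : C(Torus2, ℝ))
    {φ : Torus2 → ℝ} (hφ : MemLp φ 2 torusMeasure) :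
    hsq σ (fun x => a x * φ x) ≤ prodConst r (hsq r a) * hsq σ φ := by
  have hC : MemLp (fun x => (φ x : ℂ)) 2 torusMeasure := hφ.ofReal
  have h1 : hsq σ (fun x => a x * φ x) ≤
      wsq σ (conv (fun k => ‖coeff a k‖ₑ) (fun k => ‖coeff φ k‖ₑ)) := by
    refine tsum_le_tsum fun k => ?_
    gcongr
    have h := hasSum_coeff_mul a hC k
    have e : coeff (fun x => a x * φ x) k =
        mFourierCoeff (fun x => (a x : ℂ) * (φ x : ℂ)) k := by
      rw [coeff_eq, mFourierCoeff_eq]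
      simp
    beta_reduce
    rw [e]
    refine (enorm_le_of_hasSum h).trans (le_of_eq ?_)
    simp only [conv, enorm_mul]
    rfl
  refine h1.trans ((wsq_conv_le hr h0 hσ _ _).trans ?_)
  have h2 : (2 : ℝ) ^ σ ≤ 2 ^ r := Real.rpow_le_rpow_of_exponent_le one_le_two hσ
  rw [prodConst]
  gcongr
  all_goals exact le_rfl

lemma hsq_succ (σ : ℝ) (φ : Torus2 → ℝ) :
    hsq (σ + 1) φ = hsq σ φ + ∑ i, wsq σ fun k => ‖(xi i k : ℂ) * I * coeff φ k‖ₑ := by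
  rw [sum_univ_two]
  simp only [hsq, wsq]
  rw [← tsum_add, ← tsum_add]
  refine tsum_congr fun k => ?_
  have hj := jap_pos k
  have hs := jap_sq k
  rw [sum_univ_two] at hs
  have e : ∀ i, ‖(xi i k : ℂ) * I * coeff φ k‖ₑ = ofReal |xi i k| * ‖coeff φ k‖ₑ := by
    intro i
    rw [enorm_mul, enorm_mul, ← ofReal_norm, ← ofReal_norm (I), norm_real,
      norm_I, ofReal_one, mul_one, norm_eq_abs]
  have e2 : ofReal (jap k ^ (σ + 1)) ^ 2 = ofReal (jap k ^ σ) ^ 2 *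
      (1 + ofReal |xi 0 k| ^ 2 + ofReal |xi 1 k| ^ 2) := by
    rw [rpow_add_one hj.ne', ofReal_mul (by positivity), mul_pow]
    congr 1
    rw [← ofReal_pow hj.le, ← ofReal_pow (abs_nonneg _),
      ← ofReal_pow (abs_nonneg _), ← ofReal_one,
      ← ofReal_add (by positivity) (by positivity),
      ← ofReal_add (by positivity) (by positivity), sq_abs, sq_abs, hs]
    congr 1; ring
  rw [e, e, mul_pow, e2]
  ring

/-- `H^r` bound of the slope of the graph. -/
lemma hsq_surfPartial_le (hr : 1 < r) (hf : MemH (r + 1) f) (i : Fin 2) :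
    hsq r (surfPartial i f) ≤ ofReal ‖toSob (r + 1) f‖ ^ 2 := by
  rw [ofReal_norm, Seq.enorm_sq]
  refine tsum_le_tsum fun k => ?_
  gcongr
  have hj := jap_pos k
  have e : coeff (surfPartial i f) k = dvsym (r + 1) i k * toSob (r + 1) f k := by
    have hm := sqSummable_dvsym (σ := r + 1) (by linarith) i
    rw [← diag_apply (isBdd_of_sqSummable hm), ← analysisL_synthOf hm, analysisL_apply, coeff]
    congr 1
    funext x
    exact surfPartial_eq_synthOf hr hf i x
  have e2 : ‖dvsym (r + 1) i k‖ₑ ≤ ofReal (jap k ^ (-r)) := by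
    rw [← ofReal_norm]
    apply ENNReal.ofReal_le_ofReal
    rw [dvsym, norm_mul, norm_I, mul_one, norm_real, norm_eq_abs, abs_mul,
      abs_of_pos (a := jap k ^ (-(r + 1))) (by positivity)]
    calc _ ≤ jap k * jap k ^ (-(r + 1)) := by gcongr; exact abs_xi_le i k
      _ = _ := by rw [mul_comm, ← rpow_add_one hj.ne']; congr 1; ring
  beta_reduce
  rw [e, enorm_mul, ← mul_assoc]
  calc _ ≤ ofReal (jap k ^ r) * ofReal (jap k ^ (-r)) * ‖toSob (r + 1) f k‖ₑ := by
        gcongr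
    _ = _ := by
      rw [← ofReal_mul (by positivity), ← rpow_add hj]
      simp

variable {u : Bulk → ℝ} {α : Fin 3 → ℕ} {va vi v3 : Bulk → ℝ}

/-- One more tangential derivative in the collar. -/
lemma Collar.colNorm_succ_le (h : Collar f ς c Ω) (hr : 5 / 2 ≤ r) (h0 : 0 ≤ σ) (hσ : σ ≤ r)
    (hf : MemH (r + 1) f) {L : ℝ} (hL : ‖toSob (r + 1) f‖ ≤ L) {v : Fin 3 → Bulk → ℝ}
    (hα : IsWeakDeriv Ω α u va) (hv : ∀ i, IsWeakDeriv Ω (α + Pi.single i 1) u (v i)) {G : ℝ≥0∞}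
    (hGa : colNorm c σ (va ∘ shearMap f ς) ≤ G) (hG : ∀ i, colNorm c σ (v i ∘ shearMap f ς) ≤ G) :
    colNorm c (σ + 1) (va ∘ shearMap f ς) ≤ (5 + 4 * prodConst r (ofReal L ^ 2)) * G := by
  set K := prodConst r (ofReal L ^ 2) with hK
  have hr1 : 1 < r := by linarith
  have m1 := h.memLp hα.2.1
  have m2 := fun i => h.memLp (hv i).2.1
  have key : ∀ᵐ z ∂volume.restrict (Ioo 0 c), hsq (σ + 1) (fun x => (va ∘ shearMap f ς) (x, z)) ≤
      hsq σ (fun x => (va ∘ shearMap f ς) (x, z)) + ∑ i : Fin 2,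
        (2 * hsq σ (fun x => (v i.castSucc ∘ shearMap f ς) (x, z)) +
          2 * K * hsq σ (fun x => (v 2 ∘ shearMap f ς) (x, z))) := by
    have ht : ∀ᵐ z ∂volume.restrict (Ioo 0 c), ∀ (i : Fin 2) (k : Freq), (xi i k : ℂ) * I *
        sliceCoeff (va ∘ shearMap f ς) k z = sliceCoeff (fun q => v i.castSucc (shearMap f ς q) +
          surfPartial i f q.1 * v 2 (shearMap f ς q)) k z :=
      ae_all_iff.2 fun i => ae_all_iff.2 fun k => h.tangential hr1 hf hα (hv _) (hv 2) k
    filter_upwards [ht, ae_memLp_slice m1, ae_memLp_slice (m2 0), ae_memLp_slice (m2 1),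
      ae_memLp_slice (m2 2)] with z hz hz1 hz2 hz3 hz4
    rw [hsq_succ]
    gcongr with i
    have hfc := continuous_surfPartial hr1 hf i
    have hi : MemLp (fun x => (v i.castSucc ∘ shearMap f ς) (x, z)) 2 torusMeasure := by
      fin_cases i
      exacts [hz2, hz3]
    have hp : MemLp (fun x => surfPartial i f x * (v 2 ∘ shearMap f ς) (x, z)) 2 torusMeasure := by
      obtain ⟨D, hD⟩ := isCompact_univ.exists_bound_of_continuousOn hfc.continuousOn
      exact hz4.of_le_mul (c := D) (hfc.aestronglyMeasurable.mul hz4.1)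
        (.of_forall fun x => by
          rw [norm_mul]; gcongr; exact hD x (mem_univ _))
    have e : ∀ k, (xi i k : ℂ) * I * coeff (fun x => (va ∘ shearMap f ς) (x, z)) k =
        coeff (fun x => (v i.castSucc ∘ shearMap f ς) (x, z)) k +
          coeff (fun x => surfPartial i f x * (v 2 ∘ shearMap f ς) (x, z)) k := by
      intro k
      rw [← coeff_add' (hi.integrable (by norm_num)) (hp.integrable (by norm_num))]
      exact hz i k
    have hprod := wsq_coeff_mul_le hr h0 hσ ⟨surfPartial i f, hfc⟩ hz4
    have hK' : prodConst r (hsq r (surfPartial i f)) ≤ K := by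
      rw [hK, prodConst, prodConst]
      gcongr
      refine (hsq_surfPartial_le hr1 hf i).trans ?_
      gcongr
    calc wsq σ (fun k => ‖(xi i k : ℂ) * I *
          coeff (fun x => (va ∘ shearMap f ς) (x, z)) k‖ₑ)
        ≤ ∑' k, (ofReal (jap k ^ σ) * ‖coeff (fun x => (v i.castSucc ∘ shearMap f ς) (x, z)) k‖ₑ
          + ofReal (jap k ^ σ) *
            ‖coeff (fun x => surfPartial i f x * (v 2 ∘ shearMap f ς) (x, z)) k‖ₑ) ^ 2 := by
          refine tsum_le_tsum fun k => ?_
          beta_reduce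
          rw [e, ← mul_add]
          gcongr
          exact enorm_add_le _ _
      _ ≤ 2 * hsq σ (fun x => (v i.castSucc ∘ shearMap f ς) (x, z)) +
          2 * hsq σ (fun x => surfPartial i f x * (v 2 ∘ shearMap f ς) (x, z)) :=
          ENNReal_tsum_add_sq_le _ _
      _ ≤ _ := by
          rw [mul_assoc 2 K]
          gcongr
          refine hprod.trans ?_
          gcongr
          exact hK'
  have hm := fun i => aemeasurable_hsq ((m2 i).integrable (by norm_num)) σ
  have hm' : ∀ i : Fin 2, AEMeasurable (fun z =>
      2 * hsq σ (fun x => (v i.castSucc ∘ shearMap f ς) (x, z)) +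
        2 * K * hsq σ (fun x => (v 2 ∘ shearMap f ς) (x, z))) (volume.restrict (Ioo 0 c)) :=
    fun i => ((hm _).const_mul _).add ((hm 2).const_mul _)
  calc colNorm c (σ + 1) (va ∘ shearMap f ς) ≤ _ := lintegral_mono_ae key
    _ = colNorm c σ (va ∘ shearMap f ς) + ∑ i : Fin 2,
        (2 * colNorm c σ (v i.castSucc ∘ shearMap f ς) +
          2 * K * colNorm c σ (v 2 ∘ shearMap f ς)) := by
      rw [lintegral_add_left' (aemeasurable_hsq (m1.integrable (by norm_num)) σ),
        lintegral_finsetSum' _ fun i _ => hm' i]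
      congr 1
      refine sum_congr rfl fun i _ => ?_
      rw [lintegral_add_left' ((hm _).const_mul _), lintegral_const_mul'' _ (hm _),
        lintegral_const_mul'' _ (hm 2)]
      rfl
    _ ≤ G + ∑ _i : Fin 2, (2 * G + 2 * K * G) := by
      gcongr
      exacts [hG _, hG 2]
    _ = _ := by
      rw [sum_univ_two]; ring

/-- Sobolev regularity in the flat collar. -/
lemma Collar.colNorm_le (h : Collar f ς c Ω) {s : ℕ} (hs : 3 ≤ s) (hr : r = s - 1 / 2)
    (hf : MemH (r + 1) f) {L : ℝ} (hL : ‖toSob (r + 1) f‖ ≤ L) {v : (Fin 3 → ℕ) → Bulk → ℝ}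
    (hv : ∀ α, ∑ i, α i ≤ s → IsWeakDeriv Ω α u (v α)) {G : ℝ≥0∞}
    (hG : ∀ α, ∑ i, α i ≤ s → eLpNorm (v α) 2 (bulkMeasure.restrict Ω) ^ 2 ≤ G) (m : ℕ) :
    ∀ α, (∑ i, α i) + m ≤ s → colNorm c m (v α ∘ shearMap f ς) ≤
      (5 + 4 * prodConst r (ofReal L ^ 2)) ^ m * G := by
  have hs' : (3 : ℝ) ≤ s := by exact_mod_cast hs
  induction m with
  | zero =>
    intro α hα
    have hα' := hv α (by omega)
    rw [Nat.cast_zero, colNorm_zero_le (h.memLp hα'.2.1), pow_zero, one_mul]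
    exact (pow_le_pow_left' (h.eLpNorm_le hα'.2.1) 2).trans (hG α (by omega))
  | succ m ih =>
    intro α hα
    have hsum : ∀ i, ∑ j, (α + Pi.single i 1 : Fin 3 → ℕ) j = (∑ j, α j) + 1 := by
      intro i
      simp [sum_add_distrib]
    have hm : (m : ℝ) + 1 ≤ s := by exact_mod_cast (by omega : m + 1 ≤ s)
    rw [Nat.cast_succ, pow_succ', mul_assoc]
    refine h.colNorm_succ_le (by linarith) (by positivity) (by linarith) hf hL
      (v := fun i => v (α + Pi.single i 1)) (hv α (by omega)) (fun i => hv _ ?_)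
      (ih α (by omega)) (fun i => ih _ ?_)
    · rw [hsum]; omega
    · rw [hsum]; omega

end

section

/-! ### Traces on the graph -/

variable {f : Torus2 → ℝ} {ς c r σ L : ℝ} {s : ℕ} {Ω : Set Bulk} {V W W' u v0 v3 : Bulk → ℝ}

lemma continuousOn_sliceCoeff (hV : ContinuousOn V (univ ×ˢ Ico 0 c)) (k : Freq) :
    ContinuousOn (sliceCoeff V k) (Ico 0 c) := by
  have h : ContinuousOn (fun z => ∫ x, mFourier (-k) x * (V (x, z) : ℂ) ∂torusMeasure)
      (Ico 0 c) := by
    refine continuousOn_integral_of_compact_support isCompact_univ ?_ fun _ x _ hx => absurd (mem_univ x) hx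
    refine ContinuousOn.mul (Continuous.continuousOn (by fun_prop))
      (Complex.continuous_ofReal.comp_continuousOn (hV.comp (f := fun q : ℝ × Torus2 => (q.2, q.1))
        (Continuous.continuousOn (by fun_prop)) fun q hq => ⟨mem_univ _, hq.1⟩))
  exact h.congr fun z _ => coeff_eq _ k

lemma sliceCoeff_const_mul (a : ℝ) (V : Bulk → ℝ) (k : Freq) (z : ℝ) :
    sliceCoeff (fun q => a * V q) k z = a * sliceCoeff V k z := by
  simp only [sliceCoeff, coeff_eq]
  rw [← integral_const_mul]
  congr 1
  funext x
  push_cast; ring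

lemma Collar.enorm_sliceCoeff (h : Collar f ς c Ω) (V : Bulk → ℝ) (k : Freq) (z : ℝ) :
    ‖sliceCoeff (fun q => ς * V q) k z‖ₑ = ‖sliceCoeff V k z‖ₑ := by
  rw [sliceCoeff_const_mul, enorm_mul, ← ofReal_norm (ς : ℂ), norm_real, norm_eq_abs,
    h.abs, ofReal_one, one_mul]

lemma Collar.colNorm_sign (h : Collar f ς c Ω) (σ : ℝ) (V : Bulk → ℝ) :
    colNorm c σ (fun q => ς * V q) = colNorm c σ V := by
  refine lintegral_congr fun z => tsum_congr fun k => ?_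
  have := h.enorm_sliceCoeff V k z
  simp only [sliceCoeff] at this
  beta_reduce
  rw [this]

lemma tsum_primitive_le (hc : 0 < c) (hW : Integrable W (collarMeasure c))
    (hW' : Integrable W' (collarMeasure c)) {C : Freq → ℂ}
    (h : ∀ k, ∀ᵐ z ∂volume.restrict (Ioo 0 c), sliceCoeff W k z =
      C k + ∫ τ in (0 : ℝ)..z, sliceCoeff W' k τ) (σ : ℝ) {z : ℝ} (hz : z ∈ Ico 0 c) :
    ∑' k, (ofReal (jap k ^ (σ - 1 / 2)) *
      ‖C k + ∫ τ in (0 : ℝ)..z, sliceCoeff W' k τ‖ₑ) ^ 2 ≤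
      ofReal (4 / c) * colNorm c σ W + ofReal c * colNorm c (σ - 1) W' := by
  rw [colNorm_eq hW, colNorm_eq hW', ← ENNReal.tsum_mul_left, ← ENNReal.tsum_mul_left,
    ← tsum_add]
  refine tsum_le_tsum fun k => ?_
  have hJ := jap_pos k
  have h1J := one_le_jap k
  have key := enorm_primitive_sq_le (integrable_sliceCoeff hW' k) (C := C k)
    (δ := c / (2 * jap k)) (by positivity)
    (by rw [div_le_div_iff₀ (by positivity) two_pos]; nlinarith) hz
  have e0 : ∫⁻ y in Ioo 0 c, ‖C k + ∫ τ in (0 : ℝ)..y, sliceCoeff W' k τ‖ₑ ^ 2 =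
      ∫⁻ y in Ioo 0 c, ‖sliceCoeff W k y‖ₑ ^ 2 := by
    refine lintegral_congr_ae ?_
    filter_upwards [h k] with y hy
    rw [hy]
  rw [e0] at key
  set A := ∫⁻ y in Ioo 0 c, ‖sliceCoeff W k y‖ₑ ^ 2
  set A' := ∫⁻ y in Ioo 0 c, ‖sliceCoeff W' k y‖ₑ ^ 2
  set X := ‖C k + ∫ τ in (0 : ℝ)..z, sliceCoeff W' k τ‖ₑ
  set J := jap k
  have hP : 0 < J ^ σ := by positivity
  have e1 : (J ^ (σ - 1 / 2)) ^ 2 = (J ^ σ) ^ 2 / J := by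
    rw [Real.rpow_sub hJ, div_pow, ← Real.sqrt_eq_rpow, sq_sqrt hJ.le]
  have e2 : J ^ (σ - 1) = J ^ σ / J := Real.rpow_sub_one hJ.ne' σ
  have two : (2 : ℝ≥0∞) = ofReal 2 := by simp
  have m1 : ofReal (J ^ (σ - 1 / 2)) ^ 2 =
      ofReal (2 * (J ^ σ) ^ 2 / c) * ofReal (c / (2 * J)) := by
    rw [← ofReal_pow (by positivity), e1, ← ofReal_mul (by positivity)]
    congr 1; field_simp
  have m2 : ofReal (2 * (J ^ σ) ^ 2 / c) * 2 =
      ofReal (4 / c) * ofReal (J ^ σ) ^ 2 := by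
    rw [two, ← ofReal_pow (by positivity), ← ofReal_mul (by positivity),
      ← ofReal_mul (by positivity)]
    congr 1; field_simp; norm_num
  have m3 : ofReal (2 * (J ^ σ) ^ 2 / c) * (2 * ofReal (c / (2 * J)) ^ 2) =
      ofReal c * ofReal (J ^ (σ - 1)) ^ 2 := by
    rw [two, e2, ← ofReal_pow (by positivity), ← ofReal_pow (by positivity),
      ← ofReal_mul (by positivity), ← ofReal_mul (by positivity),
      ← ofReal_mul (by positivity)]
    congr 1; field_simp
  calc _ = ofReal (2 * (J ^ σ) ^ 2 / c) * (ofReal (c / (2 * J)) * X ^ 2) := by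
        rw [mul_pow, m1, mul_assoc]
    _ ≤ ofReal (2 * (J ^ σ) ^ 2 / c) *
        (2 * A + 2 * ofReal (c / (2 * J)) ^ 2 * A') := by gcongr
    _ = _ := by rw [mul_add, ← mul_assoc, ← mul_assoc, m2, m3, mul_assoc, mul_assoc]

/-- A continuous function is bounded by the sum of its Fourier coefficients. -/
lemma enorm_le_tsum_coeff (b : C(Torus2, ℝ)) (x : Torus2) : ‖b x‖ₑ ≤ ∑' k, ‖coeff b k‖ₑ := by
  by_cases ht : ∑' k, ‖coeff b k‖ₑ = ⊤
  · rw [ht]; exact le_top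
  have hs : Summable (mFourierCoeff (toC b)) := by
    refine Summable.of_norm ?_
    have := ENNReal.summable_toReal ht
    simp only [toReal_enorm] at this
    exact this
  have h1 := enorm_le_of_hasSum (UnitAddTorus.hasSum_mFourier_series_apply_of_summable hs x)
  have h2 : ‖toC b x‖ₑ = ‖b x‖ₑ := by
    rw [← ofReal_norm, ← ofReal_norm]; simp [toC]
  rw [← h2]
  refine h1.trans (le_of_eq (tsum_congr fun k => ?_))
  rw [enorm_smul, ← ofReal_norm (mFourier k x), norm_mFourier_apply, ofReal_one,
    mul_one]
  rfl

/-- The constant of the trace estimate. -/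
def traceConst (s : ℕ) (c r L : ℝ) : ℝ≥0∞ := (ofReal (4 / c) + ofReal c) *
  (5 + 4 * prodConst r (ofReal L ^ 2)) ^ s

lemma traceConst_lt_top (s : ℕ) (c r L : ℝ) : traceConst s c r L < ⊤ := by
  have := wconst_lt_top (p := 5 / 4) (by norm_num)
  unfold traceConst prodConst
  finiteness

lemma Collar.sliceCoeff_eq (h : Collar f ς c Ω) (hr : 1 < r) (hf : MemH (r + 1) f)
    (hu : ContinuousOn (u ∘ shearMap f ς) (univ ×ˢ Ico 0 c)) (h0 : IsWeakDeriv Ω 0 u v0)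
    (h3 : IsWeakDeriv Ω (Pi.single 2 1) u v3) (k : Freq) {z : ℝ} (hz : z ∈ Ico 0 c) :
    sliceCoeff (u ∘ shearMap f ς) k z = sliceCoeff (u ∘ shearMap f ς) k 0 +
      ∫ τ in (0 : ℝ)..z, sliceCoeff (fun q => ς * v3 (shearMap f ς q)) k τ := by
  have i2 : Integrable (fun q => ς * v3 (shearMap f ς q)) (collarMeasure c) :=
    ((h.memLp h3.2.1).integrable (by norm_num)).const_mul ς
  obtain ⟨C, hC⟩ := h.exists_primitive hr hf h0 (by rwa [zero_add]) k
  have hI : IntegrableOn (sliceCoeff (fun q => ς * v3 (shearMap f ς q)) k) (Icc 0 c) :=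
    (integrable_sliceCoeff i2 k).congr_set_ae Ioo_ae_eq_Icc.symm
  have hcont : ContinuousOn (fun z => C + ∫ τ in (0 : ℝ)..z,
      sliceCoeff (fun q => ς * v3 (shearMap f ς q)) k τ) (Ico 0 c) :=
    continuousOn_const.add ((intervalIntegral.continuousOn_primitive_interval
      (by rwa [uIcc_of_le h.pos.le])).mono
      (by rw [uIcc_of_le h.pos.le]; exact Ico_subset_Icc_self))
  have hae : sliceCoeff (u ∘ shearMap f ς) k =ᵐ[volume.restrict (Ico 0 c)] fun z =>
      C + ∫ τ in (0 : ℝ)..z, sliceCoeff (fun q => ς * v3 (shearMap f ς q)) k τ := by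
    rw [← restrict_Ioo_eq_restrict_Ico]
    filter_upwards [hC, h.sliceCoeff_zero hr hf h0 k] with z h1 h2
    rw [h2, h1]
  have key := Measure.eqOn_Ico_of_ae_eq _ hae (continuousOn_sliceCoeff hu k) hcont
  have k0 := key (left_mem_Ico.2 h.pos)
  have kz := key hz
  beta_reduce at k0 kz
  rw [integral_same, add_zero] at k0
  rw [kz, k0]

variable {v : (Fin 3 → ℕ) → Bulk → ℝ} {G : ℝ≥0∞}

/-- The trace theorem. -/
lemma Collar.hsq_trace_le (h : Collar f ς c Ω) (hs : 3 ≤ s) (hr : r = s - 1 / 2)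
    (hf : MemH (r + 1) f) (hL : ‖toSob (r + 1) f‖ ≤ L)
    (hu : ContinuousOn (u ∘ shearMap f ς) (univ ×ˢ Ico 0 c))
    (hv : ∀ α, ∑ i, α i ≤ s → IsWeakDeriv Ω α u (v α))
    (hG : ∀ α, ∑ i, α i ≤ s → eLpNorm (v α) 2 (bulkMeasure.restrict Ω) ^ 2 ≤ G) :
    hsq r (fun x => u (x, f x)) ≤ traceConst s c r L * G := by
  have hs' : (3 : ℝ) ≤ s := by exact_mod_cast hs
  have hr1 : 1 < r := by linarith
  have h0 := hv 0 (by simp)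
  have h3 := hv (Pi.single 2 1) (by simp; omega)
  have i1 := (h.memLp h0.2.1).integrable (by norm_num)
  have i2 : Integrable (fun q => ς * v (Pi.single 2 1) (shearMap f ς q)) (collarMeasure c) :=
    ((h.memLp h3.2.1).integrable (by norm_num)).const_mul ς
  have key := tsum_primitive_le h.pos i1 i2 (C := fun k => sliceCoeff (u ∘ shearMap f ς) k 0)
    (fun k => by
      filter_upwards [ae_restrict_mem measurableSet_Ioo, h.sliceCoeff_zero hr1 hf h0 k] with z hz h2
      rw [← h2, h.sliceCoeff_eq hr1 hf hu h0 h3 k (Ioo_subset_Ico_self hz)]) s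
    (left_mem_Ico.2 h.pos)
  have c1 := h.colNorm_le hs hr hf hL hv hG s 0 (by simp)
  have c2 := h.colNorm_le hs hr hf hL hv hG (s - 1) (Pi.single 2 1) (by simp; omega)
  rw [Nat.cast_sub (by omega), Nat.cast_one] at c2
  have e : hsq r (fun x => u (x, f x)) = ∑' k, (ofReal (jap k ^ ((s : ℝ) - 1 / 2)) *
      ‖sliceCoeff (u ∘ shearMap f ς) k 0 + ∫ τ in (0 : ℝ)..0,
        sliceCoeff (fun q => ς * v (Pi.single 2 1) (shearMap f ς q)) k τ‖ₑ) ^ 2 := by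
    refine tsum_congr fun k => ?_
    rw [integral_same, add_zero, hr]
    simp [sliceCoeff, shearMap]
  rw [e]
  refine key.trans ?_
  have hc := h.colNorm_sign ((s : ℝ) - 1) (v (Pi.single 2 1) ∘ shearMap f ς)
  simp only [Function.comp_apply] at hc
  rw [hc, traceConst, mul_assoc, add_mul]
  gcongr
  refine c2.trans ?_
  gcongr
  · exact le_self_add.trans' (by norm_num)
  · omega

/-- Lipschitz bound in the normal direction at the graph. -/
lemma Collar.normal_le (h : Collar f ς c Ω) (hs : 3 ≤ s) (hr : r = s - 1 / 2)
    (hf : MemH (r + 1) f) (hL : ‖toSob (r + 1) f‖ ≤ L)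
    (hu : ContinuousOn (u ∘ shearMap f ς) (univ ×ˢ Ico 0 c))
    (hv : ∀ α, ∑ i, α i ≤ s → IsWeakDeriv Ω α u (v α))
    (hG : ∀ α, ∑ i, α i ≤ s → eLpNorm (v α) 2 (bulkMeasure.restrict Ω) ^ 2 ≤ G) (x : Torus2)
    {z : ℝ} (hz : z ∈ Ico 0 c) {N : ℝ≥0∞} (hN : wconst (5 / 4) * (traceConst s c r L * G) ≤ N ^ 2) :
    ‖u (x, f x + ς * z) - u (x, f x)‖ₑ ≤ N * ofReal z := by
  have hs' : (3 : ℝ) ≤ s := by exact_mod_cast hs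
  have hr1 : 1 < r := by linarith
  have h0 := hv 0 (by simp)
  have h3 := hv (Pi.single 2 1) (by simp; omega)
  have h33 := hv (Pi.single 2 1 + Pi.single 2 1) (by simp [sum_add_distrib]; omega)
  have i1 := (h.memLp h3.2.1).integrable (by norm_num)
  have i2 : Integrable (fun q => ς * v (Pi.single 2 1 + Pi.single 2 1) (shearMap f ς q))
      (collarMeasure c) := ((h.memLp h33.2.1).integrable (by norm_num)).const_mul ς
  choose C hC using fun k => h.exists_primitive hr1 hf h3 h33 k
  have key : ∀ᵐ τ ∂volume.restrict (Ioo 0 c),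
      ∑' k, ‖sliceCoeff (v (Pi.single 2 1) ∘ shearMap f ς) k τ‖ₑ ≤ N := by
    filter_upwards [ae_all_iff.2 hC, ae_restrict_mem measurableSet_Ioo] with τ hτ hm
    have k1 := tsum_primitive_le h.pos i1 i2 hC ((s : ℝ) - 1) (Ioo_subset_Ico_self hm)
    simp only [← hτ] at k1
    have c1 := h.colNorm_le hs hr hf hL hv hG (s - 1) (Pi.single 2 1) (by simp; omega)
    have c2 := h.colNorm_le hs hr hf hL hv hG (s - 2) (Pi.single 2 1 + Pi.single 2 1)
      (by simp [sum_add_distrib]; omega)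
    rw [Nat.cast_sub (by omega), Nat.cast_one] at c1
    rw [Nat.cast_sub (by omega), Nat.cast_two] at c2
    have hc := h.colNorm_sign ((s : ℝ) - 1 - 1) (v (Pi.single 2 1 + Pi.single 2 1) ∘ shearMap f ς)
    simp only [Function.comp_apply] at hc
    rw [hc, show (s : ℝ) - 1 - 1 = s - 2 by ring] at k1
    have h5 : (1 : ℝ≥0∞) ≤ 5 + 4 * prodConst r (ofReal L ^ 2) :=
      le_self_add.trans' (by norm_num)
    have k2 : wsq ((s : ℝ) - 1 - 1 / 2)
        (fun k => ‖sliceCoeff (v (Pi.single 2 1) ∘ shearMap f ς) k τ‖ₑ) ≤ traceConst s c r L * G := by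
      refine k1.trans ?_
      rw [traceConst, mul_assoc, add_mul]
      gcongr
      · refine c1.trans ?_
        gcongr
        omega
      · refine c2.trans ?_
        gcongr
        omega
    have k3 := tsum_weight_sq_le 0 ((s : ℝ) - 1 - 1 / 2)
      (fun k => ‖sliceCoeff (v (Pi.single 2 1) ∘ shearMap f ς) k τ‖ₑ)
    simp only [rpow_zero, ofReal_one, one_mul, sub_zero] at k3
    refine (ENNReal.pow_right_strictMono two_ne_zero).le_iff_le.1 (k3.trans (le_trans ?_ hN))
    gcongr
    exact wconst_le (by linarith)
  have hcz : ∀ y ∈ Ico 0 c, Continuous fun x => (u ∘ shearMap f ς) (x, y) := fun y hy =>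
    hu.comp_continuous (by fun_prop) fun x => ⟨mem_univ _, hy⟩
  let b : C(Torus2, ℝ) := ⟨fun x => (u ∘ shearMap f ς) (x, z) + (-1) * (u ∘ shearMap f ς) (x, 0),
    (hcz z hz).add (continuous_const.mul (hcz 0 (left_mem_Ico.2 h.pos)))⟩
  have hb : ∀ k, coeff b k = ∫ τ in (0 : ℝ)..z,
      sliceCoeff (fun q => ς * v (Pi.single 2 1) (shearMap f ς q)) k τ := by
    intro k
    have hI : ∀ {g : Torus2 → ℝ}, Continuous g → Integrable g torusMeasure := fun hg =>
      hg.integrable_of_hasCompactSupport (of_compactSpace _)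
    have e1 : coeff b k = sliceCoeff (u ∘ shearMap f ς) k z +
        sliceCoeff (fun q => (-1) * (u ∘ shearMap f ς) q) k 0 :=
      coeff_add' (hI (hcz z hz)) (hI (continuous_const.mul (hcz 0 (left_mem_Ico.2 h.pos)))) k
    rw [e1, sliceCoeff_const_mul, h.sliceCoeff_eq hr1 hf hu h0 h3 k hz]
    push_cast; ring
  have hsub : Ioc 0 z ⊆ Ioo 0 c := fun y hy => ⟨hy.1, hy.2.trans_lt hz.2⟩
  have e : ‖u (x, f x + ς * z) - u (x, f x)‖ₑ = ‖b x‖ₑ := by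
    simp [b, shearMap, sub_eq_add_neg]
  rw [e]
  calc _ ≤ ∑' k, ‖coeff b k‖ₑ := enorm_le_tsum_coeff b x
    _ ≤ ∑' k, ∫⁻ τ in Ioc 0 z, ‖sliceCoeff (v (Pi.single 2 1) ∘ shearMap f ς) k τ‖ₑ := by
      refine tsum_le_tsum fun k => ?_
      rw [hb, integral_of_le hz.1]
      refine (enorm_integral_le_lintegral_enorm _).trans (le_of_eq (lintegral_congr fun τ => ?_))
      exact h.enorm_sliceCoeff (v (Pi.single 2 1) ∘ shearMap f ς) k τ
    _ = ∫⁻ τ in Ioc 0 z, ∑' k, ‖sliceCoeff (v (Pi.single 2 1) ∘ shearMap f ς) k τ‖ₑ :=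
      (lintegral_tsum fun k => (aemeasurable_sliceCoeff i1 k).mono_set hsub).symm
    _ ≤ ∫⁻ _ in Ioc 0 z, N := lintegral_mono_ae (ae_restrict_of_ae_restrict_of_subset hsub key)
    _ = _ := by simp

end

section

/-! ### The traces of the background state -/

variable {s : ℕ} {r c₀ L₀ L₁ L₂ T L M M' N : ℝ} {f ft : ℝ → Torus2 → ℝ} {φ : Torus2 → ℝ} {Ω : Set Bulk}
  {σ : Side} {u h : Side → ℝ → Bulk → Vec3}

lemma MemH.hsq_eq (hφ : MemH r φ) : hsq r φ = ofReal ‖toSob r φ‖ ^ 2 := by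
  rw [ofReal_norm, Seq.enorm_sq]
  refine tsum_congr fun k => ?_
  have := jap_pos k
  rw [toSob_apply hφ, enorm_mul, ← ofReal_norm (((jap k ^ r : ℝ) : ℂ)), norm_real,
    norm_eq_abs, abs_of_pos (by positivity)]

lemma exists_weakDeriv (hL : 0 < L₁) {u : Bulk → ℝ} (hn : bulkNorm Ω s u ≤ ofReal L₁) :
    ∃ v : (Fin 3 → ℕ) → Bulk → ℝ, (∀ α, ∑ i, α i ≤ s → IsWeakDeriv Ω α u (v α)) ∧
      ∀ α, ∑ i, α i ≤ s →
        eLpNorm (v α) 2 (bulkMeasure.restrict Ω) ^ 2 ≤ ofReal (2 * L₁) ^ 2 := by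
  have hlt : bulkNorm Ω s u < ofReal (2 * L₁) :=
    hn.trans_lt ((ENNReal.ofReal_lt_ofReal_iff (by positivity)).2 (by linarith))
  simp only [bulkNorm, iInf_lt_iff] at hlt
  obtain ⟨v, hv, hb⟩ := hlt
  have hm : ∀ α : Fin 3 → ℕ, ∑ i, α i ≤ s → α ∈ multiIndices s := by
    intro α hα
    simp only [multiIndices, Finset.mem_filter, Fintype.mem_piFinset, Finset.mem_range]
    exact ⟨fun i => Nat.lt_succ_of_le ((Finset.single_le_sum (f := α) (fun _ _ => Nat.zero_le _)
      (Finset.mem_univ i)).trans hα), hα⟩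
  refine ⟨v, fun α hα => hv α (hm α hα), fun α hα => ?_⟩
  refine (Finset.single_le_sum (f := fun α => eLpNorm (v α) 2 (bulkMeasure.restrict Ω) ^ 2)
    (fun _ _ => zero_le) (hm α hα)).trans ?_
  refine le_trans (le_of_eq ?_) (pow_le_pow_left' hb.le 2)
  rw [← ENNReal.rpow_natCast, ← ENNReal.rpow_mul]
  norm_num

lemma bulkNorm_le_vec (Ω : Set Bulk) (s : ℕ) (u : Bulk → Vec3) (i : Fin 3) :
    bulkNorm Ω s (fun p => u p i) ≤ bulkNormVec Ω s u := by
  have h1 : bulkNorm Ω s (fun p => u p i) = (bulkNorm Ω s (fun p => u p i) ^ 2) ^ (1 / 2 : ℝ) := by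
    rw [← ENNReal.rpow_natCast, ← ENNReal.rpow_mul]
    norm_num
  rw [h1, bulkNormVec]
  gcongr
  exact Finset.single_le_sum (f := fun i => bulkNorm Ω s (fun p => u p i) ^ 2)
    (fun _ _ => zero_le) (Finset.mem_univ i)

lemma mem_closedRegion {x : Torus2} (hx : -(1 - c₀) ≤ φ x ∧ φ x ≤ 1 - c₀) (σ : Side) {z : ℝ}
    (hz : z ∈ Ico 0 c₀) : (x, φ x + wall σ * z) ∈ closedRegion φ σ := by
  obtain ⟨h1, h2⟩ := hz
  cases σ <;> simp only [closedRegion, wall, mem_setOf_eq] <;> constructor <;> linarith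

lemma collar_region (hc : 0 < c₀) (hφ : Continuous φ) (hx : ∀ x, -(1 - c₀) ≤ φ x ∧ φ x ≤ 1 - c₀)
    (σ : Side) : Collar φ (wall σ) c₀ (region φ σ) where
  cont := hφ
  sign := by cases σ <;> simp [wall]
  pos := hc
  meas := by
    cases σ
    · exact ((isOpen_lt (by fun_prop) continuous_snd).inter
        (isOpen_lt continuous_snd continuous_const)).measurableSet
    · exact ((isOpen_lt continuous_const continuous_snd).inter
        (isOpen_lt continuous_snd (by fun_prop))).measurableSet
  mem x z hz := by
    obtain ⟨h1, h2⟩ := hz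
    have := hx x
    cases σ <;> simp only [region, wall, mem_setOf_eq] <;> constructor <;> linarith

/-- The bound of the traces in terms of the background norms. -/
def traceBound (s : ℕ) (c L : ℝ) : ℝ := √((1 + wconst (5 / 4)) *
  (traceConst s c (s - 1 / 2) L * ofReal (2 * L) ^ 2)).toReal

lemma ofReal_traceBound_sq (s : ℕ) (c L : ℝ) : ofReal (traceBound s c L) ^ 2 =
    (1 + wconst (5 / 4)) * (traceConst s c (s - 1 / 2) L * ofReal (2 * L) ^ 2) := by
  have := wconst_lt_top (p := 5 / 4) (by norm_num)
  have := traceConst_lt_top s c (s - 1 / 2) L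
  rw [traceBound, ← ofReal_pow (sqrt_nonneg _), sq_sqrt ENNReal.toReal_nonneg,
    ENNReal.ofReal_toReal (by finiteness)]

lemma trace_bounds (hs : 3 ≤ s) (hc : 0 < c₀) (hL₁ : 0 < L₁) (hφ : MemH (s + 1 / 2) φ)
    (hL : ‖toSob (s + 1 / 2) φ‖ ≤ L₁) (hx : ∀ x, -(1 - c₀) ≤ φ x ∧ φ x ≤ 1 - c₀)
    {w : Bulk → Vec3} (hw : ContinuousOn w (closedRegion φ σ))
    (hn : bulkNormVec (region φ σ) s w ≤ ofReal L₁) (i : Fin 3) :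
    hsq (s - 1 / 2) (fun x => trace φ w x i) ≤ ofReal (traceBound s c₀ L₁) ^ 2 ∧
      ∀ x, ∀ z ∈ Ico 0 c₀, |w (x, φ x + wall σ * z) i - w (x, φ x) i| ≤ traceBound s c₀ L₁ * z := by
  have h := collar_region hc hφ.1 hx σ
  have e : (s : ℝ) + 1 / 2 = s - 1 / 2 + 1 := by ring
  rw [e] at hφ hL
  obtain ⟨v, hv, hG⟩ := exists_weakDeriv hL₁ ((bulkNorm_le_vec _ s w i).trans hn)
  have hu : ContinuousOn ((fun p => w p i) ∘ shearMap φ (wall σ)) (univ ×ˢ Ico 0 c₀) :=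
    (EuclideanSpace.proj i : Vec3 →L[ℝ] ℝ).continuous.comp_continuousOn
      (hw.comp (continuous_shearMap hφ.1).continuousOn fun q hq => mem_closedRegion (hx q.1) σ hq.2)
  rw [ofReal_traceBound_sq]
  refine ⟨(h.hsq_trace_le hs rfl hφ hL hu hv hG).trans ?_, fun x z hz => ?_⟩
  · rw [add_mul, one_mul]; exact le_self_add
  · have key := h.normal_le hs rfl hφ hL hu hv hG x hz (N := ofReal (traceBound s c₀ L₁))
      (by rw [ofReal_traceBound_sq, add_mul]; exact le_add_self)
    have h0 : 0 ≤ traceBound s c₀ L₁ := sqrt_nonneg _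
    rw [← ofReal_mul h0, ← ofReal_norm,
      ENNReal.ofReal_le_ofReal_iff (mul_nonneg h0 hz.1)] at key
    exact key

lemma abs_deriv_le {g : ℝ → ℝ} {d c : ℝ} (hc : 0 < c) (hg : HasDerivWithinAt g d (Ico 0 c) 0)
    (hb : ∀ z ∈ Ico 0 c, |g z - g 0| ≤ M * z) : |d| ≤ M := by
  have h := (hasDerivWithinAt_iff_tendsto_slope' (by simp)).1 (hg.mono Ioo_subset_Ico_self)
  rw [nhdsWithin_Ioo_eq_nhdsGT hc] at h
  refine le_of_tendsto h.abs ?_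
  filter_upwards [Ioo_mem_nhdsGT hc] with z hz
  rw [slope_def_field, sub_zero, abs_div, abs_of_pos hz.1, div_le_iff₀ hz.1]
  exact hb z (Ioo_subset_Ico_self hz)

/-- The traces are differentiable in time. -/
lemma hasDerivWithinAt_trace (hc : 0 < c₀) {w : ℝ → Bulk → Vec3} {t : ℝ} (ht : t ∈ Icc 0 T)
    {x : Torus2} (hft : HasDerivWithinAt (fun τ => f τ x) (ft t x) (Icc 0 T) t)
    (hx : ∀ τ ∈ Icc 0 T, -(1 - c₀) ≤ f τ x ∧ f τ x ≤ 1 - c₀) (hw : TimeDerivBound T L f σ w t)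
    (i : Fin 3) (hM : ∀ z ∈ Ico 0 c₀, |w t (x, f t x + wall σ * z) i - w t (x, f t x) i| ≤ M * z)
    (hN : |ft t x| ≤ N) :
    ∃ d, HasDerivWithinAt (fun τ => trace (f τ) (w τ) x i) d (Icc 0 T) t ∧ |d| ≤ L + M * N := by
  obtain ⟨y, hy⟩ := bulkProj_surjective (x, f t x)
  obtain ⟨A, hA, hAL⟩ := hw y (by rw [hy])
  let e : Fin 3 → ℝ := Pi.single 2 1
  have hp : ∀ b : ℝ, bulkProj (y + b • e) = (x, f t x + b) := by
    intro b
    have : b • e = Pi.single 2 b := by simp [e, ← Pi.single_smul]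
    rw [this, bulkProj_add, hy, bulkProj_single_last]
    simp
  have key : ∀ {S : Set ℝ} {p q : ℝ → ℝ} {a p' q' : ℝ}, HasDerivWithinAt p p' S a →
      HasDerivWithinAt q q' S a → p a = t → q a = 0 →
      (∀ b ∈ S, p b ∈ Icc 0 T ∧ (x, f t x + q b) ∈ closedRegion (f (p b)) σ) →
      HasDerivWithinAt (fun b => w (p b) (x, f t x + q b) i)
        (p' * A (1, 0) i + q' * A (0, e) i) S a := by
    intro S p q a p' q' h1 h2 h3 h4 h5
    have hA' : HasFDerivWithinAt (fun q : ℝ × (Fin 3 → ℝ) => w q.1 (bulkProj q.2)) A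
        {q | q.1 ∈ Icc 0 T ∧ bulkProj q.2 ∈ closedRegion (f q.1) σ} (p a, y + q a • e) := by
      rwa [h3, h4, zero_smul, add_zero]
    have h6 := hA'.comp_hasDerivWithinAt a (h1.prodMk ((h2.smul_const e).const_add y))
      fun b hb => by simpa only [mem_setOf_eq, hp] using h5 b hb
    have h7 := (EuclideanSpace.proj i : Vec3 →L[ℝ] ℝ).hasFDerivAt.comp_hasDerivWithinAt a h6
    have e1 : A (p', q' • e) = p' • A (1, 0) + q' • A (0, e) := by
      rw [← map_smul, ← map_smul, ← map_add]; simp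
    rw [e1] at h7
    simpa [comp_def, hp] using h7
  have hx0 := hx t ht
  have k1 := key (S := Icc 0 T) (p := id) (q := fun τ => f τ x - f t x) (hasDerivWithinAt_id t _)
    (hft.sub_const _) rfl (sub_self _) fun b hb => ⟨hb, by
      simpa using mem_closedRegion (hx b hb) σ (left_mem_Ico.2 hc)⟩
  have k2 := key (S := Ico 0 c₀) (p := fun _ => t) (q := fun z => wall σ * z) (a := 0)
    (hasDerivWithinAt_const _ _ _) (((hasDerivWithinAt_id (0 : ℝ) _).const_mul (wall σ))) rfl
    (mul_zero _) fun b hb => ⟨ht, mem_closedRegion hx0 σ hb⟩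
  have k3 := abs_deriv_le hc k2 (by simpa using hM)
  have hwall : |wall σ| = 1 := by cases σ <;> simp [wall]
  rw [zero_mul, zero_add, mul_one, abs_mul, hwall, one_mul] at k3
  refine ⟨_, by simpa [trace] using k1, ?_⟩
  have h1 := (PiLp.norm_apply_le (A (1, 0)) i).trans hAL
  rw [norm_eq_abs] at h1
  refine (abs_add_le _ _).trans (add_le_add h1 ?_)
  rw [abs_mul, mul_comm M]
  exact mul_le_mul hN k3 (abs_nonneg _) ((abs_nonneg _).trans hN)

/-- Bounds of a coefficient function depending on time. -/
structure TraceField (T r M M' L : ℝ) (b : ℝ → Torus2 → ℝ) : Prop where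
  cont : ∀ t ∈ Icc 0 T, Continuous (b t)
  hsq : ∀ t ∈ Icc 0 T, hsq r (b t) ≤ ofReal M ^ 2
  sup : ∀ t ∈ Icc 0 T, ∀ x, |b t x| ≤ L
  lip : ∀ t ∈ Icc 0 T, ∀ t' ∈ Icc 0 T, ∀ x, |b t x - b t' x| ≤ M' * |t - t'|

lemma TraceField.mono {b : ℝ → Torus2 → ℝ} (h : TraceField T r M M' L b) {M₂ : ℝ} (hM : M ≤ M₂) :
    TraceField T r M₂ M' L b :=
  { h with hsq := fun t ht => (h.hsq t ht).trans (by gcongr) }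

lemma coeff_const_mul (a : ℝ) (φ : Torus2 → ℝ) (k : Freq) :
    coeff (fun x => a * φ x) k = a * coeff φ k := sliceCoeff_const_mul a (fun q => φ q.1) k 0

/-- Half sums and half differences. -/
lemma TraceField.half {b b' : ℝ → Torus2 → ℝ} (h : TraceField T r M M' L b)
    (h' : TraceField T r M M' L b') (hM : 0 ≤ M) {ε : ℝ} (hε : |ε| = 1) :
    TraceField T r (2 * M) M' L fun t x => 1 / 2 * b t x + ε / 2 * b' t x := by
  have hb : ∀ {p q X : ℝ}, |p| ≤ X → |q| ≤ X → |1 / 2 * p + ε / 2 * q| ≤ X := by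
    intro p q X hp hq
    refine (abs_add_le _ _).trans ?_
    rw [abs_mul, abs_mul, abs_div, abs_div, hε, abs_one, abs_two]
    linarith
  refine ⟨fun t ht => ((h.cont t ht).const_mul _).add ((h'.cont t ht).const_mul _), fun t ht => ?_,
    fun t ht x => hb (h.sup t ht x) (h'.sup t ht x), fun t ht t' ht' x => ?_⟩
  · have hI : ∀ {g : Torus2 → ℝ} (a : ℝ), Continuous g → Integrable (fun x => a * g x) torusMeasure :=
      fun a hg => (hg.const_mul a).integrable_of_hasCompactSupport
        (of_compactSpace _)
    have hk : ∀ a : ℝ, |a| ≤ 1 → ∀ (g : Torus2 → ℝ) k, ‖coeff (fun x => a * g x) k‖ₑ ≤ ‖coeff g k‖ₑ := by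
      intro a ha g k
      rw [coeff_const_mul, enorm_mul, ← ofReal_norm (a : ℂ), norm_real, norm_eq_abs]
      exact mul_le_of_le_one_left' (by simpa using ha)
    have h1 : CurrentVortex.hsq r (fun x => 1 / 2 * b t x + ε / 2 * b' t x) ≤
        ∑' k, (ofReal (jap k ^ r) * ‖coeff (b t) k‖ₑ +
          ofReal (jap k ^ r) * ‖coeff (b' t) k‖ₑ) ^ 2 := by
      refine tsum_le_tsum fun k => ?_
      beta_reduce
      rw [coeff_add' (hI _ (h.cont t ht)) (hI _ (h'.cont t ht)), ← mul_add]
      gcongr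
      refine (enorm_add_le _ _).trans (add_le_add (hk _ ?_ _ _) (hk _ ?_ _ _))
      · rw [abs_of_pos] <;> norm_num
      · rw [abs_div, hε]; norm_num
    refine (h1.trans (ENNReal_tsum_add_sq_le _ _)).trans
      ((add_le_add (mul_le_mul_right (h.hsq t ht) 2) (mul_le_mul_right (h'.hsq t ht) 2)).trans ?_)
    rw [ofReal_mul zero_le_two, mul_pow, ofReal_ofNat]
    apply le_of_eq; ring
  · have := hb (h.lip t ht t' ht' x) (h'.lip t ht t' ht' x)
    rwa [show 1 / 2 * (b t x - b t' x) + ε / 2 * (b' t x - b' t' x) =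
      1 / 2 * b t x + ε / 2 * b' t x - (1 / 2 * b t' x + ε / 2 * b' t' x) by ring] at this

lemma traceField (hs : 3 ≤ s) (hc : 0 < c₀) (hL₁ : 0 < L₁)
    (hbg : ∀ t ∈ Icc 0 T, BackgroundAt s c₀ L₀ L₁ L₂ T f ft u h t) {w : ℝ → Bulk → Vec3}
    (h1 : ∀ t ∈ Icc 0 T, ContinuousOn (w t) (closedRegion (f t) σ))
    (h2 : ∀ t ∈ Icc 0 T, ∀ x, ‖trace (f t) (w t) x‖ ≤ L₀)
    (h3 : ∀ t ∈ Icc 0 T, bulkNormVec (region (f t) σ) s (w t) ≤ ofReal L₁)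
    (h4 : ∀ t ∈ Icc 0 T, TimeDerivBound T L₂ f σ w t) (i : Fin 3) :
    TraceField T (s - 1 / 2) (traceBound s c₀ L₁) (L₂ + traceBound s c₀ L₁ * (wroot * L₁)) L₀
      fun t x => trace (f t) (w t) x i := by
  have hs' : (3 : ℝ) ≤ s := by exact_mod_cast hs
  have hn : ∀ t ∈ Icc 0 T, ‖toSob (s + 1 / 2) (f t)‖ ≤ L₁ ∧ ‖toSob (s - 1 / 2) (ft t)‖ ≤ L₁ := by
    intro t ht
    have hb := (hbg t ht).bound_norm
    constructor <;> rw [← ENNReal.ofReal_le_ofReal_iff hL₁.le] <;> refine le_trans ?_ hb <;>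
      refine le_add_right (le_add_right ?_)
    exacts [le_self_add, le_add_self]
  have hT := fun t ht => trace_bounds hs hc hL₁ (hbg t ht).mem_f (hn t ht).1 (hbg t ht).height
    (h1 t ht) (h3 t ht) i
  have hN : ∀ t ∈ Icc 0 T, ∀ x, |ft t x| ≤ wroot * L₁ := by
    intro t ht x
    have h5 := norm_le_of_hsq (r := s - 1 / 2) (by linarith) hL₁.le (b := ⟨ft t, (hbg t ht).mem_ft.1⟩)
      ((hbg t ht).mem_ft.hsq_eq.le.trans (by gcongr; exact (hn t ht).2))
    exact (ContinuousMap.norm_coe_le_norm _ x).trans h5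
  refine ⟨fun t ht => ?_, fun t ht => (hT t ht).1,
    fun t ht x => (PiLp.norm_apply_le (trace (f t) (w t) x) i).trans (h2 t ht x),
    fun t ht t' ht' x => ?_⟩
  · refine (EuclideanSpace.proj i : Vec3 →L[ℝ] ℝ).continuous.comp ((h1 t ht).comp_continuous
      (continuous_id.prodMk (hbg t ht).mem_f.1) fun x => ?_)
    simpa using mem_closedRegion ((hbg t ht).height x) σ (left_mem_Ico.2 hc)
  · have h5 : ∀ τ ∈ Icc 0 T, _ := fun τ hτ => hasDerivWithinAt_trace hc hτ ((hbg τ hτ).deriv_f x)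
      (fun τ hτ => (hbg τ hτ).height x) (h4 τ hτ) i ((hT τ hτ).2 x) (hN τ hτ x)
    choose! d hd using h5
    exact Convex.norm_image_sub_le_of_norm_hasDerivWithin_le (fun τ hτ => (hd τ hτ).1)
      (fun τ hτ => (hd τ hτ).2) (convex_Icc 0 T) ht' ht

end

section

/-! ### The fields of the background state -/

variable {s : ℕ} {r c₀ L₀ L₁ L₂ T L M M' : ℝ} {f ft : ℝ → Torus2 → ℝ} {u h : Side → ℝ → Bulk → Vec3}

/-- A continuous function as an element of `C(𝕋²)`. -/
def toCM (g : Torus2 → ℝ) : C(Torus2, ℝ) := open Classical in if hg : Continuous g then ⟨g, hg⟩ else 0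

lemma coe_toCM {g : Torus2 → ℝ} (hg : Continuous g) : ⇑(toCM g) = g := by
  rw [toCM, dif_pos hg]
  rfl

/-- The velocity jump and the magnetic fields on the interface. -/
def jumpFields (F : Torus2 → ℝ) (U H : Side → Bulk → Vec3) : Fin 3 → Fin 2 → Torus2 → ℝ :=
  ![jumpVel F U, fun i x => trace F (H Side.plus) x i.castSucc,
    fun i x => trace F (H Side.minus) x i.castSucc]

/-- The coefficient fields of the background state. -/
def backgroundFields (F : Torus2 → ℝ) (U H : Side → Bulk → Vec3) : Fields :=
  ⟨fun i => toCM (meanVel F U i), fun m i => toCM (jumpFields F U H m i)⟩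

lemma stable_of_stability {F : Torus2 → ℝ} {U H : Side → Bulk → Vec3}
    (hv : ∀ i x, |jumpVel F U i x| ≤ L) (hc : c₀ ≤ stability F U H) (x : Torus2) (ξ : Fin 2 → ℝ) :
    c₀ / 2 * (ξ 0 ^ 2 + ξ 1 ^ 2) ≤ ∑ m, eps m * (∑ i, jumpFields F U H m i x * ξ i) ^ 2 := by
  rcases (add_nonneg (sq_nonneg (ξ 0)) (sq_nonneg (ξ 1))).eq_or_lt with h0 | h0
  · have h1 : ξ 0 = 0 := by nlinarith [sq_nonneg (ξ 0), sq_nonneg (ξ 1)]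
    have h2 : ξ 1 = 0 := by nlinarith [sq_nonneg (ξ 0), sq_nonneg (ξ 1)]
    simp [h1, h2]
  set ρ := √(ξ 0 ^ 2 + ξ 1 ^ 2)
  have hρ0 : 0 < ρ := Real.sqrt_pos.2 h0
  have hρ2 : ρ ^ 2 = ξ 0 ^ 2 + ξ 1 ^ 2 := sq_sqrt h0.le
  have key := hc.trans (ciInf_le ⟨-(4 * L ^ 2), ?_⟩
    (⟨x, fun i => ξ i / ρ, by rw [div_pow, div_pow, ← add_div, ← hρ2]; field_simp⟩ :
      Torus2 × {φ : Fin 2 → ℝ // φ 0 ^ 2 + φ 1 ^ 2 = 1}))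
  · have e : ∀ b : Fin 2 → ℝ, (∑ i, b i * (ξ i / ρ)) ^ 2 = (∑ i, b i * ξ i) ^ 2 / ρ ^ 2 := by
      intro b
      rw [← div_pow, Finset.sum_div]
      simp only [mul_div_assoc]
    simp only [e] at key
    rw [← mul_div_assoc, ← add_div, ← sub_div, le_div_iff₀ (by positivity), hρ2] at key
    simp only [sum_univ_three, eps, jumpFields, Matrix.cons_val]
    linarith
  · rintro _ ⟨⟨y, φ, hφ⟩, rfl⟩
    have h1 := sq_le_sq' (abs_le.1 (hv 0 y)).1 (abs_le.1 (hv 0 y)).2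
    have h2 := sq_le_sq' (abs_le.1 (hv 1 y)).1 (abs_le.1 (hv 1 y)).2
    simp only [sum_univ_two (fun i => jumpVel F U i y * φ i)]
    have h3 : (jumpVel F U 0 y * φ 0 + jumpVel F U 1 y * φ 1) ^ 2 ≤
        jumpVel F U 0 y ^ 2 + jumpVel F U 1 y ^ 2 := by
      have := sq_nonneg (jumpVel F U 0 y * φ 1 - jumpVel F U 1 y * φ 0)
      have e : jumpVel F U 0 y ^ 2 + jumpVel F U 1 y ^ 2 =
        (jumpVel F U 0 y ^ 2 + jumpVel F U 1 y ^ 2) * (φ 0 ^ 2 + φ 1 ^ 2) := by rw [hφ, mul_one]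
      linarith
    have h4 := sq_nonneg (∑ i : Fin 2, trace F (H Side.plus) y i.castSucc * φ i)
    have h5 := sq_nonneg (∑ i : Fin 2, trace F (H Side.minus) y i.castSucc * φ i)
    linarith

lemma traceFields (hs : 3 ≤ s) (hc : 0 < c₀) (hL₁ : 0 < L₁)
    (hbg : ∀ t ∈ Icc 0 T, BackgroundAt s c₀ L₀ L₁ L₂ T f ft u h t) :
    (∀ i, TraceField T (s - 1 / 2) (2 * traceBound s c₀ L₁)
      (L₂ + traceBound s c₀ L₁ * (wroot * L₁)) L₀ fun t => meanVel (f t) (fun σ => u σ t) i) ∧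
    ∀ m i, TraceField T (s - 1 / 2) (2 * traceBound s c₀ L₁)
      (L₂ + traceBound s c₀ L₁ * (wroot * L₁)) L₀
      fun t => jumpFields (f t) (fun σ => u σ t) (fun σ => h σ t) m i := by
  have h0 : 0 ≤ traceBound s c₀ L₁ := sqrt_nonneg _
  have hu : ∀ σ i, _ := fun σ i => traceField hs hc hL₁ hbg (fun t ht => (hbg t ht).cont_u σ)
    (fun t ht x => ((hbg t ht).bound_trace σ x).1) (fun t ht => by
      refine le_trans ?_ (hbg t ht).bound_norm
      refine le_add_right (le_add_left ?_)
      cases σ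
      exacts [le_self_add, le_add_self]) (fun t ht => (hbg t ht).bound_time_u σ) i
  have hh : ∀ σ i, _ := fun σ i => traceField hs hc hL₁ hbg (fun t ht => (hbg t ht).cont_h σ)
    (fun t ht x => ((hbg t ht).bound_trace σ x).2) (fun t ht => by
      refine le_trans ?_ (hbg t ht).bound_norm
      refine le_add_left ?_
      cases σ
      exacts [le_self_add, le_add_self]) (fun t ht => (hbg t ht).bound_time_h σ) i
  refine ⟨fun i => ?_, fun m i => ?_⟩
  · convert (hu Side.plus i.castSucc).half (hu Side.minus i.castSucc) h0 (abs_one) using 3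
    simp only [meanVel]; ring
  · fin_cases m
    · convert (hu Side.plus i.castSucc).half (hu Side.minus i.castSucc) h0 (ε := -1) (by simp)
        using 3
      simp only [jumpFields, Fin.zero_eta, Matrix.cons_val_zero, jumpVel]; ring
    · exact (hh Side.plus i.castSucc).mono (by linarith)
    · exact (hh Side.minus i.castSucc).mono (by linarith)

lemma TraceField.sup_toCM {b : ℝ → Torus2 → ℝ} (hb : TraceField T r M M' L b) (hL : 0 ≤ L) {t : ℝ}
    (ht : t ∈ Icc 0 T) : ‖toCM (b t)‖ ≤ L := by
  rw [norm_le _ hL, coe_toCM (hb.cont t ht)]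
  exact hb.sup t ht

lemma TraceField.lip_toCM {b : ℝ → Torus2 → ℝ} (hb : TraceField T r M M' L b) (hM : 0 ≤ M') {t t' : ℝ}
    (ht : t ∈ Icc 0 T) (ht' : t' ∈ Icc 0 T) : ‖toCM (b t) - toCM (b t')‖ ≤ M' * |t - t'| := by
  rw [norm_le _ (by positivity), ContinuousMap.coe_sub, coe_toCM (hb.cont t ht),
    coe_toCM (hb.cont t' ht')]
  exact hb.lip t ht t' ht'

/-- The background state at the nearest time of `[0, T]`. -/
def backgroundFamily (hT : 0 ≤ T) (f : ℝ → Torus2 → ℝ) (u h : Side → ℝ → Bulk → Vec3) (t : ℝ) :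
    Fields :=
  backgroundFields (f (projIcc 0 T hT t)) (fun σ => u σ (projIcc 0 T hT t))
    fun σ => h σ (projIcc 0 T hT t)

lemma family_background (hs : 3 ≤ s) (hc : 0 < c₀) (hL₀ : 0 < L₀) (hL₁ : 0 < L₁) (hL₂ : 0 < L₂)
    (hT : 0 ≤ T) (hbg : ∀ t ∈ Icc 0 T, BackgroundAt s c₀ L₀ L₁ L₂ T f ft u h t) :
    Family (s - 1 / 2) (2 * traceBound s c₀ L₁) (L₂ + traceBound s c₀ L₁ * (wroot * L₁)) L₀ (c₀ / 2)
      (backgroundFamily hT f u h) := by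
  have hs' : (3 : ℝ) ≤ s := by exact_mod_cast hs
  have h0 : 0 ≤ traceBound s c₀ L₁ := sqrt_nonneg _
  have h1 := wroot_nonneg
  have hM' : 0 ≤ L₂ + traceBound s c₀ L₁ * (wroot * L₁) := by positivity
  obtain ⟨hW, hB⟩ := traceFields hs hc hL₁ hbg
  have hp := fun τ => (projIcc 0 T hT τ).2
  have hd : ∀ {X τ τ' : ℝ}, X ≤ (L₂ + traceBound s c₀ L₁ * (wroot * L₁)) *
      |(projIcc 0 T hT τ : ℝ) - projIcc 0 T hT τ'| →
      X ≤ (L₂ + traceBound s c₀ L₁ * (wroot * L₁)) * |τ - τ'| := fun hX => hX.trans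
        (mul_le_mul_of_nonneg_left (abs_projIcc_sub_projIcc hT) hM')
  refine ⟨by linarith, by positivity, hM', hL₀.le, by positivity, fun τ => ⟨fun i => ?_, fun m i => ?_⟩,
    fun τ => ⟨fun i => (hW i).sup_toCM hL₀.le (hp τ), fun m i => (hB m i).sup_toCM hL₀.le (hp τ)⟩,
    fun τ τ' => ⟨fun i => hd ((hW i).lip_toCM hM' (hp τ) (hp τ')),
      fun m i => hd ((hB m i).lip_toCM hM' (hp τ) (hp τ'))⟩, fun τ x ξ => ?_⟩
  · rw [backgroundFamily, backgroundFields, coe_toCM ((hW i).cont _ (hp τ))]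
    exact (hW i).hsq _ (hp τ)
  · rw [backgroundFamily, backgroundFields, coe_toCM ((hB m i).cont _ (hp τ))]
    exact (hB m i).hsq _ (hp τ)
  · have h2 : ∀ m i, ⇑((backgroundFamily hT f u h τ).B m i) = _ :=
      fun m i => coe_toCM ((hB m i).cont _ (hp τ))
    simp only [h2]
    exact stable_of_stability (fun i => (hB 0 i).sup _ (hp τ)) (hbg _ (hp τ)).stable x ξ

variable {F : Torus2 → ℝ} {U H : Side → Bulk → Vec3}

lemma energy_backgroundFields (hW : ∀ i, Continuous (meanVel F U i))
    (hB : ∀ m i, Continuous (jumpFields F U H m i)) (θ φ : Torus2 → ℝ) :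
    (backgroundFields F U H).energy (s - 1 / 2) θ φ = energy s F U H θ φ := by
  have hw i x : (backgroundFields F U H).W i x = meanVel F U i x := congrFun (coe_toCM (hW i)) x
  have hb m i x : (backgroundFields F U H).B m i x = jumpFields F U H m i x :=
    congrFun (coe_toCM (hB m i)) x
  simp only [Fields.energy, hw, hb, energy, sum_univ_three, eps, jumpFields, Matrix.cons_val]
  ring

lemma linR_backgroundFields (hW : ∀ i, Continuous (meanVel F U i))
    (hB : ∀ m i, Continuous (jumpFields F U H m i)) (g φ θ : Torus2 → ℝ) (x : Torus2) :
    linR (backgroundFields F U H) g φ θ x = linRHS F U H g φ θ x := by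
  have hw i x : (backgroundFields F U H).W i x = meanVel F U i x := congrFun (coe_toCM (hW i)) x
  have hb m i x : (backgroundFields F U H).B m i x = jumpFields F U H m i x :=
    congrFun (coe_toCM (hB m i)) x
  simp only [linR, linRHS, Fields.first, Fields.second, ContinuousMap.add_apply,
    ContinuousMap.neg_apply, ContinuousMap.mul_apply, ContinuousMap.smul_apply,
    hw, hb, sum_univ_three, sum_univ_two, eps, jumpFields,
    Matrix.cons_val, smul_eq_mul, meanVel, jumpVel]
  ring

lemma isLinSolution_iff {a : ℝ → Fields} {g φ θ : ℝ → Torus2 → ℝ} {φ₀ θ₀ : Torus2 → ℝ} (hT : 0 ≤ T)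
    (ha : ∀ t ∈ Icc 0 T, ∀ g φ θ x, linR (a t) g φ θ x =
      linRHS (f t) (fun σ => u σ t) (fun σ => h σ t) g φ θ x) :
    IsLinSolution s T f u h g φ₀ θ₀ φ θ ↔
      LinSol (s - 1 / 2) T a g φ θ ∧ φ 0 = φ₀ ∧ θ 0 = θ₀ := by
  have e : (s : ℝ) - 1 / 2 + 1 = s + 1 / 2 := by ring
  have hI : ∀ x, IntervalIntegrable (fun τ => linR (a τ) (g τ) (φ τ) (θ τ) x) volume 0 T ↔
      IntervalIntegrable (fun τ => linRHS (f τ) (fun σ => u σ τ) (fun σ => h σ τ) (g τ) (φ τ) (θ τ) x)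
        volume 0 T := fun x => intervalIntegrable_congr fun τ hτ =>
    ha τ (Ioc_subset_Icc_self (by rwa [uIoc_of_le hT] at hτ)) _ _ _ _
  have hJ : ∀ t ∈ Icc 0 T, ∀ x, ∫ τ in (0 : ℝ)..t, linR (a τ) (g τ) (φ τ) (θ τ) x =
      ∫ τ in (0 : ℝ)..t, linRHS (f τ) (fun σ => u σ τ) (fun σ => h σ τ) (g τ) (φ τ) (θ τ) x := by
    intro t ht x
    refine integral_congr fun τ hτ => ?_
    rw [uIcc_of_le ht.1] at hτ
    exact ha τ ⟨hτ.1, hτ.2.trans ht.2⟩ _ _ _ _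
  constructor
  · intro hs
    exact ⟨⟨e ▸ hs.mem_φ, hs.mem_θ, hs.eq_φ, fun x => (hI x).2 (hs.integrable_rhs x),
      fun t ht x => by rw [hJ t ht, hs.init_θ]; exact hs.eq_θ t ht x⟩, hs.init_φ, hs.init_θ⟩
  · rintro ⟨hs, h1, h2⟩
    exact ⟨e ▸ hs.mem_φ, hs.mem_θ, h1, h2, hs.eq_φ, fun x => (hI x).1 (hs.integrable x),
      fun t ht x => by rw [← hJ t ht, ← h2]; exact hs.eq_θ t ht x⟩

end

end CurrentVortex

end

open CurrentVortex in
theorem proposition7p1 (s : ℕ) (hs : 3 ≤ s) :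
    ∃ (C : ℝ → ℝ → ℝ) (K : ℝ → ℝ → ℝ → ℝ),
      ∀ (c₀ L₀ L₁ L₂ T : ℝ), 0 < c₀ → 0 < L₀ → 0 < L₁ → 0 < L₂ → 0 < T →
      ∀ (f ft : ℝ → Torus2 → ℝ) (u h : Side → ℝ → Bulk → Vec3),
      (∀ t ∈ Set.Icc 0 T, BackgroundAt s c₀ L₀ L₁ L₂ T f ft u h t) →
      -- coercivity of the energy functional
      (∀ t ∈ Set.Icc 0 T, ∀ φ θ : Torus2 → ℝ, MemH (s + 1 / 2) φ → MemH (s - 1 / 2) θ →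
        ‖toSob (s - 1 / 2) θ‖ ^ 2 + ‖toSob (s + 1 / 2) φ‖ ^ 2 ≤
          C c₀ L₀ * (energy s (f t) (fun σ => u σ t) (fun σ => h σ t) θ φ
            + (∫ x, θ x ^ 2 ∂torusMeasure) + ∫ x, φ x ^ 2 ∂torusMeasure)) ∧
      -- existence, uniqueness and the energy estimate
      (∀ (g : ℝ → Torus2 → ℝ) (φ₀ θ₀ : Torus2 → ℝ),
        MemLinftyH T (s - 1 / 2) g → MemH (s + 1 / 2) φ₀ → MemH (s - 1 / 2) θ₀ →
        ∃ φ θ : ℝ → Torus2 → ℝ,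
          IsLinSolution s T f u h g φ₀ θ₀ φ θ ∧
          (∀ φ' θ' : ℝ → Torus2 → ℝ, IsLinSolution s T f u h g φ₀ θ₀ φ' θ' →
            ∀ t ∈ Set.Icc 0 T, φ' t = φ t ∧ θ' t = θ t) ∧
          ∀ t ∈ Set.Icc 0 T,
            ‖toSob (s - 1 / 2) (θ t)‖ ^ 2 + ‖toSob (s + 1 / 2) (φ t)‖ ^ 2 ≤
              C c₀ L₀ * (‖toSob (s - 1 / 2) θ₀‖ ^ 2 + ‖toSob (s + 1 / 2) φ₀‖ ^ 2
                + ∫ τ in (0 : ℝ)..T, ‖toSob (s - 1 / 2) (g τ)‖ ^ 2)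
              * Real.exp (K c₀ L₁ L₂ * T)) := by
  have hs' : (3 : ℝ) ≤ s := by exact_mod_cast hs
  have e : (s : ℝ) - 1 / 2 + 1 = s + 1 / 2 := by ring
  refine ⟨fun c L => (2 * coerConst (c / 2) L + 2 ^ ((s : ℝ) - 1 / 2 + 1)) +
      coerConst (c / 2) L * (10 * (1 + L) ^ 2 + 2),
    fun c L₁ L₂ => growth (s - 1 / 2) (2 * traceBound s c L₁)
      (L₂ + traceBound s c L₁ * (wroot * L₁)) (c / 2), ?_⟩
  intro c₀ L₀ L₁ L₂ T hc hL₀ hL₁ hL₂ hT f ft u h hbg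
  have hF := family_background hs hc hL₀ hL₁ hL₂ hT.le hbg
  obtain ⟨hW, hB⟩ := traceFields hs hc hL₁ hbg
  have hk : 0 < coerConst (c₀ / 2) L₀ := coerConst_pos (by positivity)
  have hft : ∀ t ∈ Set.Icc 0 T, backgroundFamily hT.le f u h t =
      backgroundFields (f t) (fun σ => u σ t) fun σ => h σ t := by
    intro t ht
    rw [backgroundFamily, projIcc_of_mem hT.le ht]
  refine ⟨fun t ht φ θ hφ hθ => ?_, fun g φ₀ θ₀ hg hφ₀ hθ₀ => ?_⟩
  · rw [← e] at hφ ⊢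
    have key := (backgroundFamily hT.le f u h t).coercive (by linarith) (by positivity) (hF.sup t)
      (hF.stable t) hφ hθ
    rw [hft t ht, energy_backgroundFields (fun i => (hW i).cont t ht)
      fun m i => (hB m i).cont t ht] at key
    set X := energy s (f t) (fun σ => u σ t) (fun σ => h σ t) θ φ + (∫ x, θ x ^ 2 ∂torusMeasure) +
      ∫ x, φ x ^ 2 ∂torusMeasure
    have hX : 0 ≤ X := by
      by_contra hX
      have h1 : (2 * coerConst (c₀ / 2) L₀ + 2 ^ ((s : ℝ) - 1 / 2 + 1)) * X < 0 :=
        mul_neg_of_pos_of_neg (by positivity) (not_le.1 hX)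
      have h2 : 0 ≤ ‖toSob (s - 1 / 2) θ‖ ^ 2 + ‖toSob ((s : ℝ) - 1 / 2 + 1) φ‖ ^ 2 :=
        add_nonneg (sq_nonneg _) (sq_nonneg _)
      linarith
    refine key.trans (mul_le_mul_of_nonneg_right ?_ hX)
    exact le_add_of_nonneg_right (by positivity)
  · have hiff : ∀ φ θ, IsLinSolution s T f u h g φ₀ θ₀ φ θ ↔ LinSol (s - 1 / 2) T
        (backgroundFamily hT.le f u h) g φ θ ∧ φ 0 = φ₀ ∧ θ 0 = θ₀ := fun φ θ =>
      isLinSolution_iff hT.le fun t ht g φ θ x => by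
        rw [hft t ht]
        exact linR_backgroundFields (fun i => (hW i).cont t ht) (fun m i => (hB m i).cont t ht) g φ θ x
    obtain ⟨g1, g2⟩ := hg
    rw [restrict_Ioo_eq_restrict_Ioc] at g1 g2
    obtain ⟨φ, θ, h1, h2, h3, h4, h5⟩ := hF.exists_linSol hT.le (g2.mono_exponent le_top) g1
      (e ▸ hφ₀) hθ₀
    refine ⟨φ, θ, (hiff φ θ).2 ⟨h1, h2, h3⟩, fun φ' θ' h' => ?_, fun t ht => ?_⟩
    · obtain ⟨k1, k2, k3⟩ := (hiff φ' θ').1 h'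
      exact h4 φ' θ' k1 k2 k3
    · rw [← e]
      refine (h5 t ht).trans (mul_le_mul_of_nonneg_right ?_ (Real.exp_pos _).le)
      have hA : 0 ≤ ‖toSob (s - 1 / 2) θ₀‖ ^ 2 + ‖toSob ((s : ℝ) - 1 / 2 + 1) φ₀‖ ^ 2 :=
        add_nonneg (sq_nonneg _) (sq_nonneg _)
      have hJ : 0 ≤ ∫ τ in (0 : ℝ)..T, ‖toSob (s - 1 / 2) (g τ)‖ ^ 2 :=
        intervalIntegral.integral_nonneg hT.le fun _ _ => sq_nonneg _
      have h2 : (0 : ℝ) ≤ 2 * coerConst (c₀ / 2) L₀ + 2 ^ ((s : ℝ) - 1 / 2 + 1) := by positivity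
      have h6 : 0 ≤ (1 + L₀) ^ 2 := sq_nonneg _
      beta_reduce
      generalize ‖toSob (s - 1 / 2) θ₀‖ ^ 2 + ‖toSob ((s : ℝ) - 1 / 2 + 1) φ₀‖ ^ 2 = A at *
      generalize (∫ τ in (0 : ℝ)..T, ‖toSob (s - 1 / 2) (g τ)‖ ^ 2) = J at *
      generalize coerConst (c₀ / 2) L₀ = k at *
      generalize (2 : ℝ) ^ ((s : ℝ) - 1 / 2 + 1) = q at *
      generalize (1 + L₀) ^ 2 = p at *
      have m1 : 0 ≤ (2 * k + q) * (A + J) := by positivity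
      have m2 : 0 ≤ k * (2 * A + 10 * p * J) := by positivity
      linarith
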